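/- **Setting.** Let $(M,g)$ be an oriented smooth Riemannian surface with smooth, possibly empty boundary, and let $n\in\mathbb N$. Let $SM=\{(x,v)\in TM:|v|_g=1\}$, let $X$ be the geodesic vector field on $SM$, $V$ the generator of the circle action $\varphi^V_t$ given by rotating $v$ by the angle $t$ in the positive direction, $X_\perp=[X,V]$ (at $(x,v)$ this is the horizontal lift of $-v$ rotated by $\pi/2$ in the positive direction), and $\eta_\pm=\tfrac12(X\pm iX_\perp)$. The $k$-th vertical Fourier mode of a function $u$ on $SM$ is $u_k(x,v)=\frac1{2\pi}\int_0^{2\pi}u(\varphi^V_t(x,v))e^{-ikt}\,dt$, and $u$ is fibrewise holomorphic if $u_k=0$ for all $k<0$. All smooth functions are smooth up to the boundary. Let $$\mho=\{\mathbb A\in C^\infty(SM,\mathbb C^{n\times n}):\mathbb A_k=0\text{ for }k<-1\},$$ $$\mathbb G=\{F\in C^\infty(SM,GL(n,\mathbb C)):F\text{ and }F^{-1}\text{ are fibrewise holomorphic}\}.$$ Let $\mathbb D=\{\omega\in\mathbb C:|\omega|\le1\}$. The twistor space is $Z=(SM\times\mathbb D)/S^1$ for the circle action $(x,v,\omega)\mapsto(\varphi^V_t(x,v),e^{-it}\omega)$,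 with generator $\mathbb V$; a function on $Z$ is smooth if its pullback to $SM\times\mathbb D$ is smooth. Let $\Omega^{0,1}(Z,\mathbb C^{n\times n})$ be the set of pairs $(a_1,a_2)$ of functions in $C^\infty(SM\times\mathbb D,\mathbb C^{n\times n})$ with $\mathbb Va_j+ia_j=0$, and for smooth matrix-valued $\varphi$ on $Z$ (identified with its pullback) let $\bar\partial\varphi=((\omega^2\eta_++\eta_-)\varphi,\partial_{\bar\omega}\varphi)$. Define $$\mathfrak M=\mathfrak M_n(Z)=\{(a_1,a_2)\in\Omega^{0,1}(Z,\mathbb C^{n\times n}):(\omega^2\eta_++\eta_-)a_2-\partial_{\bar\omega}a_1+[a_1,a_2]=0\}/\sim,$$ where $A\sim B$ if and only if $B=\varphi^{-1}\bar\partial\varphi+\varphi^{-1}A\varphi$ for some $\varphi\in C^\infty(Z,GL(n,\mathbb C))$. **Proposition (Twistor correspondence B).** The group $\mathbb G$ acts on $\mho$ from the right by $\mathbb A\triangleleft F=F^{-1}XF+F^{-1}\mathbb AF$. For $\mathbb A\in\mho$ the series $$A^{0,1}(x,v,\omega)=\Big(\sum_{k\ge-1}\omega^{k+1}\mathbb A_k(x,v),\,0\Big)$$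 converges and defines an element of $\Omega^{0,1}(Z,\mathbb C^{n\times n})$ with vanishing curvature, hence a class $[A^{0,1}]\in\mathfrak M$. The map $\mho\to\mathfrak M$, $\mathbb A\mapsto[A^{0,1}]$, is $\mathbb G$-invariant and the induced map $\mho/\mathbb G\to\mathfrak M$ is injective. If $M$ is diffeomorphic to the closed disk, the induced map is a bijection $\mho/\mathbb G\cong\mathfrak M$. -/

import Mathlib

open scoped Manifold ContDiff Topology
open Bundle

set_option linter.unusedSectionVars false

noncomputable section

namespace Twistor

abbrev E2 := EuclideanSpace ℝ (Fin 2)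

abbrev Mat (n : ℕ) := Matrix (Fin n) (Fin n) ℂ

/-- The closed unit disk in `ℂ`. -/
abbrev Disk := Metric.closedBall (0 : ℂ) 1

/-- Application of a scalar operator to every entry of a matrix-valued function. -/
def entrywise {Y : Type*} {n : ℕ} (D : (Y → ℂ) → Y → ℂ) (F : Y → Mat n) (y : Y) : Mat n :=
  Matrix.of fun i j => D (fun z => F z i j) y

/-- `F⁻¹ D F + F⁻¹ a F`. -/
def gaugeAct {Y : Type*} {n : ℕ} (D : (Y → ℂ) → Y → ℂ) (a : Y → Mat n)
    (F : Y → GL (Fin n) ℂ) (y : Y) : Mat n :=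
  ((F y)⁻¹ : GL (Fin n) ℂ).1 * entrywise D (fun z => (F z).1) y +
    ((F y)⁻¹ : GL (Fin n) ℂ).1 * a y * (F y).1

section Algebra

variable {Y : Type*} {n : ℕ}

/-- Auxiliary: a class of functions closed under the algebraic operations. -/
structure FunctionClass (S : (Y → ℂ) → Prop) : Prop where
  const : ∀ c, S fun _ => c
  add : ∀ {u w}, S u → S w → S fun y => u y + w y
  mul : ∀ {u w}, S u → S w → S fun y => u y * w y
  inv : ∀ {u}, S u → (∀ y, u y ≠ 0) → S fun y => (u y)⁻¹

/-- Auxiliary: the derivation property on such a class. -/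
structure DerivationOn (S : (Y → ℂ) → Prop) (D : (Y → ℂ) → Y → ℂ) : Prop where
  const : ∀ c y, D (fun _ => c) y = 0
  add : ∀ {u w}, S u → S w → ∀ y, D (fun z => u z + w z) y = D u y + D w y
  mul : ∀ {u w}, S u → S w → ∀ y, D (fun z => u z * w z) y = D u y * w y + u y * D w y

namespace FunctionClass

variable {S : (Y → ℂ) → Prop}

lemma sum (hS : FunctionClass S) {ι : Type*} (s : Finset ι) {u : ι → Y → ℂ} (hu : ∀ i, S (u i)) :
    S fun y => ∑ i ∈ s, u i y := by
  classical
  induction s using Finset.induction_on with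
  | empty => simpa using hS.const 0
  | insert a s ha ih => simpa only [Finset.sum_insert ha] using hS.add (hu a) ih

lemma prod (hS : FunctionClass S) {ι : Type*} (s : Finset ι) {u : ι → Y → ℂ} (hu : ∀ i, S (u i)) :
    S fun y => ∏ i ∈ s, u i y := by
  classical
  induction s using Finset.induction_on with
  | empty => simpa using hS.const 1
  | insert a s ha ih => simpa only [Finset.prod_insert ha] using hS.mul (hu a) ih

lemma det (hS : FunctionClass S) {A : Y → Mat n} (hA : ∀ i j, S fun y => A y i j) : S fun y => (A y).det := by
  simp only [Matrix.det_apply']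
  exact hS.sum _ fun σ => hS.mul (hS.const _) (hS.prod _ fun i => hA _ _)

lemma matMul (hS : FunctionClass S) {A B : Y → Mat n} (hA : ∀ i j, S fun y => A y i j) (hB : ∀ i j, S fun y => B y i j)
    (i j : Fin n) : S fun y => (A y * B y) i j := by
  simp only [Matrix.mul_apply]
  exact hS.sum _ fun k => hS.mul (hA _ _) (hB _ _)

lemma matInv (hS : FunctionClass S) {F : Y → GL (Fin n) ℂ} (hF : ∀ i j, S fun y => (F y).1 i j) (i j : Fin n) :
    S fun y => ((F y)⁻¹ : GL (Fin n) ℂ).1 i j := by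
  simp only [Matrix.coe_units_inv, Matrix.inv_def, Ring.inverse_eq_inv', Matrix.smul_apply,
    smul_eq_mul, Matrix.adjugate_apply]
  refine hS.mul (hS.inv (hS.det hF) fun y => ?_) (hS.det fun k l => ?_)
  · exact ((Matrix.isUnit_iff_isUnit_det _).1 (F y).isUnit).ne_zero
  · by_cases hk : k = j
    · subst hk; simpa using hS.const _
    · simpa [Matrix.updateRow_ne hk] using hF k l

end FunctionClass

lemma entrywise_mul {S : (Y → ℂ) → Prop} (hS : FunctionClass S) {D : (Y → ℂ) → Y → ℂ}
    (hD : DerivationOn S D) {A B : Y → Mat n} (hA : ∀ i j, S fun y => A y i j)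
    (hB : ∀ i j, S fun y => B y i j) (y : Y) :
    entrywise D (fun z => A z * B z) y = entrywise D A y * B y + A y * entrywise D B y := by
  have hsum : ∀ (s : Finset (Fin n)) (u : Fin n → Y → ℂ), (∀ i, S (u i)) →
      D (fun z => ∑ i ∈ s, u i z) y = ∑ i ∈ s, D (u i) y := by
    intro s u hu
    induction s using Finset.induction_on with
    | empty => simpa using hD.const 0 y
    | insert a s ha ih =>
      simp only [Finset.sum_insert ha]
      rw [hD.add (hu a) (hS.sum s hu), ih]
  ext i j
  simp only [entrywise, Matrix.mul_apply, Matrix.of_apply, Matrix.add_apply]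
  rw [hsum _ _ fun k => hS.mul (hA i k) (hB k j), ← Finset.sum_add_distrib]
  exact Finset.sum_congr rfl fun k _ => hD.mul (hA i k) (hB k j) y

lemma gaugeAct_one {S : (Y → ℂ) → Prop} {D : (Y → ℂ) → Y → ℂ} (hD : DerivationOn S D)
    (a : Y → Mat n) : gaugeAct D a 1 = a := by
  funext y
  have : entrywise D (fun z => ((1 : Y → GL (Fin n) ℂ) z).1) y = 0 := by
    ext i j; exact hD.const _ y
  rw [gaugeAct, this]
  simp

lemma gaugeAct_mul {S : (Y → ℂ) → Prop} (hS : FunctionClass S) {D : (Y → ℂ) → Y → ℂ}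
    (hD : DerivationOn S D) (a : Y → Mat n) {F G : Y → GL (Fin n) ℂ}
    (hF : ∀ i j, S fun y => (F y).1 i j) (hG : ∀ i j, S fun y => (G y).1 i j) :
    gaugeAct D a (F * G) = gaugeAct D (gaugeAct D a F) G := by
  funext y
  have h := entrywise_mul hS hD hF hG y
  simp only [gaugeAct, Pi.mul_apply, mul_inv_rev, Units.val_mul] at h ⊢
  have h1 : ((F y)⁻¹ : GL (Fin n) ℂ).1 * (F y).1 = 1 := (F y).inv_mul
  rw [h]
  simp only [mul_add, add_mul, mul_assoc]
  rw [← mul_assoc ((F y)⁻¹ : GL (Fin n) ℂ).1 (F y).1, h1, one_mul]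
  abel

lemma gaugeAct_inv {S : (Y → ℂ) → Prop} (hS : FunctionClass S) {D : (Y → ℂ) → Y → ℂ}
    (hD : DerivationOn S D) (a : Y → Mat n) {F : Y → GL (Fin n) ℂ}
    (hF : ∀ i j, S fun y => (F y).1 i j) : gaugeAct D (gaugeAct D a F) F⁻¹ = a := by
  rw [← gaugeAct_mul hS hD a hF (G := F⁻¹) (hS.matInv hF), mul_inv_cancel, gaugeAct_one hD]

end Algebra

section Surface

variable {M : Type*} [TopologicalSpace M] [ChartedSpace (EuclideanHalfSpace 2) M]
  [IsManifold (𝓡∂ 2) ∞ M]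

variable (M) in
/-- An orientation of the surface `M`: an orientation of every tangent plane which, read in the
local trivialisations of the tangent bundle, is locally constant. -/
structure SurfaceOrientation where
  at' : ∀ x : M, Orientation ℝ (TangentSpace (𝓡∂ 2) x) (Fin 2)
  locallyConstant : ∀ x₀ : M, ∃ ξ : Orientation ℝ E2 (Fin 2), ∀ᶠ x in 𝓝 x₀,
    ∃ hx : x ∈ (trivializationAt E2 (TangentSpace (𝓡∂ 2)) x₀).baseSet,
      Orientation.map (Fin 2)
        ((trivializationAt E2 (TangentSpace (𝓡∂ 2)) x₀).linearEquivAt ℝ x hx) (at' x) = ξ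

variable (M) in
/-- `M` is diffeomorphic to the closed unit disk. -/
def DiffeomorphicToDisk : Prop :=
  ∃ (f : M → ℂ) (f' : ℂ → M), ContMDiff (𝓡∂ 2) 𝓘(ℝ, ℂ) ∞ f ∧
    ContMDiffOn 𝓘(ℝ, ℂ) (𝓡∂ 2) ∞ f' (Metric.closedBall 0 1) ∧
    (∀ x, f x ∈ Metric.closedBall (0 : ℂ) 1) ∧ (∀ x, f' (f x) = x) ∧
    ∀ z ∈ Metric.closedBall (0 : ℂ) 1, f (f' z) = z

variable [RiemannianBundle (fun x : M => TangentSpace (𝓡∂ 2) x)]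

variable (M) in
/-- The unit sphere bundle `SM`. -/
abbrev SM : Type _ := {p : TangentBundle (𝓡∂ 2) M // ‖p.2‖ = 1}

instance tangentFiniteDimensional (x : M) : FiniteDimensional ℝ (TangentSpace (𝓡∂ 2) x) :=
  inferInstanceAs (FiniteDimensional ℝ E2)

instance tangentFinrank (x : M) : Fact (Module.finrank ℝ (TangentSpace (𝓡∂ 2) x) = 2) :=
  ⟨(finrank_euclideanSpace_fin : Module.finrank ℝ E2 = 2)⟩

/-- The radial projection of a nonzero tangent vector to `SM`. -/
def normalize (p : TangentBundle (𝓡∂ 2) M) (hp : p.2 ≠ 0) : SM M :=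
  ⟨⟨p.1, ‖p.2‖⁻¹ • p.2⟩, norm_smul_inv_norm (𝕜 := ℝ) hp⟩

/-- The extension of a function on `SM`, constant along rays, to the nonzero tangent vectors. -/
def homExt (u : SM M → ℂ) (p : TangentBundle (𝓡∂ 2) M) : ℂ :=
  open Classical in if hp : p.2 ≠ 0 then u (normalize p hp) else 0

/-- `C^∞(SM)`, smoothness being up to the boundary. -/
def SmoothSM (u : SM M → ℂ) : Prop :=
  ContMDiffOn (𝓡∂ 2).tangent 𝓘(ℝ, ℂ) ∞ (homExt u) {p | p.2 ≠ 0}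

/-- The extension to `(TM ∖ 0) × 𝔻` of a function on `SM × 𝔻`. -/
def homExtD (h : SM M × Disk → ℂ) (q : TangentBundle (𝓡∂ 2) M × ℂ) : ℂ :=
  open Classical in
  if hq : q.1.2 ≠ 0 ∧ q.2 ∈ Metric.closedBall (0 : ℂ) 1 then
    h (normalize q.1 hq.1, ⟨q.2, hq.2⟩) else 0

/-- `C^∞(SM × 𝔻)`, smoothness being up to the boundary and corners. -/
def SmoothSMD (h : SM M × Disk → ℂ) : Prop :=
  ContMDiffOn ((𝓡∂ 2).tangent.prod 𝓘(ℝ, ℂ)) 𝓘(ℝ, ℂ) ∞ (homExtD h)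
    ({p | p.2 ≠ 0} ×ˢ Metric.closedBall (0 : ℂ) 1)

/-- `∂_a (g(b, c))` at `x`, where `b` and `c` are extended with constant coefficients in the chart
at `x`. -/
def metricDeriv (x : M) (a b c : TangentSpace (𝓡∂ 2) x) : ℝ :=
  mvfderiv (𝓡∂ 2)
    (fun y : M => inner ℝ (FiberBundle.extend E2 b y) (FiberBundle.extend E2 c y)) x a

/-- The Christoffel symbols `Γ(v, w)` of the Levi-Civita connection in the chart at `x`:
`g(Γ(v, w), e) = (∂_v g(w, e) + ∂_w g(v, e) - ∂_e g(v, w)) / 2` for all `e`. -/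
def christoffel (x : M) (v w : TangentSpace (𝓡∂ 2) x) : TangentSpace (𝓡∂ 2) x :=
  ∑ i, ((metricDeriv x v w (stdOrthonormalBasis ℝ (TangentSpace (𝓡∂ 2) x) i)
      + metricDeriv x w v (stdOrthonormalBasis ℝ (TangentSpace (𝓡∂ 2) x) i)
      - metricDeriv x (stdOrthonormalBasis ℝ (TangentSpace (𝓡∂ 2) x) i) v w) / 2) •
    stdOrthonormalBasis ℝ (TangentSpace (𝓡∂ 2) x) i

/-- The derivative of `u` at `(x, v) ∈ SM` along the horizontal lift of `w ∈ T_x M`, which in the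
coordinates `(x, v)` of `TM` induced by the chart at `x` is `(w, -Γ(v, w))`. -/
def horDeriv (u : SM M → ℂ) (p : SM M) (w : TangentSpace (𝓡∂ 2) p.1.1) : ℂ :=
  mvfderiv (𝓡∂ 2).tangent (homExt u) p.1
    (((w, -christoffel p.1.1 p.1.2 w) : E2 × E2) : TangentSpace (𝓡∂ 2).tangent p.1)

/-- The geodesic vector field: the horizontal lift of `v` at `(x, v)`. -/
def X (u : SM M → ℂ) (p : SM M) : ℂ := horDeriv u p p.1.2

variable (o : SurfaceOrientation M)

/-- The vector field `X_⊥ = [X, V]`: the horizontal lift of `-Jv` at `(x, v)`, with `J` the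
counterclockwise rotation by a right angle. -/
def Xperp (u : SM M → ℂ) (p : SM M) : ℂ :=
  horDeriv u p (-((o.at' p.1.1).rightAngleRotation p.1.2))

def etaPlus (u : SM M → ℂ) (p : SM M) : ℂ := (X u p + Complex.I * Xperp o u p) / 2

def etaMinus (u : SM M → ℂ) (p : SM M) : ℂ := (X u p - Complex.I * Xperp o u p) / 2

/-- The circle action on the fibres of `SM`, that is, the flow of the vertical field `V`. -/
def rot (θ : Real.Angle) (p : SM M) : SM M :=
  ⟨⟨p.1.1, (o.at' p.1.1).rotation θ p.1.2⟩, by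
    change ‖(o.at' p.1.1).rotation θ p.1.2‖ = 1
    rw [LinearIsometryEquiv.norm_map]; exact p.2⟩

instance factTwoPiPos : Fact (0 < 2 * Real.pi) := ⟨Real.two_pi_pos⟩

/-- The vertical Fourier mode `u_k` of `u`. -/
def fourierMode (u : SM M → ℂ) (k : ℤ) (p : SM M) : ℂ :=
  fourierCoeff (T := 2 * Real.pi) (fun θ => u (rot o θ p)) k

def FibrewiseHolomorphic (u : SM M → ℂ) : Prop := ∀ k < 0, ∀ p, fourierMode o u k p = 0

/-- `C^∞(SM, ℂ^{n × n})`. -/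
def SmoothMat {n : ℕ} (A : SM M → Mat n) : Prop := ∀ i j, SmoothSM fun p => A p i j

/-- The attenuations `A` with `A_k = 0` for `k < -1`. -/
def Mho (n : ℕ) : Type _ :=
  {A : SM M → Mat n // SmoothMat A ∧
    ∀ k < -1, ∀ p i j, fourierMode o (fun q => A q i j) k p = 0}

/-- The circle action on `SM × 𝔻`, `θ ↦ ((x, v, ω) ↦ (φ^V_θ(x, v), e^{-iθ} ω))`. -/
def rotD (θ : Real.Angle) (q : SM M × Disk) : SM M × Disk :=
  (rot o θ q.1, ⟨((-θ).toCircle : ℂ) * q.2.1, by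
    have h := q.2.2
    rw [mem_closedBall_zero_iff] at h ⊢
    rwa [norm_mul, Circle.norm_coe, one_mul]⟩)

/-- The vector field generating the circle action on `SM × 𝔻`. -/
def VV (h : SM M × Disk → ℂ) (q : SM M × Disk) : ℂ :=
  deriv (fun t : ℝ => h (rotD o (t : Real.Angle) q)) 0

/-- `ω² η₊ + η₋` on functions on `SM × 𝔻`. -/
def dbar₁ (h : SM M × Disk → ℂ) (q : SM M × Disk) : ℂ :=
  q.2.1 ^ 2 * etaPlus o (fun p => h (p, q.2)) q.1 + etaMinus o (fun p => h (p, q.2)) q.1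

/-- The function `h(x, v, ·)` on `𝔻`, extended by zero to `ℂ`. -/
def diskExt (h : SM M × Disk → ℂ) (p : SM M) (z : ℂ) : ℂ :=
  open Classical in if hz : z ∈ Metric.closedBall (0 : ℂ) 1 then h (p, ⟨z, hz⟩) else 0

/-- `∂_{\bar ω}` on functions on `SM × 𝔻`, with derivatives taken within the closed disk. -/
def dbar₂ (h : SM M × Disk → ℂ) (q : SM M × Disk) : ℂ :=
  (fderivWithin ℝ (diskExt h q.1) (Metric.closedBall 0 1) q.2.1 1
    + Complex.I * fderivWithin ℝ (diskExt h q.1) (Metric.closedBall 0 1) q.2.1 Complex.I) / 2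

/-- The components of the `ℂ^{n × n}`-valued `(0,1)`-forms on the twistor space: smooth `a` on
`SM × 𝔻` with `𝕍 a + i a = 0`. -/
def IsForm01 {n : ℕ} (a : SM M × Disk → Mat n) : Prop :=
  ∀ i j, SmoothSMD (fun q => a q i j) ∧
    ∀ q, VV o (fun r => a r i j) q + Complex.I * a q i j = 0

/-- `(a₁, a₂)` is a partial connection on the twistor space with vanishing curvature
`(ω² η₊ + η₋) a₂ - ∂_{\bar ω} a₁ + [a₁, a₂]`. -/
def IsFlat {n : ℕ} (a : (SM M × Disk → Mat n) × (SM M × Disk → Mat n)) : Prop :=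
  IsForm01 o a.1 ∧ IsForm01 o a.2 ∧
    ∀ q, entrywise (dbar₁ o) a.2 q - entrywise dbar₂ a.1 q + (a.1 q * a.2 q - a.2 q * a.1 q) = 0

/-- The partial connections `A^{0,1} = (a₁, a₂)` with vanishing curvature. -/
def FlatPartialConnection (n : ℕ) : Type _ :=
  {a : (SM M × Disk → Mat n) × (SM M × Disk → Mat n) // IsFlat o a}

/-- `(a, 0)` with `a = ∑_{k ≥ -1} ω^{k+1} A_k`. -/
def twistorForm {n : ℕ} (A : SM M → Mat n) :
    (SM M × Disk → Mat n) × (SM M × Disk → Mat n) :=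
  (fun q => Matrix.of fun i j =>
    ∑' m : ℕ, q.2.1 ^ m * fourierMode o (fun p => A p i j) ((m : ℤ) - 1) q.1, 0)

lemma rot_add (θ φ : Real.Angle) (p : SM M) : rot o θ (rot o φ p) = rot o (θ + φ) p :=
  Subtype.ext (congrArg (TotalSpace.mk p.1.1) ((o.at' p.1.1).rotation_rotation θ φ p.1.2))

lemma rot_zero (p : SM M) : rot o 0 p = p := by
  apply Subtype.ext
  simp [rot]

lemma rotD_add (θ φ : Real.Angle) (q : SM M × Disk) :
    rotD o θ (rotD o φ q) = rotD o (θ + φ) q := by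
  refine Prod.ext (rot_add o θ φ q.1) (Subtype.ext ?_)
  simp only [rotD, neg_add, Real.Angle.toCircle_add, Circle.coe_mul]
  ring

lemma rotD_zero (q : SM M × Disk) : rotD o 0 q = q := by
  refine Prod.ext (rot_zero o q.1) (Subtype.ext ?_)
  simp [rotD]

/-- The orbit relation of the circle action on `SM × 𝔻`. -/
def circleSetoid : Setoid (SM M × Disk) where
  r q r := ∃ θ : Real.Angle, rotD o θ q = r
  iseqv := ⟨fun q => ⟨0, rotD_zero o q⟩,
    by rintro q _ ⟨θ, rfl⟩; exact ⟨-θ, by rw [rotD_add, neg_add_cancel, rotD_zero]⟩,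
    by rintro q _ _ ⟨θ, rfl⟩ ⟨φ, rfl⟩; exact ⟨φ + θ, by rw [rotD_add]⟩⟩

/-- The twistor space `Z = (SM × 𝔻) / S¹`. -/
def Z : Type _ := Quotient (circleSetoid o)

/-- The quotient map `p : SM × 𝔻 → Z`. -/
def toZ (q : SM M × Disk) : Z o := Quotient.mk (circleSetoid o) q


lemma fourier_mul {f g : C(AddCircle (2 * Real.pi), ℂ)} (hf : ∀ k < 0, fourierCoeff f k = 0)
    (hg : ∀ k < 0, fourierCoeff g k = 0) (k : ℤ) (hk : k < 0) :
    fourierCoeff (fun t => f t * g t) k = 0 := by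
  let f' : C(AddCircle (2 * Real.pi), ℂ) := ⟨fun t => star (fourier (-k) t * f t), by fun_prop⟩
  let F := ContinuousMap.toLp (E := ℂ) 2 AddCircle.haarAddCircle ℂ f'
  let G := ContinuousMap.toLp (E := ℂ) 2 AddCircle.haarAddCircle ℂ g
  have h0 : inner ℂ F G = fourierCoeff (fun t => f t * g t) k := by
    rw [MeasureTheory.ContinuousMap.inner_toLp]
    unfold fourierCoeff
    congr 1
    ext t
    simp [f']
    ring_nf
  have h1 := fourierBasis.hasSum_inner_mul_inner F G
  rw [h0] at h1
  refine h1.unique ?_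
  convert! hasSum_zero with j
  by_cases hj : j < 0
  · have : inner ℂ (fourierBasis j) G = 0 := by
      rw [← fourierBasis.repr_apply_apply, fourierBasis_repr, fourierCoeff_toLp, hg j hj]
    rw [this, mul_zero]
  · have : inner ℂ (fourierBasis j) F = 0 := by
      rw [← fourierBasis.repr_apply_apply, fourierBasis_repr, fourierCoeff_toLp]
      have h2 := hf (k - j) (by omega)
      rw [← star_eq_zero, ← h2]
      unfold fourierCoeff
      rw [← starRingEnd_apply, ← integral_conj]
      congr 1
      ext t
      have h3 : fourier (-(k - j)) t = fourier (-k) t * fourier j t := by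
        rw [show -(k - j) = -k + j by ring, fourier_add]
      rw [h3]
      simp [f']
      ring_nf
    rw [← inner_conj_symm, this]
    simp

lemma homExt_eq (u : SM M → ℂ) (p : SM M) : homExt u p.1 = u p := by
  have hp : p.1.2 ≠ 0 := by
    intro h; have := p.2; rw [h, norm_zero] at this; exact zero_ne_one this
  rw [homExt, dif_pos hp]
  congr 1
  apply Subtype.ext
  have := p.2
  simp [normalize, this]

lemma SmoothSM.continuous_fibre {u : SM M → ℂ} (hu : SmoothSM u) (p : SM M) :
    Continuous fun θ : AddCircle (2 * Real.pi) => u (rot o θ p) := by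
  have h1 : Continuous fun θ : Real.Angle => (rot o θ p).1 := by
    have h2 : Continuous fun θ : Real.Angle => (o.at' p.1.1).rotation θ p.1.2 := by
      simp only [Orientation.rotation_apply]
      have := Real.Angle.continuous_cos
      have := Real.Angle.continuous_sin
      fun_prop
    exact (FiberBundle.continuous_totalSpaceMk E2 (TangentSpace (𝓡∂ 2)) p.1.1).comp h2
  have h3 : Continuous fun θ : Real.Angle => homExt u (rot o θ p).1 := by
    refine hu.continuousOn.comp_continuous h1 fun θ h => ?_
    have := (rot o θ p).2; rw [h, norm_zero] at this; exact zero_ne_one this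
  simp only [homExt_eq] at h3
  exact h3

lemma FibrewiseHolomorphic.mul {u w : SM M → ℂ} (hu : SmoothSM u) (hw : SmoothSM w)
    (hu' : FibrewiseHolomorphic o u) (hw' : FibrewiseHolomorphic o w) :
    FibrewiseHolomorphic o (fun p => u p * w p) := fun k hk p =>
  fourier_mul (f := ⟨_, hu.continuous_fibre o p⟩) (g := ⟨_, hw.continuous_fibre o p⟩)
    (fun k hk => hu' k hk p) (fun k hk => hw' k hk p) k hk

lemma FibrewiseHolomorphic.sum {ι : Type*} (s : Finset ι) {u : ι → SM M → ℂ}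
    (hu : ∀ i, SmoothSM (u i)) (hu' : ∀ i, FibrewiseHolomorphic o (u i)) :
    FibrewiseHolomorphic o (fun p => ∑ i ∈ s, u i p) := by
  intro k hk p
  have := fourierCoeff.sum (T := 2 * Real.pi) s (fun i θ => u i (rot o θ p))
    (fun i _ => ((hu i).continuous_fibre o p).integrable_of_hasCompactSupport
      (HasCompactSupport.of_compactSpace _))
  have h2 := congrFun this k
  rw [Finset.sum_apply] at h2
  have h3 : ∑ i ∈ s, fourierCoeff (T := 2 * Real.pi) (fun θ => u i (rot o θ p)) k = 0 :=
    Finset.sum_eq_zero fun i _ => hu' i k hk p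
  rw [h3] at h2
  rw [fourierMode, ← h2]
  congr 1
  funext θ
  rw [Finset.sum_apply]

section

variable {E' H' N : Type*} [NormedAddCommGroup E'] [NormedSpace ℝ E'] [TopologicalSpace H']
  {J : ModelWithCorners ℝ E' H'} [TopologicalSpace N] [ChartedSpace H' N] {s : Set N}

lemma contMDiffOn_mul {u w : N → ℂ} (hu : ContMDiffOn J 𝓘(ℝ, ℂ) ∞ u s)
    (hw : ContMDiffOn J 𝓘(ℝ, ℂ) ∞ w s) : ContMDiffOn J 𝓘(ℝ, ℂ) ∞ (fun y => u y * w y) s :=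
  (contDiff_fst.mul contDiff_snd : ContDiff ℝ ∞ fun z : ℂ × ℂ => z.1 * z.2).contMDiff.comp_contMDiffOn
    (hu.prodMk_space hw)

lemma contMDiffOn_inv {u : N → ℂ} (hu : ContMDiffOn J 𝓘(ℝ, ℂ) ∞ u s) (h : ∀ y ∈ s, u y ≠ 0) :
    ContMDiffOn J 𝓘(ℝ, ℂ) ∞ (fun y => (u y)⁻¹) s := fun y hy =>
  (contDiffAt_inv ℝ (h y hy)).contMDiffAt.comp_contMDiffWithinAt y (hu y hy)

end

lemma functionClassSM : FunctionClass (SmoothSM (M := M)) where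
  const c := (contMDiffOn_const (c := c)).congr fun p hp => dif_pos hp
  add hu hw := (ContMDiffOn.add hu hw).congr fun p (hp : p.2 ≠ 0) => by simp [homExt, hp]
  mul hu hw := (contMDiffOn_mul hu hw).congr fun p (hp : p.2 ≠ 0) => by simp [homExt, hp]
  inv hu h := (contMDiffOn_inv hu fun p (hp : p.2 ≠ 0) => by simp [homExt, hp, h]).congr
    fun p (hp : p.2 ≠ 0) => by simp [homExt, hp]

lemma homExtD_of_mem (h : SM M × Disk → ℂ) {q : TangentBundle (𝓡∂ 2) M × ℂ}
    (hq : q ∈ {p : TangentBundle (𝓡∂ 2) M | p.2 ≠ 0} ×ˢ Metric.closedBall (0 : ℂ) 1) :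
    homExtD h q = h (normalize q.1 hq.1, ⟨q.2, hq.2⟩) := dif_pos hq

lemma functionClassSMD : FunctionClass (SmoothSMD (M := M)) where
  const c := (contMDiffOn_const (c := c)).congr fun p hp => dif_pos hp
  add hu hw := (ContMDiffOn.add hu hw).congr fun p hp => by simp only [homExtD_of_mem _ hp, Pi.add_apply]
  mul hu hw := (contMDiffOn_mul hu hw).congr fun p hp => by simp only [homExtD_of_mem _ hp]
  inv hu h := (contMDiffOn_inv hu fun p hp => by rw [homExtD_of_mem _ hp]; exact h _).congr
    fun p hp => by simp only [homExtD_of_mem _ hp]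

lemma isOpen_nonzero : IsOpen {p : TangentBundle (𝓡∂ 2) M | p.2 ≠ 0} := by
  rw [isOpen_iff_mem_nhds]
  intro p hp
  let e := trivializationAt E2 (TangentSpace (𝓡∂ 2)) p.1
  have hpe : p ∈ e.source := (e.mem_source).2 (FiberBundle.mem_baseSet_trivializationAt' p.1)
  have key : ∀ q ∈ e.source, (e q).2 ≠ 0 ↔ q.2 ≠ 0 := by
    intro q hq
    have hq' := e.mem_source.1 hq
    have : (e q).2 = e.linearEquivAt ℝ q.1 hq' q.2 := rfl
    rw [this]
    exact (e.linearEquivAt ℝ q.1 hq').map_ne_zero_iff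
  have h1 : ContinuousAt (fun q => (e q).2) p :=
    (continuous_snd.continuousAt).comp (e.continuousAt hpe)
  filter_upwards [e.open_source.mem_nhds hpe, h1.eventually_ne ((key p hpe).2 hp)] with q hq hq'
  exact (key q hq).1 hq'

lemma SM.ne_zero (p : SM M) : p.1.2 ≠ 0 := by
  intro h; have := p.2; rw [h, norm_zero] at this; exact zero_ne_one this

lemma SmoothSM.mdifferentiableAt {u : SM M → ℂ} (hu : SmoothSM u) (p : SM M) :
    MDifferentiableAt (𝓡∂ 2).tangent 𝓘(ℝ, ℂ) (homExt u) p.1 :=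
  (hu.contMDiffAt (isOpen_nonzero.mem_nhds (SM.ne_zero p))).mdifferentiableAt (by simp)

lemma horDeriv_const (c : ℂ) (p : SM M) (w) : horDeriv (fun _ => c) p w = 0 := by
  have h : homExt (fun _ : SM M => c) =ᶠ[𝓝 p.1] fun _ => c := by
    filter_upwards [isOpen_nonzero.mem_nhds (SM.ne_zero p)] with q hq
    exact dif_pos hq
  rw [horDeriv, mvfderiv, h.mfderiv_eq, mfderiv_const]
  rfl

lemma horDeriv_add {u v : SM M → ℂ} (hu : SmoothSM u) (hv : SmoothSM v) (p : SM M) (w) :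
    horDeriv (fun q => u q + v q) p w = horDeriv u p w + horDeriv v p w := by
  have : homExt (fun q => u q + v q) = homExt u + homExt v := by
    funext q; by_cases hq : q.2 = 0 <;> simp [homExt, hq]
  rw [horDeriv, this, mvfderiv_add (hu.mdifferentiableAt p) (hv.mdifferentiableAt p)]
  rfl

lemma horDeriv_mul {u v : SM M → ℂ} (hu : SmoothSM u) (hv : SmoothSM v) (p : SM M) (w) :
    horDeriv (fun q => u q * v q) p w = horDeriv u p w * v p + u p * horDeriv v p w := by
  have : homExt (fun q => u q * v q) = homExt u * homExt v := by
    funext q; by_cases hq : q.2 = 0 <;> simp [homExt, hq]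
  have h := ((hu.mdifferentiableAt p).hasMFDerivAt.mul (hv.mdifferentiableAt p).hasMFDerivAt).mfderiv
  rw [horDeriv, this, mvfderiv, h]
  simp only [homExt_eq]
  change u p * horDeriv v p w + v p * horDeriv u p w = _
  ring

lemma derivationX : DerivationOn (SmoothSM (M := M)) X where
  const c p := horDeriv_const c p _
  add hu hw p := horDeriv_add hu hw p _
  mul hu hw p := horDeriv_mul hu hw p _

lemma SmoothSMD.slice {h : SM M × Disk → ℂ} (hh : SmoothSMD h) (z : Disk) :
    SmoothSM fun p => h (p, z) := by
  have h1 : ContMDiffOn (𝓡∂ 2).tangent 𝓘(ℝ, ℂ) ∞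
      (fun p : TangentBundle (𝓡∂ 2) M => homExtD h (p, z.1)) {p | p.2 ≠ 0} :=
    ContMDiffOn.comp hh ((contMDiff_id.prodMk contMDiff_const).contMDiffOn)
      fun p hp => ⟨hp, z.2⟩
  refine h1.congr fun p hp => ?_
  rw [homExtD_of_mem h ⟨hp, z.2⟩, homExt, dif_pos (show p.2 ≠ 0 from hp)]

lemma derivationDbar₁ : DerivationOn (SmoothSMD (M := M)) (dbar₁ o) where
  const c q := by
    simp only [dbar₁, etaPlus, etaMinus, X, Xperp, horDeriv_const]; ring
  add hu hw q := by
    simp only [dbar₁, etaPlus, etaMinus, X, Xperp, horDeriv_add (hu.slice q.2) (hw.slice q.2)]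
    ring
  mul hu hw q := by
    simp only [dbar₁, etaPlus, etaMinus, X, Xperp, horDeriv_mul (hu.slice q.2) (hw.slice q.2)]
    ring

lemma SmoothSMD.differentiableWithinAt {h : SM M × Disk → ℂ} (hh : SmoothSMD h)
    (q : SM M × Disk) :
    DifferentiableWithinAt ℝ (diskExt h q.1) (Metric.closedBall 0 1) q.2.1 := by
  have h1 : ContMDiffOn 𝓘(ℝ, ℂ) 𝓘(ℝ, ℂ) ∞
      (fun z : ℂ => homExtD h (q.1.1, z)) (Metric.closedBall 0 1) :=
    ContMDiffOn.comp hh ((contMDiff_const.prodMk contMDiff_id).contMDiffOn)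
      fun z hz => ⟨SM.ne_zero q.1, hz⟩
  have h2 : ContDiffOn ℝ ∞ (diskExt h q.1) (Metric.closedBall 0 1) := by
    refine h1.contDiffOn.congr fun z hz => ?_
    rw [homExtD_of_mem h (q := (q.1.1, z)) ⟨SM.ne_zero q.1, hz⟩, diskExt, dif_pos hz]
    congr 2
    apply Subtype.ext
    have := q.1.2
    simp [normalize, this]
  exact (h2.differentiableOn (by simp)) _ q.2.2

lemma uniqueDiffDisk (z : Disk) : UniqueDiffWithinAt ℝ (Metric.closedBall (0 : ℂ) 1) z.1 :=
  uniqueDiffWithinAt_convex (convex_closedBall 0 1)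
    ⟨0, by rw [interior_closedBall _ one_ne_zero]; simp⟩ (subset_closure z.2)

lemma diskExt_eq (h : SM M × Disk → ℂ) (q : SM M × Disk) : diskExt h q.1 q.2.1 = h q :=
  dif_pos q.2.2

lemma derivationDbar₂ : DerivationOn (SmoothSMD (M := M)) dbar₂ where
  const c q := by
    have h : ∀ z ∈ Metric.closedBall (0 : ℂ) 1, diskExt (fun _ => c) q.1 z = c :=
      fun z hz => dif_pos hz
    rw [dbar₂, fderivWithin_congr h (h _ q.2.2), fderivWithin_const_apply]
    simp
  add {u w} hu hw q := by
    have h : diskExt (fun z => u z + w z) q.1 = diskExt u q.1 + diskExt w q.1 := by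
      funext z; by_cases hz : z ∈ Metric.closedBall (0 : ℂ) 1 <;> simp only [diskExt, hz, Pi.add_apply] <;> simp
    rw [dbar₂, h, fderivWithin_add (uniqueDiffDisk q.2) (hu.differentiableWithinAt q)
      (hw.differentiableWithinAt q)]
    simp only [dbar₂, add_apply]
    ring
  mul {u w} hu hw q := by
    have h : diskExt (fun z => u z * w z) q.1 = diskExt u q.1 * diskExt w q.1 := by
      funext z; by_cases hz : z ∈ Metric.closedBall (0 : ℂ) 1 <;> simp only [diskExt, hz, Pi.mul_apply] <;> simp
    rw [dbar₂, h, fderivWithin_mul (uniqueDiffDisk q.2) (hu.differentiableWithinAt q)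
      (hw.differentiableWithinAt q)]
    simp only [dbar₂, add_apply, smul_apply, diskExt_eq, smul_eq_mul]
    ring

variable (n : ℕ)

/-- The group `𝔾` of smooth `F : SM → GL(n, ℂ)` with `F` and `F⁻¹` fibrewise holomorphic. -/
def GG : Subgroup (SM M → GL (Fin n) ℂ) where
  carrier := {F | SmoothMat (fun p => (F p).1) ∧
    (∀ i j, FibrewiseHolomorphic o fun p => (F p).1 i j) ∧
    ∀ i j, FibrewiseHolomorphic o fun p => ((F p)⁻¹ : GL (Fin n) ℂ).1 i j}
  one_mem' := by
    have h : ∀ c : ℂ, FibrewiseHolomorphic o fun _ => c := by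
      intro c k hk p
      have h := fourierCoeff.const_mul (T := 2 * Real.pi) (fourier 0) c k
      rw [fourierCoeff_fourier, Pi.single_eq_of_ne hk.ne, mul_zero] at h
      simp only [fourier_zero, mul_one] at h
      exact h
    refine ⟨fun i j => functionClassSM.const _, fun i j => ?_, fun i j => ?_⟩
    · exact h _
    · simpa using h ((1 : Mat n) i j)
  mul_mem' := by
    rintro F G ⟨hF, hF1, hF2⟩ ⟨hG, hG1, hG2⟩
    have h : ∀ {A B : SM M → Mat n}, SmoothMat A → SmoothMat B →
        (∀ i j, FibrewiseHolomorphic o fun p => A p i j) →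
        (∀ i j, FibrewiseHolomorphic o fun p => B p i j) →
        ∀ i j, FibrewiseHolomorphic o fun p => (A p * B p) i j := by
      intro A B hA hB hA' hB' i j
      simp only [Matrix.mul_apply]
      exact FibrewiseHolomorphic.sum o _ (fun k => functionClassSM.mul (hA i k) (hB k j))
        fun k => FibrewiseHolomorphic.mul o (hA i k) (hB k j) (hA' i k) (hB' k j)
    refine ⟨functionClassSM.matMul hF hG, h hF hG hF1 hG1, ?_⟩
    simp only [Pi.mul_apply, mul_inv_rev, Units.val_mul]
    exact h (functionClassSM.matInv hG) (functionClassSM.matInv hF) hG2 hF2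
  inv_mem' := by
    rintro F ⟨hF, hF1, hF2⟩
    exact ⟨functionClassSM.matInv hF, hF2, by simpa using hF1⟩

/-- The orbit relation of the right action `A ◁ F = F⁻¹ X F + F⁻¹ A F` of `𝔾`. -/
def orbitSetoid : Setoid (Mho o n) where
  r A B := ∃ F ∈ GG o n, B.1 = gaugeAct X A.1 F
  iseqv := by
    refine ⟨fun A => ⟨1, one_mem _, (gaugeAct_one derivationX A.1).symm⟩, ?_, ?_⟩
    · rintro A B ⟨F, hF, h⟩
      exact ⟨F⁻¹, inv_mem hF, by rw [h, gaugeAct_inv functionClassSM derivationX _ hF.1]⟩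
    · rintro A B C ⟨F, hF, h⟩ ⟨G, hG, h'⟩
      refine ⟨F * G, mul_mem hF hG, ?_⟩
      rw [h', h, gaugeAct_mul functionClassSM derivationX _ hF.1 hG.1]

/-- The gauges `φ ∈ C^∞(Z, GL(n, ℂ))`, a function on `Z` being smooth when its pullback to
`SM × 𝔻` is. -/
def Gauge : Subgroup (Z o → GL (Fin n) ℂ) where
  carrier := {φ | ∀ i j, SmoothSMD fun q => (φ (toZ o q)).1 i j}
  one_mem' := fun _ _ => functionClassSMD.const _
  mul_mem' := fun hφ hψ => functionClassSMD.matMul hφ hψ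
  inv_mem' := fun hφ => functionClassSMD.matInv (F := fun _ => _) hφ

/-- Gauge equivalence `B^{0,1} = φ⁻¹ ∂̄ φ + φ⁻¹ A^{0,1} φ`. -/
def gaugeSetoid : Setoid (FlatPartialConnection o n) where
  r a b := ∃ φ ∈ Gauge o n,
    b.1.1 = gaugeAct (dbar₁ o) a.1.1 (fun q => φ (toZ o q)) ∧
    b.1.2 = gaugeAct dbar₂ a.1.2 (fun q => φ (toZ o q))
  iseqv := by
    refine ⟨fun a => ⟨1, one_mem _, (gaugeAct_one (derivationDbar₁ o) _).symm,
      (gaugeAct_one derivationDbar₂ _).symm⟩, ?_, ?_⟩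
    · rintro a b ⟨φ, hφ, h₁, h₂⟩
      refine ⟨φ⁻¹, inv_mem hφ, ?_, ?_⟩
      · rw [h₁]; exact (gaugeAct_inv functionClassSMD (derivationDbar₁ o) _ hφ).symm
      · rw [h₂]; exact (gaugeAct_inv functionClassSMD derivationDbar₂ _ hφ).symm
    · rintro a b c ⟨φ, hφ, h₁, h₂⟩ ⟨ψ, hψ, h₃, h₄⟩
      refine ⟨φ * ψ, mul_mem hφ hψ, ?_, ?_⟩
      · rw [h₃, h₁, ← gaugeAct_mul functionClassSMD (derivationDbar₁ o) _ hφ hψ]; rfl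
      · rw [h₄, h₂, ← gaugeAct_mul functionClassSMD derivationDbar₂ _ hφ hψ]; rfl

/-- The moduli space `𝔐_n(Z)`. -/
def Moduli : Type _ := Quotient (gaugeSetoid o n)

/-- The map `A ↦ [A^{0,1}]` into the moduli space, given that every `A^{0,1}` has vanishing
curvature. -/
def toModuli (hflat : ∀ A : Mho o n, IsFlat o (twistorForm o A.1)) (A : Mho o n) : Moduli o n :=
  Quotient.mk (gaugeSetoid o n) ⟨twistorForm o A.1, hflat A⟩

end Surface

end Twistor

end

/-! The dictionary behind the correspondence is boundary values. A smooth `u` on `SM` with `u_k = 0`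
for `k < c` extends to `h = ∑ ω^m u_{m+c}` on `SM × 𝔻`, which is smooth up to the boundary,
holomorphic in `ω`, and satisfies `h(p, e^{it}) = e^{-ict} u(φ_t p)`; this relation is
`IsDiskExtension`. The extension is unique, it has weight `c` under the circle action, and sums and
products of extensions are extensions. Conversely, Cauchy's theorem shows that boundary values of
this form have no modes below `c`. Horizontal lifts commute with the circle action, so `e^{it} X
u(φ_t p)` equals `ω² η₊ h + η₋ h` at `ω = e^{it}` when `c = 0`. The geodesic field therefore
corresponds to the first component of `∂̄` (`IsDiskExtension.apply_dbar₁`).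

Consequently `℧` corresponds to flat connections with `a₂ = 0`, and `𝔾` to gauges on `Z` killed by
`∂_{ω̄}`; the two gauge actions match. This yields the action, flatness and invariance. A gauge
between `(a, 0)` and `(b, 0)` must satisfy `∂_{ω̄} φ = 0`, so its restriction to `ω = 1` lies in
`𝔾`; this is injectivity.

For surjectivity it suffices to solve `∂_{ω̄} φ + a₂ φ = 0` by an invertible smooth `φ` on `Z`: in
that gauge flatness makes the first component holomorphic in `ω`, and its weight `-1` places it in
the image of `℧` (`exists_mho_of_gauge`). Over a disk a nonvanishing vector field identifies `Z`
with `M × 𝔻`, and the problem becomes a `∂̄`-equation on the closed disk with a smooth parameter in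
a closed disk (`exists_frame_bidisc`). The coefficient is extended to a compactly supported one on
`ℂ²` by reflections with infinitely many matching moments. For a fixed parameter, a Neumann series
together with a dimension count produces a solution `V` asymptotic to a nonzero polynomial times the
identity. Its determinant is an entire function up to a nonvanishing factor, and its zeros in a disc
are divided out one by one (`exists_frame_on_disc`). A second Neumann series treats nearby
parameters. Local families differ by factors holomorphic in `ω`; such a factor may be reparametrised
freely in the parameter, hence extended by a smooth retraction, and this glues the families
(`IsFrame.glue`).

The geometric input is regularity. The horizontal derivative is defined in the chart at each base
point, so the transformation law of the Christoffel symbols is needed to express it in one fixed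
chart (`horDeriv_eq`). That the rotation by a right angle is parallel makes horizontal lifts
rotation invariant, and symmetry of second derivatives makes the two components of `∂̄` commute. -/

noncomputable section

namespace Twistor

attribute [-instance] instNormedAddCommGroupOfRiemannianBundleOfIsTopologicalAddGroupOfContinuousConstSMulReal
  instInnerProductSpaceReal

open MeasureTheory Complex Set

/-! ### The Cauchy–Pompeiu formula. -/

section CauchyKernel

variable {F : Type*} [NormedAddCommGroup F] [NormedSpace ℂ F]

/-- The Cauchy kernel `1 / (π w)`, the fundamental solution of `∂̄`. -/
def cauchyKernel (w : ℂ) : ℂ := ((Real.pi : ℂ) * w)⁻¹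

/-- The Wirtinger derivative `∂f/∂z̄`. -/
def dbar (f : ℂ → F) (z : ℂ) : F := (2⁻¹ : ℂ) • (fderiv ℝ f z 1 + I • fderiv ℝ f z I)

lemma measurable_cauchyKernel : Measurable cauchyKernel := by
  unfold cauchyKernel; fun_prop

lemma locallyIntegrable_cauchyKernel : LocallyIntegrable cauchyKernel := by
  refine locallyIntegrable_of_norm_le_rpow (C := Real.pi⁻¹) (α := 1) ?_ ?_ ?_ ?_
  · simp
  · simp
  · refine Filter.Eventually.of_forall fun x => ?_
    rw [cauchyKernel, mul_inv, norm_mul, norm_inv, norm_inv, Complex.norm_real,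
      Real.norm_of_nonneg Real.pi_pos.le, Real.rpow_neg_one]
  · exact measurable_cauchyKernel.aestronglyMeasurable

variable [CompleteSpace F]

/-- In polar coordinates around `z` the Jacobian cancels the singularity, and `∂̄` splits into a
radial and an angular derivative. The radial part integrates to `f z` along every ray; the angular
part integrates to zero over every circle. -/
theorem integral_cauchyKernel_smul_dbar {f : ℂ → F} (hf : ContDiff ℝ 1 f)
    (hc : HasCompactSupport f) (z : ℂ) : ∫ w, cauchyKernel w • dbar f (z - w) = f z := by
  let u : ℝ → ℂ := fun θ => Real.cos θ + Real.sin θ * I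
  let D1 : ℝ × ℝ → F := fun p => fderiv ℝ f (z - p.1 * u p.2) (u p.2)
  let D2 : ℝ × ℝ → F := fun p => fderiv ℝ f (z - p.1 * u p.2) (I * u p.2)
  have hu : Continuous u := by fun_prop
  have hDf : Continuous (fderiv ℝ f) := hf.continuous_fderiv (by simp)
  have hD1 : Continuous D1 := by
    have : Continuous fun p : ℝ × ℝ => fderiv ℝ f (z - p.1 * u p.2) := by fun_prop
    exact this.clm_apply (by fun_prop)
  have hD2 : Continuous D2 := by
    have : Continuous fun p : ℝ × ℝ => fderiv ℝ f (z - p.1 * u p.2) := by fun_prop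
    exact this.clm_apply (by fun_prop)
  have hnu : ∀ θ, ‖u θ‖ = 1 := fun θ => by
    have := Complex.norm_exp_ofReal_mul_I θ
    rwa [Complex.exp_mul_I, ← Complex.ofReal_cos, ← Complex.ofReal_sin] at this
  -- the integrand vanishes for large radius
  obtain ⟨R, hR⟩ := hc.isCompact.isBounded.subset_closedBall z
  have hfar : ∀ r θ : ℝ, R < r → z - r * u θ ∉ tsupport f := by
    intro r θ hr h
    have h1 := hR h
    rw [Metric.mem_closedBall, dist_eq_norm, sub_sub_cancel_left, norm_neg, norm_mul, hnu,
      Complex.norm_real, mul_one] at h1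
    exact absurd ((le_abs_self r).trans h1) (not_le.2 hr)
  have hzero : ∀ r θ : ℝ, R < r → fderiv ℝ f (z - r * u θ) = 0 := fun r θ hr => by
    by_contra h
    exact hfar r θ hr (support_fderiv_subset ℝ h)
  have hint : ∀ D : ℝ × ℝ → F, Continuous D → (∀ r θ, R < r → D (r, θ) = 0) →
      IntegrableOn D (Ioi (0 : ℝ) ×ˢ Ioo (-Real.pi) Real.pi) := by
    intro D hD h0
    have h1 : IntegrableOn D (Ioc 0 R ×ˢ Ioo (-Real.pi) Real.pi) :=
      (hD.continuousOn.integrableOn_compact (isCompact_Icc.prod isCompact_Icc)).mono_set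
        (prod_mono Ioc_subset_Icc_self Ioo_subset_Icc_self)
    refine h1.of_forall_sdiff_eq_zero (measurableSet_Ioi.prod measurableSet_Ioo) ?_
    rintro ⟨r, θ⟩ ⟨⟨hr, hθ⟩, hn⟩
    refine h0 r θ (not_le.1 fun h => hn ⟨⟨hr, h⟩, hθ⟩)
  have hI1 := hint D1 hD1 fun r θ hr => by simp [D1, hzero r θ hr]
  have hI2 := hint D2 hD2 fun r θ hr => by simp [D2, hzero r θ hr]
  rw [← Complex.integral_comp_polarCoord_symm]
  -- For `u = e^{iθ}` and a real-linear `L` one has `u⁻¹ (L 1 + i L i) = L u + i L (i u)`, while the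
  -- radius cancels against the kernel.
  have hcongr : EqOn (fun p : ℝ × ℝ => p.1 • (cauchyKernel (Complex.polarCoord.symm p) •
      dbar f (z - Complex.polarCoord.symm p)))
      (fun p => ((2 * Real.pi : ℝ) : ℂ)⁻¹ • (D1 p + I • D2 p)) polarCoord.target := by
    rintro ⟨r, θ⟩ hp
    have hr : (r : ℂ) ≠ 0 := by exact_mod_cast (show (0 : ℝ) < r from hp.1).ne'
    simp only [Complex.polarCoord_symm_apply]
    have hw : (r : ℂ) * (Real.cos θ + Real.sin θ * I) = r * u θ := rfl
    rw [hw]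
    simp only [D1, D2, dbar]
    generalize fderiv ℝ f (z - r * u θ) = L
    have e1 : L (u θ) = (Real.cos θ : ℂ) • L 1 + (Real.sin θ : ℂ) • L I := by
      have : u θ = Real.cos θ • (1 : ℂ) + Real.sin θ • I := by simp [u]
      rw [this, map_add, map_smul, map_smul]; simp only [Complex.coe_smul]
    have e2 : L (I * u θ) = (Real.cos θ : ℂ) • L I - (Real.sin θ : ℂ) • L 1 := by
      have : I * u θ = Real.cos θ • I - Real.sin θ • (1 : ℂ) := by
        simp only [u, Complex.real_smul]; linear_combination (Real.sin θ : ℂ) * I_mul_I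
      rw [this, map_sub, map_smul, map_smul]; simp only [Complex.coe_smul]
    have e3 : (u θ)⁻¹ = Real.cos θ - Real.sin θ * I := by
      refine inv_eq_of_mul_eq_one_right ?_
      have : (Real.sin θ : ℂ) ^ 2 + (Real.cos θ : ℂ) ^ 2 = 1 := by
        exact_mod_cast Real.sin_sq_add_cos_sq θ
      simp only [u]
      linear_combination this - (Real.sin θ : ℂ) ^ 2 * I_mul_I
    rw [e1, e2, cauchyKernel, ← Complex.coe_smul]
    have e4 : ((Real.pi : ℂ) * (r * u θ))⁻¹ = (Real.pi : ℂ)⁻¹ * (r : ℂ)⁻¹ * (Real.cos θ - Real.sin θ * I) := by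
      rw [mul_inv, mul_inv, e3]; ring
    rw [e4]
    have hpi : (Real.pi : ℂ) ≠ 0 := by exact_mod_cast Real.pi_ne_zero
    push_cast
    match_scalars
    · field_simp; ring
    · field_simp; linear_combination (-Complex.sin θ) * I_mul_I
  rw [setIntegral_congr_fun polarCoord.open_target.measurableSet hcongr, integral_smul]
  have htarget : polarCoord.target = Ioi (0 : ℝ) ×ˢ Ioo (-Real.pi) Real.pi := rfl
  rw [htarget, integral_add (g := fun p => I • D2 p) hI1 (hI2.smul I), integral_smul]
  have hderiv : ∀ r θ : ℝ, HasDerivAt (fun r : ℝ => - f (z - r * u θ)) (D1 (r, θ)) r := by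
    intro r θ
    have h1 : HasDerivAt (fun r : ℝ => z - r * u θ) (-u θ) r := by
      simpa using ((Complex.ofRealCLM.hasDerivAt (x := r)).mul_const (u θ)).const_sub z
    have h2 := (((hf.differentiable one_ne_zero) (z - r * u θ)).hasFDerivAt.comp_hasDerivAt r h1).neg
    convert! h2 using 1; simp [D1]
  -- The radial variable is integrated first: `-f (z - r u)` is a primitive of `D1` that vanishes
  -- for large `r` and equals `-f z` at `r = 0`.
  have s1 : ∫ p in Ioi (0 : ℝ) ×ˢ Ioo (-Real.pi) Real.pi, D1 p = (2 * Real.pi) • f z := by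
    have h1 : ∀ θ, ∫ r in Ioi (0 : ℝ), D1 (r, θ) = f z := by
      intro θ
      have h2 : IntegrableOn (fun r => D1 (r, θ)) (Ioi 0) := by
        have : IntegrableOn (fun r => D1 (r, θ)) (Icc 0 R) :=
          (Continuous.continuousOn (by fun_prop)).integrableOn_compact isCompact_Icc
        refine this.of_forall_sdiff_eq_zero measurableSet_Ioi fun r hr => ?_
        have : R < r := not_le.1 fun h => hr.2 ⟨le_of_lt hr.1, h⟩
        simp [D1, hzero r θ this]
      rw [integral_Ioi_of_hasDerivAt_of_tendsto (m := 0) (hderiv 0 θ).continuousAt.continuousWithinAt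
        (fun r _ => hderiv r θ) h2]
      · simp
      · refine tendsto_const_nhds.congr' ?_
        filter_upwards [Filter.eventually_gt_atTop R] with r hr
        rw [image_eq_zero_of_notMem_tsupport (hfar r θ hr), neg_zero]
    rw [Measure.volume_eq_prod] at hI1 ⊢
    rw [← setIntegral_prod_swap, setIntegral_prod (fun z => D1 z.swap) hI1.swap]
    simp only [Prod.swap_prod_mk, h1]
    rw [setIntegral_const]
    simp [Measure.real, Real.pi_pos.le, two_mul]
  -- For fixed `r` the function `D2` is a derivative in `θ` whose primitive has equal values at `-π`
  -- and `π`.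
  have s2 : ∫ p in Ioi (0 : ℝ) ×ˢ Ioo (-Real.pi) Real.pi, D2 p = 0 := by
    rw [Measure.volume_eq_prod] at hI2 ⊢
    rw [setIntegral_prod _ hI2]
    refine setIntegral_eq_zero_of_forall_eq_zero fun r hr => ?_
    have hr : (r : ℂ) ≠ 0 := by exact_mod_cast (show (0 : ℝ) < r from hr).ne'
    rw [← integral_Ioc_eq_integral_Ioo, ← intervalIntegral.integral_of_le (by linarith [Real.pi_pos])]
    have h1 : ∀ θ : ℝ, HasDerivAt (fun θ : ℝ => - ((r : ℝ)⁻¹ • f (z - r * u θ))) (D2 (r, θ)) θ := by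
      intro θ
      have hu' : HasDerivAt u (I * u θ) θ := by
        have h := ((Real.hasDerivAt_cos θ).ofReal_comp).add
          (((Real.hasDerivAt_sin θ).ofReal_comp).mul_const I)
        convert! h using 1
        simp only [u]; push_cast
        linear_combination Complex.sin θ * I_mul_I
      have h1 : HasDerivAt (fun θ : ℝ => z - r * u θ) (-(r * (I * u θ))) θ :=
        (hu'.const_mul (r : ℂ)).const_sub z
      have h2 := ((((hf.differentiable one_ne_zero) (z - r * u θ)).hasFDerivAt.comp_hasDerivAt θ
        h1).const_smul (r : ℝ)⁻¹).neg
      convert! h2 using 1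
      rw [← map_smul, ← map_neg]
      simp only [D2]
      congr 1
      rw [Complex.real_smul]; push_cast; field_simp
    rw [intervalIntegral.integral_eq_sub_of_hasDerivAt (fun θ _ => h1 θ)
      (Continuous.intervalIntegrable (by fun_prop) _ _)]
    simp [u]
  rw [s1, s2, smul_zero, add_zero, ← Complex.coe_smul, smul_smul, inv_mul_cancel₀, one_smul]
  exact_mod_cast (by positivity : (2 * Real.pi) ≠ 0)

end CauchyKernel

end Twistor

end

/-! ### Smoothness of solutions of convolution equations, by translation. -/

noncomputable section

namespace Twistor

attribute [-instance] instNormedAddCommGroupOfRiemannianBundleOfIsTopologicalAddGroupOfContinuousConstSMulReal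
  instInnerProductSpaceReal

open MeasureTheory Complex Set BoundedContinuousFunction

section Translation

variable {G F : Type} [NormedAddCommGroup G] [NormedSpace ℝ G]
  [NormedAddCommGroup F] [NormedSpace ℝ F]

/-- Translation of a bounded continuous function. -/
def translate (s : G) (f : G →ᵇ F) : G →ᵇ F := f.compContinuous ⟨fun p => s + p, by fun_prop⟩

@[simp] lemma translate_apply (s : G) (f : G →ᵇ F) (p : G) : translate s f p = f (s + p) := rfl

/-- A bounded family of linear maps as a linear map into bounded functions. -/
def flipBounded : (G →ᵇ (G →L[ℝ] F)) →L[ℝ] (G →L[ℝ] (G →ᵇ F)) :=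
  LinearMap.mkContinuous₂
    (LinearMap.mk₂ ℝ (fun (f : G →ᵇ (G →L[ℝ] F)) (h : G) =>
        ((ContinuousLinearMap.apply ℝ F h).compLeftContinuousBounded G f : G →ᵇ F))
      (fun f g h => by ext p; rfl) (fun c f h => by ext p; rfl)
      (fun f h k => by ext p; simp) (fun c f h => by ext p; simp)) 1 (fun f h => by
        rw [one_mul]
        refine (BoundedContinuousFunction.norm_le (by positivity)).2 fun p => ?_
        exact ((f p).le_opNorm h).trans (by gcongr; exact f.norm_coe_le_norm p))

@[simp] lemma flipBounded_apply (f : G →ᵇ (G →L[ℝ] F)) (h p : G) : flipBounded f h p = f p h := rfl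

/-- A compactly supported continuous function as a bounded continuous function. -/
def bddOfCompactSupport (f : G → F) (hf : Continuous f) (hc : HasCompactSupport f) : G →ᵇ F :=
  BoundedContinuousFunction.ofNormedAddCommGroup f hf (hc.exists_bound_of_continuous hf).choose
    (hc.exists_bound_of_continuous hf).choose_spec

@[simp] lemma bddOfCompactSupport_apply (f : G → F) (hf : Continuous f) (hc : HasCompactSupport f)
    (p : G) : bddOfCompactSupport f hf hc p = f p := rfl

/-- The expansion must hold in the sup norm, so the remainder has to be uniform in the point.
Uniform continuity of the compactly supported derivative supplies this. -/
lemma hasFDerivAt_translate (f : G →ᵇ F) (hf : ContDiff ℝ 1 f) (hc : HasCompactSupport f) (s : G) :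
    HasFDerivAt (fun s => translate s f) (flipBounded (translate s (bddOfCompactSupport (fderiv ℝ f)
      (hf.continuous_fderiv (by simp)) (hc.fderiv ℝ)))) s := by
  have hu : UniformContinuous (fderiv ℝ f) :=
    (hc.fderiv ℝ).uniformContinuous_of_continuous (hf.continuous_fderiv (by simp))
  rw [hasFDerivAt_iff_isLittleO_nhds_zero, Asymptotics.isLittleO_iff]
  intro ε hε
  obtain ⟨δ, hδ, hu⟩ := Metric.uniformContinuous_iff.1 hu ε hε
  filter_upwards [Metric.ball_mem_nhds (0 : G) hδ] with h hh
  refine (BoundedContinuousFunction.norm_le (by positivity)).2 fun p => ?_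
  have key := (convex_segment (s + p) (s + p + h)).norm_image_sub_le_of_norm_fderiv_le'
    (f := f) (φ := fderiv ℝ f (s + p)) (C := ε) (fun x _ => hf.differentiable one_ne_zero x)
    (fun x hx => ?_) (left_mem_segment ℝ _ _) (right_mem_segment ℝ _ _)
  · simpa [add_right_comm s p h] using key
  · rw [← dist_eq_norm]
    refine (hu ?_).le
    obtain ⟨t, ht, rfl⟩ := (segment_eq_image' ℝ _ _).subset hx
    rw [dist_eq_norm, add_sub_cancel_left, add_sub_cancel_left, norm_smul, Real.norm_of_nonneg ht.1]
    rw [mem_ball_zero_iff] at hh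
    nlinarith [ht.1, ht.2, norm_nonneg h]

/-- Up to the bounded map `flipBounded`, the derivative of a translation orbit is the translation
orbit of `fderiv ℝ f`. Induction on the order applies because the target space is allowed to change.
-/
lemma contDiff_translate (f : G →ᵇ F) (hf : ContDiff ℝ ∞ f) (hc : HasCompactSupport f) :
    ContDiff ℝ ∞ fun s => translate s f := by
  refine contDiff_infty.2 fun m => ?_
  induction m generalizing F with
  | zero =>
    exact contDiff_zero.2 (continuous_iff_continuousAt.2 fun s =>
      (hasFDerivAt_translate f (hf.of_le (by simp)) hc s).continuousAt)
  | succ m ih =>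
    rw [Nat.cast_succ, contDiff_succ_iff_hasFDerivAt]
    refine ⟨_, ?_, fun s => hasFDerivAt_translate f (hf.of_le (by simp)) hc s⟩
    refine (flipBounded (G := G) (F := F)).contDiff.comp (ih (F := G →L[ℝ] F) _ ?_ ?_)
    · exact hf.fderiv_right (m := ∞) (by simp)
    · exact hc.fderiv ℝ

end Translation

section Convolution

variable {G F : Type} [NormedAddCommGroup G] [NormedSpace ℝ G]
  [NormedAddCommGroup F] [NormedSpace ℂ F]

lemma integrable_kernel_smul {K : ℂ → ℂ} (hK : Integrable K) (ι : ℂ →L[ℝ] G) (f : G →ᵇ F) (p : G) : Integrable fun w => K w • f (p - ι w) :=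
  hK.smul_bdd (f := fun w => f (p - ι w)) ‖f‖ (Continuous.aestronglyMeasurable (by fun_prop))
    (Filter.Eventually.of_forall fun w => f.norm_coe_le_norm _)

lemma norm_integral_kernel_smul_le {K : ℂ → ℂ} (hK : Integrable K) (ι : ℂ →L[ℝ] G) (f : G →ᵇ F) (p : G) :
    ‖∫ w, K w • f (p - ι w)‖ ≤ (∫ w, ‖K w‖) * ‖f‖ := by
  rw [← integral_mul_const]
  refine (norm_integral_le_integral_norm _).trans (integral_mono
    (integrable_kernel_smul hK ι f p).norm (hK.norm.mul_const _) fun w => ?_)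
  simp only [norm_smul]
  gcongr
  exact f.norm_coe_le_norm _

variable {K : ℂ → ℂ} (hK : Integrable K) (ι : ℂ →L[ℝ] G)

/-- The function `p ↦ ∫ K(w) f(p - ι w) dw`. -/
def partialConvFun (f : G →ᵇ F) : G →ᵇ F := BoundedContinuousFunction.ofNormedAddCommGroup
  (fun p => ∫ w, K w • f (p - ι w))
  (continuous_of_dominated (bound := fun w => ‖K w‖ * ‖f‖)
    (fun p => (integrable_kernel_smul hK ι f p).aestronglyMeasurable)
    (fun p => Filter.Eventually.of_forall fun w => by
      rw [norm_smul]; gcongr; exact f.norm_coe_le_norm _)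
    (hK.norm.mul_const _)
    (Filter.Eventually.of_forall fun w => by fun_prop))
  ((∫ w, ‖K w‖) * ‖f‖) (norm_integral_kernel_smul_le hK ι f)

lemma norm_partialConvFun_le (f : G →ᵇ F) : ‖partialConvFun hK ι f‖ ≤ (∫ w, ‖K w‖) * ‖f‖ :=
  (BoundedContinuousFunction.norm_le (by positivity)).2 (norm_integral_kernel_smul_le hK ι f)

/-- The operator `f ↦ (p ↦ ∫ K(w) f(p - ι w) dw)` of partial convolution with an integrable
kernel. -/
def partialConv : (G →ᵇ F) →L[ℝ] (G →ᵇ F) :=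
  LinearMap.mkContinuous
    { toFun := partialConvFun hK ι
      map_add' := fun f g => by
        ext p
        simp only [partialConvFun, BoundedContinuousFunction.coe_ofNormedAddCommGroup,
          BoundedContinuousFunction.add_apply, smul_add]
        exact integral_add (integrable_kernel_smul hK ι f p) (integrable_kernel_smul hK ι g p)
      map_smul' := fun c f => by
        ext p
        simp only [partialConvFun, BoundedContinuousFunction.coe_ofNormedAddCommGroup,
          BoundedContinuousFunction.coe_smul, RingHom.id_apply, ← integral_smul]
        exact integral_congr_ae (Filter.Eventually.of_forall fun w => smul_comm _ _ _) }
    (∫ w, ‖K w‖) (norm_partialConvFun_le hK ι)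

lemma partialConv_apply (f : G →ᵇ F) (p : G) :
    partialConv hK ι f p = ∫ w, K w • f (p - ι w) := rfl

lemma norm_partialConv_le : ‖(partialConv hK ι : (G →ᵇ F) →L[ℝ] (G →ᵇ F))‖ ≤ ∫ w, ‖K w‖ :=
  ContinuousLinearMap.opNorm_le_bound _ (integral_nonneg fun _ => norm_nonneg _)
    (norm_partialConvFun_le hK ι)

lemma partialConv_translate (s : G) (f : G →ᵇ F) :
    partialConv hK ι (translate s f) = translate s (partialConv hK ι f) := by
  ext p
  simp only [partialConv_apply, translate_apply, add_sub_assoc]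

end Convolution

section SmallPerturbation

variable {G 𝔸 : Type} [NormedAddCommGroup G] [NormedSpace ℝ G]
  [NormedRing 𝔸] [NormedAlgebra ℂ 𝔸] [CompleteSpace 𝔸]
  {K : ℂ → ℂ} (hK : Integrable K) (ι : ℂ →L[ℝ] G)

/-- `f ↦ K * (b f)`. -/
def convMul (b : G →ᵇ 𝔸) : (G →ᵇ 𝔸) →L[ℝ] (G →ᵇ 𝔸) :=
  (partialConv hK ι).comp (ContinuousLinearMap.mul ℝ (G →ᵇ 𝔸) b)

lemma convMul_apply (b f : G →ᵇ 𝔸) (p : G) :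
    convMul hK ι b f p = ∫ w, K w • (b (p - ι w) * f (p - ι w)) := rfl

lemma norm_convMul_le (b : G →ᵇ 𝔸) : ‖convMul hK ι b‖ ≤ (∫ w, ‖K w‖) * ‖b‖ :=
  (ContinuousLinearMap.opNorm_comp_le _ _).trans (mul_le_mul (norm_partialConv_le hK ι)
    (ContinuousLinearMap.opNorm_mul_apply_le ..) (norm_nonneg _) (by positivity))

lemma isUnit_one_add_of_norm_lt {R : Type*} [NormedRing R] [HasSummableGeomSeries R] {x : R}
    (h : ‖x‖ < 1) : IsUnit (1 + x) := by
  have := isUnit_one_sub_of_norm_lt_one (x := -x) (by rwa [norm_neg])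
  rwa [sub_neg_eq_add] at this

lemma exists_contDiff_inverse {R E : Type*} [NormedRing R] [NormedAlgebra ℝ R] [CompleteSpace R]
    [NormedAddCommGroup E] [NormedSpace ℝ E] {A : E → R} (hA : ContDiff ℝ ∞ A)
    (hu : ∀ s, IsUnit (A s)) : ∃ B : E → R, ContDiff ℝ ∞ B ∧ ∀ s, B s * A s = 1 := by
  refine ⟨fun s => Ring.inverse (A s), contDiff_iff_contDiffAt.2 fun s => ?_,
    fun s => Ring.inverse_mul_cancel _ (hu s)⟩
  obtain ⟨U, hU⟩ := hu s
  exact (hU ▸ contDiffAt_ringInverse ℝ U : ContDiffAt ℝ ∞ Ring.inverse (A s)).comp s hA.contDiffAt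

lemma norm_translate_le (s : G) (f : G →ᵇ 𝔸) : ‖translate s f‖ ≤ ‖f‖ :=
  (BoundedContinuousFunction.norm_le (norm_nonneg _)).2 fun _ => f.norm_coe_le_norm _

/-- Convolution commutes with translation, so the translates of `f` solve the equation with
translated `b` and `g`. The operator stays invertible under translation and depends smoothly on `s`;
hence so does `translate s f` in the sup norm, and evaluation at `0` recovers `f s`. This gives
smoothness in all directions of `G`, although the convolution acts only along `ι`. -/
theorem contDiff_of_add_convMul_eq {b f g : G →ᵇ 𝔸} (hb : ContDiff ℝ ∞ fun s => translate s b)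
    (hg : ContDiff ℝ ∞ fun s => translate s g) (hsmall : (∫ w, ‖K w‖) * ‖b‖ < 1)
    (hf : f + convMul hK ι b f = g) : ContDiff ℝ ∞ f := by
  let A : G → ((G →ᵇ 𝔸) →L[ℝ] (G →ᵇ 𝔸)) := fun s => 1 + convMul hK ι (translate s b)
  have hA : ∀ s, IsUnit (A s) := fun s => isUnit_one_add_of_norm_lt
    (R := (G →ᵇ 𝔸) →L[ℝ] (G →ᵇ 𝔸))
    (((norm_convMul_le hK ι _).trans (by gcongr; exact norm_translate_le s b)).trans_lt hsmall)
  have hAs : ContDiff ℝ ∞ A := contDiff_const.add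
    (((ContinuousLinearMap.compL ℝ (G →ᵇ 𝔸) (G →ᵇ 𝔸) (G →ᵇ 𝔸) (partialConv hK ι)).comp
      (ContinuousLinearMap.mul ℝ (G →ᵇ 𝔸))).contDiff.comp hb)
  obtain ⟨B, hB, hBA⟩ :=
    exists_contDiff_inverse (R := (G →ᵇ 𝔸) →L[ℝ] (G →ᵇ 𝔸)) hAs hA
  have hsol : ∀ s, translate s f = B s (translate s g) := by
    intro s
    have h1 : A s (translate s f) = translate s g := by
      rw [← hf]
      change translate s f + partialConv hK ι (translate s b * translate s f) = _
      have : translate s b * translate s f = translate s (b * f) := rfl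
      rw [this, partialConv_translate]; rfl
    rw [← h1]
    exact (DFunLike.congr_fun (hBA s) (translate s f)).symm
  have h2 : ContDiff ℝ ∞ fun s => translate s f := by
    simp only [hsol]; exact hB.clm_apply hg
  have h3 : (f : G → 𝔸) = fun s => BoundedContinuousFunction.evalCLM ℝ (0 : G) (translate s f) := by
    funext s; simp
  rw [h3]
  exact (BoundedContinuousFunction.evalCLM ℝ (0 : G)).contDiff.comp h2

end SmallPerturbation

end Twistor

end

/-! ### The operator `∂̄` along a complex direction, and invertible solutions for small
coefficients. -/

noncomputable section

namespace Twistor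

attribute [-instance] instNormedAddCommGroupOfRiemannianBundleOfIsTopologicalAddGroupOfContinuousConstSMulReal
  instInnerProductSpaceReal

open MeasureTheory Complex Set BoundedContinuousFunction

section DbarDir

variable {G F : Type*} [NormedAddCommGroup G] [NormedSpace ℝ G]
  [NormedAddCommGroup F] [NormedSpace ℂ F] {𝔸 : Type*} [NormedRing 𝔸] [NormedAlgebra ℂ 𝔸]

/-- The Wirtinger derivative along a complex direction `ι` in a real vector space. -/
def dbarDir (ι : ℂ →L[ℝ] G) (f : G → F) (p : G) : F :=
  (2⁻¹ : ℂ) • (fderiv ℝ f p (ι 1) + I • fderiv ℝ f p (ι I))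

lemma dbar_slice (ι : ℂ →L[ℝ] G) {f : G → F} {p : G} {z : ℂ}
    (hf : DifferentiableAt ℝ f (p + ι z)) :
    dbar (fun w => f (p + ι w)) z = dbarDir ι f (p + ι z) := by
  have h : HasFDerivAt (fun w => f (p + ι w)) ((fderiv ℝ f (p + ι z)).comp ι) z :=
    hf.hasFDerivAt.comp z (ι.hasFDerivAt.const_add p)
  rw [dbar, h.fderiv]; rfl

lemma dbar_congr {f g : ℂ → F} {z : ℂ} (h : f =ᶠ[𝓝 z] g) : dbar f z = dbar g z := by
  rw [dbar, dbar, h.fderiv_eq]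

lemma dbarDir_mul (ι : ℂ →L[ℝ] G) {f g : G → 𝔸} {p : G} (hf : DifferentiableAt ℝ f p)
    (hg : DifferentiableAt ℝ g p) :
    dbarDir ι (fun q => f q * g q) p = dbarDir ι f p * g p + f p * dbarDir ι g p := by
  rw [dbarDir, fderiv_fun_mul' hf hg]
  simp only [dbarDir, _root_.add_apply, _root_.smul_apply, smul_eq_mul, op_smul_eq_mul,
    smul_add, smul_mul_assoc, mul_smul_comm, add_mul, mul_add]
  abel

lemma dbar_mul {f g : ℂ → 𝔸} {z : ℂ} (hf : DifferentiableAt ℝ f z)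
    (hg : DifferentiableAt ℝ g z) :
    dbar (fun w => f w * g w) z = dbar f z * g z + f z * dbar g z :=
  dbarDir_mul (.id ℝ ℂ) hf hg

lemma dbar_eq_zero {f : ℂ → F} {z : ℂ} (hf : DifferentiableAt ℂ f z) : dbar f z = 0 := by
  have h := (differentiableAt_complex_iff_differentiableAt_real.1 hf).2
  rw [dbar, h, smul_smul, I_mul_I]; simp

lemma differentiableAt_of_dbar_eq_zero {f : ℂ → F} {z : ℂ} (hf : DifferentiableAt ℝ f z)
    (h : dbar f z = 0) : DifferentiableAt ℂ f z := by
  refine differentiableAt_complex_iff_differentiableAt_real.2 ⟨hf, ?_⟩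
  rw [dbar, smul_eq_zero_iff_right (by simp)] at h
  have h2 : I • (fderiv ℝ f z 1 + I • fderiv ℝ f z I) = 0 := by rw [h, smul_zero]
  rw [smul_add, smul_smul, I_mul_I, neg_one_smul, ← sub_eq_add_neg, sub_eq_zero] at h2
  exact h2.symm

lemma hasFDerivAt_kernelConv {K : ℂ → ℂ} (hK : LocallyIntegrable K) {g : ℂ → F}
    (hg : ContDiff ℝ 1 g) (hc : HasCompactSupport g) [CompleteSpace F] (z : ℂ) :
    ∃ L : ℂ →L[ℝ] F, HasFDerivAt (fun z => ∫ w, K w • g (z - w)) L z ∧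
      ∀ v, L v = ∫ w, K w • fderiv ℝ g (z - w) v := by
  refine ⟨_, hc.hasFDerivAt_convolution_right (ContinuousLinearMap.lsmul ℝ ℂ) hK hg z, fun v => ?_⟩
  rw [convolution_precompR_apply _ hK (hc.fderiv ℝ) (hg.continuous_fderiv one_ne_zero)]
  rfl

/-- All derivatives fall on the smooth factor, so local integrability of the kernel is enough. -/
lemma dbar_kernelConv {K : ℂ → ℂ} (hK : LocallyIntegrable K) {g : ℂ → F}
    (hg : ContDiff ℝ 1 g) (hc : HasCompactSupport g) [CompleteSpace F] (z : ℂ) :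
    dbar (fun z => ∫ w, K w • g (z - w)) z = ∫ w, K w • dbar g (z - w) := by
  obtain ⟨L, hL, hLv⟩ := hasFDerivAt_kernelConv hK hg hc z
  have hint : ∀ v, Integrable fun w => K w • fderiv ℝ g (z - w) v := fun v => by
    have hc' : HasCompactSupport fun w => fderiv ℝ g w v :=
      (hc.fderiv ℝ).comp_left (g := fun l : ℂ →L[ℝ] F => l v) rfl
    exact hc'.convolutionExists_right (ContinuousLinearMap.lsmul ℝ ℂ) hK
      ((hg.continuous_fderiv one_ne_zero).clm_apply continuous_const) z
  rw [dbar, hL.fderiv, hLv, hLv, ← integral_smul, ← integral_add (hint 1) (g := fun w => I • K w • fderiv ℝ g (z - w) I)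
    ((hint I).smul _),
    ← integral_smul]
  congr 1
  funext w
  simp only [dbar, smul_add, smul_smul]
  congr 2 <;> ring

end DbarDir

/-- A smooth cutoff at scale `ε` on `ℂ`. -/
def cutoff (ε : ℝ) (w : ℂ) : ℝ := Real.smoothTransition (2 - ‖w‖ ^ 2 / (4 * ε ^ 2))

lemma contDiff_cutoff (ε : ℝ) : ContDiff ℝ ∞ (cutoff ε) :=
  Real.smoothTransition.contDiff.comp (contDiff_const.sub ((contDiff_norm_sq ℝ).div_const _))

lemma cutoff_nonneg (ε : ℝ) (w : ℂ) : 0 ≤ cutoff ε w := Real.smoothTransition.nonneg _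

lemma cutoff_le_one (ε : ℝ) (w : ℂ) : cutoff ε w ≤ 1 := Real.smoothTransition.le_one _

lemma cutoff_eq_one {ε : ℝ} (hε : 0 < ε) {w : ℂ} (hw : ‖w‖ ≤ 2 * ε) : cutoff ε w = 1 := by
  refine Real.smoothTransition.one_of_one_le ?_
  have : ‖w‖ ^ 2 / (4 * ε ^ 2) ≤ 1 := by
    rw [div_le_one (by positivity)]; nlinarith [norm_nonneg w]
  linarith

lemma cutoff_eq_zero {ε : ℝ} (hε : 0 < ε) {w : ℂ} (hw : 3 * ε ≤ ‖w‖) : cutoff ε w = 0 := by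
  refine Real.smoothTransition.zero_of_nonpos ?_
  have : 2 ≤ ‖w‖ ^ 2 / (4 * ε ^ 2) := by
    rw [le_div_iff₀ (by positivity)]; nlinarith [norm_nonneg w]
  linarith

lemma hasCompactSupport_cutoff {ε : ℝ} (hε : 0 < ε) : HasCompactSupport (cutoff ε) :=
  HasCompactSupport.intro (isCompact_closedBall 0 (3 * ε)) fun w hw => cutoff_eq_zero hε (by
    rw [mem_closedBall_zero_iff, not_le] at hw; exact hw.le)

/-- The Cauchy kernel cut off at scale `ε`. -/
def truncKernel (ε : ℝ) (w : ℂ) : ℂ := cutoff ε w • cauchyKernel w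

lemma integrable_truncKernel {ε : ℝ} (hε : 0 < ε) : Integrable (truncKernel ε) :=
  locallyIntegrable_cauchyKernel.integrable_smul_left_of_hasCompactSupport
    (contDiff_cutoff ε).continuous (hasCompactSupport_cutoff hε)

lemma truncKernel_eq {ε : ℝ} (hε : 0 < ε) {w : ℂ} (hw : ‖w‖ ≤ 2 * ε) :
    truncKernel ε w = cauchyKernel w := by
  rw [truncKernel, cutoff_eq_one hε hw, one_smul]

/-- The Cauchy kernel is locally integrable, so its mass at scale `1 / (n + 1)` tends to zero by
dominated convergence; the kernel on the ball of radius `3` dominates all truncations. -/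
lemma exists_truncKernel_small (C : ℝ) : ∃ ε, 0 < ε ∧ (∫ w, ‖truncKernel ε w‖) * C < 1 / 2 := by
  have h : Filter.Tendsto (fun n : ℕ => ∫ w, ‖truncKernel (1 / ((n : ℝ) + 1)) w‖) Filter.atTop (𝓝 0) := by
    have h0 : (0 : ℝ) = ∫ _ : ℂ, (0 : ℝ) := by simp
    rw [h0]
    refine tendsto_integral_of_dominated_convergence
      (fun w => ‖(Metric.closedBall (0 : ℂ) 3).indicator cauchyKernel w‖) (fun n => ?_) ?_
      (fun n => Filter.Eventually.of_forall fun w => ?_) ?_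
    · exact (integrable_truncKernel (by positivity)).norm.aestronglyMeasurable
    · exact ((integrable_indicator_iff Metric.isClosed_closedBall.measurableSet).2
        (locallyIntegrable_cauchyKernel.integrableOn_isCompact (isCompact_closedBall _ _))).norm
    · rw [norm_norm]
      by_cases hw : w ∈ Metric.closedBall (0 : ℂ) 3
      · rw [indicator_of_mem hw, truncKernel, norm_smul, Real.norm_of_nonneg (cutoff_nonneg _ _)]
        exact mul_le_of_le_one_left (norm_nonneg _) (cutoff_le_one _ _)
      · rw [indicator_of_notMem hw, truncKernel, cutoff_eq_zero (by positivity), zero_smul]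
        rw [mem_closedBall_zero_iff, not_le] at hw
        have : 1 / ((n : ℝ) + 1) ≤ 1 := by
          rw [div_le_one (by positivity)]; linarith [n.cast_nonneg (α := ℝ)]
        linarith
    · refine Filter.Eventually.of_forall fun w => ?_
      -- At the origin the kernel takes the value `0⁻¹ = 0`; elsewhere the truncations vanish
      -- eventually.
      by_cases hw : w = 0
      · subst hw; simp [truncKernel, cauchyKernel]
      have h1 := (tendsto_one_div_add_atTop_nhds_zero_nat (𝕜 := ℝ)).const_mul 3
      rw [mul_zero] at h1
      refine tendsto_const_nhds.congr' ?_
      filter_upwards [h1.eventually (gt_mem_nhds (norm_pos_iff.2 hw))] with n hn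
      rw [truncKernel, cutoff_eq_zero (by positivity) hn.le, zero_smul, norm_zero]
  have h2 := h.mul_const C
  rw [zero_mul] at h2
  obtain ⟨n, hn⟩ := (h2.eventually (gt_mem_nhds (by norm_num : (0 : ℝ) < 1 / 2))).exists
  exact ⟨_, by positivity, hn⟩

section SmallGauge

variable {G 𝔸 : Type} [NormedAddCommGroup G] [NormedSpace ℝ G]
  [NormedRing 𝔸] [NormedAlgebra ℂ 𝔸] [CompleteSpace 𝔸]

/-- A Neumann series solves `φ + K_ε * (b φ) = 1`, the convolution running along `ι` while the other
directions of `G` are parameters. Smallness keeps the correction below `1` in norm, which gives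
invertibility. In the slab where `pr p` is within `ε` of `z₀`, only `‖w‖ ≤ 2 ε` contributes; there
the truncated kernel is the Cauchy kernel, and the Cauchy–Pompeiu formula yields the equation. -/
theorem exists_small_gauge (ι : ℂ →L[ℝ] G) (pr : G →L[ℝ] ℂ) (hpr : ∀ w, pr (ι w) = w) {b : G → 𝔸}
    (hb : ContDiff ℝ ∞ b) (hc : HasCompactSupport b) {ε : ℝ} (hε : 0 < ε) {z₀ : ℂ}
    (hsupp : ∀ p, b p ≠ 0 → ‖pr p - z₀‖ < ε) {C : ℝ} (hC0 : 0 ≤ C) (hC : ∀ p, ‖b p‖ ≤ C)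
    (hsmall : (∫ w, ‖truncKernel ε w‖) * (C * (1 + ‖(1 : 𝔸)‖)) < 1 / 2) :
    ∃ φ : G → 𝔸, ContDiff ℝ ∞ φ ∧ (∀ p, IsUnit (φ p)) ∧
      ∀ p, ‖pr p - z₀‖ < ε → dbarDir ι φ p + b p * φ p = 0 := by
  have hK := integrable_truncKernel hε
  set c := ∫ w, ‖truncKernel ε w‖ with hcdef
  have hc0 : 0 ≤ c := integral_nonneg fun _ => norm_nonneg _
  let B : G →ᵇ 𝔸 := bddOfCompactSupport b hb.continuous hc
  have hB : ‖B‖ ≤ C := (BoundedContinuousFunction.norm_le hC0).2 hC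
  -- The norm of `1` in `𝔸` is not assumed to be one, hence the factor `1 + ‖1‖` in the hypothesis;
  -- the two consequences needed are separated here.
  have h1 : c * C < 1 / 2 ∧ c * C * ‖(1 : 𝔸)‖ < 1 / 2 := by
    have : 0 ≤ c * C := by positivity
    constructor <;> nlinarith [norm_nonneg (1 : 𝔸)]
  have hcB : c * ‖B‖ ≤ c * C := by gcongr
  have hT : ‖convMul hK ι B‖ ≤ c * C := (norm_convMul_le hK ι B).trans hcB
  obtain ⟨U, hU⟩ := isUnit_one_add_of_norm_lt (R := (G →ᵇ 𝔸) →L[ℝ] (G →ᵇ 𝔸))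
    (hT.trans_lt (by linarith [h1.1] : c * C < 1))
  let f : G →ᵇ 𝔸 := (U⁻¹).1 1
  have hf : f + convMul hK ι B f = 1 := by
    have := DFunLike.congr_fun (U.mul_inv) (1 : G →ᵇ 𝔸)
    rw [hU] at this; exact this
  have hfs : ContDiff ℝ ∞ f := contDiff_of_add_convMul_eq hK ι
    (contDiff_translate B hb hc) (g := 1)
    (show ContDiff ℝ ∞ fun _ : G => (1 : G →ᵇ 𝔸) from contDiff_const) (hcB.trans_lt (by linarith [h1.1])) hf
  have hone : ‖(1 : G →ᵇ 𝔸)‖ ≤ ‖(1 : 𝔸)‖ :=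
    (BoundedContinuousFunction.norm_le (norm_nonneg _)).2 fun _ => le_rfl
  -- From `‖f‖ ≤ ‖1‖ + c C ‖f‖` and `c C < 1/2` follows `‖f‖ ≤ 2 ‖1‖`, so the correction is bounded
  -- by `2 c C ‖1‖ < 1`.
  have hTf : ‖convMul hK ι B f‖ < 1 := by
    have h2 : ‖convMul hK ι B f‖ ≤ c * C * ‖f‖ :=
      ((convMul hK ι B).le_opNorm f).trans (by gcongr)
    have h3 : ‖f‖ ≤ ‖(1 : 𝔸)‖ + c * C * ‖f‖ := by
      calc ‖f‖ = ‖1 - convMul hK ι B f‖ := by rw [← hf, add_sub_cancel_right]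
        _ ≤ ‖(1 : G →ᵇ 𝔸)‖ + ‖convMul hK ι B f‖ := norm_sub_le _ _
        _ ≤ _ := by gcongr
    nlinarith [norm_nonneg f, h1.1, h1.2, mul_nonneg hc0 hC0]
  have hfp : ∀ p, f p = 1 - convMul hK ι B f p := fun p => by
    have := DFunLike.congr_fun hf p
    rw [BoundedContinuousFunction.add_apply] at this
    exact eq_sub_of_add_eq this
  refine ⟨f, hfs, fun p => ?_, fun p hp => ?_⟩
  · rw [hfp]
    exact isUnit_one_sub_of_norm_lt_one
      (((convMul hK ι B f).norm_coe_le_norm p).trans_lt hTf)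
  let g : ℂ → 𝔸 := fun z => b (p + ι z) * f (p + ι z)
  have hι : ContDiff ℝ ∞ fun z => p + ι z := contDiff_const.add ι.contDiff
  have hg : ContDiff ℝ 1 g := ((hb.comp hι).mul (hfs.comp hι)).of_le (by simp)
  have hgsupp : ∀ z, g z ≠ 0 → ‖pr p + z - z₀‖ < ε := fun z hz => by
    have := hsupp (p + ι z) fun h => hz (by simp [g, h])
    rwa [map_add, hpr] at this
  have hgt : ∀ z ∈ tsupport g, ‖pr p + z - z₀‖ ≤ ε := fun z hz =>
    closure_minimal (t := {z | ‖pr p + z - z₀‖ ≤ ε}) (fun z hz => (hgsupp z hz).le)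
      (isClosed_le (by fun_prop) continuous_const) hz
  have hgc : HasCompactSupport g := by
    refine HasCompactSupport.intro (isCompact_closedBall (z₀ - pr p) ε) fun z hz => ?_
    by_contra h
    refine hz ?_
    rw [Metric.mem_closedBall, dist_eq_norm]
    refine le_trans (le_of_eq ?_) (hgsupp z h).le
    congr 1; ring
  have hslice : (fun z => f (p + ι z)) = fun z => 1 - ∫ w, truncKernel ε w • g (z - w) := by
    funext z
    rw [hfp, convMul_apply]
    congr 2
    funext w
    simp only [g, map_sub, add_sub_assoc]; rfl
  have hKl := hK.locallyIntegrable
  obtain ⟨L, hL, -⟩ := hasFDerivAt_kernelConv hKl hg hgc 0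
  have hd : dbar (fun z => f (p + ι z)) 0 = - g 0 := by
    have e1 : dbar (fun z => f (p + ι z)) 0 = - dbar (fun z => ∫ w, truncKernel ε w • g (z - w)) 0 := by
      rw [hslice, dbar, dbar, fderiv_const_sub]
      simp only [_root_.neg_apply, smul_neg, ← neg_add]
    -- The value `g 0` is rewritten with the full Cauchy kernel. The two integrands then agree
    -- pointwise: where `‖w‖ > 2 ε`, the point `-w` lies outside the support of `g`.
    rw [e1, dbar_kernelConv hKl hg hgc, ← integral_cauchyKernel_smul_dbar hg hgc 0]
    congr 2
    funext w
    by_cases hw : ‖w‖ ≤ 2 * ε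
    · rw [truncKernel_eq hε hw]
    have : fderiv ℝ g (0 - w) = 0 := by
      by_contra h
      have h2 := hgt _ (support_fderiv_subset ℝ h)
      refine hw ?_
      calc ‖w‖ = ‖(pr p - z₀) - (pr p + (0 - w) - z₀)‖ := by congr 1; ring
        _ ≤ ‖pr p - z₀‖ + ‖pr p + (0 - w) - z₀‖ := norm_sub_le _ _
        _ ≤ 2 * ε := by linarith
    have h0 : dbar g (0 - w) = 0 := by simp only [dbar, this]; simp
    rw [h0, smul_zero, smul_zero]
  rw [dbar_slice ι (hfs.differentiable (by simp) _)] at hd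
  simp only [map_zero, add_zero, g] at hd
  rw [hd, neg_add_cancel]

end SmallGauge

end Twistor

end

/-! ### Finite-rank approximation of the smooth part of the Cauchy transform. -/

noncomputable section

namespace Twistor

attribute [-instance] instNormedAddCommGroupOfRiemannianBundleOfIsTopologicalAddGroupOfContinuousConstSMulReal
  instInnerProductSpaceReal

open MeasureTheory Complex Set BoundedContinuousFunction

section GlobalFrame

variable {𝔸 : Type} [NormedRing 𝔸] [NormedAlgebra ℂ 𝔸] [CompleteSpace 𝔸]

lemma exists_fine_partition (R : ℝ) {δ : ℝ} (hδ : 0 < δ) :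
    ∃ (N : ℕ) (c : Fin N → ℂ) (f : Fin N → C(ℂ, ℝ)), (∀ i z, f i z ≠ 0 → dist z (c i) < δ) ∧
      (∀ z ∈ Metric.closedBall (0 : ℂ) R, ∑ i, f i z = 1) ∧ ∀ i z, 0 ≤ f i z := by
  have hK := isCompact_closedBall (0 : ℂ) R
  obtain ⟨t, -, ht, hcov⟩ := hK.finite_cover_balls hδ
  let e := ht.toFinset.equivFin.symm
  obtain ⟨f, h1, h2, h3, -⟩ := exists_continuous_sum_one_of_isOpen_isCompact
    (s := fun i : Fin ht.toFinset.card => Metric.ball (e i : ℂ) δ) (fun i => Metric.isOpen_ball) hK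
    (fun z hz => by
      obtain ⟨x, hx, hzx⟩ := mem_iUnion₂.1 (hcov hz)
      refine mem_iUnion.2 ⟨ht.toFinset.equivFin ⟨x, ht.mem_toFinset.2 hx⟩, ?_⟩
      simpa [e] using hzx)
  refine ⟨_, fun i => e i, f, fun i z hz => h1 i (subset_tsupport _ hz), fun z hz => ?_,
    fun i z => (h3 i z).1⟩
  have := h2 hz
  simpa using this

/-- `f ↦` the constant function `f z`. -/
def evalConst (z : ℂ) : (ℂ →ᵇ 𝔸) →L[ℝ] (ℂ →ᵇ 𝔸) :=
  LinearMap.mkContinuous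
    { toFun := fun f => BoundedContinuousFunction.const ℂ (f z)
      map_add' := fun _ _ => rfl
      map_smul' := fun _ _ => rfl } 1 fun f => by
    rw [one_mul]
    exact (BoundedContinuousFunction.norm_le (norm_nonneg _)).2 fun _ => f.norm_coe_le_norm z

variable (𝔸) in
/-- The cutoff function with values in the scalars of `𝔸`. -/
def cutoffOne {σ : ℝ} (hσ : 0 < σ) : ℂ →ᵇ 𝔸 :=
  bddOfCompactSupport (fun z => cutoff σ z • (1 : 𝔸))
    ((contDiff_cutoff σ).continuous.smul continuous_const) (hasCompactSupport_cutoff hσ).smul_right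

lemma cutoffOne_mul_apply {σ : ℝ} (hσ : 0 < σ) (f : ℂ →ᵇ 𝔸) (z : ℂ) :
    (cutoffOne 𝔸 hσ * f) z = cutoff σ z • f z := by
  change (cutoff σ z • (1 : 𝔸)) * f z = _
  rw [smul_mul_assoc, one_mul]

lemma norm_cutoffOne_mul_le {σ : ℝ} (hσ : 0 < σ) (f : ℂ →ᵇ 𝔸) : ‖cutoffOne 𝔸 hσ * f‖ ≤ ‖f‖ := by
  refine (BoundedContinuousFunction.norm_le (norm_nonneg _)).2 fun z => ?_
  rw [cutoffOne_mul_apply, norm_smul, Real.norm_of_nonneg (cutoff_nonneg _ _)]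
  exact (mul_le_of_le_one_left (norm_nonneg _) (cutoff_le_one _ _)).trans (f.norm_coe_le_norm z)

/-- This is compactness in explicit form. The image of the unit ball under `R` is equicontinuous, so
interpolating the values `R f (c i)` with a fine partition of unity is accurate to `1/4`. The point
of the first conclusion is that `F f` is controlled by finitely many values. -/
lemma exists_finite_rank_approx {R : (ℂ →ᵇ 𝔸) →L[ℝ] (ℂ →ᵇ 𝔸)}
    (hR : ∃ δ > 0, ∀ f z z', dist z z' < δ → ‖R f z - R f z'‖ ≤ 1 / 4 * ‖f‖) {σ : ℝ}
    (hσ : 0 < σ) : ∃ (N : ℕ) (c : Fin N → ℂ) (F : (ℂ →ᵇ 𝔸) →L[ℝ] (ℂ →ᵇ 𝔸)),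
      (∀ f, (∀ i, R f (c i) = 0) → F f = 0) ∧ ∀ f, ‖cutoffOne 𝔸 hσ * R f - F f‖ ≤ 1 / 4 * ‖f‖ := by
  obtain ⟨δ, hδ, hR⟩ := hR
  obtain ⟨N, c, f, hf, hsum, hpos⟩ := exists_fine_partition (3 * σ) hδ
  let ρ : Fin N → (ℂ →ᵇ 𝔸) := fun i => bddOfCompactSupport (fun z => (cutoff σ z * f i z) • (1 : 𝔸))
    (((contDiff_cutoff σ).continuous.mul (f i).continuous).smul continuous_const)
    (hasCompactSupport_cutoff hσ).mul_right.smul_right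
  refine ⟨N, c, ∑ i, (ContinuousLinearMap.mul ℝ (ℂ →ᵇ 𝔸) (ρ i)).comp ((evalConst (c i)).comp R),
    fun g hg => ?_, fun g => ?_⟩
  · rw [_root_.sum_apply]
    refine Finset.sum_eq_zero fun i _ => ?_
    have : evalConst (c i) (R g) = 0 := by ext z; exact hg i
    rw [ContinuousLinearMap.comp_apply, ContinuousLinearMap.comp_apply, this, map_zero]
  · refine (BoundedContinuousFunction.norm_le (by positivity)).2 fun z => ?_
    have h1 : (∑ i, (ContinuousLinearMap.mul ℝ (ℂ →ᵇ 𝔸) (ρ i)).comp ((evalConst (c i)).comp R)) g z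
        = ∑ i, (cutoff σ z * f i z) • R g (c i) := by
      rw [_root_.sum_apply, BoundedContinuousFunction.sum_apply]
      refine Finset.sum_congr rfl fun i _ => ?_
      change ((cutoff σ z * f i z) • (1 : 𝔸)) * R g (c i) = _
      rw [smul_mul_assoc, one_mul]
    rw [BoundedContinuousFunction.sub_apply, cutoffOne_mul_apply, h1]
    by_cases hz : z ∈ Metric.closedBall (0 : ℂ) (3 * σ)
    · have h2 : cutoff σ z • R g z = ∑ i, (cutoff σ z * f i z) • R g z := by
        rw [← Finset.sum_smul, ← Finset.mul_sum, hsum z hz, mul_one]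
      rw [h2, ← Finset.sum_sub_distrib]
      calc ‖∑ i, ((cutoff σ z * f i z) • R g z - (cutoff σ z * f i z) • R g (c i))‖
          ≤ ∑ i, f i z * (1 / 4 * ‖g‖) := by
            refine norm_sum_le_of_le _ fun i _ => ?_
            rw [← smul_sub, norm_smul, Real.norm_of_nonneg (mul_nonneg (cutoff_nonneg _ _) (hpos i z))]
            by_cases h0 : f i z = 0
            · simp [h0]
            · refine mul_le_mul (mul_le_of_le_one_left (hpos i z) (cutoff_le_one _ _))
                (hR g z (c i) (hf i z h0)) (norm_nonneg _) (hpos i z)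
        _ = 1 / 4 * ‖g‖ := by rw [← Finset.sum_mul, hsum z hz, one_mul]
    · have : cutoff σ z = 0 := cutoff_eq_zero hσ (by
        rw [mem_closedBall_zero_iff, not_le] at hz; exact hz.le)
      simp only [this, zero_mul, zero_smul, Finset.sum_const_zero, sub_zero, norm_zero]
      positivity

/-- Both truncations equal the Cauchy kernel near the origin, so the singularities cancel. -/
lemma contDiff_truncKernel_sub {ε ε' : ℝ} (hε : 0 < ε) (hε' : 0 < ε') :
    ContDiff ℝ ∞ fun w => truncKernel ε w - truncKernel ε' w := by
  refine contDiff_iff_contDiffAt.2 fun w => ?_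
  by_cases hw : w = 0
  · subst hw
    refine (contDiffAt_const (c := (0 : ℂ))).congr_of_eventuallyEq ?_
    have hm : 0 < min ε ε' := lt_min hε hε'
    filter_upwards [Metric.ball_mem_nhds (0 : ℂ) hm] with w hw
    rw [mem_ball_zero_iff, lt_min_iff] at hw
    rw [truncKernel_eq hε (by linarith [hw.1]), truncKernel_eq hε' (by linarith [hw.2]), sub_self]
  · have h : ContDiffAt ℝ ∞ cauchyKernel w := by
      refine ContDiffAt.inv (by fun_prop) ?_
      exact mul_ne_zero (by exact_mod_cast Real.pi_ne_zero) hw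
    exact ((contDiff_cutoff ε).contDiffAt.smul h).sub ((contDiff_cutoff ε').contDiffAt.smul h)

lemma hasCompactSupport_truncKernel {ε : ℝ} (hε : 0 < ε) : HasCompactSupport (truncKernel ε) :=
  (hasCompactSupport_cutoff hε).smul_right

lemma integral_kernel_swap {F : Type} [NormedAddCommGroup F] [NormedSpace ℂ F] (r : ℂ → ℂ) (u : ℂ → F) (z : ℂ) :
    ∫ w, r w • u (z - w) = ∫ w, r (z - w) • u w := by
  rw [← integral_sub_left_eq_self (fun w => r w • u (z - w)) volume z]
  simp only [sub_sub_cancel]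

lemma norm_kernelConv_sub_le {F : Type} [NormedAddCommGroup F] [NormedSpace ℂ F] {r : ℂ → ℂ}
    (hr : Continuous r) {u : ℂ → F} (hu : Continuous u) (huc : HasCompactSupport u)
    {α : ℂ → ℝ} (hα : Integrable α) (hb : ∀ w, ‖u w‖ ≤ α w) {z z' : ℂ} {η : ℝ}
    (hη : ∀ w, ‖r (z - w) - r (z' - w)‖ ≤ η) :
    ‖(∫ w, r w • u (z - w)) - ∫ w, r w • u (z' - w)‖ ≤ η * ∫ w, α w := by
  have hint : ∀ z, Integrable fun w => r (z - w) • u w := fun z =>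
    Continuous.integrable_of_hasCompactSupport ((hr.comp (continuous_const.sub continuous_id)).smul hu)
      (HasCompactSupport.smul_left (f := fun w => r (z - w)) huc)
  rw [integral_kernel_swap, integral_kernel_swap, ← integral_sub (hint z) (hint z'),
    ← integral_const_mul]
  refine norm_integral_le_of_norm_le (hα.const_mul _) (Filter.Eventually.of_forall fun w => ?_)
  rw [← sub_smul, norm_smul]
  exact mul_le_mul (hη w) (hb w) (norm_nonneg _) ((norm_nonneg _).trans (hη w))

/-- Equicontinuity of the image of the unit ball under convolution with a continuous kernel. -/
lemma equicontinuous_kernelConv {r : ℂ → ℂ} (hr : Continuous r) (hrc : HasCompactSupport r)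
    {a : ℂ → 𝔸} (ha : Continuous a) (hac : HasCompactSupport a) :
    ∃ δ > 0, ∀ (f : ℂ →ᵇ 𝔸) (z z' : ℂ), dist z z' < δ →
      ‖(∫ w, r w • (a (z - w) * f (z - w))) - ∫ w, r w • (a (z' - w) * f (z' - w))‖
        ≤ 1 / 4 * ‖f‖ := by
  obtain ⟨J, hJ⟩ : ∃ J, J = ∫ w, ‖a w‖ := ⟨_, rfl⟩
  have hI : 0 ≤ J := hJ ▸ integral_nonneg fun _ => norm_nonneg _
  -- Dividing by `1 + J` instead of `J` covers the case in which `a` vanishes.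
  obtain ⟨δ, hδ, h⟩ := Metric.uniformContinuous_iff.1 (hrc.uniformContinuous_of_continuous hr)
    (1 / (4 * (1 + J))) (by positivity)
  refine ⟨δ, hδ, fun f z z' hz => ?_⟩
  have hb : ∀ w, ‖a w * f w‖ ≤ ‖a w‖ * ‖f‖ := fun w =>
    (norm_mul_le _ _).trans (by gcongr; exact f.norm_coe_le_norm w)
  refine (norm_kernelConv_sub_le hr (ha.mul f.continuous) (HasCompactSupport.mul_right (f' := ⇑f) hac)
    ((ha.integrable_of_hasCompactSupport hac).norm.mul_const ‖f‖) hb (η := 1 / (4 * (1 + J)))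
    fun w => ?_).trans ?_
  · rw [← dist_eq_norm]
    exact (h (by rwa [dist_sub_right])).le
  · rw [integral_mul_const, ← hJ]
    have : 1 / (4 * (1 + J)) * (J * ‖f‖) = (1 / 4 * ‖f‖) * (J / (1 + J)) := by field_simp
    rw [this]
    refine mul_le_of_le_one_right (by positivity) ?_
    rw [div_le_one (by positivity)]; linarith

end GlobalFrame

end Twistor

end

/-! ### Global solutions of `∂̄V + aV = 0` on the plane. -/

noncomputable section

namespace Twistor

attribute [-instance] instNormedAddCommGroupOfRiemannianBundleOfIsTopologicalAddGroupOfContinuousConstSMulReal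
  instInnerProductSpaceReal

open MeasureTheory Complex Set BoundedContinuousFunction

section GlobalFrame

variable {𝔸 : Type} [NormedRing 𝔸] [NormedAlgebra ℂ 𝔸] [CompleteSpace 𝔸]

/-- The functional-analytic step: a solution of the integral equation with polynomial leading
term. -/
lemma exists_integral_solution [FiniteDimensional ℝ 𝔸]
    {T R : (ℂ →ᵇ 𝔸) →L[ℝ] (ℂ →ᵇ 𝔸)} {σ : ℝ} (hσ : 0 < σ) (hT : ‖T‖ ≤ 1 / 2)
    (hR : ∃ δ > 0, ∀ f z z', dist z z' < δ → ‖R f z - R f z'‖ ≤ 1 / 4 * ‖f‖) :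
    ∃ (q : Polynomial ℂ) (v : ℂ →ᵇ 𝔸), q ≠ 0 ∧
      ∀ z, v z + cutoff σ z • (T v z + R v z) = cutoff σ z • (q.eval z • (1 : 𝔸)) := by
  obtain ⟨N, c, F, hF, hRF⟩ := exists_finite_rank_approx hR hσ
  let χ := ContinuousLinearMap.mul ℝ (ℂ →ᵇ 𝔸) (cutoffOne 𝔸 hσ)
  -- The part `S` has norm at most `1/2 + 1/4`, so `1 + S` is invertible. The omitted finite-rank
  -- operator `F` is annihilated by the choice of the right-hand side.
  let S : (ℂ →ᵇ 𝔸) →L[ℝ] (ℂ →ᵇ 𝔸) := χ.comp T + (χ.comp R - F)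
  have hχ : ∀ f, ‖χ f‖ ≤ ‖f‖ := norm_cutoffOne_mul_le hσ
  have hS : ‖S‖ < 1 := by
    have h1 : ‖χ.comp T‖ ≤ 1 / 2 := ContinuousLinearMap.opNorm_le_bound _ (by norm_num) fun f =>
      (hχ _).trans (T.le_of_opNorm_le hT f)
    have h2 : ‖χ.comp R - F‖ ≤ 1 / 4 := ContinuousLinearMap.opNorm_le_bound _ (by norm_num) hRF
    linarith [norm_add_le (χ.comp T) (χ.comp R - F)]
  obtain ⟨A, hA⟩ := isUnit_one_add_of_norm_lt (R := (ℂ →ᵇ 𝔸) →L[ℝ] (ℂ →ᵇ 𝔸)) hS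
  let B : (ℂ →ᵇ 𝔸) →L[ℝ] (ℂ →ᵇ 𝔸) := (A⁻¹).1
  have hAB : ∀ g, B g + S (B g) = g := fun g => by
    have h := DFunLike.congr_fun A.mul_inv g
    rw [hA] at h
    exact h
  -- Vanishing of `R v` at the `N` points amounts to `N · dim 𝔸` real linear conditions. Real
  -- polynomials with one more coefficient than that contain a nonzero one for which all conditions
  -- hold, and then `F v = 0`.
  let d := N * Module.finrank ℝ 𝔸 + 1
  let P : Fin d → (ℂ →ᵇ 𝔸) := fun k => bddOfCompactSupport (fun z => cutoff σ z • (z ^ (k : ℕ) • (1 : 𝔸)))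
    ((contDiff_cutoff σ).continuous.smul (by fun_prop)) (hasCompactSupport_cutoff hσ).smul_right
  let G := Fintype.linearCombination ℝ P
  let L : (Fin d → ℝ) →ₗ[ℝ] (Fin N → 𝔸) := LinearMap.pi fun j =>
    (BoundedContinuousFunction.evalCLM ℝ (c j)).toLinearMap ∘ₗ R.toLinearMap ∘ₗ B.toLinearMap ∘ₗ G
  have hker : LinearMap.ker L ≠ ⊥ := LinearMap.ker_ne_bot_of_finrank_lt (by
    rw [Module.finrank_fin_fun, Module.finrank_pi_fintype]; simp [d])
  obtain ⟨t, ht, ht0⟩ := (Submodule.ne_bot_iff _).1 hker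
  have hz : ∀ j, R (B (G t)) (c j) = 0 := fun j => congrFun (LinearMap.mem_ker.1 ht) j
  have hG : ∀ z, G t z = cutoff σ z • ((∑ k : Fin d, Polynomial.monomial (k : ℕ) (t k : ℂ)).eval z • (1 : 𝔸)) := by
    intro z
    simp only [G, Fintype.linearCombination_apply, BoundedContinuousFunction.sum_apply,
      Polynomial.eval_finsetSum, Polynomial.eval_monomial, Finset.sum_smul, Finset.smul_sum]
    refine Finset.sum_congr rfl fun k _ => ?_
    change t k • cutoff σ z • z ^ (k : ℕ) • (1 : 𝔸) = _
    rw [smul_comm (t k), mul_smul, Complex.coe_smul]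
  refine ⟨∑ k : Fin d, Polynomial.monomial (k : ℕ) (t k : ℂ), B (G t), fun h0 => ht0 ?_, fun z => ?_⟩
  · funext k
    have h := congrArg (fun p => Polynomial.coeff p (k : ℕ)) h0
    simpa [Polynomial.finsetSum_coeff, Polynomial.coeff_monomial, Fin.val_inj] using h
  · rw [← hG]
    conv_rhs => rw [← hAB (G t)]
    have h1 : S (B (G t)) = χ (T (B (G t))) + (χ (R (B (G t))) - F (B (G t))) := rfl
    rw [h1, hF _ hz, sub_zero]
    simp only [BoundedContinuousFunction.add_apply, smul_add]
    congr 2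
    · exact (cutoffOne_mul_apply hσ _ _).symm
    · exact (cutoffOne_mul_apply hσ _ _).symm

/-- The kernel decays like the inverse distance: once `‖z‖` exceeds twice the radius of the support,
`‖z - w‖ ≥ ‖z‖ / 2` on it. -/
lemma tendsto_kernelConv {F : Type} [NormedAddCommGroup F] [NormedSpace ℂ F]
    {u : ℂ → F} (hu : Continuous u) (huc : HasCompactSupport u) :
    Filter.Tendsto (fun z => ∫ w, cauchyKernel w • u (z - w)) (Filter.cocompact ℂ) (𝓝 0) := by
  obtain ⟨ρ, hρ⟩ := huc.isCompact.isBounded.subset_closedBall 0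
  have hle : ∀ z : ℂ, 2 * |ρ| + 1 ≤ ‖z‖ → ‖∫ w, cauchyKernel w • u (z - w)‖ ≤ (∫ w, ‖u w‖) * (2 * ‖z‖⁻¹) := by
    intro z hz
    rw [integral_kernel_swap, ← integral_mul_const]
    refine norm_integral_le_of_norm_le ((hu.integrable_of_hasCompactSupport huc).norm.mul_const _)
      (Filter.Eventually.of_forall fun w => ?_)
    rw [norm_smul, mul_comm]
    by_cases hw : u w = 0
    · simp [hw]
    gcongr
    have h1 : ‖w‖ ≤ |ρ| := (mem_closedBall_zero_iff.1 (hρ (subset_tsupport _ hw))).trans (le_abs_self _)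
    have h2 : ‖z‖ / 2 ≤ ‖z - w‖ := by linarith [norm_sub_norm_le z w]
    have h3 : 0 < ‖z‖ := by linarith [abs_nonneg ρ]
    rw [cauchyKernel, norm_inv, norm_mul, Complex.norm_real, Real.norm_of_nonneg Real.pi_pos.le]
    rw [show 2 * ‖z‖⁻¹ = (‖z‖ / 2)⁻¹ by field_simp]
    refine inv_anti₀ (by positivity) (h2.trans ?_)
    nlinarith [Real.pi_gt_three, norm_nonneg (z - w)]
  have h0 : Filter.Tendsto (fun z : ℂ => (∫ w, ‖u w‖) * (2 * ‖z‖⁻¹)) (Filter.cocompact ℂ) (𝓝 0) := by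
    have := ((tendsto_inv_atTop_zero.comp (tendsto_norm_cocompact_atTop (E := ℂ))).const_mul 2).const_mul (∫ w, ‖u w‖)
    simpa using this
  refine squeeze_zero_norm' ?_ h0
  filter_upwards [(tendsto_norm_cocompact_atTop (E := ℂ)).eventually_ge_atTop (2 * |ρ| + 1)] with z hz
  exact hle z hz

lemma contDiff_kernelConv {F : Type} [NormedAddCommGroup F] [NormedSpace ℂ F] [CompleteSpace F] {u : ℂ → F}
    (hu : ContDiff ℝ ∞ u) (huc : HasCompactSupport u) {K : ℂ → ℂ} (hK : LocallyIntegrable K) :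
    ContDiff ℝ ∞ fun z => ∫ w, K w • u (z - w) :=
  huc.contDiff_convolution_right (ContinuousLinearMap.lsmul ℝ ℂ) hK hu

lemma contDiff_smooth_kernelConv {F : Type} [NormedAddCommGroup F] [NormedSpace ℂ F] [CompleteSpace F] {u : ℂ → F}
    (hu : LocallyIntegrable u) {K : ℂ → ℂ} (hK : ContDiff ℝ ∞ K) (hKc : HasCompactSupport K) :
    ContDiff ℝ ∞ fun z => ∫ w, K w • u (z - w) :=
  hKc.contDiff_convolution_left (ContinuousLinearMap.lsmul ℝ ℂ) hK hu

/-- The equation is recast as `V = q - K * (a V)` with the Cauchy kernel `K`. The kernel is split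
into a short-range part, contracting by the choice of `ε`, and a smooth remainder, compact in the
sense of `exists_finite_rank_approx`; the freedom in the polynomial `q` absorbs the cokernel.
Nonvanishing of `q` is what later makes `V` invertible near infinity. -/
theorem exists_global_solution [FiniteDimensional ℝ 𝔸] {a : ℂ → 𝔸} (ha : ContDiff ℝ ∞ a)
    (hac : HasCompactSupport a) : ∃ (q : Polynomial ℂ) (V : ℂ → 𝔸), q ≠ 0 ∧ ContDiff ℝ ∞ V ∧
      (∀ z, dbar V z + a z * V z = 0) ∧
      Filter.Tendsto (fun z => V z - q.eval z • (1 : 𝔸)) (Filter.cocompact ℂ) (𝓝 0) := by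
  obtain ⟨ρ, hρ0, hρ⟩ : ∃ ρ > 0, ∀ z, a z ≠ 0 → ‖z‖ ≤ ρ := by
    obtain ⟨ρ, hρ⟩ := hac.isCompact.isBounded.subset_closedBall 0
    exact ⟨|ρ| + 1, by positivity, fun z hz => by
      have := mem_closedBall_zero_iff.1 (hρ (subset_tsupport _ hz))
      linarith [le_abs_self ρ]⟩
  let ab := bddOfCompactSupport a ha.continuous hac
  obtain ⟨ε, hε, hsmall⟩ := exists_truncKernel_small ‖ab‖
  -- Two facts fix this radius. The short-range term `T v` vanishes outside the ball of radius `ρ +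
  -- 3 ε`, so the cutoff does not affect it. If `z` and `z - w` both have norm at most `ρ`, then
  -- `‖w‖ ≤ 2 σ`, where truncation at scale `σ` changes nothing.
  let σ := ρ + 3 * ε
  have hσ : 0 < σ := by positivity
  let r := fun w => truncKernel σ w - truncKernel ε w
  have hr : ContDiff ℝ ∞ r := contDiff_truncKernel_sub hσ hε
  have hrc : HasCompactSupport r :=
    (hasCompactSupport_truncKernel hσ).sub (hasCompactSupport_truncKernel hε)
  have hri : Integrable r := hr.continuous.integrable_of_hasCompactSupport hrc
  have hεi := integrable_truncKernel hε
  let ι := ContinuousLinearMap.id ℝ ℂ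
  obtain ⟨q, v, hq, hv⟩ := exists_integral_solution (T := convMul hεi ι ab) (R := convMul hri ι ab) hσ
    ((norm_convMul_le hεi ι ab).trans hsmall.le)
    (by
      obtain ⟨δ, hδ, h⟩ := equicontinuous_kernelConv hr.continuous hrc ha.continuous hac
      exact ⟨δ, hδ, fun f z z' hz => h f z z' hz⟩)
  have hcut : ∀ z, ‖z‖ ≤ 2 * σ → cutoff σ z = 1 := fun z => cutoff_eq_one hσ
  have havc : HasCompactSupport fun z => a z * v z := HasCompactSupport.mul_right (f' := ⇑v) hac
  have havs : Continuous fun z => a z * v z := ha.continuous.mul v.continuous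
  have hTsupp : ∀ z, 2 * σ < ‖z‖ → convMul hεi ι ab v z = 0 := by
    intro z hz
    rw [convMul_apply]
    refine integral_eq_zero_of_ae (Filter.Eventually.of_forall fun w => ?_)
    change truncKernel ε w • (a (z - w) * v (z - w)) = 0
    by_cases h1 : a (z - w) = 0
    · rw [h1, zero_mul, smul_zero]
    · have h2 := hρ _ h1
      have h3 : 3 * ε ≤ ‖w‖ := by
        have := norm_sub_norm_le z w
        simp only [σ] at hz; linarith
      rw [truncKernel, cutoff_eq_zero hε h3, zero_smul, zero_smul]
  have hRs : ContDiff ℝ ∞ (convMul hri ι ab v) :=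
    contDiff_smooth_kernelConv havs.locallyIntegrable hr hrc
  have hqs : ContDiff ℝ ∞ fun z => q.eval z • (1 : 𝔸) := by
    have : ContDiff ℂ ∞ fun z => q.eval z := q.differentiable.contDiff
    exact (this.restrict_scalars ℝ).smul contDiff_const
  let g : ℂ → 𝔸 := fun z => cutoff σ z • (q.eval z • (1 : 𝔸) - convMul hri ι ab v z)
  have hg : ContDiff ℝ ∞ g := (contDiff_cutoff σ).smul (hqs.sub hRs)
  have hgc : HasCompactSupport g := (hasCompactSupport_cutoff hσ).smul_right
  -- The polynomial and the long-range term are smooth and are moved to the right-hand side `g`;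
  -- what remains is a small convolution equation.
  have hvs : ContDiff ℝ ∞ v := by
    refine contDiff_of_add_convMul_eq hεi ι (b := ab) (g := bddOfCompactSupport g hg.continuous hgc)
      (contDiff_translate ab ha hac) (contDiff_translate _ hg hgc) (by linarith) ?_
    ext z
    have h := hv z
    rw [BoundedContinuousFunction.add_apply, bddOfCompactSupport_apply]
    have h2 : cutoff σ z • convMul hεi ι ab v z = convMul hεi ι ab v z := by
      by_cases hz : ‖z‖ ≤ 2 * σ
      · rw [hcut z hz, one_smul]
      · rw [hTsupp z (not_le.1 hz), smul_zero]
    simp only [g]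
    rw [smul_sub, ← h, smul_add, h2]
    abel
  have hav : ContDiff ℝ ∞ fun z => a z * v z := ha.mul hvs
  have hKs := contDiff_kernelConv hav havc locallyIntegrable_cauchyKernel
  have hval : ∀ z, ‖z‖ ≤ ρ → q.eval z • (1 : 𝔸) - (∫ w, cauchyKernel w • (a (z - w) * v (z - w))) = v z := by
    intro z hz
    have h := hv z
    rw [hcut z (by simp only [σ]; linarith), one_smul, one_smul] at h
    have h2 : convMul hεi ι ab v z + convMul hri ι ab v z
        = ∫ w, cauchyKernel w • (a (z - w) * v (z - w)) := by
      rw [convMul_apply, convMul_apply]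
      refine (integral_add (integrable_kernel_smul hεi ι (ab * v) z)
        (integrable_kernel_smul hri ι (ab * v) z)).symm.trans ?_
      refine integral_congr_ae (Filter.Eventually.of_forall fun w => ?_)
      change truncKernel ε w • (a (z - w) * v (z - w)) +
        (truncKernel σ w - truncKernel ε w) • (a (z - w) * v (z - w)) = _
      beta_reduce
      rw [← add_smul, add_sub_cancel]
      by_cases h1 : a (z - w) = 0
      · rw [h1, zero_mul, smul_zero, smul_zero]
      · have h2 := hρ _ h1
        rw [truncKernel_eq hσ]
        have := norm_sub_norm_le w z
        rw [norm_sub_rev] at this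
        simp only [σ]; linarith
    rw [← h2, ← h]; abel
  -- The solution is redefined without cutoff. It agrees with `v` wherever `a ≠ 0`, so `a v = a V`
  -- and the equation holds on the whole plane.
  refine ⟨q, fun z => q.eval z • (1 : 𝔸) - ∫ w, cauchyKernel w • (a (z - w) * v (z - w)), hq,
    hqs.sub hKs, fun z => ?_, ?_⟩
  · have hd : dbar (fun z => q.eval z • (1 : 𝔸) - ∫ w, cauchyKernel w • (a (z - w) * v (z - w))) z
        = - (a z * v z) := by
      have h1 : dbar (fun z => q.eval z • (1 : 𝔸)) z = 0 :=
        dbar_eq_zero (q.differentiable.differentiableAt.smul_const _)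
      have h2 := dbar_kernelConv locallyIntegrable_cauchyKernel (hav.of_le (by simp)) havc z
      rw [integral_cauchyKernel_smul_dbar (hav.of_le (by simp)) havc] at h2
      rw [← h2, ← zero_sub, ← h1]
      simp only [dbar]
      rw [fderiv_fun_sub (hqs.differentiable (by simp) z) (hKs.differentiable (by simp) z)]
      simp only [_root_.sub_apply, ← smul_sub]
      congr 1
      rw [smul_sub]; abel
    rw [hd]
    by_cases h1 : a z = 0
    · rw [h1, zero_mul, zero_mul, neg_zero, add_zero]
    · beta_reduce
      rw [hval z (hρ z h1), neg_add_cancel]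
  · simp only [sub_sub_cancel_left]
    simpa using (tendsto_kernelConv havs havc).neg

end GlobalFrame

end Twistor

end

/-! ### Zeros of entire functions, and `∂̄` of a determinant. -/

noncomputable section

namespace Twistor

attribute [-instance] instNormedAddCommGroupOfRiemannianBundleOfIsTopologicalAddGroupOfContinuousConstSMulReal
  instInnerProductSpaceReal

open MeasureTheory Complex Set BoundedContinuousFunction

section Zeros

/-- Removal of the zeros of an entire function in a disc. -/
lemma exists_factor_zeros {h : ℂ → ℂ} (hd : Differentiable ℂ h) {w : ℂ} (hw : h w ≠ 0) (R : ℝ) :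
    ∃ (s : List ℂ) (g : ℂ → ℂ), Continuous g ∧ (∀ z ∈ Metric.closedBall (0 : ℂ) R, g z ≠ 0) ∧
      ∀ z, h z = (s.map (z - ·)).prod * g z := by
  have hfin : ∀ {h : ℂ → ℂ}, Differentiable ℂ h → h w ≠ 0 →
      (Metric.closedBall (0 : ℂ) R ∩ h ⁻¹' {0}).Finite := by
    intro h hd hw
    have ha : AnalyticOnNhd ℂ h univ := fun z _ => hd.analyticAt z
    have h1 := Filter.codiscreteWithin_mono (subset_univ (Metric.closedBall (0 : ℂ) R))
      (ha.preimage_zero_mem_codiscrete hw)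
    have h2 := (isCompact_closedBall (0 : ℂ) R).finite_sdiff_of_mem_codiscreteWithin h1
    simpa [sdiff_eq, compl_compl] using h2
  have hstrip : ∀ (z₀ : ℂ) (m : ℕ) (h : ℂ → ℂ), Differentiable ℂ h → h w ≠ 0 → analyticOrderAt h z₀ = m →
      ∃ g : ℂ → ℂ, Differentiable ℂ g ∧ g z₀ ≠ 0 ∧ ∀ z, h z = (z - z₀) ^ m * g z := by
    intro z₀ m
    induction m with
    | zero =>
      intro h hd hw hm
      exact ⟨h, hd, (hd.analyticAt z₀).analyticOrderAt_eq_zero.1 (by simpa using hm), by simp⟩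
    | succ m ih =>
      intro h hd hw hm
      have h0 : h z₀ = 0 := apply_eq_zero_of_analyticOrderAt_ne_zero (by rw [hm]; simp)
      have hd' : Differentiable ℂ (dslope h z₀) := by
        rw [← differentiableOn_univ] at hd ⊢
        exact (differentiableOn_dslope Filter.univ_mem).2 hd
      have he : ∀ z, h z = (z - z₀) * dslope h z₀ z := fun z => by
        have := sub_smul_dslope h z₀ z
        rw [h0, sub_zero, smul_eq_mul] at this
        exact this.symm
      have hord : analyticOrderAt (dslope h z₀) z₀ = m := by
        have h1 : h = (fun z => z - z₀) * dslope h z₀ := funext he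
        rw [h1, analyticOrderAt_mul (by fun_prop) (hd'.analyticAt z₀),
          analyticOrderAt_id_sub_const_self, Nat.cast_succ, add_comm] at hm
        exact (ENat.add_left_injective_of_ne_top ENat.one_ne_top) hm
      obtain ⟨g, hg, hg0, hge⟩ := ih _ hd' (fun h1 => hw (by rw [he, h1, mul_zero])) hord
      exact ⟨g, hg, hg0, fun z => by rw [he, hge]; ring⟩
  obtain ⟨Z, hZ⟩ : ∃ Z : Finset ℂ, ∀ z ∈ Metric.closedBall (0 : ℂ) R, h z = 0 → z ∈ Z :=
    ⟨(hfin hd hw).toFinset, fun z hz h0 => by simpa using ⟨by simpa using hz, h0⟩⟩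
  -- The induction runs over a finite set containing the zeros in the disc. Stripping `z₀` with its
  -- full multiplicity leaves an entire function whose zeros in the disc lie in the smaller set.
  induction Z using Finset.induction_on generalizing h with
  | empty => exact ⟨[], h, hd.continuous, fun z hz h0 => by simpa using hZ z hz h0, by simp⟩
  | insert z₀ Z _ ih =>
    have htop : analyticOrderAt h z₀ ≠ ⊤ := fun ht => hw (by
      have ha : AnalyticOnNhd ℂ h univ := fun z _ => hd.analyticAt z
      exact ha.eqOn_zero_of_preconnected_of_eventuallyEq_zero isPreconnected_univ (mem_univ z₀)
        (analyticOrderAt_eq_top.1 ht) (mem_univ w))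
    obtain ⟨m, hm⟩ := ENat.ne_top_iff_exists.1 htop
    obtain ⟨g, hg, hg0, hge⟩ := hstrip z₀ m h hd hw hm.symm
    obtain ⟨s, k, hk, hk0, hgk⟩ := ih hg (fun h1 => hw (by rw [hge, h1, mul_zero])) fun z hz h0 => by
      have h1 := hZ z hz (by rw [hge, h0, mul_zero])
      rw [Finset.mem_insert] at h1
      exact h1.resolve_left fun h2 => hg0 (h2 ▸ h0)
    refine ⟨List.replicate m z₀ ++ s, k, hk, hk0, fun z => ?_⟩
    rw [hge, hgk]; simp [mul_assoc]

end Zeros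

section Determinant

variable {F F' : Type} [NormedAddCommGroup F] [NormedSpace ℂ F] [NormedAddCommGroup F']
  [NormedSpace ℂ F']

lemma dbar_comp_clm (L : F →L[ℂ] F') {f : ℂ → F} {z : ℂ} (hf : DifferentiableAt ℝ f z) :
    dbar (fun w => L (f w)) z = L (dbar f z) := by
  have h : HasFDerivAt (fun w => L (f w)) ((L.restrictScalars ℝ).comp (fderiv ℝ f z)) z :=
    (L.restrictScalars ℝ).hasFDerivAt.comp z hf.hasFDerivAt
  rw [dbar, h.fderiv, dbar, map_smul, map_add, map_smul]; rfl

variable {n : ℕ}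

/-- The determinant is complex multilinear in the rows, so its derivative is complex linear and
passes through the Wirtinger combination. -/
lemma dbar_det {f : ℂ → Fin n → Fin n → ℂ} {z : ℂ} (hf : DifferentiableAt ℝ f z) :
    dbar (fun w => (Matrix.of (f w)).det) z
      = ∑ i, ((Matrix.of (f z)).updateRow i (dbar f z i)).det := by
  let D : ContinuousMultilinearMap ℂ (fun _ : Fin n => Fin n → ℂ) ℂ :=
    { toMultilinearMap := (Matrix.detRowAlternating (n := Fin n) (R := ℂ)).toMultilinearMap
      cont := Continuous.matrix_det continuous_id }
  have h : HasFDerivAt (fun w => D (f w)) (((D.linearDeriv (f z)).restrictScalars ℝ).comp (fderiv ℝ f z)) z :=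
    ((D.hasStrictFDerivAt (f z)).hasFDerivAt.restrictScalars ℝ).comp z hf.hasFDerivAt
  change dbar (fun w => D (f w)) z = _
  have h2 : dbar (fun w => D (f w)) z = D.linearDeriv (f z) (dbar f z) := by
    rw [dbar, h.fderiv, dbar, map_smul, map_add, map_smul]; rfl
  rw [h2, ContinuousMultilinearMap.linearDeriv_apply]
  rfl

/-- Row `i` of `A * B` is a combination of the rows of `B`, and only the multiple of row `i` itself
survives in the determinant. -/
lemma sum_det_updateRow (A B : Matrix (Fin n) (Fin n) ℂ) :
    ∑ i, (B.updateRow i ((A * B) i)).det = A.trace * B.det := by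
  rw [Matrix.trace, Finset.sum_mul]
  refine Finset.sum_congr rfl fun i _ => ?_
  have : (A * B) i = ∑ k, A i k • B k := by
    funext j; simp [Matrix.mul_apply]
  rw [this, Matrix.det_updateRow_sum]
  rfl

end Determinant

end Twistor

end

/-! ### Local frames, and the scalar equation for the determinant. -/

noncomputable section

namespace Twistor

attribute [-instance] instNormedAddCommGroupOfRiemannianBundleOfIsTopologicalAddGroupOfContinuousConstSMulReal
  instInnerProductSpaceReal

open MeasureTheory Complex Set BoundedContinuousFunction

section Frame

variable {𝔸 : Type} [NormedRing 𝔸] [NormedAlgebra ℂ 𝔸] [CompleteSpace 𝔸]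

/-- An invertible solution near a given point. -/
lemma exists_local_frame {a : ℂ → 𝔸} (ha : ContDiff ℝ ∞ a) (hac : HasCompactSupport a) (z₀ : ℂ) :
    ∃ ε > 0, ∃ φ : ℂ → 𝔸, ContDiff ℝ ∞ φ ∧ (∀ z, IsUnit (φ z)) ∧
      ∀ z ∈ Metric.ball z₀ ε, dbar φ z + a z * φ z = 0 := by
  obtain ⟨C, hC⟩ := hac.exists_bound_of_continuous ha.continuous
  obtain ⟨ε, hε, hsmall⟩ := exists_truncKernel_small (C * (1 + ‖(1 : 𝔸)‖))
  -- At scale `ε / 3` the cutoff equals `1` up to radius `2 ε / 3` and vanishes from radius `ε` on,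
  -- as required by the support condition of `exists_small_gauge`.
  have hε3 : 0 < ε / 3 := by positivity
  let b : ℂ → 𝔸 := fun z => cutoff (ε / 3) (z - z₀) • a z
  have hb : ContDiff ℝ ∞ b := ((contDiff_cutoff _).comp (contDiff_id.sub contDiff_const)).smul ha
  obtain ⟨φ, hφ, hu, hφe⟩ := exists_small_gauge (.id ℝ ℂ) (.id ℝ ℂ) (fun w => rfl) hb
    (hac.smul_left (f := fun z => cutoff (ε / 3) (z - z₀))) hε (z₀ := z₀) (fun p hp => by
      by_contra h
      refine hp ?_
      simp only [b]
      rw [cutoff_eq_zero hε3 (by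
        simp only [ContinuousLinearMap.id_apply] at h; linarith), zero_smul])
    ((norm_nonneg _).trans (hC 0)) (fun p => by
      rw [norm_smul, Real.norm_of_nonneg (cutoff_nonneg _ _)]
      exact (mul_le_of_le_one_left (norm_nonneg _) (cutoff_le_one _ _)).trans (hC p)) hsmall
  refine ⟨2 * (ε / 3), by positivity, φ, hφ, hu, fun z hz => ?_⟩
  rw [mem_ball_iff_norm] at hz
  have h := hφe z (by simp only [ContinuousLinearMap.id_apply]; linarith)
  simp only [b] at h
  rwa [cutoff_eq_one hε3 hz.le, one_smul] at h

lemma dbar_smul_of_differentiableAt {F : Type} [NormedAddCommGroup F] [NormedSpace ℂ F] {g : ℂ → ℂ}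
    {f : ℂ → F} {z : ℂ} (hg : DifferentiableAt ℂ g z) (hf : DifferentiableAt ℝ f z) :
    dbar (fun w => g w • f w) z = g z • dbar f z := by
  have h0 := dbar_eq_zero hg
  rw [dbar, fderiv_fun_smul (hg.restrictScalars ℝ) hf]
  simp only [_root_.add_apply, _root_.smul_apply, ContinuousLinearMap.smulRight_apply]
  rw [dbar, smul_comm (g z), smul_add (g z)]
  have h1 : (2⁻¹ : ℂ) • (fderiv ℝ g z 1 + I • fderiv ℝ g z I) • f z = 0 := by
    rw [← smul_assoc, ← dbar, h0, zero_smul]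
  rw [← sub_eq_zero, ← h1, ← smul_sub]
  congr 1
  rw [add_smul, smul_add, smul_assoc, smul_comm I (g z)]
  abel

variable {n : ℕ} (Φ : 𝔸 ≃ₐ[ℂ] Matrix (Fin n) (Fin n) ℂ)

lemma finiteDimensional_of_algEquiv (Φ : 𝔸 ≃ₐ[ℂ] Matrix (Fin n) (Fin n) ℂ) :
    FiniteDimensional ℂ 𝔸 :=
  Φ.symm.toLinearEquiv.finiteDimensional

/-- `Φ` as a continuous linear map to arrays. -/
def entriesCLM : 𝔸 →L[ℂ] (Fin n → Fin n → ℂ) :=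
  haveI := finiteDimensional_of_algEquiv Φ
  LinearMap.toContinuousLinearMap
    { toFun := fun a => Φ a, map_add' := map_add Φ, map_smul' := map_smul Φ }

lemma entriesCLM_apply (a : 𝔸) : Matrix.of (entriesCLM Φ a) = Φ a := rfl

lemma contDiff_entries {G : Type} [NormedAddCommGroup G] [NormedSpace ℝ G] {f : G → 𝔸} (hf : ContDiff ℝ ∞ f) :
    ContDiff ℝ ∞ fun z => entriesCLM Φ (f z) :=
  ((entriesCLM Φ).restrictScalars ℝ).contDiff.comp hf

lemma contDiff_det {G : Type} [NormedAddCommGroup G] [NormedSpace ℝ G] {f : G → 𝔸} (hf : ContDiff ℝ ∞ f) :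
    ContDiff ℝ ∞ fun z => (Φ (f z)).det := by
  have h := contDiff_entries Φ hf
  simp only [Matrix.det_apply']
  refine ContDiff.sum fun σ _ => contDiff_const.mul (contDiff_prod fun i _ => ?_)
  exact contDiff_pi.1 (contDiff_pi.1 h (σ i)) i

/-- This is Liouville's formula for `∂̄`: the determinant of a solution solves the equation whose
coefficient is the trace. -/
lemma dbar_det_of_eq {a V : ℂ → 𝔸} (hV : ContDiff ℝ ∞ V) {z : ℂ} (h : dbar V z + a z * V z = 0) :
    dbar (fun w => (Φ (V w)).det) z = -((Φ (a z)).trace * (Φ (V z)).det) := by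
  have h1 := dbar_det ((contDiff_entries Φ hV).differentiable (by simp) z)
  simp only [entriesCLM_apply] at h1
  have h2 : dbar (fun w => entriesCLM Φ (V w)) z = (Φ (-a z) * Φ (V z) : Matrix (Fin n) (Fin n) ℂ) := by
    rw [dbar_comp_clm _ (hV.differentiable (by simp) z), eq_neg_of_add_eq_zero_left h, ← map_mul,
      neg_mul]
    rfl
  rw [h1, h2, sum_det_updateRow, map_neg, Matrix.trace_neg, neg_mul]

/-- The condition on `l` and `c` makes the rank-one matrix a projection, and multiplying its range
by `t` multiplies the determinant by `t`. -/
lemma det_one_sub_add_smul {n : ℕ} (c l : Fin n → ℂ) (h : l ⬝ᵥ c = 1) (t : ℂ) :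
    (1 - Matrix.vecMulVec c l + t • Matrix.vecMulVec c l).det = t := by
  have h1 : (1 - Matrix.vecMulVec c l + t • Matrix.vecMulVec c l)
      = 1 + Matrix.replicateCol Unit ((t - 1) • c) * Matrix.replicateRow Unit l := by
    rw [← Matrix.vecMulVec_eq, Matrix.smul_vecMulVec, sub_smul, one_smul]; abel
  rw [h1, Matrix.det_one_add_replicateCol_mul_replicateRow, dotProduct_smul, h, smul_eq_mul]; ring

end Frame

end Twistor

end

/-! ### Division of solutions, removal of the zeros of the determinant, frames on a disc. -/

noncomputable section

namespace Twistor

attribute [-instance] instNormedAddCommGroupOfRiemannianBundleOfIsTopologicalAddGroupOfContinuousConstSMulReal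
  instInnerProductSpaceReal

open MeasureTheory Complex Set BoundedContinuousFunction

section Frame

variable {𝔸 : Type} [NormedRing 𝔸] [NormedAlgebra ℂ 𝔸] [CompleteSpace 𝔸] {n : ℕ}

/-- Near a point, a solution is the product of an invertible solution and a holomorphic
function. -/
lemma exists_holomorphic_factor {a U : ℂ → 𝔸} (ha : ContDiff ℝ ∞ a) (hac : HasCompactSupport a)
    (hU : ContDiff ℝ ∞ U) (hUe : ∀ z, dbar U z + a z * U z = 0) (z₀ : ℂ) :
    ∃ ε > 0, ∃ φ H : ℂ → 𝔸, ContDiff ℝ ∞ φ ∧ (∀ z, IsUnit (φ z)) ∧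
      (∀ z ∈ Metric.ball z₀ ε, dbar φ z + a z * φ z = 0) ∧
      DifferentiableOn ℂ H (Metric.ball z₀ ε) ∧ ∀ z, U z = φ z * H z := by
  obtain ⟨ε, hε, φ, hφ, hu, hφe⟩ := exists_local_frame ha hac z₀
  obtain ⟨ψ, hψ, hψφ⟩ := exists_contDiff_inverse hφ hu
  have hφψ : ∀ z, φ z * ψ z = 1 := fun z =>
    (hu z).mul_right_cancel (by rw [mul_assoc, hψφ, mul_one, one_mul])
  have hH : ContDiff ℝ ∞ fun z => ψ z * U z := hψ.mul hU
  have hUH : ∀ z, U z = φ z * (ψ z * U z) := fun z => by rw [← mul_assoc, hφψ, one_mul]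
  refine ⟨ε, hε, φ, fun z => ψ z * U z, hφ, hu, hφe, fun z hz => ?_, hUH⟩
  refine (differentiableAt_of_dbar_eq_zero (hH.differentiable (by simp) z) ?_).differentiableWithinAt
  -- Applying the product rule to `U = φ H`, with `U` and `φ` solving the same equation, leaves `φ
  -- ∂̄H = 0`.
  have h1 := dbar_mul (hφ.differentiable (by simp) z) (hH.differentiable (by simp) z)
  rw [← funext hUH, eq_neg_of_add_eq_zero_left (hUe z), eq_neg_of_add_eq_zero_left (hφe z hz),
    neg_mul, mul_assoc, ← hUH, left_eq_add] at h1
  calc dbar (fun z => ψ z * U z) z = ψ z * (φ z * dbar (fun z => ψ z * U z) z) := by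
        rw [← mul_assoc, hψφ, one_mul]
    _ = 0 := by rw [h1, mul_zero]

/-- Division of a solution by `z - z₀` at a zero. -/
lemma exists_divided_solution {a U : ℂ → 𝔸} (ha : ContDiff ℝ ∞ a) (hac : HasCompactSupport a)
    (hU : ContDiff ℝ ∞ U) (hUe : ∀ z, dbar U z + a z * U z = 0) {z₀ : ℂ} (h0 : U z₀ = 0) :
    ∃ W : ℂ → 𝔸, ContDiff ℝ ∞ W ∧ (∀ z, dbar W z + a z * W z = 0) ∧
      ∀ z, z ≠ z₀ → W z = (z - z₀)⁻¹ • U z := by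
  obtain ⟨ε, hε, φ, H, hφ, hu, hφe, hH, hUH⟩ := exists_holomorphic_factor ha hac hU hUe z₀
  have hb : Metric.ball z₀ ε ∈ 𝓝 z₀ := Metric.ball_mem_nhds _ hε
  have hH0 : H z₀ = 0 := by
    rw [hUH] at h0; exact (hu z₀).mul_right_eq_zero.1 h0
  have hd : DifferentiableOn ℂ (dslope H z₀) (Metric.ball z₀ ε) := (differentiableOn_dslope hb).2 hH
  -- The value at `z₀` is chosen so that `W = φ · dslope H z₀` everywhere. Smoothness across `z₀`
  -- then follows from holomorphy of the divided difference.
  let W : ℂ → 𝔸 := Function.update (fun z => (z - z₀)⁻¹ • U z) z₀ (φ z₀ * dslope H z₀ z₀)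
  have hWne : ∀ z, z ≠ z₀ → W z = (z - z₀)⁻¹ • U z := fun z hz => Function.update_of_ne hz _ _
  have hW : ∀ z, W z = φ z * dslope H z₀ z := by
    intro z
    by_cases hz : z = z₀
    · subst hz; exact Function.update_self _ _ _
    · rw [hWne z hz, dslope_of_ne _ hz, slope_def_module, hH0, sub_zero, hUH, mul_smul_comm]
  have hWev : ∀ z, z ≠ z₀ → W =ᶠ[𝓝 z] fun z => (z - z₀)⁻¹ • U z := fun z hz => by
    filter_upwards [isOpen_compl_singleton.mem_nhds hz] with w hw using hWne w hw
  refine ⟨W, contDiff_iff_contDiffAt.2 fun z => ?_, fun z => ?_, hWne⟩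
  · by_cases hz : z = z₀
    · subst hz
      rw [funext hW]
      have h1 : ContDiffAt ℂ ∞ (dslope H z) z := (hd.contDiffOn Metric.isOpen_ball).contDiffAt hb
      exact hφ.contDiffAt.mul (h1.restrict_scalars ℝ)
    · refine ContDiffAt.congr_of_eventuallyEq ?_ (hWev z hz)
      exact ((contDiffAt_id.sub contDiffAt_const).inv (sub_ne_zero.2 hz)).smul hU.contDiffAt
  · by_cases hz : z = z₀
    · subst hz
      have h1 : DifferentiableAt ℂ (dslope H z) z := hd.differentiableAt hb
      rw [funext hW, dbar_mul (hφ.differentiable (by simp) z) (h1.restrictScalars ℝ),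
        dbar_eq_zero h1, mul_zero, add_zero, ← mul_assoc, ← add_mul,
        hφe z (Metric.mem_ball_self hε), zero_mul]
    · have hg : DifferentiableAt ℂ (fun z => (z - z₀)⁻¹) z :=
        (differentiableAt_id.sub_const z₀).inv (sub_ne_zero.2 hz)
      rw [dbar_congr (hWev z hz), hWne z hz,
        dbar_smul_of_differentiableAt hg (hU.differentiable (by simp) z), mul_smul_comm, ← smul_add,
        hUe, smul_zero]

variable (Φ : 𝔸 ≃ₐ[ℂ] Matrix (Fin n) (Fin n) ℂ)

/-- A simple factor of the determinant of a solution can be removed. -/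
lemma exists_kill_zero {a V : ℂ → 𝔸} (ha : ContDiff ℝ ∞ a) (hac : HasCompactSupport a)
    (hV : ContDiff ℝ ∞ V) (hVe : ∀ z, dbar V z + a z * V z = 0) {z₀ : ℂ}
    (h0 : (Φ (V z₀)).det = 0) :
    ∃ W : ℂ → 𝔸, ContDiff ℝ ∞ W ∧ (∀ z, dbar W z + a z * W z = 0) ∧
      ∀ z, z ≠ z₀ → (z - z₀) * (Φ (W z)).det = (Φ (V z)).det := by
  obtain ⟨c, hc, hVc⟩ := Matrix.exists_mulVec_eq_zero_iff.2 h0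
  obtain ⟨i₀, hi⟩ := Function.ne_iff.1 hc
  let l : Fin n → ℂ := Pi.single i₀ (c i₀)⁻¹
  have hl : l ⬝ᵥ c = 1 := by simp only [l, single_dotProduct]; exact inv_mul_cancel₀ hi
  -- The projection `P` has range spanned by a kernel vector of `V z₀`, so `V P` vanishes at `z₀`
  -- and may be divided by `z - z₀`. The new solution `V (1 - P) + V P / (z - z₀)` has the old
  -- determinant divided by exactly one factor `z - z₀`.
  let P := Φ.symm (Matrix.vecMulVec c l)
  have hP : V z₀ * P = 0 := Φ.injective (by
    rw [map_mul, AlgEquiv.apply_symm_apply, map_zero, Matrix.mul_vecMulVec, hVc,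
      Matrix.zero_vecMulVec])
  have hright : ∀ Q : 𝔸, ∀ z, dbar (fun z => V z * Q) z + a z * (V z * Q) = 0 := fun Q z => by
    rw [dbar_mul (hV.differentiable (by simp) z) (differentiableAt_const Q),
      dbar_eq_zero (differentiableAt_const Q), mul_zero, add_zero, ← mul_assoc, ← add_mul, hVe,
      zero_mul]
  obtain ⟨W, hW, hWe, hWV⟩ := exists_divided_solution ha hac (hV.mul contDiff_const) (hright P) hP
  have hVP := hV.mul (contDiff_const (c := 1 - P))
  refine ⟨fun z => V z * (1 - P) + W z, hVP.add hW, fun z => ?_, fun z hz => ?_⟩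
  · have h1 : dbar (fun z => V z * (1 - P) + W z) z = dbar (fun z => V z * (1 - P)) z + dbar W z := by
      simp only [dbar]
      rw [fderiv_fun_add (hVP.differentiable (by simp) z) (hW.differentiable (by simp) z)]
      simp only [_root_.add_apply, smul_add]
      abel
    rw [h1, mul_add, add_add_add_comm, hright, hWe, add_zero]
  · have h1 : V z * (1 - P) + W z = V z * (1 - P + (z - z₀)⁻¹ • P) := by
      rw [hWV z hz, mul_add, mul_smul_comm]
    beta_reduce
    rw [h1, map_mul, Matrix.det_mul, map_add, map_sub, map_one, map_smul, AlgEquiv.apply_symm_apply,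
      det_one_sub_add_smul c l hl, mul_comm, mul_assoc, inv_mul_cancel₀ (sub_ne_zero.2 hz), mul_one]

/-- The listed factors of the determinant are removed one at a time. After each removal the
factorisation holds off `z₀`, and extends to `z₀` by density and continuity. -/
lemma exists_frame_of_factor {a : ℂ → 𝔸} (ha : ContDiff ℝ ∞ a) (hac : HasCompactSupport a)
    {k : ℂ → ℂ} (hk : Continuous k) {S : Set ℂ} (hkS : ∀ z ∈ S, k z ≠ 0) (s : List ℂ) {V : ℂ → 𝔸}
    (hV : ContDiff ℝ ∞ V) (hVe : ∀ z, dbar V z + a z * V z = 0)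
    (hdet : ∀ z, (Φ (V z)).det = (s.map (z - ·)).prod * k z) :
    ∃ W : ℂ → 𝔸, ContDiff ℝ ∞ W ∧ (∀ z, dbar W z + a z * W z = 0) ∧ ∀ z ∈ S, (Φ (W z)).det ≠ 0 := by
  induction s generalizing V with
  | nil => exact ⟨V, hV, hVe, fun z hz => by rw [hdet]; simpa using hkS z hz⟩
  | cons z₀ s ih =>
    obtain ⟨W, hW, hWe, hWV⟩ := exists_kill_zero Φ ha hac hV hVe (z₀ := z₀) (by rw [hdet]; simp)
    refine ih hW hWe fun z => ?_
    have hs : Continuous fun z => (s.map (z - ·)).prod * k z := by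
      refine Continuous.mul ?_ hk
      clear ih hdet
      induction s with
      | nil => simpa using continuous_const
      | cons x s ih => simp only [List.map_cons, List.prod_cons]; exact (continuous_id.sub continuous_const).mul ih
    refine congrFun (Continuous.ext_on (dense_compl_singleton z₀) (contDiff_det Φ hW).continuous hs
      fun z hz => ?_) z
    have h1 := hWV z hz
    rw [hdet, List.map_cons, List.prod_cons, mul_assoc] at h1
    exact mul_left_cancel₀ (sub_ne_zero.2 hz) h1

/-- A solution of `∂̄V + aV = 0`, invertible on a given disc. -/
theorem exists_frame_on_disc {a : ℂ → 𝔸} (ha : ContDiff ℝ ∞ a) (hac : HasCompactSupport a) (R : ℝ) :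
    ∃ V : ℂ → 𝔸, ContDiff ℝ ∞ V ∧ (∀ z, dbar V z + a z * V z = 0) ∧
      ∀ z ∈ Metric.closedBall (0 : ℂ) R, (Φ (V z)).det ≠ 0 := by
  have := finiteDimensional_of_algEquiv Φ
  have : FiniteDimensional ℝ 𝔸 := FiniteDimensional.complexToReal 𝔸
  obtain ⟨q, V, hq, hV, hVe, hlim⟩ := exists_global_solution ha hac
  -- A nonzero polynomial is bounded away from zero near infinity, either growing or being a nonzero
  -- constant. There `V` is a small relative perturbation of a nonzero scalar, hence invertible.
  have hne : ∃ w, (Φ (V w)).det ≠ 0 := by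
    obtain ⟨δ, hδ, hqδ⟩ : ∃ δ > 0, ∀ᶠ z in Filter.cocompact ℂ, δ ≤ ‖q.eval z‖ := by
      by_cases hdeg : 0 < q.degree
      · exact ⟨1, one_pos, (q.tendsto_norm_atTop hdeg
          (tendsto_norm_cocompact_atTop (E := ℂ))).eventually_ge_atTop 1⟩
      · have h1 := Polynomial.eq_C_of_degree_le_zero (not_lt.1 hdeg)
        have h2 : q.coeff 0 ≠ 0 := fun h => hq (by rw [h1, h, map_zero])
        refine ⟨‖q.coeff 0‖, norm_pos_iff.2 h2, Filter.Eventually.of_forall fun z => ?_⟩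
        rw [h1]; simp
    obtain ⟨w, hw1, hw2⟩ := (hqδ.and (hlim.norm.eventually_lt_const (by rwa [norm_zero] : ‖(0 : 𝔸)‖ < δ))).exists
    have hq0 : q.eval w ≠ 0 := norm_pos_iff.1 (hδ.trans_le hw1)
    have h1 : ‖(q.eval w)⁻¹ • (V w - q.eval w • (1 : 𝔸))‖ < 1 := by
      rw [norm_smul, norm_inv, inv_mul_lt_one₀ (norm_pos_iff.2 hq0)]
      exact hw2.trans_le hw1
    have h2 := isUnit_one_add_of_norm_lt h1
    rw [smul_sub, inv_smul_smul₀ hq0, add_sub_cancel] at h2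
    have h3 := ((Matrix.isUnit_iff_isUnit_det _).1 (h2.map Φ)).ne_zero
    rw [map_smul, Matrix.det_smul] at h3
    exact ⟨w, right_ne_zero_of_mul h3⟩
  let tr : 𝔸 →L[ℂ] ℂ := LinearMap.toContinuousLinearMap ((Matrix.traceLinearMap (Fin n) ℂ ℂ) ∘ₗ Φ.toLinearMap)
  have htr : ∀ x, tr x = (Φ x).trace := fun x => rfl
  have hta : ContDiff ℝ ∞ fun z => tr (a z) := (tr.restrictScalars ℝ).contDiff.comp ha
  have htac : HasCompactSupport fun z => tr (a z) := hac.comp_left (map_zero tr)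
  -- The Cauchy transform of the trace satisfies `∂̄E = tr a`, so multiplying the determinant by
  -- `exp E` makes it entire without introducing zeros.
  let E : ℂ → ℂ := fun z => ∫ w, cauchyKernel w • tr (a (z - w))
  have hE : ContDiff ℝ ∞ E := contDiff_kernelConv hta htac locallyIntegrable_cauchyKernel
  have hEd : ∀ z, dbar E z = tr (a z) := fun z => by
    have h2 := dbar_kernelConv locallyIntegrable_cauchyKernel (hta.of_le (by simp)) htac z
    rwa [integral_cauchyKernel_smul_dbar (hta.of_le (by simp)) htac] at h2
  have hdets := contDiff_det Φ hV
  let h : ℂ → ℂ := fun z => (Φ (V z)).det * exp (E z)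
  have hh : Differentiable ℂ h := fun z => by
    have hEz : DifferentiableAt ℝ E z := hE.differentiable (by simp) z
    have hexp : DifferentiableAt ℝ (fun z => exp (E z)) z := hEz.cexp
    have hdz : DifferentiableAt ℝ (fun w => (Φ (V w)).det) z := hdets.differentiable (by simp) z
    refine differentiableAt_of_dbar_eq_zero (hdz.mul hexp) ?_
    have h1 : dbar (fun z => exp (E z)) z = exp (E z) * dbar E z := by
      have h2 : HasFDerivAt (fun z => exp (E z)) (exp (E z) • fderiv ℝ E z) z := hEz.hasFDerivAt.cexp
      rw [dbar, h2.fderiv, dbar]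
      simp only [_root_.smul_apply, smul_eq_mul]; ring
    rw [dbar_mul hdz hexp, h1, hEd, dbar_det_of_eq Φ hV (hVe z), htr]
    ring
  obtain ⟨w, hw⟩ := hne
  obtain ⟨s, g, hg, hg0, hgs⟩ := exists_factor_zeros hh (mul_ne_zero hw (exp_ne_zero (E w))) R
  refine exists_frame_of_factor Φ ha hac (k := fun z => g z * exp (-E z))
    (hg.mul (by have := hE.continuous; fun_prop)) (fun z hz => mul_ne_zero (hg0 z hz) (exp_ne_zero _)) s hV hVe fun z => ?_
  rw [← mul_assoc, ← hgs, mul_assoc, ← Complex.exp_add, add_neg_cancel, Complex.exp_zero, mul_one]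

end Frame

end Twistor

end

/-! ### Frames depending smoothly on a parameter: local existence and gluing. -/

noncomputable section

namespace Twistor

attribute [-instance] instNormedAddCommGroupOfRiemannianBundleOfIsTopologicalAddGroupOfContinuousConstSMulReal
  instInnerProductSpaceReal

open MeasureTheory Complex Set BoundedContinuousFunction

section Families

variable {𝔸 : Type} [NormedRing 𝔸] [NormedAlgebra ℂ 𝔸] [CompleteSpace 𝔸]

/-- `φ` is a smooth family of invertible solutions of `∂φ/∂ω̄ + aφ = 0` on `|ω| < 2`, with
parameter in `Ω`. -/
structure IsFrame (a : ℂ × ℂ → 𝔸) (Ω : Set ℂ) (φ : ℂ × ℂ → 𝔸) : Prop where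
  smooth : ContDiffOn ℝ ∞ φ (Ω ×ˢ Metric.ball 0 2)
  isUnit : ∀ x ∈ Ω, ∀ w ∈ Metric.ball (0 : ℂ) 2, IsUnit (φ (x, w))
  eqn : ∀ x ∈ Ω, ∀ w ∈ Metric.ball (0 : ℂ) 2,
    dbar (fun z => φ (x, z)) w + a (x, w) * φ (x, w) = 0

namespace IsFrame

variable {a : ℂ × ℂ → 𝔸} {Ω Ω' : Set ℂ} {φ ψ k : ℂ × ℂ → 𝔸}

lemma mono (h : IsFrame a Ω φ) (hΩ : Ω' ⊆ Ω) : IsFrame a Ω' φ where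
  smooth := h.smooth.mono (prod_mono_left hΩ)
  isUnit x hx := h.isUnit x (hΩ hx)
  eqn x hx := h.eqn x (hΩ hx)

lemma contDiffAt (h : IsFrame a Ω φ) (hΩ : IsOpen Ω) {x w : ℂ} (hx : x ∈ Ω)
    (hw : w ∈ Metric.ball (0 : ℂ) 2) : ContDiffAt ℝ ∞ φ (x, w) :=
  h.smooth.contDiffAt ((hΩ.prod Metric.isOpen_ball).mem_nhds ⟨hx, hw⟩)

lemma differentiableAt (h : IsFrame a Ω φ) (hΩ : IsOpen Ω) {x w : ℂ} (hx : x ∈ Ω)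
    (hw : w ∈ Metric.ball (0 : ℂ) 2) : DifferentiableAt ℝ (fun z => φ (x, z)) w :=
  ((h.contDiffAt hΩ hx hw).comp w (contDiffAt_const.prodMk contDiffAt_id)).differentiableAt (by simp)

lemma of_local (h : ∀ x ∈ Ω, ∃ U, IsOpen U ∧ x ∈ U ∧ ∃ ψ, IsFrame a U ψ ∧
      ∀ y ∈ U, ∀ w ∈ Metric.ball (0 : ℂ) 2, φ (y, w) = ψ (y, w)) :
    IsFrame a Ω φ where
  smooth := by
    rintro ⟨x, w⟩ ⟨hx, hw⟩
    obtain ⟨U, hU, hxU, ψ, hψ, he⟩ := h x hx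
    refine ((hψ.contDiffAt hU hxU hw).congr_of_eventuallyEq ?_).contDiffWithinAt
    filter_upwards [(hU.prod Metric.isOpen_ball).mem_nhds ⟨hxU, hw⟩] with p hp
    exact he p.1 hp.1 p.2 hp.2
  isUnit x hx w hw := by
    obtain ⟨U, hU, hxU, ψ, hψ, he⟩ := h x hx
    rw [he x hxU w hw]; exact hψ.isUnit x hxU w hw
  eqn x hx w hw := by
    obtain ⟨U, hU, hxU, ψ, hψ, he⟩ := h x hx
    rw [dbar_congr (Filter.eventuallyEq_of_mem (Metric.isOpen_ball.mem_nhds hw) (he x hxU)),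
      he x hxU w hw]
    exact hψ.eqn x hxU w hw

/-- Two frames differ by a holomorphic factor. -/
lemma transition (hφ : IsFrame a Ω φ) (hψ : IsFrame a Ω ψ) (hΩ : IsOpen Ω) :
    IsFrame 0 Ω fun p => Ring.inverse (φ p) * ψ p := by
  have hi : ∀ x ∈ Ω, ∀ w ∈ Metric.ball (0 : ℂ) 2, ContDiffAt ℝ ∞ (fun p => Ring.inverse (φ p)) (x, w) := by
    intro x hx w hw
    obtain ⟨u, hu⟩ := hφ.isUnit x hx w hw
    exact (hu ▸ contDiffAt_ringInverse ℝ u : ContDiffAt ℝ ∞ Ring.inverse (φ (x, w))).comp (x, w)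
      (hφ.contDiffAt hΩ hx hw)
  have hs : ∀ x ∈ Ω, ∀ w ∈ Metric.ball (0 : ℂ) 2, ContDiffAt ℝ ∞ (fun p => Ring.inverse (φ p) * ψ p) (x, w) :=
    fun x hx w hw => (hi x hx w hw).mul (hψ.contDiffAt hΩ hx hw)
  refine ⟨fun p hp => (hs p.1 hp.1 p.2 hp.2).contDiffWithinAt, fun x hx w hw =>
    (isUnit_ringInverse.2 (hφ.isUnit x hx w hw)).mul (hψ.isUnit x hx w hw), fun x hx w hw => ?_⟩
  have hk : DifferentiableAt ℝ (fun z => Ring.inverse (φ (x, z)) * ψ (x, z)) w :=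
    ((hs x hx w hw).comp w (contDiffAt_const.prodMk contDiffAt_id)).differentiableAt (by simp)
  have h1 := dbar_mul (hφ.differentiableAt hΩ hx hw) hk
  have h2 : (fun z => φ (x, z) * (Ring.inverse (φ (x, z)) * ψ (x, z))) =ᶠ[𝓝 w] fun z => ψ (x, z) := by
    filter_upwards [Metric.isOpen_ball.mem_nhds hw] with z hz
    rw [← mul_assoc, Ring.mul_inverse_cancel _ (hφ.isUnit x hx z hz), one_mul]
  rw [dbar_congr h2, eq_neg_of_add_eq_zero_left (hψ.eqn x hx w hw),
    eq_neg_of_add_eq_zero_left (hφ.eqn x hx w hw), neg_mul, mul_assoc, show φ (x, w) * (Ring.inverse (φ (x, w)) * ψ (x, w)) = ψ (x, w) from h2.self_of_nhds,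
    left_eq_add] at h1
  rw [Pi.zero_apply, zero_mul, add_zero]
  exact (hφ.isUnit x hx w hw).mul_right_eq_zero.1 h1

lemma mul (hφ : IsFrame a Ω φ) (hk : IsFrame 0 Ω k) (hΩ : IsOpen Ω) :
    IsFrame a Ω fun p => φ p * k p where
  smooth := hφ.smooth.mul hk.smooth
  isUnit x hx w hw := (hφ.isUnit x hx w hw).mul (hk.isUnit x hx w hw)
  eqn x hx w hw := by
    have h := hk.eqn x hx w hw
    rw [Pi.zero_apply, zero_mul, add_zero] at h
    rw [dbar_mul (hφ.differentiableAt hΩ hx hw) (hk.differentiableAt hΩ hx hw), h, mul_zero,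
      add_zero, ← mul_assoc, ← add_mul, hφ.eqn x hx w hw, zero_mul]

/-- With zero coefficient the equation does not see the parameter, so the parameter may be
substituted arbitrarily. This is why transition functions between frames extend past the overlap. -/
lemma pullback (hk : IsFrame 0 Ω k) {r : ℂ → ℂ} (hr : ContDiff ℝ ∞ r) (hΩ : ∀ x ∈ Ω', r x ∈ Ω) :
    IsFrame 0 Ω' fun p => k (r p.1, p.2) where
  smooth := hk.smooth.comp ((hr.comp contDiff_fst).prodMk contDiff_snd).contDiffOn
    fun _ hp => ⟨hΩ _ hp.1, hp.2⟩
  isUnit x hx := hk.isUnit _ (hΩ x hx)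
  eqn x hx := hk.eqn _ (hΩ x hx)

end IsFrame

/-- It serves to extend transition functions: points left of `m` stay fixed, and everything to the
right of `m` is pushed back into `[m, b)`. -/
lemma exists_smooth_retraction {m b : ℝ} (hmb : m < b) :
    ∃ ρ : ℝ → ℝ, ContDiff ℝ ∞ ρ ∧ (∀ t ≤ m, ρ t = t) ∧ ∀ t, m ≤ t → m ≤ ρ t ∧ ρ t < b := by
  let η := (b - m) / 2
  have hη : 0 < η := by simp only [η]; linarith
  refine ⟨fun t => t - (t - m) * Real.smoothTransition ((t - m) / η), ?_, fun t ht => ?_,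
    fun t ht => ?_⟩
  · exact contDiff_id.sub ((contDiff_id.sub contDiff_const).mul
      (Real.smoothTransition.contDiff.comp ((contDiff_id.sub contDiff_const).div_const _)))
  · beta_reduce
    rw [Real.smoothTransition.zero_of_nonpos (div_nonpos_of_nonpos_of_nonneg (by linarith) hη.le)]
    ring
  · have h0 := Real.smoothTransition.nonneg ((t - m) / η)
    have h1 := Real.smoothTransition.le_one ((t - m) / η)
    refine ⟨by nlinarith, ?_⟩
    rcases le_or_gt η (t - m) with h | h
    · beta_reduce
      rw [Real.smoothTransition.one_of_one_le (by rwa [one_le_div hη])]; linarith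
    · have : η < b - m := by simp only [η]; linarith
      nlinarith

/-- Gluing of frames over overlapping slabs. -/
lemma IsFrame.glue {a φ₁ φ₂ : ℂ × ℂ → 𝔸} {L N : ℂ →L[ℝ] ℝ} {e : ℂ} (hL : L e = 1) (hN : N e = 0)
    {J : Set ℝ} (hJ : IsOpen J) {p q r s : ℝ} (hrq : r < q)
    (h₁ : IsFrame a {x | L x ∈ Ioo p q ∧ N x ∈ J} φ₁)
    (h₂ : IsFrame a {x | L x ∈ Ioo r s ∧ N x ∈ J} φ₂) :
    ∃ φ, IsFrame a {x | L x ∈ Ioo p s ∧ N x ∈ J} φ := by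
  obtain ⟨m, hrm, hmq⟩ := exists_between hrq
  obtain ⟨ρ, hρ, hρ1, hρ2⟩ := exists_smooth_retraction hmq
  have hop : ∀ u v, IsOpen {x | L x ∈ Ioo u v ∧ N x ∈ J} := fun u v =>
    (isOpen_Ioo.preimage L.continuous).inter (hJ.preimage N.continuous)
  -- In these degenerate positions one of the two frames already serves on the whole slab.
  rcases le_or_gt q p with hpq | hpq
  · exact ⟨φ₂, h₂.mono fun x hx => ⟨⟨(hrq.trans_le hpq).trans hx.1.1, hx.1.2⟩, hx.2⟩⟩
  rcases le_or_gt s q with hsq | hsq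
  · exact ⟨φ₁, h₁.mono fun x hx => ⟨⟨hx.1.1, hx.1.2.trans_le hsq⟩, hx.2⟩⟩
  rcases le_or_gt r p with hrp | hrp
  · exact ⟨φ₂, h₂.mono fun x hx => ⟨⟨hrp.trans_lt hx.1.1, hx.1.2⟩, hx.2⟩⟩
  have ht := (h₂.mono (Ω' := {x | L x ∈ Ioo r q ∧ N x ∈ J}) fun x hx =>
      ⟨⟨hx.1.1, hx.1.2.trans hsq⟩, hx.2⟩).transition
    (h₁.mono fun x hx => ⟨⟨hrp.trans hx.1.1, hx.1.2⟩, hx.2⟩) (hop _ _)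
  -- The parameter is moved along `e`, which changes `L x` to `ρ (L x)` and leaves `N x` unchanged.
  -- The second slab is thereby mapped into the overlap.
  let R : ℂ → ℂ := fun x => x + (ρ (L x) - L x) • e
  have hRs : ContDiff ℝ ∞ R := contDiff_id.add
    (((hρ.comp L.contDiff).sub L.contDiff).smul contDiff_const)
  have hLR : ∀ x, L (R x) = ρ (L x) := fun x => by
    simp only [R, map_add, map_smul, hL, smul_eq_mul, mul_one, add_sub_cancel]
  have hNR : ∀ x, N (R x) = N x := fun x => by
    simp only [R, map_add, map_smul, hN, smul_zero, add_zero]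
  have hk := ht.pullback (Ω' := {x | L x ∈ Ioo r s ∧ N x ∈ J}) hRs fun x hx => by
    refine ⟨?_, by rw [hNR]; exact hx.2⟩
    rw [hLR]
    rcases le_or_gt (L x) m with h | h
    · rw [hρ1 _ h]; exact ⟨hx.1.1, h.trans_lt hmq⟩
    · exact ⟨hrm.trans_le (hρ2 _ h.le).1, (hρ2 _ h.le).2⟩
  have h3 := h₂.mul hk (hop _ _)
  classical
  -- To the right of `m` the frame `φ₂` is corrected by the transition function `φ₂⁻¹ φ₁` evaluated
  -- at the retracted parameter. Where `r < L x < m` the retraction is the identity and the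
  -- correction turns `φ₂` into `φ₁`, so the two formulas fit together smoothly.
  refine ⟨fun x => if L x.1 < m then φ₁ x else
    φ₂ x * (Ring.inverse (φ₂ (R x.1, x.2)) * φ₁ (R x.1, x.2)), IsFrame.of_local fun x hx => ?_⟩
  by_cases hxm : L x < m
  · exact ⟨_, hop p m, ⟨⟨hx.1.1, hxm⟩, hx.2⟩, φ₁,
      h₁.mono fun y hy => ⟨⟨hy.1.1, hy.1.2.trans hmq⟩, hy.2⟩, fun y hy w _ => if_pos hy.1.2⟩
  · refine ⟨_, hop r s, ⟨⟨hrm.trans_le (not_lt.1 hxm), hx.1.2⟩, hx.2⟩, _, h3, fun y hy w hw => ?_⟩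
    split_ifs with hym
    · have hR : R y = y := by simp only [R, hρ1 _ (le_of_lt hym), sub_self, zero_smul, add_zero]
      simp only [hR]
      rw [← mul_assoc, Ring.mul_inverse_cancel _ (h₂.isUnit y hy w hw), one_mul]
    · rfl

/-- Induction along an interval. -/
lemma exists_of_local_of_glue {Q : ℝ → ℝ → Prop} (hloc : ∀ t, ∃ δ > 0, Q (t - δ) (t + δ))
    (hmono : ∀ {p q p' q'}, Q p q → p ≤ p' → q' ≤ q → Q p' q')
    (hglue : ∀ {p q r s}, r < q → Q p q → Q r s → Q p s) (A B : ℝ) : Q A B := by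
  choose δ hδ hQ using hloc
  obtain ⟨r, hr, hcov⟩ := lebesgue_number_lemma_of_metric (isCompact_Icc (a := A) (b := B))
    (c := fun t => Ioo (t - δ t) (t + δ t)) (fun _ => isOpen_Ioo)
    (fun t _ => mem_iUnion.2 ⟨t, by linarith [hδ t], by linarith [hδ t]⟩)
  have hQr : ∀ x ∈ Icc A B, Q (x - r / 2) (x + r / 2) := fun x hx => by
    obtain ⟨t, ht⟩ := hcov x hx
    have h1 := ht (show x - r / 2 ∈ Metric.ball x r by rw [Metric.mem_ball, Real.dist_eq, abs_lt]; constructor <;> linarith)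
    have h2 := ht (show x + r / 2 ∈ Metric.ball x r by rw [Metric.mem_ball, Real.dist_eq, abs_lt]; constructor <;> linarith)
    exact hmono (hQ t) h1.1.le h2.2.le
  rcases lt_or_ge B A with hBA | hAB
  · exact hmono (hQ A) (by linarith [hδ A]) (by linarith [hδ A])
  have hn : ∀ n : ℕ, A + n * (r / 2) ≤ B → Q A (A + n * (r / 2) + r / 2) := by
    intro n
    induction n with
    | zero => intro _; simpa using hmono (hQr A ⟨le_rfl, hAB⟩) (by linarith) le_rfl
    | succ n ih =>
      intro hle
      push_cast at hle ⊢
      exact hglue (by linarith) (ih (by linarith)) (hQr _ ⟨by nlinarith, hle⟩)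
  let n := ⌊(B - A) / (r / 2)⌋₊
  have h1 : (n : ℝ) * (r / 2) ≤ B - A := by
    rw [← le_div_iff₀ (by positivity)]; exact Nat.floor_le (div_nonneg (by linarith) (by positivity))
  have h2 : B - A < (n + 1 : ℝ) * (r / 2) := by
    rw [← div_lt_iff₀ (by positivity)]; exact Nat.lt_floor_add_one _
  exact hmono (hn n (by linarith)) le_rfl (by linarith)

variable {n : ℕ}

/-- The inverse of a frame, cut off to a disc on which the frame is invertible. -/
lemma contDiff_cutoff_smul_inverse {V : ℂ → 𝔸} (hV : ContDiff ℝ ∞ V)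
    (hu : ∀ z ∈ Metric.closedBall (0 : ℂ) 3, IsUnit (V z)) :
    ContDiff ℝ ∞ fun z => cutoff 1 z • Ring.inverse (V z) := by
  refine contDiff_iff_contDiffAt.2 fun z => ?_
  by_cases hz : z ∈ Metric.closedBall (0 : ℂ) 3
  · obtain ⟨u, h⟩ := hu z hz
    exact (contDiff_cutoff 1).contDiffAt.smul
      ((h ▸ contDiffAt_ringInverse ℝ u : ContDiffAt ℝ ∞ Ring.inverse (V z)).comp z hV.contDiffAt)
  · refine (contDiffAt_const (c := (0 : 𝔸))).congr_of_eventuallyEq ?_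
    filter_upwards [Metric.isClosed_closedBall.isOpen_compl.mem_nhds hz] with w hw
    rw [mem_compl_iff, mem_closedBall_zero_iff, not_le] at hw
    rw [cutoff_eq_zero one_pos (by linarith), zero_smul]

/-- Frames with parameter exist locally. -/
lemma exists_isFrame_local (Φ : 𝔸 ≃ₐ[ℂ] Matrix (Fin n) (Fin n) ℂ) {a : ℂ × ℂ → 𝔸} (ha : ContDiff ℝ ∞ a) (hac : HasCompactSupport a)
    (x₀ : ℂ) : ∃ δ > 0, ∃ φ, IsFrame a (Metric.ball x₀ δ) φ := by
  have ha₀ : ContDiff ℝ ∞ fun w => a (x₀, w) := ha.comp (contDiff_const.prodMk contDiff_id)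
  have hac₀ : HasCompactSupport fun w => a (x₀, w) :=
    hac.comp_isClosedEmbedding (Topology.IsClosedEmbedding.of_continuous_injective_isClosedMap (by fun_prop) (Prod.mk_right_injective x₀) (isClosedMap_prodMk_left x₀))
  -- The equation is solved at the frozen parameter `x₀`. A frame is then sought in the form `V φ`,
  -- which turns the coefficient into `V⁻¹ (a - a(x₀, ·)) V`, small for `x` near `x₀`.
  obtain ⟨V, hV, hVe, hVdet⟩ := exists_frame_on_disc Φ ha₀ hac₀ 3
  have hVu : ∀ z ∈ Metric.closedBall (0 : ℂ) 3, IsUnit (V z) := fun z hz => by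
    have h := (Matrix.isUnit_iff_isUnit_det _).2 (isUnit_iff_ne_zero.2 (hVdet z hz))
    simpa using h.map Φ.symm
  -- This is `V⁻¹` on the region `‖z‖ ≤ 2` where the frame is wanted, and zero from radius `3` on,
  -- the radius at which the small-coefficient result is applied.
  let ψ : ℂ → 𝔸 := fun z => cutoff 1 z • Ring.inverse (V z)
  have hψ : ContDiff ℝ ∞ ψ := contDiff_cutoff_smul_inverse hV hVu
  have hψc : HasCompactSupport ψ := (hasCompactSupport_cutoff one_pos).smul_right
  have hψ0 : ∀ z, 3 ≤ ‖z‖ → ψ z = 0 := fun z hz => by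
    simp only [ψ]; rw [cutoff_eq_zero one_pos (by linarith), zero_smul]
  have hVψ : ∀ z, ‖z‖ < 2 → V z * ψ z = 1 := fun z hz => by
    simp only [ψ]
    rw [cutoff_eq_one one_pos (by linarith), one_smul, Ring.mul_inverse_cancel _ (hVu z (by
      rw [mem_closedBall_zero_iff]; linarith))]
  obtain ⟨M, hM⟩ := HasCompactSupport.exists_bound_of_continuous (f := fun z => ‖ψ z‖ * ‖V z‖)
    (hψc.norm.mul_right) (hψ.continuous.norm.mul hV.continuous.norm)
  have hM0 : 0 ≤ M := (norm_nonneg _).trans (hM 0)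
  -- With this `κ`, oscillation at most `η` of `a` in the parameter makes the smallness quantity
  -- equal to `η κ = κ / (4 (1 + κ)) < 1/2`.
  let κ := (∫ w, ‖truncKernel 3 w‖) * (M * (1 + ‖(1 : 𝔸)‖))
  have hκ : 0 ≤ κ := mul_nonneg (integral_nonneg fun _ => norm_nonneg _) (by positivity)
  let η := 1 / (4 * (1 + κ))
  have hη : 0 < η := by positivity
  obtain ⟨δ, hδ, hau⟩ := Metric.uniformContinuous_iff.1
    (hac.uniformContinuous_of_continuous ha.continuous) η hη
  have hδ3 : 0 < δ / 3 := by positivity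
  let b : ℂ × ℂ → 𝔸 := fun p => cutoff (δ / 3) (p.1 - x₀) • (ψ p.2 * (a p - a (x₀, p.2)) * V p.2)
  have hb : ContDiff ℝ ∞ b := by
    have hc : ContDiff ℝ ∞ fun p : ℂ × ℂ => cutoff (δ / 3) (p.1 - x₀) :=
      (contDiff_cutoff _).comp (contDiff_fst.sub contDiff_const)
    exact hc.smul (((hψ.comp contDiff_snd).mul (ha.sub (ha₀.comp contDiff_snd))).mul (hV.comp contDiff_snd))
  have hbsupp : ∀ p, b p ≠ 0 → ‖p.1 - x₀‖ < δ ∧ ‖p.2‖ < 3 := by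
    refine fun p hp => ⟨?_, ?_⟩
    · by_contra h
      refine hp ?_
      simp only [b]; rw [cutoff_eq_zero hδ3 (by linarith), zero_smul]
    · by_contra h
      refine hp ?_
      simp only [b]; rw [hψ0 _ (not_lt.1 h), zero_mul, zero_mul, smul_zero]
  have hbc : HasCompactSupport b := HasCompactSupport.intro
    ((isCompact_closedBall x₀ δ).prod (isCompact_closedBall (0 : ℂ) 3)) fun p hp => by
      by_contra h
      obtain ⟨h1, h2⟩ := hbsupp p h
      exact hp ⟨by rw [Metric.mem_closedBall, dist_eq_norm]; exact h1.le,
        by rw [mem_closedBall_zero_iff]; exact h2.le⟩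
  have hbC : ∀ p, ‖b p‖ ≤ M * η := by
    intro p
    by_cases hp : b p = 0
    · rw [hp, norm_zero]; positivity
    have h1 : ‖a p - a (x₀, p.2)‖ ≤ η := by
      rw [← dist_eq_norm]
      refine (hau ?_).le
      have := (hbsupp p hp).1
      rw [← dist_eq_norm] at this
      rw [Prod.dist_eq, dist_self]
      exact max_lt this hδ
    calc ‖b p‖ ≤ ‖ψ p.2 * (a p - a (x₀, p.2)) * V p.2‖ := by
          rw [norm_smul, Real.norm_of_nonneg (cutoff_nonneg _ _)]
          exact mul_le_of_le_one_left (norm_nonneg _) (cutoff_le_one _ _)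
      _ ≤ ‖ψ p.2‖ * ‖a p - a (x₀, p.2)‖ * ‖V p.2‖ :=
          (norm_mul_le _ _).trans (by gcongr; exact norm_mul_le _ _)
      _ = (‖ψ p.2‖ * ‖V p.2‖) * ‖a p - a (x₀, p.2)‖ := by ring
      _ ≤ M * η := by
          have := hM p.2
          rw [Real.norm_of_nonneg (by positivity)] at this
          gcongr
  obtain ⟨φ, hφ, hφu, hφe⟩ := exists_small_gauge (.inr ℝ ℂ ℂ) (.snd ℝ ℂ ℂ) (fun w => rfl) hb hbc
    (ε := 3) (z₀ := 0) (by norm_num) (fun p hp => by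
      rw [sub_zero]; exact (hbsupp p hp).2) (by positivity) hbC (by
      have h1 : (∫ w, ‖truncKernel 3 w‖) * (M * η * (1 + ‖(1 : 𝔸)‖)) = η * κ := by
        simp only [κ]; ring
      rw [h1]
      simp only [η]
      rw [div_mul_eq_mul_div, div_lt_div_iff₀ (by positivity) (by norm_num)]
      linarith)
  refine ⟨2 * (δ / 3), by positivity, fun p => V p.2 * φ p, ?_, fun x hx w hw => ?_, fun x hx w hw => ?_⟩
  · exact ((hV.comp contDiff_snd).mul hφ).contDiffOn
  · rw [mem_ball_zero_iff] at hw
    exact (hVu w (by rw [mem_closedBall_zero_iff]; linarith)).mul (hφu _)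
  · rw [mem_ball_zero_iff] at hw
    rw [mem_ball_iff_norm] at hx
    have h1 := hφe (x, w) (by rw [sub_zero]; exact hw.trans (by norm_num))
    have h2 := dbar_slice (.inr ℝ ℂ ℂ) (f := φ) (p := (x, 0)) (z := w)
      (hφ.differentiable (by simp) _)
    simp only [ContinuousLinearMap.inr_apply, Prod.mk_add_mk, add_zero, zero_add] at h2
    rw [← h2] at h1
    have hφd : DifferentiableAt ℝ (fun z => φ (x, z)) w :=
      (hφ.comp (contDiff_const.prodMk contDiff_id)).differentiable (by simp) w
    have h3 : V w * b (x, w) = (a (x, w) - a (x₀, w)) * V w := by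
      simp only [b]
      rw [cutoff_eq_one hδ3 hx.le, one_smul, ← mul_assoc, ← mul_assoc, hVψ w hw, one_mul]
    rw [dbar_mul (hV.differentiable (by simp) w) hφd, eq_neg_of_add_eq_zero_left (hVe w),
      eq_neg_of_add_eq_zero_left h1, mul_neg, ← mul_assoc, h3]
    noncomm_ring

/-- Frames with parameter in a rectangle. -/
theorem exists_isFrame (Φ : 𝔸 ≃ₐ[ℂ] Matrix (Fin n) (Fin n) ℂ) {a : ℂ × ℂ → 𝔸} (ha : ContDiff ℝ ∞ a) (hac : HasCompactSupport a)
    (A B : ℝ) : ∃ φ, IsFrame a {x | x.re ∈ Ioo A B ∧ x.im ∈ Ioo A B} φ := by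
  refine exists_of_local_of_glue (Q := fun p q => ∃ φ, IsFrame a {x | x.re ∈ Ioo p q ∧ x.im ∈ Ioo A B} φ)
    (fun t => ?_) ?_ ?_ A B
  -- For a fixed real part the imaginary parts are covered first. The width `δ` in the real
  -- direction may shrink at each gluing and is therefore quantified inside; the second induction
  -- then runs over the real part.
  · have key : ∃ δ > 0, ∃ φ, IsFrame a {x | x.im ∈ Ioo A B ∧ x.re ∈ Ioo (t - δ) (t + δ)} φ := by
      refine exists_of_local_of_glue
        (Q := fun p q => ∃ δ > 0, ∃ φ, IsFrame a {x | x.im ∈ Ioo p q ∧ x.re ∈ Ioo (t - δ) (t + δ)} φ)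
        (fun s => ?_) ?_ ?_ A B
      · obtain ⟨δ, hδ, φ, hφ⟩ := exists_isFrame_local Φ ha hac ⟨t, s⟩
        refine ⟨δ / 2, by positivity, δ / 2, by positivity, φ, hφ.mono fun x hx => ?_⟩
        rw [mem_ball_iff_norm]
        refine (Complex.norm_le_abs_re_add_abs_im _).trans_lt ?_
        have h1 : |(x - ⟨t, s⟩ : ℂ).re| < δ / 2 := by
          rw [Complex.sub_re, abs_lt]; constructor <;> linarith [hx.2.1, hx.2.2]
        have h2 : |(x - ⟨t, s⟩ : ℂ).im| < δ / 2 := by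
          rw [Complex.sub_im, abs_lt]; constructor <;> linarith [hx.1.1, hx.1.2]
        linarith
      · rintro p q p' q' ⟨δ, hδ, φ, hφ⟩ hp hq
        exact ⟨δ, hδ, φ, hφ.mono fun x hx => ⟨⟨hp.trans_lt hx.1.1, hx.1.2.trans_le hq⟩, hx.2⟩⟩
      · rintro p q r s hrq ⟨δ₁, hδ₁, φ₁, h₁⟩ ⟨δ₂, hδ₂, φ₂, h₂⟩
        have hm := lt_min hδ₁ hδ₂
        obtain ⟨φ, hφ⟩ := IsFrame.glue (L := imCLM) (N := reCLM) (e := I) (by simp) (by simp)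
          (J := Ioo (t - min δ₁ δ₂) (t + min δ₁ δ₂)) isOpen_Ioo hrq
          (h₁.mono fun x hx => ⟨hx.1, (show t - min δ₁ δ₂ < x.re from hx.2.1).trans_le' (by linarith [min_le_left δ₁ δ₂]),
            (show x.re < t + min δ₁ δ₂ from hx.2.2).trans_le (by linarith [min_le_left δ₁ δ₂])⟩)
          (h₂.mono fun x hx => ⟨hx.1, (show t - min δ₁ δ₂ < x.re from hx.2.1).trans_le' (by linarith [min_le_right δ₁ δ₂]),
            (show x.re < t + min δ₁ δ₂ from hx.2.2).trans_le (by linarith [min_le_right δ₁ δ₂])⟩)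
        exact ⟨min δ₁ δ₂, hm, φ, hφ⟩
    obtain ⟨δ, hδ, φ, hφ⟩ := key
    exact ⟨δ, hδ, φ, hφ.mono fun x hx => ⟨hx.2, hx.1⟩⟩
  · rintro p q p' q' ⟨φ, hφ⟩ hp hq
    exact ⟨φ, hφ.mono fun x hx => ⟨⟨hp.trans_lt hx.1.1, hx.1.2.trans_le hq⟩, hx.2⟩⟩
  · rintro p q r s hrq ⟨φ₁, h₁⟩ ⟨φ₂, h₂⟩
    exact IsFrame.glue (L := reCLM) (N := imCLM) (e := 1) (by simp) (by simp) isOpen_Ioo hrq h₁ h₂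

end Families

end Twistor

end

/-! ### Weights for smooth reflection. -/

noncomputable section

namespace Twistor

attribute [-instance] instNormedAddCommGroupOfRiemannianBundleOfIsTopologicalAddGroupOfContinuousConstSMulReal
  instInnerProductSpaceReal

open MeasureTheory Complex Set BoundedContinuousFunction

section ReflectionWeights

/-- Unnormalised weights of the reflection `y ↦ -9ᵏ y`. -/
def preWeight (k : ℤ) : ℝ := (-1) ^ k * 3 ^ (-(k * (k - 1))) / (1 + 9 ^ k)

lemma abs_preWeight (k : ℤ) : |preWeight k| = 3 ^ (-(k * (k - 1))) / (1 + 9 ^ k) := by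
  have h1 : (0 : ℝ) < 9 ^ k := by positivity
  rw [preWeight, abs_div, abs_mul, abs_zpow, abs_neg, abs_one, one_zpow, one_mul,
    abs_of_pos (by positivity), abs_of_pos (by positivity)]

lemma nine_zpow (k : ℤ) : (9 : ℝ) ^ k = 3 ^ (2 * k) := by
  rw [zpow_mul]; norm_num

lemma summable_three_zpow : Summable fun k : ℤ => (3 : ℝ) ^ (-|k|) := by
  have h : Summable fun n : ℕ => (3 : ℝ) ^ (-|(n : ℤ)|) := by
    refine (summable_geometric_of_lt_one (r := (1 / 3 : ℝ)) (by norm_num) (by norm_num)).congr fun n => ?_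
    rw [abs_of_nonneg (by positivity), zpow_neg, zpow_natCast, one_div, inv_pow]
  exact Summable.of_nat_of_neg h (by simpa using h)

/-- The quadratic exponent beats every power of `9 ^ k`: completing the square gives `-k (k - 1) + 2
k j ≤ (j + 1)² - |k|`. -/
lemma summable_abs_preWeight_mul (j : ℕ) : Summable fun k : ℤ => |preWeight k| * (9 ^ k) ^ j := by
  refine (summable_three_zpow.mul_left (3 ^ ((j : ℤ) + 1) ^ 2)).of_nonneg_of_le
    (fun k => by positivity) fun k => ?_
  rw [abs_preWeight]
  have h1 : (0 : ℝ) < 9 ^ k := by positivity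
  calc (3 : ℝ) ^ (-(k * (k - 1))) / (1 + 9 ^ k) * (9 ^ k) ^ j
      ≤ 3 ^ (-(k * (k - 1))) * (9 ^ k) ^ j := by
        gcongr; exact div_le_self (by positivity) (by linarith)
    _ = 3 ^ (-(k * (k - 1)) + 2 * k * j) := by
        rw [nine_zpow, ← zpow_natCast, ← zpow_mul, ← zpow_add₀ (by norm_num)]
    _ ≤ 3 ^ (((j : ℤ) + 1) ^ 2 + -|k|) := by
        refine zpow_le_zpow_right₀ (by norm_num) ?_
        have h2 := abs_nonneg k
        have h3 : k ≤ |k| := le_abs_self k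
        have h4 : k * k = |k| * |k| := (abs_mul_abs_self k).symm
        have h5 : k * j ≤ |k| * j := by gcongr
        nlinarith [sq_nonneg (|k| - ((j : ℤ) + 1))]
    _ = _ := by rw [zpow_add₀ (by norm_num)]

lemma summable_preWeight_mul (j : ℕ) : Summable fun k : ℤ => preWeight k * (-9 ^ k) ^ j := by
  refine Summable.of_norm ((summable_abs_preWeight_mul j).congr fun k => ?_)
  have h1 : (0 : ℝ) < 9 ^ k := by positivity
  rw [norm_mul, norm_pow, norm_neg, Real.norm_of_nonneg h1.le, Real.norm_eq_abs]

/-- In the difference of consecutive moments the factor `-9 ^ k - 1` cancels the denominator and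
leaves, up to sign, an alternating theta series. The substitution `k ↦ 2 j + 1 - k` preserves its
exponent and reverses its sign, so it vanishes. -/
lemma tsum_preWeight_mul (j : ℕ) : ∑' k, preWeight k * (-9 ^ k) ^ j = ∑' k, preWeight k := by
  induction j with
  | zero => simp
  | succ j ih =>
    rw [← ih, ← sub_eq_zero, ← (summable_preWeight_mul _).tsum_sub (summable_preWeight_mul _)]
    have hv : ∀ k : ℤ, preWeight k * (-9 ^ k) ^ (j + 1) - preWeight k * (-9 ^ k) ^ j
        = -(-1) ^ j * ((-1) ^ k * 3 ^ (-(k * (k - 1)) + 2 * k * j)) := by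
      intro k
      have h1 : (0 : ℝ) < 9 ^ k := by positivity
      have h2 : ((9 : ℝ) ^ k) ^ j = 3 ^ (2 * k * j) := by rw [nine_zpow, ← zpow_natCast, ← zpow_mul]
      rw [zpow_add₀ (by norm_num), ← h2, preWeight, neg_pow ((9 : ℝ) ^ k), neg_pow ((9 : ℝ) ^ k)]
      field_simp
      ring
    simp only [hv]
    rw [tsum_mul_left]
    let f : ℤ → ℝ := fun k => (-1) ^ k * 3 ^ (-(k * (k - 1)) + 2 * k * j)
    have h1 : ∑' k, f k = - ∑' k, f k := by
      refine ((Equiv.subLeft (2 * (j : ℤ) + 1)).tsum_eq f).symm.trans ?_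
      rw [← tsum_neg]
      refine tsum_congr fun k => ?_
      simp only [f, Equiv.subLeft_apply]
      rw [sub_eq_add_neg, zpow_add₀ (by norm_num), zpow_neg, zpow_add₀ (by norm_num), zpow_mul]
      have h2 : ((-1 : ℝ) ^ k)⁻¹ = (-1) ^ k := by
        rw [← inv_zpow, inv_neg_one]
      have h3 : -((2 * (j : ℤ) + 1 + -k) * (2 * j + 1 + -k - 1)) + 2 * (2 * j + 1 + -k) * j
        = -(k * (k - 1)) + 2 * k * j := by ring
      rw [h2, h3]
      norm_num
    have h2 : ∑' k, f k = 0 := by linarith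
    rw [h2, mul_zero]

/-- The term at `k = 0` is `1/2`, while each of the two tails is at most `1/8` by comparison with a
geometric series. -/
lemma tsum_preWeight_ne_zero : ∑' k, preWeight k ≠ 0 := by
  have hs : Summable preWeight := by simpa using summable_preWeight_mul 0
  have h1 : ∀ n : ℕ, |preWeight ((n : ℤ) + 1)| ≤ 1 / 9 * (1 / 9) ^ n := fun n => by
    rw [abs_preWeight]
    have e : (1 : ℝ) / 9 * (1 / 9) ^ n = 1 / 9 ^ ((n : ℤ) + 1) := by
      rw [zpow_add_one₀ (by norm_num), zpow_natCast, one_div_pow]; field_simp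
    rw [e]
    have h9 : (0 : ℝ) < 9 ^ ((n : ℤ) + 1) := by positivity
    refine div_le_div₀ zero_le_one ?_ h9 (by linarith)
    exact zpow_le_one_of_nonpos₀ (by norm_num) (by nlinarith)
  have h2 : ∀ n : ℕ, |preWeight (-((n : ℤ) + 1))| ≤ 1 / 9 * (1 / 9) ^ n := fun n => by
    rw [abs_preWeight]
    have e : (1 : ℝ) / 9 * (1 / 9) ^ n = 3 ^ (-(2 * ((n : ℤ) + 1))) := by
      rw [zpow_neg, ← nine_zpow, zpow_add_one₀ (by norm_num), zpow_natCast, one_div_pow]; field_simp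
    rw [e]
    have h9 : (0 : ℝ) < 9 ^ (-((n : ℤ) + 1)) := by positivity
    refine (div_le_self (by positivity) (by linarith)).trans ?_
    exact zpow_le_zpow_right₀ (by norm_num) (by nlinarith)
  have hg : HasSum (fun n : ℕ => (1 : ℝ) / 9 * (1 / 9) ^ n) (1 / 8) := by
    have := (hasSum_geometric_of_lt_one (r := (1 / 9 : ℝ)) (by norm_num) (by norm_num)).mul_left (1 / 9)
    norm_num at this ⊢; exact this
  have hb : ∀ g : ℕ → ℝ, (∀ n, |g n| ≤ 1 / 9 * (1 / 9) ^ n) → |∑' n, g n| ≤ 1 / 8 := fun g h =>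
    tsum_of_norm_bounded (f := g) hg h
  have hs1 : Summable fun n : ℕ => preWeight n := hs.comp_injective Nat.cast_injective
  have hs2 : Summable fun n : ℕ => preWeight (-((n : ℤ) + 1)) :=
    hs.comp_injective fun m n h => by simpa using h
  rw [tsum_of_nat_of_neg_add_one hs1 hs2, hs1.tsum_eq_zero_add]
  have h3 := abs_le.1 (hb _ h1)
  have h4 := abs_le.1 (hb _ h2)
  have h0 : preWeight ((0 : ℕ) : ℤ) = 1 / 2 := by norm_num [preWeight]
  push_cast at h3 h4 ⊢
  rw [show preWeight 0 = 1 / 2 by simpa using h0]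
  intro h
  linarith [h3.1, h4.1]

/-- The reflection weights: all moments of `∑ wₖ δ_{-9ᵏ}` are equal to one. -/
def reflWeight (j : ℕ) (k : ℤ) : ℝ := preWeight k * (-9 ^ k) ^ j / ∑' k, preWeight k

lemma hasSum_reflWeight (j : ℕ) : HasSum (reflWeight j) 1 := by
  have h := (summable_preWeight_mul j).hasSum.div_const (∑' k, preWeight k)
  rwa [tsum_preWeight_mul, div_self tsum_preWeight_ne_zero] at h

lemma reflWeight_succ (j : ℕ) (k : ℤ) : reflWeight (j + 1) k = reflWeight j k * -9 ^ k := by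
  rw [reflWeight, reflWeight, pow_succ]; ring

lemma summable_abs_reflWeight (j : ℕ) : Summable fun k => |reflWeight j k| :=
  (hasSum_reflWeight j).summable.abs

end ReflectionWeights

end Twistor

end

/-! ### Smooth extension across a hyperplane by infinitely many reflections. -/

noncomputable section

namespace Twistor

attribute [-instance] instNormedAddCommGroupOfRiemannianBundleOfIsTopologicalAddGroupOfContinuousConstSMulReal
  instInnerProductSpaceReal

open MeasureTheory Complex Set BoundedContinuousFunction

section Reflection

variable {E V : Type} [NormedAddCommGroup E] [NormedSpace ℝ E] [NormedAddCommGroup V]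
  [NormedSpace ℝ V] [CompleteSpace V]

/-- Extension of a function on `y ≤ 0` to all `y` by weighted reflections. -/
def reflExt (j : ℕ) (f : ℝ × E → V) (p : ℝ × E) : V :=
  f (min p.1 0, p.2) + (∑' k, reflWeight j k • f (-9 ^ k * max p.1 0, p.2)) - f (0, p.2)

/-- For nonpositive first coordinate every reflected term equals `f (0, ·)`, and the weights sum to
one. -/
lemma reflExt_of_nonpos (j : ℕ) (f : ℝ × E → V) {p : ℝ × E} (hp : p.1 ≤ 0) :
    reflExt j f p = f p := by
  rw [reflExt, min_eq_left hp, max_eq_right hp]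
  simp only [mul_zero]
  rw [((hasSum_reflWeight j).smul_const (f (0, p.2))).tsum_eq, one_smul, add_sub_cancel_right]

lemma reflExt_of_nonneg (j : ℕ) (f : ℝ × E → V) {p : ℝ × E} (hp : 0 ≤ p.1) :
    reflExt j f p = ∑' k, reflWeight j k • f (-9 ^ k * p.1, p.2) := by
  rw [reflExt, min_eq_right hp, max_eq_left hp, add_sub_cancel_left]

variable [FiniteDimensional ℝ E] {T : Set E}

lemma exists_bound_of_vanish (hT : IsClosed T) {f : ℝ × E → V} (hf : ContinuousOn f (Iic 0 ×ˢ T))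
    (hv : ∀ y < -1, ∀ t ∈ T, f (y, t) = 0) (t₀ : E) :
    ∃ C, 0 ≤ C ∧ ∀ y ≤ 0, ∀ t ∈ T ∩ Metric.closedBall t₀ 1, ‖f (y, t)‖ ≤ C := by
  have hK : IsCompact (Icc (-1 : ℝ) 0 ×ˢ (T ∩ Metric.closedBall t₀ 1)) :=
    isCompact_Icc.prod ((isCompact_closedBall t₀ 1).inter_left hT)
  obtain ⟨C, hC⟩ := hK.exists_bound_of_continuousOn (hf.mono fun p hp => ⟨hp.1.2, hp.2.1⟩)
  refine ⟨max C 0, le_max_right _ _, fun y hy t ht => ?_⟩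
  rcases lt_or_ge y (-1) with h | h
  · rw [hv y h t ht.1, norm_zero]; exact le_max_right _ _
  · exact (hC (y, t) ⟨⟨h, hy⟩, ht⟩).trans (le_max_left _ _)

lemma neg_nine_zpow_mul_nonpos (k : ℤ) {y : ℝ} (hy : 0 ≤ y) : -9 ^ k * y ≤ 0 := by
  have h1 : (0 : ℝ) < 9 ^ k := by positivity
  nlinarith

/-- Writing the extension with `min` and `max` avoids a case distinction at the hyperplane; the
series converges uniformly near each parameter because `f` vanishes below `-1`. -/
lemma continuousOn_reflExt (hT : IsClosed T) {f : ℝ × E → V} (hf : ContinuousOn f (Iic 0 ×ˢ T))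
    (hv : ∀ y < -1, ∀ t ∈ T, f (y, t) = 0) (j : ℕ) :
    ContinuousOn (reflExt j f) (univ ×ˢ T) := by
  rintro ⟨y₀, t₀⟩ ⟨-, ht₀⟩
  obtain ⟨C, hC0, hC⟩ := exists_bound_of_vanish hT hf hv t₀
  let s : Set (ℝ × E) := univ ×ˢ (T ∩ Metric.closedBall t₀ 1)
  have hs : ContinuousOn (reflExt j f) s := by
    refine ContinuousOn.sub (ContinuousOn.add ?_ ?_) ?_
    · exact hf.comp (by fun_prop) fun p hp => ⟨mem_Iic.2 (min_le_right _ _), hp.2.1⟩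
    · refine continuousOn_tsum (u := fun k => |reflWeight j k| * C) (fun k => ?_)
        ((summable_abs_reflWeight j).mul_right C) fun k p hp => ?_
      · exact (hf.comp (by fun_prop) fun p hp =>
          ⟨mem_Iic.2 (neg_nine_zpow_mul_nonpos k (le_max_right _ _)), hp.2.1⟩).const_smul _
      · rw [norm_smul, Real.norm_eq_abs]
        gcongr
        exact hC _ (neg_nine_zpow_mul_nonpos k (le_max_right _ _)) _ hp.2
    · exact hf.comp (by fun_prop) fun p hp => ⟨self_mem_Iic, hp.2.1⟩
  refine (hs (y₀, t₀) ⟨mem_univ _, ht₀, Metric.mem_closedBall_self zero_le_one⟩).mono_of_mem_nhdsWithin ?_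
  have h1 : (univ : Set ℝ) ×ˢ Metric.closedBall t₀ 1 ∈ 𝓝 (y₀, t₀) :=
    prod_mem_nhds Filter.univ_mem (Metric.closedBall_mem_nhds t₀ one_pos)
  filter_upwards [mem_nhdsWithin_of_mem_nhds h1, self_mem_nhdsWithin] with p hp hp'
  exact ⟨mem_univ _, hp'.2, hp.2⟩

variable (T) in
/-- The derivative of `f` in the reflected variable. -/
def derivFst (f : ℝ × E → V) (p : ℝ × E) : V := fderivWithin ℝ f (Iic 0 ×ˢ T) p (1, 0)

variable (T) in
/-- The derivative of `f` in the parameters. -/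
def derivSnd (f : ℝ × E → V) (p : ℝ × E) : E →L[ℝ] V :=
  (fderivWithin ℝ f (Iic 0 ×ˢ T) p).comp (.inr ℝ ℝ E)

/-- A linear map from its restrictions to the two factors. -/
def joinCLM (v : V) (A : E →L[ℝ] V) : ℝ × E →L[ℝ] V :=
  (ContinuousLinearMap.fst ℝ ℝ E).smulRight v + A.comp (.snd ℝ ℝ E)

lemma fderivWithin_eq_joinCLM (f : ℝ × E → V) (p : ℝ × E) :
    fderivWithin ℝ f (Iic 0 ×ˢ T) p = joinCLM (derivFst T f p) (derivSnd T f p) := by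
  refine ContinuousLinearMap.ext fun q => ?_
  have h : q = q.1 • ((1, 0) : ℝ × E) + (0, q.2) := by ext <;> simp
  conv_lhs => rw [h, map_add, map_smul]
  rfl

lemma fderivWithin_eq_zero_of_vanish {f : ℝ × E → V} (hv : ∀ y < -1, ∀ t ∈ T, f (y, t) = 0)
    {y : ℝ} (hy : y < -1) {t : E} (ht : t ∈ T) : fderivWithin ℝ f (Iic 0 ×ˢ T) (y, t) = 0 := by
  have h : f =ᶠ[𝓝[Iic 0 ×ˢ T] (y, t)] fun _ => 0 := by
    have h1 : Iio (-1 : ℝ) ×ˢ (univ : Set E) ∈ 𝓝 (y, t) := prod_mem_nhds (Iio_mem_nhds hy) Filter.univ_mem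
    filter_upwards [mem_nhdsWithin_of_mem_nhds h1, self_mem_nhdsWithin] with p hp hp'
    exact hv p.1 hp.1 p.2 hp'.2
  rw [h.fderivWithin_eq (hv y hy t ht), fderivWithin_const_apply]

lemma norm_joinCLM_le (v : V) (A : E →L[ℝ] V) : ‖joinCLM v A‖ ≤ ‖v‖ + ‖A‖ := by
  refine ContinuousLinearMap.opNorm_le_bound _ (by positivity) fun q => ?_
  have h : joinCLM v A q = q.1 • v + A q.2 := rfl
  rw [h, add_mul]
  refine (norm_add_le _ _).trans (add_le_add ?_ ?_)
  · rw [norm_smul, mul_comm]; gcongr; exact norm_fst_le q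
  · exact (A.le_opNorm _).trans (by gcongr; exact norm_snd_le q)

/-- `joinCLM` as a linear map. -/
def joinL : V × (E →L[ℝ] V) →L[ℝ] (ℝ × E →L[ℝ] V) :=
  LinearMap.mkContinuous
    { toFun := fun q => joinCLM q.1 q.2
      map_add' := fun p q => by ext r <;> simp [joinCLM]
      map_smul' := fun c q => by ext r <;> simp [joinCLM] } 2 fun q => by
    refine (norm_joinCLM_le q.1 q.2).trans ?_
    linarith [norm_fst_le q, norm_snd_le q]

lemma joinL_apply (v : V) (A : E →L[ℝ] V) : joinL (v, A) = joinCLM v A := rfl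

section

variable {f : ℝ × E → V}

lemma uniqueDiffOn_Iic_prod (hTc : Convex ℝ T) (hTi : (interior T).Nonempty) :
    UniqueDiffOn ℝ (Iic (0 : ℝ) ×ˢ T) :=
  (uniqueDiffOn_Iic 0).prod (uniqueDiffOn_convex hTc hTi)

lemma contDiffOn_derivFst (hTc : Convex ℝ T) (hTi : (interior T).Nonempty) {m : ℕ}
    (hf : ContDiffOn ℝ (m + 1) f (Iic 0 ×ˢ T)) : ContDiffOn ℝ m (derivFst T f) (Iic 0 ×ˢ T) :=
  (hf.fderivWithin (uniqueDiffOn_Iic_prod hTc hTi) le_rfl).clm_apply contDiffOn_const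

lemma contDiffOn_derivSnd (hTc : Convex ℝ T) (hTi : (interior T).Nonempty) {m : ℕ}
    (hf : ContDiffOn ℝ (m + 1) f (Iic 0 ×ˢ T)) : ContDiffOn ℝ m (derivSnd T f) (Iic 0 ×ˢ T) :=
  (hf.fderivWithin (uniqueDiffOn_Iic_prod hTc hTi) le_rfl).clm_comp contDiffOn_const

variable (T) in
/-- The derivative of `reflExt j f`. -/
def reflDeriv (j : ℕ) (f : ℝ × E → V) (p : ℝ × E) : ℝ × E →L[ℝ] V :=
  joinL (reflExt (j + 1) (derivFst T f) p, reflExt j (derivSnd T f) p)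

/-- The series is differentiated term by term. The chain-rule factor `-9 ^ k` in the reflected
variable raises the weight index from `j` to `j + 1`; parameter derivatives keep it. -/
lemma hasFDerivAt_reflExt_of_pos (hT : IsClosed T) (hTc : Convex ℝ T) (hTi : (interior T).Nonempty)
    (hf : ContDiffOn ℝ 1 f (Iic 0 ×ˢ T)) (hv : ∀ y < -1, ∀ t ∈ T, f (y, t) = 0) (j : ℕ)
    {q : ℝ × E} (hq : q ∈ Ioi (0 : ℝ) ×ˢ interior T) :
    HasFDerivAt (reflExt j f) (reflDeriv T j f q) q := by
  have hf1 : ContDiffOn ℝ ((0 : ℕ) + 1) f (Iic 0 ×ˢ T) := by simpa using hf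
  have hv1 : ∀ y < -1, ∀ t ∈ T, derivFst T f (y, t) = 0 := fun y hy t ht => by
    rw [derivFst, fderivWithin_eq_zero_of_vanish hv hy ht]; rfl
  have hv2 : ∀ y < -1, ∀ t ∈ T, derivSnd T f (y, t) = 0 := fun y hy t ht => by
    rw [derivSnd, fderivWithin_eq_zero_of_vanish hv hy ht, ContinuousLinearMap.zero_comp]
  obtain ⟨C, hC0, hC⟩ := exists_bound_of_vanish hT hf.continuousOn hv q.2
  obtain ⟨C₁, hC₁0, hC₁⟩ := exists_bound_of_vanish hT (contDiffOn_derivFst hTc hTi hf1).continuousOn hv1 q.2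
  obtain ⟨C₂, hC₂0, hC₂⟩ := exists_bound_of_vanish hT (contDiffOn_derivSnd hTc hTi hf1).continuousOn hv2 q.2
  let s : Set (ℝ × E) := Ioi 0 ×ˢ (interior T ∩ Metric.ball q.2 1)
  have hso : IsOpen s := isOpen_Ioi.prod (isOpen_interior.inter Metric.isOpen_ball)
  have hsc : Convex ℝ s := (convex_Ioi 0).prod (hTc.interior.inter (convex_ball _ _))
  have hqs : q ∈ s := ⟨hq.1, hq.2, Metric.mem_ball_self one_pos⟩
  have hsT : ∀ x ∈ s, x.2 ∈ T ∩ Metric.closedBall q.2 1 := fun x hx =>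
    ⟨interior_subset hx.2.1, Metric.ball_subset_closedBall hx.2.2⟩
  have hneg : ∀ k : ℤ, ∀ x ∈ s, -9 ^ k * x.1 < 0 := fun k x hx => by
    have h1 : (0 : ℝ) < 9 ^ k := by positivity
    have h2 : 0 < x.1 := hx.1
    nlinarith
  have hsum : ∀ x ∈ s, Summable fun k => reflWeight j k • f (-9 ^ k * x.1, x.2) := fun x hx =>
    Summable.of_norm_bounded ((summable_abs_reflWeight j).mul_right C) fun k => by
      rw [norm_smul, Real.norm_eq_abs]
      gcongr
      exact hC _ (hneg k x hx).le _ (hsT x hx)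
  have hsum1 : Summable fun k => reflWeight (j + 1) k • derivFst T f (-9 ^ k * q.1, q.2) :=
    Summable.of_norm_bounded ((summable_abs_reflWeight (j + 1)).mul_right C₁) fun k => by
      rw [norm_smul, Real.norm_eq_abs]
      gcongr
      exact hC₁ _ (hneg k q hqs).le _ (hsT q hqs)
  have hsum2 : Summable fun k => reflWeight j k • derivSnd T f (-9 ^ k * q.1, q.2) :=
    Summable.of_norm_bounded ((summable_abs_reflWeight j).mul_right C₂) fun k => by
      rw [norm_smul, Real.norm_eq_abs]
      gcongr
      exact hC₂ _ (hneg k q hqs).le _ (hsT q hqs)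
  have key := hasFDerivAt_tsum_of_isPreconnected
    (f := fun k (x : ℝ × E) => reflWeight j k • f (-9 ^ k * x.1, x.2))
    (f' := fun k x => joinL (reflWeight (j + 1) k • derivFst T f (-9 ^ k * x.1, x.2),
      reflWeight j k • derivSnd T f (-9 ^ k * x.1, x.2)))
    (u := fun k => |reflWeight (j + 1) k| * C₁ + |reflWeight j k| * C₂)
    (((summable_abs_reflWeight (j + 1)).mul_right C₁).add ((summable_abs_reflWeight j).mul_right C₂))
    hso hsc.isPreconnected (fun k x hx => ?_) (fun k x hx => ?_) hqs (hsum q hqs) hqs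
  · have h2 : HasSum (fun k => joinL (reflWeight (j + 1) k • derivFst T f (-9 ^ k * q.1, q.2),
        reflWeight j k • derivSnd T f (-9 ^ k * q.1, q.2))) (reflDeriv T j f q) := by
      refine ContinuousLinearMap.hasSum (joinL (E := E) (V := V)) (HasSum.prodMk ?_ ?_)
      · rw [reflExt_of_nonneg _ _ (le_of_lt hq.1)]; exact hsum1.hasSum
      · rw [reflExt_of_nonneg _ _ (le_of_lt hq.1)]; exact hsum2.hasSum
    rw [h2.tsum_eq] at key
    refine key.congr_of_eventuallyEq ?_
    filter_upwards [hso.mem_nhds hqs] with x hx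
    exact reflExt_of_nonneg _ _ (le_of_lt hx.1)
  · have hmem : Iic (0 : ℝ) ×ˢ T ∈ 𝓝 (-9 ^ k * x.1, x.2) :=
      prod_mem_nhds (Iic_mem_nhds (hneg k x hx)) (mem_interior_iff_mem_nhds.1 hx.2.1)
    have h1 : HasFDerivAt f (fderivWithin ℝ f (Iic 0 ×ˢ T) (-9 ^ k * x.1, x.2)) (-9 ^ k * x.1, x.2) :=
      ((hf.differentiableOn one_ne_zero _ (mem_of_mem_nhds hmem)).hasFDerivWithinAt).hasFDerivAt hmem
    have h2 : HasFDerivAt (fun x : ℝ × E => (-9 ^ k * x.1, x.2))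
        (((-9 ^ k : ℝ) • ContinuousLinearMap.fst ℝ ℝ E).prod (.snd ℝ ℝ E)) x :=
      (hasFDerivAt_fst.const_mul _).prodMk hasFDerivAt_snd
    have h3 := (HasFDerivAt.comp x h1 h2).const_smul (reflWeight j k)
    convert! h3 using 1
    rw [fderivWithin_eq_joinCLM, joinL_apply]
    refine ContinuousLinearMap.ext fun z => ?_
    simp only [joinCLM, _root_.add_apply, ContinuousLinearMap.smulRight_apply,
      ContinuousLinearMap.comp_apply, ContinuousLinearMap.coe_fst', ContinuousLinearMap.coe_snd',
      _root_.smul_apply, ContinuousLinearMap.prod_apply, smul_add, smul_eq_mul, reflWeight_succ, smul_smul]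
    congr 2
    ring
  · rw [joinL_apply]
    refine (norm_joinCLM_le _ _).trans ?_
    rw [norm_smul, norm_smul, Real.norm_eq_abs, Real.norm_eq_abs]
    gcongr
    · exact hC₁ _ (hneg k x hx).le _ (hsT x hx)
    · exact hC₂ _ (hneg k x hx).le _ (hsT x hx)

lemma continuousOn_reflDeriv (hT : IsClosed T) (hTc : Convex ℝ T) (hTi : (interior T).Nonempty)
    (hf : ContDiffOn ℝ 1 f (Iic 0 ×ˢ T)) (hv : ∀ y < -1, ∀ t ∈ T, f (y, t) = 0) (j : ℕ) :
    ContinuousOn (reflDeriv T j f) (univ ×ˢ T) := by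
  have hf1 : ContDiffOn ℝ ((0 : ℕ) + 1) f (Iic 0 ×ˢ T) := by simpa using hf
  refine joinL.continuous.comp_continuousOn (ContinuousOn.prodMk
    (continuousOn_reflExt hT (contDiffOn_derivFst hTc hTi hf1).continuousOn (fun y hy t ht => ?_) _)
    (continuousOn_reflExt hT (contDiffOn_derivSnd hTc hTi hf1).continuousOn (fun y hy t ht => ?_) _))
  · rw [derivFst, fderivWithin_eq_zero_of_vanish hv hy ht]; rfl
  · rw [derivSnd, fderivWithin_eq_zero_of_vanish hv hy ht, ContinuousLinearMap.zero_comp]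

/-- On the positive side the derivative exists in the interior and extends continuously to the
closure, hence exists there as well. On the hyperplane it agrees with the derivative from the
negative side because the moments of all orders equal one. -/
lemma hasFDerivWithinAt_reflExt (hT : IsClosed T) (hTc : Convex ℝ T) (hTi : (interior T).Nonempty)
    (hf : ContDiffOn ℝ 1 f (Iic 0 ×ˢ T)) (hv : ∀ y < -1, ∀ t ∈ T, f (y, t) = 0) (j : ℕ)
    {p : ℝ × E} (hp : p ∈ (univ : Set ℝ) ×ˢ T) :
    HasFDerivWithinAt (reflExt j f) (reflDeriv T j f p) (univ ×ˢ T) p := by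
  have hcl : closure (Ioi (0 : ℝ) ×ˢ interior T) = Ici 0 ×ˢ T := by
    rw [closure_prod_eq, closure_Ioi, hTc.closure_interior_eq_closure_of_nonempty_interior hTi,
      hT.closure_eq]
  have hcont := continuousOn_reflExt hT hf.continuousOn hv j
  have hderiv := fun q hq => hasFDerivAt_reflExt_of_pos hT hTc hTi hf hv j (q := q) hq
  have h1 : HasFDerivWithinAt (reflExt j f) (reflDeriv T j f p) (Ici 0 ×ˢ T) p := by
    rcases lt_or_ge p.1 0 with h | h
    · exact HasFDerivWithinAt.of_notMem_closure fun hc => by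
        rw [(isClosed_Ici.prod hT).closure_eq] at hc
        exact absurd hc.1 (not_le.2 h)
    rw [← hcl]
    refine hasFDerivWithinAt_closure_of_tendsto_fderiv
      (fun q hq => (hderiv q hq).differentiableAt.differentiableWithinAt)
      ((convex_Ioi 0).prod hTc.interior) (isOpen_Ioi.prod isOpen_interior) (fun y hy => ?_) ?_
    · rw [hcl] at hy
      exact (hcont y ⟨mem_univ _, hy.2⟩).mono (prod_mono (subset_univ _) interior_subset)
    · refine ((continuousOn_reflDeriv hT hTc hTi hf hv j p hp).mono
        (prod_mono (subset_univ _) interior_subset)).tendsto.congr' ?_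
      filter_upwards [self_mem_nhdsWithin] with q hq
      exact (hderiv q hq).fderiv.symm
  have h2 : HasFDerivWithinAt (reflExt j f) (reflDeriv T j f p) (Iic 0 ×ˢ T) p := by
    rcases lt_or_ge 0 p.1 with h | h
    · exact HasFDerivWithinAt.of_notMem_closure fun hc => by
        rw [(isClosed_Iic.prod hT).closure_eq] at hc
        exact absurd hc.1 (not_le.2 h)
    -- On the negative side the weight indices `j` and `j + 1` play no role, and the two pieces
    -- reassemble the derivative of `f`.
    have h3 : reflDeriv T j f p = fderivWithin ℝ f (Iic 0 ×ˢ T) p := by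
      rw [reflDeriv, reflExt_of_nonpos _ _ h, reflExt_of_nonpos _ _ h, joinL_apply,
        ← fderivWithin_eq_joinCLM]
    rw [h3]
    exact ((hf.differentiableOn one_ne_zero _ ⟨h, hp.2⟩).hasFDerivWithinAt).congr
      (fun q hq => reflExt_of_nonpos _ _ hq.1) (reflExt_of_nonpos _ _ h)
  have h3 := h2.union h1
  rwa [← union_prod, Iic_union_Ici] at h3

end

/-- The derivative consists again of extensions of the same type, with another target space and
weight index. Induction therefore quantifies over `V` and `j`. -/
lemma contDiffOn_reflExt_nat (hT : IsClosed T) (hTc : Convex ℝ T) (hTi : (interior T).Nonempty)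
    (m : ℕ) : ∀ {V : Type} [NormedAddCommGroup V] [NormedSpace ℝ V] [CompleteSpace V] {f : ℝ × E → V},
      ContDiffOn ℝ m f (Iic 0 ×ˢ T) → (∀ y < -1, ∀ t ∈ T, f (y, t) = 0) → ∀ j : ℕ,
      ContDiffOn ℝ m (reflExt j f) (univ ×ˢ T) := by
  induction m with
  | zero =>
    intro V _ _ _ f hf hv j
    exact contDiffOn_zero.2 (continuousOn_reflExt hT hf.continuousOn hv j)
  | succ m ih =>
    intro V _ _ _ f hf hv j
    have hu : UniqueDiffOn ℝ ((univ : Set ℝ) ×ˢ T) :=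
      uniqueDiffOn_univ.prod (uniqueDiffOn_convex hTc hTi)
    rw [Nat.cast_succ] at hf ⊢
    refine (contDiffOn_succ_iff_hasFDerivWithinAt_of_uniqueDiffOn hu).2
      ⟨by simp, reflDeriv T j f, ?_, fun p hp =>
        hasFDerivWithinAt_reflExt hT hTc hTi (hf.of_le (by simp)) hv j hp⟩
    refine joinL.contDiff.comp_contDiffOn (ContDiffOn.prodMk
      (ih (contDiffOn_derivFst hTc hTi hf) (fun y hy t ht => ?_) _)
      (ih (contDiffOn_derivSnd hTc hTi hf) (fun y hy t ht => ?_) _))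
    · rw [derivFst, fderivWithin_eq_zero_of_vanish hv hy ht]; rfl
    · rw [derivSnd, fderivWithin_eq_zero_of_vanish hv hy ht, ContinuousLinearMap.zero_comp]

theorem contDiffOn_reflExt (hT : IsClosed T) (hTc : Convex ℝ T) (hTi : (interior T).Nonempty)
    {f : ℝ × E → V} (hf : ContDiffOn ℝ ∞ f (Iic 0 ×ˢ T)) (hv : ∀ y < -1, ∀ t ∈ T, f (y, t) = 0)
    (j : ℕ) : ContDiffOn ℝ ∞ (reflExt j f) (univ ×ˢ T) :=
  contDiffOn_infty.2 fun m => contDiffOn_reflExt_nat hT hTc hTi m (contDiffOn_infty.1 hf m) hv j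

end Reflection

end Twistor

end

/-! ### Extension from the closed disc and bidisc, and matrix frames over the bidisc. -/

noncomputable section

namespace Twistor

attribute [-instance] instNormedAddCommGroupOfRiemannianBundleOfIsTopologicalAddGroupOfContinuousConstSMulReal
  instInnerProductSpaceReal

open MeasureTheory Complex Set BoundedContinuousFunction

section DiscExtension

variable {E V : Type} [NormedAddCommGroup E] [NormedSpace ℝ E] [NormedAddCommGroup V]
  [NormedSpace ℝ V] [CompleteSpace V] [FiniteDimensional ℝ E] {S : Set E}

lemma reflExt_periodic {g : ℝ × (ℝ × E) → V} {c : ℝ}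
    (hg : ∀ y θ t, g (y, (θ + c, t)) = g (y, (θ, t))) (j : ℕ) (y θ : ℝ) (t : E) :
    reflExt j g (y, (θ + c, t)) = reflExt j g (y, (θ, t)) := by
  simp only [reflExt, hg]

/-- The function on `ℂ` which is `G(y, θ)` at `exp (y + iθ)`. -/
def polarDescent (G : ℝ × (ℝ × E) → V) (q : ℂ × E) : V :=
  open Classical in if q.1 = 0 then 0 else G ((log q.1).re, ((log q.1).im, q.2))

lemma polarDescent_exp {G : ℝ × (ℝ × E) → V}
    (hG : ∀ (n : ℤ) y θ t, G (y, (θ + n * (2 * Real.pi), t)) = G (y, (θ, t))) (z : ℂ) (t : E) :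
    polarDescent G (exp z, t) = G (z.re, (z.im, t)) := by
  rw [polarDescent, if_neg (exp_ne_zero z)]
  obtain ⟨n, hn⟩ := Complex.exp_eq_exp_iff_exists_int.1 (exp_log (exp_ne_zero z))
  have h1 : (log (exp z)).re = z.re := by rw [hn]; simp
  have h2 : (log (exp z)).im = z.im + n * (2 * Real.pi) := by rw [hn]; simp
  rw [h1, h2, hG]

/-- Near a nonzero point a local branch of the logarithm gives smoothness, periodicity making the
branch irrelevant. Near the origin the function is zero, because `G` vanishes for `y < -1`. -/
lemma contDiffOn_polarDescent {G : ℝ × (ℝ × E) → V}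
    (hG : ∀ (n : ℤ) y θ t, G (y, (θ + n * (2 * Real.pi), t)) = G (y, (θ, t)))
    (hGs : ContDiffOn ℝ ∞ G (univ ×ˢ (univ ×ˢ S)))
    (hv : ∀ y < -1, ∀ θ, ∀ t ∈ S, G (y, (θ, t)) = 0) :
    ContDiffOn ℝ ∞ (polarDescent G) (univ ×ˢ S) := by
  rintro ⟨z₀, t₀⟩ ⟨-, ht₀⟩
  by_cases hz : z₀ = 0
  · subst hz
    refine (contDiffWithinAt_const (c := (0 : V))).congr_of_eventuallyEq ?_ (if_pos rfl)
    have h1 : Metric.ball (0 : ℂ) (Real.exp (-1)) ×ˢ (univ : Set E) ∈ 𝓝 ((0 : ℂ), t₀) :=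
      prod_mem_nhds (Metric.ball_mem_nhds _ (Real.exp_pos _)) Filter.univ_mem
    filter_upwards [mem_nhdsWithin_of_mem_nhds h1, self_mem_nhdsWithin] with q hq hq'
    rw [polarDescent]
    split_ifs with h0
    · rfl
    · refine hv _ ?_ _ _ hq'.2
      rw [log_re, Real.log_lt_iff_lt_exp (norm_pos_iff.2 h0)]
      exact mem_ball_zero_iff.1 hq.1
  · let L : ℂ → ℂ := fun z => log (z / z₀) + log z₀
    have hL : ContDiffAt ℝ ∞ L z₀ := by
      have h1 : ContDiffAt ℂ ∞ L z₀ :=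
        (ContDiffAt.comp z₀ (f := fun z => z / z₀) (g := log)
          (contDiffAt_log (by simp [div_self hz])) (contDiffAt_id.div_const z₀)).add contDiffAt_const
      exact h1.restrict_scalars ℝ
    have hexp : ∀ z, z ≠ 0 → exp (L z) = z := fun z h => by
      rw [exp_add, exp_log (div_ne_zero h hz), exp_log hz, div_mul_cancel₀ _ hz]
    have hL2 : ContDiffWithinAt ℝ ∞ (fun q : ℂ × E => L q.1) (univ ×ˢ S) (z₀, t₀) :=
      (ContDiffAt.comp (z₀, t₀) hL contDiffAt_fst).contDiffWithinAt
    have hcomp : ContDiffWithinAt ℝ ∞ (fun q : ℂ × E => G ((L q.1).re, ((L q.1).im, q.2)))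
        (univ ×ˢ S) (z₀, t₀) := by
      refine ContDiffWithinAt.comp (t := univ ×ˢ (univ ×ˢ S)) (z₀, t₀)
        (hGs _ ⟨mem_univ _, mem_univ _, ht₀⟩) ?_ fun q hq => ⟨mem_univ _, mem_univ _, hq.2⟩
      exact (reCLM.contDiff.contDiffAt.comp_contDiffWithinAt _ hL2).prodMk
        ((imCLM.contDiff.contDiffAt.comp_contDiffWithinAt _ hL2).prodMk contDiffWithinAt_snd)
    refine hcomp.congr_of_eventuallyEq_of_mem ?_ ⟨mem_univ _, ht₀⟩
    have h1 : ({0}ᶜ : Set ℂ) ×ˢ (univ : Set E) ∈ 𝓝 (z₀, t₀) :=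
      prod_mem_nhds (isOpen_compl_singleton.mem_nhds hz) Filter.univ_mem
    filter_upwards [mem_nhdsWithin_of_mem_nhds h1] with q hq
    conv_lhs => rw [← Prod.mk.eta (p := q), ← hexp q.1 hq.1]
    exact polarDescent_exp hG _ _

/-- In logarithmic polar coordinates the punctured closed disc becomes the half-plane `y ≤ 0`,
periodic in the angle. The part of `f` near the circle is extended there by reflections, which
respect periodicity; the part near the centre is extended by zero. -/
theorem exists_disc_extension (hS : IsClosed S) (hSc : Convex ℝ S) (hSi : (interior S).Nonempty)
    {f : ℂ × E → V} (hf : ContDiffOn ℝ ∞ f (Metric.closedBall 0 1 ×ˢ S)) :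
    ∃ F : ℂ × E → V, ContDiffOn ℝ ∞ F (univ ×ˢ S) ∧
      ∀ z ∈ Metric.closedBall (0 : ℂ) 1, ∀ t ∈ S, F (z, t) = f (z, t) := by
  have h4 : (0 : ℝ) < 1 / 4 := by norm_num
  let F₁ : ℂ × E → V := fun q => cutoff (1 / 4) q.1 • f q
  have hF₁ : ContDiffOn ℝ ∞ F₁ (univ ×ˢ S) := by
    rintro ⟨z, t⟩ ⟨-, ht⟩
    rcases lt_or_ge ‖z‖ 1 with hz | hz
    · have hc : ContDiff ℝ ∞ fun q : ℂ × E => cutoff (1 / 4) q.1 := (contDiff_cutoff _).comp contDiff_fst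
      refine hc.contDiffAt.contDiffWithinAt.smul ?_
      refine (hf (z, t) ⟨mem_closedBall_zero_iff.2 hz.le, ht⟩).mono_of_mem_nhdsWithin ?_
      have h1 : Metric.ball (0 : ℂ) 1 ×ˢ (univ : Set E) ∈ 𝓝 (z, t) :=
        prod_mem_nhds (Metric.isOpen_ball.mem_nhds (mem_ball_zero_iff.2 hz)) Filter.univ_mem
      filter_upwards [mem_nhdsWithin_of_mem_nhds h1, self_mem_nhdsWithin] with q hq hq'
      exact ⟨Metric.ball_subset_closedBall hq.1, hq'.2⟩
    · refine (contDiffWithinAt_const (c := (0 : V))).congr_of_eventuallyEq_of_mem ?_ ⟨mem_univ _, ht⟩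
      have h1 : (fun q : ℂ × E => ‖q.1‖) ⁻¹' Ioi (3 / 4) ∈ 𝓝 (z, t) :=
        (isOpen_Ioi.preimage (by fun_prop)).mem_nhds (show 3 / 4 < ‖z‖ by linarith)
      filter_upwards [mem_nhdsWithin_of_mem_nhds h1] with q hq
      simp only [F₁]
      rw [cutoff_eq_zero h4 (by have : 3 / 4 < ‖q.1‖ := hq; linarith), zero_smul]
  let e : ℝ × (ℝ × E) → ℂ := fun p => exp (p.1 + p.2.1 * I)
  have hnorm : ∀ p, ‖e p‖ = Real.exp p.1 := fun p => by simp [e, Complex.norm_exp]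
  have he : ContDiff ℝ ∞ e := by
    refine ContDiff.cexp ?_
    exact (ofRealCLM.contDiff.comp contDiff_fst).add
      ((ofRealCLM.contDiff.comp (contDiff_fst.comp contDiff_snd)).mul contDiff_const)
  let g : ℝ × (ℝ × E) → V := fun p => (1 - cutoff (1 / 4) (e p)) • f (e p, p.2.2)
  have hg : ContDiffOn ℝ ∞ g (Iic 0 ×ˢ ((univ : Set ℝ) ×ˢ S)) := by
    refine ((contDiff_const.sub ((contDiff_cutoff _).comp he)).contDiffOn).smul
      (hf.comp (he.prodMk (contDiff_snd.comp contDiff_snd)).contDiffOn fun p hp => ⟨?_, hp.2.2⟩)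
    rw [mem_closedBall_zero_iff, hnorm]
    exact Real.exp_le_one_iff.2 hp.1
  -- The cutoff at scale `1/4` equals one up to radius `1/2`, and `e^{-1} ≤ 1/2`.
  have hgv : ∀ y < -1, ∀ t ∈ (univ : Set ℝ) ×ˢ S, g (y, t) = 0 := fun y hy t _ => by
    have h1 : ‖e (y, t)‖ ≤ 2 * (1 / 4) := by
      rw [hnorm]
      have h2 : Real.exp y ≤ Real.exp (-1) := Real.exp_le_exp.2 (le_of_lt hy)
      have h3 : Real.exp (-1) * Real.exp 1 = 1 := by rw [← Real.exp_add]; simp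
      nlinarith [Real.add_one_le_exp (1 : ℝ), Real.exp_pos (-1)]
    simp only [g]
    rw [cutoff_eq_one h4 h1, sub_self, zero_smul]
  have hper : ∀ (n : ℤ) y θ t, g (y, (θ + n * (2 * Real.pi), t)) = g (y, (θ, t)) := fun n y θ t => by
    have h1 : e (y, (θ + n * (2 * Real.pi), t)) = e (y, (θ, t)) :=
      Complex.exp_eq_exp_iff_exists_int.2 ⟨n, by push_cast; ring⟩
    simp only [g, h1]
  have hTi : (interior ((univ : Set ℝ) ×ˢ S)).Nonempty := by
    rw [interior_prod_eq, interior_univ]; exact univ_nonempty.prod hSi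
  have hG := contDiffOn_reflExt (isClosed_univ.prod hS) (convex_univ.prod hSc) hTi hg hgv 0
  have hGper : ∀ (n : ℤ) y θ t, reflExt 0 g (y, (θ + n * (2 * Real.pi), t)) = reflExt 0 g (y, (θ, t)) :=
    fun n y θ t => reflExt_periodic (hper n) 0 y θ t
  have hF₂ := contDiffOn_polarDescent hGper hG fun y hy θ t ht => by
    rw [reflExt_of_nonpos _ _ (show y ≤ 0 by linarith)]; exact hgv y hy (θ, t) ⟨mem_univ _, ht⟩
  refine ⟨fun q => F₁ q + polarDescent (reflExt 0 g) q, hF₁.add hF₂, fun z hz t ht => ?_⟩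
  have h1 : polarDescent (reflExt 0 g) (z, t) = (1 - cutoff (1 / 4) z) • f (z, t) := by
    by_cases h0 : z = 0
    · rw [polarDescent, if_pos h0, h0, cutoff_eq_one h4 (by simp), sub_self, zero_smul]
    · have h2 : (log z).re ≤ 0 := by
        rw [log_re]; exact Real.log_nonpos (norm_nonneg _) (mem_closedBall_zero_iff.1 hz)
      rw [polarDescent, if_neg h0, reflExt_of_nonpos _ _ h2]
      have h3 : e ((log z).re, ((log z).im, t)) = z := by
        simp only [e]; rw [re_add_im, exp_log h0]
      simp only [g, h3]
  beta_reduce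
  rw [h1]
  simp only [F₁]
  rw [← add_smul, add_sub_cancel, one_smul]

/-- The extension is carried out in one variable at a time, the other serving as parameter; allowing
a closed disc and the whole plane as parameter sets is what makes this possible. -/
theorem exists_bidisc_extension {f : ℂ × ℂ → V}
    (hf : ContDiffOn ℝ ∞ f (Metric.closedBall 0 1 ×ˢ Metric.closedBall 0 1)) :
    ∃ F : ℂ × ℂ → V, ContDiff ℝ ∞ F ∧ HasCompactSupport F ∧
      ∀ z ∈ Metric.closedBall (0 : ℂ) 1, ∀ w ∈ Metric.closedBall (0 : ℂ) 1, F (z, w) = f (z, w) := by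
  have hDi : (interior (Metric.closedBall (0 : ℂ) 1)).Nonempty := by
    rw [interior_closedBall _ one_ne_zero]; exact ⟨0, Metric.mem_ball_self one_pos⟩
  obtain ⟨F₁, hF₁, h₁⟩ := exists_disc_extension Metric.isClosed_closedBall (convex_closedBall (0 : ℂ) 1) hDi
    (f := fun q => f (q.2, q.1)) (hf.comp (contDiff_snd.prodMk contDiff_fst).contDiffOn
      fun q hq => ⟨hq.2, hq.1⟩)
  obtain ⟨F₂, hF₂, h₂⟩ := exists_disc_extension isClosed_univ convex_univ (by simp)
    (f := fun q => F₁ (q.2, q.1)) (hF₁.comp (contDiff_snd.prodMk contDiff_fst).contDiffOn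
      fun q hq => ⟨hq.2, hq.1⟩)
  rw [univ_prod_univ, contDiffOn_univ] at hF₂
  have hc1 : ContDiff ℝ ∞ fun q : ℂ × ℂ => cutoff 1 q.1 := (contDiff_cutoff _).comp contDiff_fst
  have hc2 : ContDiff ℝ ∞ fun q : ℂ × ℂ => cutoff 1 q.2 := (contDiff_cutoff _).comp contDiff_snd
  refine ⟨fun q => (cutoff 1 q.1 * cutoff 1 q.2) • F₂ q, (hc1.mul hc2).smul hF₂,
    HasCompactSupport.intro ((isCompact_closedBall (0 : ℂ) 3).prod (isCompact_closedBall (0 : ℂ) 3))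
      fun q hq => ?_, fun z hz w hw => ?_⟩
  · have h3 : 3 < ‖q.1‖ ∨ 3 < ‖q.2‖ := by
      by_contra! h
      exact hq ⟨mem_closedBall_zero_iff.2 h.1, mem_closedBall_zero_iff.2 h.2⟩
    rcases h3 with h3 | h3
    · rw [cutoff_eq_zero (w := q.1) one_pos (by linarith), zero_mul, zero_smul]
    · rw [cutoff_eq_zero (w := q.2) one_pos (by linarith), mul_zero, zero_smul]
  · beta_reduce
    rw [h₂ z hz w (mem_univ w), h₁ w hw z hz]
    rw [mem_closedBall_zero_iff] at hz hw
    rw [cutoff_eq_one one_pos (by linarith), cutoff_eq_one one_pos (by linarith), mul_one, one_smul]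

end DiscExtension

section MatrixFrame

/-- The normed algebra `𝔸` stands in for the matrices, which carry no canonical norm. All conditions
are read off entrywise through `Φ`. -/
lemma exists_frame_bidisc_of_algEquiv {n : ℕ} {𝔸 : Type} [NormedRing 𝔸] [NormedAlgebra ℂ 𝔸]
    [CompleteSpace 𝔸] (Φ : 𝔸 ≃ₐ[ℂ] Mat n) {a : ℂ × ℂ → Mat n}
    (ha : ∀ i j, ContDiffOn ℝ ∞ (fun p => a p i j) (Metric.closedBall 0 1 ×ˢ Metric.closedBall 0 1)) :
    ∃ φ : ℂ × ℂ → Mat n,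
      (∀ i j, ContDiffOn ℝ ∞ (fun p => φ p i j) (Metric.closedBall 0 1 ×ˢ Metric.closedBall 0 1)) ∧
      (∀ x ∈ Metric.closedBall (0 : ℂ) 1, ∀ w ∈ Metric.closedBall (0 : ℂ) 1, IsUnit (φ (x, w))) ∧
      ∀ x ∈ Metric.closedBall (0 : ℂ) 1, ∀ w ∈ Metric.closedBall (0 : ℂ) 1, ∀ i j,
        (fderivWithin ℝ (fun z => φ (x, z) i j) (Metric.closedBall 0 1) w 1
          + I * fderivWithin ℝ (fun z => φ (x, z) i j) (Metric.closedBall 0 1) w I) / 2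
          + (a (x, w) * φ (x, w)) i j = 0 := by
  have ha' : ContDiffOn ℝ ∞ (fun p => Φ.symm (a p)) (Metric.closedBall 0 1 ×ˢ Metric.closedBall 0 1) := by
    have h : (fun p => Φ.symm (a p)) = fun p => ∑ i, ∑ j, a p i j • Φ.symm (Matrix.single i j (1 : ℂ)) := by
      funext p
      conv_lhs => rw [Matrix.matrix_eq_sum_single (a p)]
      simp only [map_sum, ← map_smul, Matrix.smul_single, smul_eq_mul, mul_one]
    rw [h]
    exact ContDiffOn.sum fun i _ => ContDiffOn.sum fun j _ => (ha i j).smul contDiffOn_const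
  obtain ⟨b, hb, hbc, hba⟩ := exists_bidisc_extension ha'
  obtain ⟨φ, hφ⟩ := exists_isFrame Φ hb hbc (-2) 2
  have hsub : Metric.closedBall (0 : ℂ) 1 ⊆ {x | x.re ∈ Ioo (-2 : ℝ) 2 ∧ x.im ∈ Ioo (-2 : ℝ) 2} := by
    intro x hx
    rw [mem_closedBall_zero_iff] at hx
    have h1 := abs_le.1 ((abs_re_le_norm x).trans hx)
    have h2 := abs_le.1 ((abs_im_le_norm x).trans hx)
    exact ⟨⟨by linarith [h1.1], by linarith [h1.2]⟩, by linarith [h2.1], by linarith [h2.2]⟩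
  have hsub2 : Metric.closedBall (0 : ℂ) 1 ⊆ Metric.ball 0 2 :=
    Metric.closedBall_subset_ball (by norm_num)
  have hop : IsOpen {x : ℂ | x.re ∈ Ioo (-2 : ℝ) 2 ∧ x.im ∈ Ioo (-2 : ℝ) 2} :=
    (isOpen_Ioo.preimage continuous_re).inter (isOpen_Ioo.preimage continuous_im)
  let ent : Fin n → Fin n → (𝔸 →L[ℂ] ℂ) := fun i j =>
    ((ContinuousLinearMap.proj j).comp (ContinuousLinearMap.proj i)).comp (entriesCLM Φ)
  have hent : ∀ i j m, ent i j m = Φ m i j := fun i j m => rfl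
  refine ⟨fun p => Φ (φ p), fun i j => ?_, fun x hx w hw =>
    (hφ.isUnit x (hsub hx) w (hsub2 hw)).map Φ, fun x hx w hw i j => ?_⟩
  · exact (((ent i j).restrictScalars ℝ).contDiff.comp_contDiffOn hφ.smooth).mono
      (prod_mono hsub hsub2)
  · have hd := hφ.differentiableAt hop (hsub hx) (hsub2 hw)
    have h1 := hφ.eqn x (hsub hx) w (hsub2 hw)
    have h2 := dbar_comp_clm (ent i j) hd
    rw [eq_neg_of_add_eq_zero_left h1, map_neg, hent, map_mul, hba x hx w hw,
      AlgEquiv.apply_symm_apply] at h2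
    have hd2 : DifferentiableAt ℝ (fun z => Φ (φ (x, z)) i j) w :=
      ((ent i j).restrictScalars ℝ).differentiableAt.comp w hd
    have hu : UniqueDiffWithinAt ℝ (Metric.closedBall (0 : ℂ) 1) w := uniqueDiffDisk ⟨w, hw⟩
    rw [hd2.fderivWithin hu]
    have h3 : dbar (fun w => ent i j (φ (x, w))) w
        = (fderiv ℝ (fun z => Φ (φ (x, z)) i j) w 1 + I * fderiv ℝ (fun z => Φ (φ (x, z)) i j) w I) / 2 := by
      rw [dbar]; simp only [hent, smul_eq_mul]; ring
    rw [← h3, h2, neg_add_cancel]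

attribute [local instance] Matrix.linftyOpNormedRing Matrix.linftyOpNormedAlgebra

/-- A smooth family of invertible solutions of `∂φ/∂ω̄ + aφ = 0` on the closed disc. -/
theorem exists_frame_bidisc {n : ℕ} {a : ℂ × ℂ → Mat n}
    (ha : ∀ i j, ContDiffOn ℝ ∞ (fun p => a p i j) (Metric.closedBall 0 1 ×ˢ Metric.closedBall 0 1)) :
    ∃ φ : ℂ × ℂ → Mat n,
      (∀ i j, ContDiffOn ℝ ∞ (fun p => φ p i j) (Metric.closedBall 0 1 ×ˢ Metric.closedBall 0 1)) ∧
      (∀ x ∈ Metric.closedBall (0 : ℂ) 1, ∀ w ∈ Metric.closedBall (0 : ℂ) 1, IsUnit (φ (x, w))) ∧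
      ∀ x ∈ Metric.closedBall (0 : ℂ) 1, ∀ w ∈ Metric.closedBall (0 : ℂ) 1, ∀ i j,
        (fderivWithin ℝ (fun z => φ (x, z) i j) (Metric.closedBall 0 1) w 1
          + I * fderivWithin ℝ (fun z => φ (x, z) i j) (Metric.closedBall 0 1) w I) / 2
          + (a (x, w) * φ (x, w)) i j = 0 :=
  have : CompleteSpace (Mat n) := FiniteDimensional.complete ℂ (Mat n)
  exists_frame_bidisc_of_algEquiv AlgEquiv.refl ha

end MatrixFrame

end Twistor

end

/-! ### Power series built from Fourier coefficients, smooth up to the unit circle. -/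

noncomputable section

namespace Twistor

attribute [-instance] instNormedAddCommGroupOfRiemannianBundleOfIsTopologicalAddGroupOfContinuousConstSMulReal
  instInnerProductSpaceReal

open MeasureTheory Complex Set BoundedContinuousFunction

section HolomorphicSeries

variable {E V : Type} [NormedAddCommGroup E] [NormedSpace ℝ E] [NormedAddCommGroup V]
  [NormedSpace ℝ V] [NormedSpace ℂ V] [IsScalarTower ℝ ℂ V] [CompleteSpace V] {K : Set E}

/-- The `m`-th Fourier coefficient of `U(y, ·)`, up to the factor `2π`. -/
def fcoef (U : E × ℝ → V) (m : ℤ) (y : E) : V :=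
  ∫ t in (0 : ℝ)..2 * Real.pi, cexp (-(m * I) * t) • U (y, t)

/-- Periodicity over `K`. -/
def PeriodicOver (K : Set E) (U : E × ℝ → V) : Prop :=
  ∀ y ∈ K, ∀ t, U (y, t + 2 * Real.pi) = U (y, t)

variable (K) in
/-- The derivative of `U` in the periodic variable. -/
def derivT (U : E × ℝ → V) (p : E × ℝ) : V := fderivWithin ℝ U (K ×ˢ univ) p (0, 1)

variable (K) in
/-- The derivative of `U` in the parameters. -/
def derivY (U : E × ℝ → V) (p : E × ℝ) : E →L[ℝ] V :=
  (fderivWithin ℝ U (K ×ˢ univ) p).comp (.inl ℝ E ℝ)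

/-- The power series whose coefficients are the Fourier coefficients of index at least `c`. -/
def fourierSeriesFrom (c : ℤ) (U : E × ℝ → V) (p : E × ℂ) : V :=
  ∑' m : ℕ, p.2 ^ m • fcoef U (m + c) p.1

variable {U : E × ℝ → V}

open scoped Pointwise in
-- The set `K ×ˢ univ` is invariant under translation by the period.
lemma PeriodicOver.fderivWithin (hU : PeriodicOver K U) {y : E} (hy : y ∈ K) (t : ℝ) :
    fderivWithin ℝ U (K ×ˢ univ) (y, t + 2 * Real.pi) = fderivWithin ℝ U (K ×ˢ univ) (y, t) := by
  have h1 : ((0, 2 * Real.pi) : E × ℝ) +ᵥ (K ×ˢ (univ : Set ℝ)) = K ×ˢ univ := by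
    ext ⟨z, s⟩
    rw [Set.mem_vadd_set_iff_neg_vadd_mem]
    simp
  have h2 := fderivWithin_comp_add_right (𝕜 := ℝ) (f := U) (s := K ×ˢ univ) (x := (y, t)) (0, 2 * Real.pi)
  rw [h1] at h2
  have h3 : ((y, t) : E × ℝ) + (0, 2 * Real.pi) = (y, t + 2 * Real.pi) := by simp
  rw [← h3, ← h2]
  refine fderivWithin_congr (fun p hp => ?_) ?_
  · have h4 : p + (0, 2 * Real.pi) = (p.1, p.2 + 2 * Real.pi) := by ext <;> simp
    rw [h4, hU _ hp.1]
  · rw [h3, hU _ hy]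

lemma PeriodicOver.derivT (hU : PeriodicOver K U) : PeriodicOver K (derivT K U) := fun y hy t => by
  rw [Twistor.derivT, hU.fderivWithin hy, Twistor.derivT]

lemma PeriodicOver.derivY (hU : PeriodicOver K U) : PeriodicOver K (derivY K U) := fun y hy t => by
  rw [Twistor.derivY, hU.fderivWithin hy, Twistor.derivY]

lemma contDiffOn_derivT (hu : UniqueDiffOn ℝ K) (hU : ContDiffOn ℝ ∞ U (K ×ˢ univ)) :
    ContDiffOn ℝ ∞ (derivT K U) (K ×ˢ univ) :=
  (hU.fderivWithin (hu.prod uniqueDiffOn_univ) (by simp)).clm_apply contDiffOn_const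

lemma contDiffOn_derivY (hu : UniqueDiffOn ℝ K) (hU : ContDiffOn ℝ ∞ U (K ×ˢ univ)) :
    ContDiffOn ℝ ∞ (derivY K U) (K ×ˢ univ) :=
  (hU.fderivWithin (hu.prod uniqueDiffOn_univ) (by simp)).clm_comp contDiffOn_const

lemma hasDerivAt_slice (hU : ContDiffOn ℝ ∞ U (K ×ˢ univ)) {y : E} (hy : y ∈ K) (t : ℝ) :
    HasDerivAt (fun t => U (y, t)) (derivT K U (y, t)) t := by
  have h1 := (hU.differentiableOn (by simp) (y, t) ⟨hy, mem_univ _⟩).hasFDerivWithinAt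
  have h2 : HasDerivWithinAt (fun t : ℝ => (y, t)) (0, 1) univ t :=
    ((hasDerivAt_const t y).prodMk (hasDerivAt_id t)).hasDerivWithinAt
  exact hasDerivWithinAt_univ.1 (h1.comp_hasDerivWithinAt t h2 fun s _ => ⟨hy, mem_univ _⟩)

lemma continuous_slice (hU : ContinuousOn U (K ×ˢ univ)) {y : E} (hy : y ∈ K) :
    Continuous fun t => U (y, t) :=
  hU.comp_continuous (by fun_prop) fun t => ⟨hy, mem_univ _⟩

lemma continuous_expI (m : ℤ) : Continuous fun t : ℝ => cexp (-(m * I) * t) := by fun_prop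

lemma continuous_expI_smul (m : ℤ) (hU : ContinuousOn U (K ×ˢ univ)) {y : E} (hy : y ∈ K) :
    Continuous fun t : ℝ => cexp (-(m * I) * t) • U (y, t) :=
  (continuous_expI m).smul (continuous_slice hU hy)

/-- Integration by parts; the boundary terms cancel by periodicity. -/
lemma fcoef_derivT (hu : UniqueDiffOn ℝ K) (hU : ContDiffOn ℝ ∞ U (K ×ˢ univ)) (hp : PeriodicOver K U) (m : ℤ) {y : E}
    (hy : y ∈ K) : fcoef (derivT K U) m y = ((m : ℂ) * I) • fcoef U m y := by
  have he : ∀ t : ℝ, HasDerivAt (fun t : ℝ => cexp (-(m * I) * t)) (-(m * I) * cexp (-(m * I) * t)) t := by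
    intro t
    have h := ((Complex.ofRealCLM.hasDerivAt (x := t)).const_mul (-(m * I))).cexp
    convert! h using 1
    simp [mul_comm]
  have c1 := continuous_expI_smul m (contDiffOn_derivT hu hU).continuousOn hy
  have c2 : Continuous fun t : ℝ => (-(m * I)) • cexp (-(m * I) * t) • U (y, t) :=
    (continuous_expI_smul m hU.continuousOn hy).const_smul _
  have h1 := intervalIntegral.integral_eq_sub_of_hasDerivAt (a := 0) (b := 2 * Real.pi)
    (f := fun t : ℝ => cexp (-(m * I) * t) • U (y, t))
    (f' := fun t : ℝ => cexp (-(m * I) * t) • derivT K U (y, t) +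
      (-(m * I) * cexp (-(m * I) * t)) • U (y, t))
    (fun t _ => (he t).smul (hasDerivAt_slice hU hy t)) ?_
  · have h2 : cexp (-(m * I) * ((2 * Real.pi : ℝ) : ℂ)) = 1 := by
      rw [show (-(m * I) * ((2 * Real.pi : ℝ) : ℂ)) = (-m : ℤ) * (2 * Real.pi * I) by push_cast; ring]
      exact Complex.exp_int_mul_two_pi_mul_I _
    have h3 := hp y hy 0
    rw [zero_add] at h3
    simp only [mul_smul] at h1
    rw [intervalIntegral.integral_add (c1.intervalIntegrable _ _)
      (c2.intervalIntegrable _ _)] at h1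
    rw [intervalIntegral.integral_smul] at h1
    rw [h2, h3, ofReal_zero, mul_zero, Complex.exp_zero, sub_self] at h1
    rw [fcoef, fcoef, eq_neg_of_add_eq_zero_left h1, neg_smul, neg_neg, mul_smul]
  · simp only [mul_smul]
    exact (c1.add c2).intervalIntegrable _ _

lemma norm_expI (m : ℤ) (t : ℝ) : ‖cexp (-(m * I) * t)‖ = 1 := by
  rw [show (-(m * I) * t : ℂ) = ((-m * t : ℝ) : ℂ) * I by push_cast; ring]
  exact norm_exp_ofReal_mul_I _

lemma exists_bound_slab (hK : IsCompact K) (hU : ContinuousOn U (K ×ˢ univ)) :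
    ∃ C, 0 ≤ C ∧ ∀ y ∈ K, ∀ t ∈ Icc (0 : ℝ) (2 * Real.pi), ‖U (y, t)‖ ≤ C := by
  obtain ⟨C, hC⟩ := (hK.prod (isCompact_Icc (a := (0 : ℝ)) (b := 2 * Real.pi))).exists_bound_of_continuousOn
    (hU.mono (prod_mono le_rfl (subset_univ _)))
  exact ⟨max C 0, le_max_right _ _, fun y hy t ht => (hC (y, t) ⟨hy, ht⟩).trans (le_max_left _ _)⟩

lemma uIoc_two_pi_subset : uIoc 0 (2 * Real.pi) ⊆ Icc 0 (2 * Real.pi) := by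
  rw [uIoc_of_le Real.two_pi_pos.le]; exact Ioc_subset_Icc_self

lemma exists_bound_fcoef (hK : IsCompact K) (hU : ContinuousOn U (K ×ˢ univ)) :
    ∃ C, 0 ≤ C ∧ ∀ m, ∀ y ∈ K, ‖fcoef U m y‖ ≤ C := by
  obtain ⟨C, hC0, hC⟩ := exists_bound_slab hK hU
  refine ⟨C * (2 * Real.pi), by positivity, fun m y hy => ?_⟩
  have := intervalIntegral.norm_integral_le_of_norm_le_const (a := 0) (b := 2 * Real.pi) (C := C)
    (f := fun t : ℝ => cexp (-(m * I) * t) • U (y, t)) fun t ht => by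
      rw [norm_smul, norm_expI, one_mul]
      exact hC y hy t (uIoc_two_pi_subset ht)
  rwa [sub_zero, abs_of_pos Real.two_pi_pos] at this

lemma fcoef_sub_smul {W : E × ℝ → V} (hU : ContinuousOn U (K ×ˢ univ))
    (hW : ContinuousOn W (K ×ˢ univ)) (a b : ℂ) (m : ℤ) {y : E} (hy : y ∈ K) :
    fcoef (fun p => a • U p + b • W p) m y = a • fcoef U m y + b • fcoef W m y := by
  have c1 : Continuous fun t : ℝ => a • cexp (-(m * I) * t) • U (y, t) :=
    (continuous_expI_smul m hU hy).const_smul _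
  have c2 : Continuous fun t : ℝ => b • cexp (-(m * I) * t) • W (y, t) :=
    (continuous_expI_smul m hW hy).const_smul _
  rw [fcoef, fcoef, fcoef, ← intervalIntegral.integral_smul, ← intervalIntegral.integral_smul,
    ← intervalIntegral.integral_add (c1.intervalIntegrable _ _) (c2.intervalIntegrable _ _)]
  refine intervalIntegral.integral_congr fun t _ => ?_
  simp only [smul_add, smul_smul, mul_comm]

/-- The coefficients of `U - ∂_t² U` are those of `U` multiplied by `1 + m²`, and they are bounded
uniformly over the compact set `K`. -/
lemma exists_decay_fcoef (hK : IsCompact K) (hu : UniqueDiffOn ℝ K)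
    (hU : ContDiffOn ℝ ∞ U (K ×ˢ univ)) (hp : PeriodicOver K U) :
    ∃ C, 0 ≤ C ∧ ∀ m : ℤ, ∀ y ∈ K, ‖fcoef U m y‖ ≤ C * (1 + (m : ℝ) ^ 2)⁻¹ := by
  have h1 := contDiffOn_derivT hu hU
  have h2 := contDiffOn_derivT hu h1
  obtain ⟨C, hC0, hC⟩ := exists_bound_fcoef hK
    (U := fun p => (1 : ℂ) • U p + (-1 : ℂ) • derivT K (derivT K U) p)
    ((hU.continuousOn.const_smul _).add (h2.continuousOn.const_smul _))
  refine ⟨C, hC0, fun m y hy => ?_⟩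
  have h3 := hC m y hy
  rw [fcoef_sub_smul hU.continuousOn h2.continuousOn _ _ _ hy, fcoef_derivT hu h1 hp.derivT _ hy,
    fcoef_derivT hu hU hp _ hy, smul_smul, smul_smul, ← add_smul, norm_smul] at h3
  have h4 : ∀ z : ℂ, z = ((1 + (m : ℝ) ^ 2 : ℝ) : ℂ) → ‖z‖ = 1 + (m : ℝ) ^ 2 := fun z hz => by
    rw [hz, Complex.norm_real, Real.norm_of_nonneg (by positivity)]
  rw [h4 _ (by push_cast; linear_combination (-(m : ℂ) ^ 2) * I_sq)] at h3
  rw [← div_eq_mul_inv, le_div_iff₀ (by positivity)]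
  linarith

lemma summable_inv_one_add_sq (c : ℤ) : Summable fun m : ℕ => (1 + (((m : ℤ) + c : ℤ) : ℝ) ^ 2)⁻¹ := by
  have h1 : Summable fun k : ℤ => (1 + (k : ℝ) ^ 2)⁻¹ := by
    refine (Real.summable_one_div_int_pow.2 one_lt_two).of_norm_bounded_eventually ?_
    filter_upwards [(Set.finite_singleton (0 : ℤ)).compl_mem_cofinite] with k hk
    have hk' : (k : ℝ) ≠ 0 := by exact_mod_cast hk
    rw [Real.norm_of_nonneg (by positivity), one_div]
    gcongr
    linarith
  exact h1.comp_injective (i := fun m : ℕ => (m : ℤ) + c) fun a b h => by simpa using h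

lemma continuousOn_fcoef (hK : IsCompact K) (hU : ContinuousOn U (K ×ˢ univ)) (m : ℤ) :
    ContinuousOn (fcoef U m) K := by
  obtain ⟨C, hC0, hC⟩ := exists_bound_slab hK hU
  intro y hy
  refine intervalIntegral.continuousWithinAt_of_dominated_interval (bound := fun _ => C) ?_ ?_
    (by simp) (Filter.Eventually.of_forall fun t _ => ?_)
  · filter_upwards [self_mem_nhdsWithin] with z hz
    exact (continuous_expI_smul m hU hz).aestronglyMeasurable
  · filter_upwards [self_mem_nhdsWithin] with z hz
    refine Filter.Eventually.of_forall fun t ht => ?_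
    rw [norm_smul, norm_expI, one_mul]
    exact hC z hz t (uIoc_two_pi_subset ht)
  · have h1 : ContinuousWithinAt (fun z => U (z, t)) K y :=
      (hU (y, t) ⟨hy, mem_univ _⟩).comp (f := fun z => (z, t)) (by fun_prop) fun z hz => ⟨hz, mem_univ _⟩
    exact h1.const_smul _

lemma hasFDerivAt_fcoef (hK : IsCompact K) (hu : UniqueDiffOn ℝ K)
    (hU : ContDiffOn ℝ ∞ U (K ×ˢ univ)) (m : ℤ) {y : E} (hy : y ∈ interior K) :
    HasFDerivAt (fcoef U m) (fcoef (derivY K U) m y) y := by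
  have hd := (contDiffOn_derivY hu hU).continuousOn
  obtain ⟨C, hC0, hC⟩ := exists_bound_slab hK hd
  have hyK := interior_subset hy
  refine intervalIntegral.hasFDerivAt_integral_of_dominated_of_fderiv_le (bound := fun _ => C)
    (F' := fun z t => cexp (-(m * I) * t) • derivY K U (z, t))
    (isOpen_interior.mem_nhds hy) ?_ ((continuous_expI_smul m hU.continuousOn hyK).intervalIntegrable _ _)
    (continuous_expI_smul m hd hyK).aestronglyMeasurable (Filter.Eventually.of_forall fun t ht z hz => ?_)
    (by simp) (Filter.Eventually.of_forall fun t ht z hz => ?_)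
  · filter_upwards [isOpen_interior.mem_nhds hy] with z hz
    exact (continuous_expI_smul m hU.continuousOn (interior_subset hz)).aestronglyMeasurable
  · rw [norm_smul, norm_expI, one_mul]
    exact hC z (interior_subset hz) t (uIoc_two_pi_subset ht)
  · have hmem : K ×ˢ (univ : Set ℝ) ∈ 𝓝 (z, t) :=
      prod_mem_nhds (mem_interior_iff_mem_nhds.1 hz) Filter.univ_mem
    have h1 : HasFDerivAt U (fderivWithin ℝ U (K ×ˢ univ) (z, t)) (z, t) :=
      ((hU.differentiableOn (by simp) _ (mem_of_mem_nhds hmem)).hasFDerivWithinAt).hasFDerivAt hmem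
    have h2 : HasFDerivAt (fun z : E => (z, t)) (.inl ℝ E ℝ) z := hasFDerivAt_prodMk_left z t
    exact (HasFDerivAt.comp z h1 h2).const_smul (cexp (-(m * I) * t))

lemma summable_fourierSeriesFrom (hK : IsCompact K) (hu : UniqueDiffOn ℝ K)
    (hU : ContDiffOn ℝ ∞ U (K ×ˢ univ)) (hp : PeriodicOver K U) (c : ℤ) {p : E × ℂ}
    (hpK : p ∈ K ×ˢ Metric.closedBall (0 : ℂ) 1) :
    Summable fun m : ℕ => p.2 ^ m • fcoef U (m + c) p.1 := by
  obtain ⟨C, hC0, hC⟩ := exists_decay_fcoef hK hu hU hp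
  refine Summable.of_norm_bounded ((summable_inv_one_add_sq c).mul_left C) fun m => ?_
  rw [norm_smul, norm_pow]
  exact (mul_le_of_le_one_left (norm_nonneg _) (pow_le_one₀ (norm_nonneg _)
    (mem_closedBall_zero_iff.1 hpK.2))).trans (hC _ _ hpK.1)

lemma continuousOn_fourierSeriesFrom (hK : IsCompact K) (hu : UniqueDiffOn ℝ K)
    (hU : ContDiffOn ℝ ∞ U (K ×ˢ univ)) (hp : PeriodicOver K U) (c : ℤ) :
    ContinuousOn (fourierSeriesFrom c U) (K ×ˢ Metric.closedBall (0 : ℂ) 1) := by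
  obtain ⟨C, hC0, hC⟩ := exists_decay_fcoef hK hu hU hp
  refine continuousOn_tsum (fun m => ?_) ((summable_inv_one_add_sq c).mul_left C) fun m p hpK => ?_
  · exact (by fun_prop : Continuous fun p : E × ℂ => p.2 ^ m).continuousOn.smul
      ((continuousOn_fcoef hK hU.continuousOn _).comp continuousOn_fst fun p hp => hp.1)
  · rw [norm_smul, norm_pow]
    exact (mul_le_of_le_one_left (norm_nonneg _) (pow_le_one₀ (norm_nonneg _)
      (mem_closedBall_zero_iff.1 hpK.2))).trans (hC _ _ hpK.1)

variable (K) in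
/-- The function whose Fourier coefficients are `(m - c)` times those of `U`. -/
def shiftDeriv (c : ℤ) (U : E × ℝ → V) (p : E × ℝ) : V :=
  (-I) • derivT K U p + (-c : ℂ) • U p

lemma contDiffOn_shiftDeriv (hu : UniqueDiffOn ℝ K) (hU : ContDiffOn ℝ ∞ U (K ×ˢ univ)) (c : ℤ) :
    ContDiffOn ℝ ∞ (shiftDeriv K c U) (K ×ˢ univ) :=
  ((contDiffOn_derivT hu hU).const_smul _).add (hU.const_smul _)

lemma PeriodicOver.shiftDeriv (hU : PeriodicOver K U) (c : ℤ) : PeriodicOver K (shiftDeriv K c U) :=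
  fun y hy t => by rw [Twistor.shiftDeriv, hU.derivT y hy, hU y hy, Twistor.shiftDeriv]

lemma fcoef_shiftDeriv (hu : UniqueDiffOn ℝ K) (hU : ContDiffOn ℝ ∞ U (K ×ˢ univ))
    (hp : PeriodicOver K U) (c m : ℤ) {y : E} (hy : y ∈ K) :
    fcoef (shiftDeriv K c U) m y = ((m - c : ℤ) : ℂ) • fcoef U m y := by
  have h := fcoef_sub_smul (contDiffOn_derivT hu hU).continuousOn hU.continuousOn (-I) (-c) m hy
  rw [fcoef_derivT hu hU hp m hy, smul_smul, ← add_smul] at h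
  refine h.trans (congrArg (· • _) ?_)
  push_cast
  linear_combination (-(m : ℂ)) * I_sq

/-- A real-linear map from a linear map on the first factor and a complex slope on the second. -/
def slopeCLM : (E →L[ℝ] V) × V →L[ℝ] (E × ℂ →L[ℝ] V) :=
  LinearMap.mkContinuous
    { toFun := fun q => q.1.comp (.fst ℝ E ℂ) +
        (ContinuousLinearMap.toSpanSingleton ℂ q.2).restrictScalars ℝ ∘L (.snd ℝ E ℂ)
      map_add' := fun p q => by ext r <;> simp
      map_smul' := fun c q => by ext r <;> simp [smul_algebra_smul_comm] } 2 fun q => by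
    refine ContinuousLinearMap.opNorm_le_bound _ (by positivity) fun r => ?_
    have h : ‖q.1 r.1 + r.2 • q.2‖ ≤ 2 * ‖q‖ * ‖r‖ := by
      have h1 : ‖q.1 r.1‖ ≤ ‖q‖ * ‖r‖ := (q.1.le_opNorm _).trans
        (mul_le_mul (norm_fst_le q) (norm_fst_le r) (norm_nonneg _) (norm_nonneg _))
      have h2 : ‖r.2 • q.2‖ ≤ ‖q‖ * ‖r‖ := by
        rw [norm_smul, mul_comm]
        exact mul_le_mul (norm_snd_le q) (norm_snd_le r) (norm_nonneg _) (norm_nonneg _)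
      linarith [norm_add_le (q.1 r.1) (r.2 • q.2)]
    exact h

lemma slopeCLM_apply (A : E →L[ℝ] V) (v : V) (r : E × ℂ) : slopeCLM (A, v) r = A r.1 + r.2 • v := rfl

lemma norm_slopeCLM_le (A : E →L[ℝ] V) (v : V) : ‖slopeCLM (A, v)‖ ≤ ‖A‖ + ‖v‖ := by
  refine ContinuousLinearMap.opNorm_le_bound _ (by positivity) fun r => ?_
  rw [slopeCLM_apply, add_mul]
  refine (norm_add_le _ _).trans (add_le_add ?_ ?_)
  · exact (A.le_opNorm _).trans (by gcongr; exact norm_fst_le r)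
  · rw [norm_smul, mul_comm]; gcongr; exact norm_snd_le r

variable (K) in
/-- The derivative of `fourierSeriesFrom c U`. -/
def fourierSeriesDeriv (c : ℤ) (U : E × ℝ → V) (p : E × ℂ) : E × ℂ →L[ℝ] V :=
  slopeCLM (fourierSeriesFrom c (derivY K U) p, fourierSeriesFrom (c + 1) (shiftDeriv K c U) p)

/-- Differentiation in the disc variable yields `m ω^{m-1}` times the coefficient of index `m + c`.
After an index shift this is the series from `c + 1` of `shiftDeriv`, so derivatives remain in the
same class of series. -/
lemma hasFDerivAt_fourierSeriesFrom (hK : IsCompact K) (hKc : Convex ℝ K) (hKi : (interior K).Nonempty)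
    (hU : ContDiffOn ℝ ∞ U (K ×ˢ univ)) (hp : PeriodicOver K U) (c : ℤ) {q : E × ℂ}
    (hq : q ∈ interior K ×ˢ Metric.ball (0 : ℂ) 1) :
    HasFDerivAt (fourierSeriesFrom c U) (fourierSeriesDeriv K c U q) q := by
  have hu := uniqueDiffOn_convex hKc hKi
  have hUY := contDiffOn_derivY hu hU
  have hUW := contDiffOn_shiftDeriv hu hU c
  obtain ⟨C₁, hC₁0, hC₁⟩ := exists_decay_fcoef hK hu hUY hp.derivY
  obtain ⟨C₂, hC₂0, hC₂⟩ := exists_decay_fcoef hK hu hUW (hp.shiftDeriv c)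
  have hsub : ∀ x ∈ interior K ×ˢ Metric.ball (0 : ℂ) 1, x ∈ K ×ˢ Metric.closedBall (0 : ℂ) 1 :=
    fun x hx => ⟨interior_subset hx.1, Metric.ball_subset_closedBall hx.2⟩
  have hs1 := summable_fourierSeriesFrom hK hu hUY hp.derivY c (hsub q hq)
  have hs2 := summable_fourierSeriesFrom hK hu hUW (hp.shiftDeriv c) (c + 1) (hsub q hq)
  -- The term of index zero is constant in the disc variable and is set to zero, as the truncated
  -- exponent `m - 1` has no meaning there.
  let g : ℕ → E × ℂ → V := fun m x => if m = 0 then 0 else x.2 ^ (m - 1) • fcoef (shiftDeriv K c U) (m + c) x.1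
  have hg : HasSum (fun m => g m q) (fourierSeriesFrom (c + 1) (shiftDeriv K c U) q) := by
    refine (hasSum_nat_add_iff' 1).1 ?_
    convert! hs2.hasSum using 1
    · funext m
      have h : ((m + 1 : ℕ) : ℤ) + c = m + (c + 1) := by push_cast; ring
      simp only [g, Nat.succ_ne_zero, if_false, Nat.add_sub_cancel, h]
    · simp [g, fourierSeriesFrom]
  have key := hasFDerivAt_tsum_of_isPreconnected
    (f := fun (m : ℕ) (x : E × ℂ) => x.2 ^ m • fcoef U (m + c) x.1)
    (f' := fun (m : ℕ) x => slopeCLM (x.2 ^ m • fcoef (derivY K U) (m + c) x.1, g m x))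
    (u := fun m : ℕ => C₁ * (1 + (((m : ℤ) + c : ℤ) : ℝ) ^ 2)⁻¹ + C₂ * (1 + (((m : ℤ) + c : ℤ) : ℝ) ^ 2)⁻¹)
    (((summable_inv_one_add_sq c).mul_left C₁).add ((summable_inv_one_add_sq c).mul_left C₂))
    (isOpen_interior.prod Metric.isOpen_ball) (hKc.interior.prod (convex_ball _ _)).isPreconnected
    (fun m x hx => ?_) (fun m x hx => ?_) hq (summable_fourierSeriesFrom hK hu hU hp c (hsub q hq)) hq
  · rwa [(ContinuousLinearMap.hasSum (slopeCLM (E := E) (V := V)) (hs1.hasSum.prodMk hg)).tsum_eq] at key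
  · have h1 : HasFDerivAt (fun x : E × ℂ => fcoef U (m + c) x.1)
        ((fcoef (derivY K U) (m + c) x.1).comp (.fst ℝ E ℂ)) x :=
      HasFDerivAt.comp x (hasFDerivAt_fcoef hK hu hU _ hx.1) hasFDerivAt_fst
    have h2 : HasFDerivAt (fun x : E × ℂ => x.2 ^ m)
        (((ContinuousLinearMap.toSpanSingleton ℂ ((m : ℂ) * x.2 ^ (m - 1))).restrictScalars ℝ) ∘L (.snd ℝ E ℂ)) x :=
      HasFDerivAt.comp x ((hasDerivAt_pow m x.2).hasFDerivAt.restrictScalars ℝ) hasFDerivAt_snd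
    convert! h2.smul h1 using 1
    refine ContinuousLinearMap.ext fun r => ?_
    have hgm : g m x = (m * x.2 ^ (m - 1)) • fcoef U (m + c) x.1 := by
      rcases Nat.eq_zero_or_pos m with rfl | hm
      · simp [g]
      · simp only [g, hm.ne', if_false]
        rw [fcoef_shiftDeriv hu hU hp _ _ (interior_subset hx.1), smul_smul]
        congr 1
        push_cast; ring
    rw [slopeCLM_apply, hgm]
    simp [smul_smul]
  · refine (norm_slopeCLM_le _ _).trans (add_le_add ?_ ?_)
    · rw [norm_smul, norm_pow]
      exact (mul_le_of_le_one_left (norm_nonneg _) (pow_le_one₀ (norm_nonneg _)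
        (mem_closedBall_zero_iff.1 (hsub x hx).2))).trans (hC₁ _ _ (hsub x hx).1)
    · simp only [g]
      split_ifs with hm
      · rw [norm_zero]; positivity
      rw [norm_smul, norm_pow]
      exact (mul_le_of_le_one_left (norm_nonneg _) (pow_le_one₀ (norm_nonneg _)
        (mem_closedBall_zero_iff.1 (hsub x hx).2))).trans (hC₂ _ _ (hsub x hx).1)

lemma continuousOn_fourierSeriesDeriv (hK : IsCompact K) (hu : UniqueDiffOn ℝ K)
    (hU : ContDiffOn ℝ ∞ U (K ×ˢ univ)) (hp : PeriodicOver K U) (c : ℤ) :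
    ContinuousOn (fourierSeriesDeriv K c U) (K ×ˢ Metric.closedBall (0 : ℂ) 1) :=
  slopeCLM.continuous.comp_continuousOn (ContinuousOn.prodMk
    (continuousOn_fourierSeriesFrom hK hu (contDiffOn_derivY hu hU) hp.derivY _)
    (continuousOn_fourierSeriesFrom hK hu (contDiffOn_shiftDeriv hu hU c) (hp.shiftDeriv c) _))

/-- The derivative found in the interior extends continuously to the closure, which gives
differentiability up to the boundary circle and the boundary of `K`. -/
lemma hasFDerivWithinAt_fourierSeriesFrom (hK : IsCompact K) (hKc : Convex ℝ K)
    (hKi : (interior K).Nonempty) (hU : ContDiffOn ℝ ∞ U (K ×ˢ univ)) (hp : PeriodicOver K U) (c : ℤ)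
    {q : E × ℂ} (hq : q ∈ K ×ˢ Metric.closedBall (0 : ℂ) 1) :
    HasFDerivWithinAt (fourierSeriesFrom c U) (fourierSeriesDeriv K c U q)
      (K ×ˢ Metric.closedBall (0 : ℂ) 1) q := by
  have hu := uniqueDiffOn_convex hKc hKi
  have hcl : closure (interior K ×ˢ Metric.ball (0 : ℂ) 1) = K ×ˢ Metric.closedBall (0 : ℂ) 1 := by
    rw [closure_prod_eq, closure_ball _ one_ne_zero,
      hKc.closure_interior_eq_closure_of_nonempty_interior hKi, hK.isClosed.closure_eq]
  have hderiv := fun q hq => hasFDerivAt_fourierSeriesFrom hK hKc hKi hU hp c (q := q) hq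
  have hsub : interior K ×ˢ Metric.ball (0 : ℂ) 1 ⊆ K ×ˢ Metric.closedBall (0 : ℂ) 1 :=
    prod_mono interior_subset Metric.ball_subset_closedBall
  rw [← hcl]
  refine hasFDerivWithinAt_closure_of_tendsto_fderiv
    (fun q hq => (hderiv q hq).differentiableAt.differentiableWithinAt)
    (hKc.interior.prod (convex_ball _ _)) (isOpen_interior.prod Metric.isOpen_ball) (fun y hy => ?_) ?_
  · rw [hcl] at hy
    exact (continuousOn_fourierSeriesFrom hK hu hU hp c y hy).mono hsub
  · refine ((continuousOn_fourierSeriesDeriv hK hu hU hp c q hq).mono hsub).tendsto.congr' ?_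
    filter_upwards [self_mem_nhdsWithin] with q hq
    exact (hderiv q hq).fderiv.symm

/-- The parameter derivative changes the target space and the disc derivative changes `c`, so the
induction quantifies over both. -/
lemma contDiffOn_fourierSeriesFrom_nat (hK : IsCompact K) (hKc : Convex ℝ K)
    (hKi : (interior K).Nonempty) (k : ℕ) :
    ∀ {V : Type} [NormedAddCommGroup V] [NormedSpace ℝ V] [NormedSpace ℂ V] [IsScalarTower ℝ ℂ V]
      [CompleteSpace V] {U : E × ℝ → V}, ContDiffOn ℝ ∞ U (K ×ˢ univ) → PeriodicOver K U → ∀ c : ℤ,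
      ContDiffOn ℝ k (fourierSeriesFrom c U) (K ×ˢ Metric.closedBall (0 : ℂ) 1) := by
  have hu := uniqueDiffOn_convex hKc hKi
  have hu' : UniqueDiffOn ℝ (K ×ˢ Metric.closedBall (0 : ℂ) 1) :=
    hu.prod (uniqueDiffOn_convex (convex_closedBall 0 1) (by
      rw [interior_closedBall _ one_ne_zero]; exact Metric.nonempty_ball.2 one_pos))
  induction k with
  | zero =>
    intro V _ _ _ _ _ U hU hp c
    exact contDiffOn_zero.2 (continuousOn_fourierSeriesFrom hK hu hU hp c)
  | succ k ih =>
    intro V _ _ _ _ _ U hU hp c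
    rw [Nat.cast_succ]
    exact (contDiffOn_succ_iff_hasFDerivWithinAt_of_uniqueDiffOn hu').2
      ⟨by simp, fourierSeriesDeriv K c U, (slopeCLM (E := E) (V := V)).contDiff.comp_contDiffOn (ContDiffOn.prodMk
        (ih (contDiffOn_derivY hu hU) hp.derivY _)
        (ih (contDiffOn_shiftDeriv hu hU c) (hp.shiftDeriv c) _)),
        fun p hpK => hasFDerivWithinAt_fourierSeriesFrom hK hKc hKi hU hp c hpK⟩

theorem contDiffOn_fourierSeriesFrom (hK : IsCompact K) (hKc : Convex ℝ K)
    (hKi : (interior K).Nonempty) (hU : ContDiffOn ℝ ∞ U (K ×ˢ univ)) (hp : PeriodicOver K U) (c : ℤ) :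
    ContDiffOn ℝ ∞ (fourierSeriesFrom c U) (K ×ˢ Metric.closedBall (0 : ℂ) 1) :=
  contDiffOn_infty.2 fun k => contDiffOn_fourierSeriesFrom_nat hK hKc hKi k hU hp c

end HolomorphicSeries

end Twistor

end

/-! ### Coordinates on the tangent bundle, and smoothness tested in charts. -/

noncomputable section

namespace Twistor

open MeasureTheory Complex Set

section LocalCoordinates

variable {M : Type*} [TopologicalSpace M] [ChartedSpace (EuclideanHalfSpace 2) M]
  [IsManifold (𝓡∂ 2) ∞ M] (x₀ : M)

/-- The trivialisation of the tangent bundle given by the chart at `x₀`. -/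
abbrev triv : Trivialization E2 (TotalSpace.proj : TangentBundle (𝓡∂ 2) M → M) :=
  trivializationAt E2 (TangentSpace (𝓡∂ 2)) x₀

/-- The range of the chart at `x₀`. -/
abbrev chartDom : Set E2 := (extChartAt (𝓡∂ 2) x₀).target

/-- The tangent vector with given coordinates in the chart at `x₀`. -/
def chartPt (s : E2 × E2) : TangentBundle (𝓡∂ 2) M :=
  ⟨(extChartAt (𝓡∂ 2) x₀).symm s.1, (triv x₀).symmL ℝ ((extChartAt (𝓡∂ 2) x₀).symm s.1) s.2⟩

/-- The coordinates of a tangent vector in the chart at `x₀`. -/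
def chartCo (p : TangentBundle (𝓡∂ 2) M) : E2 × E2 := (extChartAt (𝓡∂ 2) x₀ p.1, (triv x₀ p).2)

variable {x₀}

lemma mem_baseSet_of_mem {x : M} (hx : x ∈ (extChartAt (𝓡∂ 2) x₀).source) : x ∈ (triv x₀).baseSet := by
  simpa using hx

lemma symm_mem_baseSet {y : E2} (hy : y ∈ chartDom x₀) :
    (extChartAt (𝓡∂ 2) x₀).symm y ∈ (triv x₀).baseSet :=
  mem_baseSet_of_mem ((extChartAt (𝓡∂ 2) x₀).map_target hy)

lemma chartPt_eq {s : E2 × E2} (hs : s.1 ∈ chartDom x₀) :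
    chartPt x₀ s = (extChartAt (𝓡∂ 2).tangent (⟨x₀, 0⟩ : TangentBundle (𝓡∂ 2) M)).symm s := by
  have h : (extChartAt (𝓡∂ 2).tangent (⟨x₀, 0⟩ : TangentBundle (𝓡∂ 2) M)).symm s =
      (triv x₀).toPartialEquiv.symm ((extChartAt (𝓡∂ 2) x₀).symm s.1, s.2) := by
    erw [FiberBundle.extChartAt]
    rfl
  rw [h, chartPt, Trivialization.symmL_apply _ (symm_mem_baseSet hs)]
  exact (triv x₀).mk_symm (symm_mem_baseSet hs) s.2

lemma chartCo_eq (p : TangentBundle (𝓡∂ 2) M) (hp : p.1 ∈ (extChartAt (𝓡∂ 2) x₀).source) :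
    chartCo x₀ p = extChartAt (𝓡∂ 2).tangent (⟨x₀, 0⟩ : TangentBundle (𝓡∂ 2) M) p := by
  have h : extChartAt (𝓡∂ 2).tangent (⟨x₀, 0⟩ : TangentBundle (𝓡∂ 2) M) p =
      (extChartAt (𝓡∂ 2) x₀ (triv x₀ p).1, (triv x₀ p).2) := by
    erw [FiberBundle.extChartAt]
    rfl
  rw [h, chartCo, (triv x₀).coe_fst' (mem_baseSet_of_mem hp)]

lemma extChartAt_tangent_target :
    (extChartAt (𝓡∂ 2).tangent (⟨x₀, 0⟩ : TangentBundle (𝓡∂ 2) M)).target = chartDom x₀ ×ˢ univ := by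
  refine (FiberBundle.extChartAt_target (IB := 𝓡∂ 2) (⟨x₀, 0⟩ : TangentBundle (𝓡∂ 2) M)).trans ?_
  congr 1
  exact inter_eq_left.2 fun y hy => symm_mem_baseSet hy

lemma chartCo_chartPt {s : E2 × E2} (hs : s.1 ∈ chartDom x₀) : chartCo x₀ (chartPt x₀ s) = s := by
  have hs' : s ∈ (extChartAt (𝓡∂ 2).tangent (⟨x₀, 0⟩ : TangentBundle (𝓡∂ 2) M)).target := by
    rw [extChartAt_tangent_target]; exact ⟨hs, mem_univ _⟩
  have h1 : (chartPt x₀ s).1 ∈ (extChartAt (𝓡∂ 2) x₀).source := (extChartAt (𝓡∂ 2) x₀).map_target hs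
  rw [chartCo_eq _ h1, chartPt_eq hs]
  exact PartialEquiv.right_inv _ hs'

lemma chartPt_chartCo {p : TangentBundle (𝓡∂ 2) M} (hp : p.1 ∈ (extChartAt (𝓡∂ 2) x₀).source) :
    chartPt x₀ (chartCo x₀ p) = p := by
  have h1 : (chartCo x₀ p).1 ∈ chartDom x₀ := (extChartAt (𝓡∂ 2) x₀).map_source hp
  have h2 : (extChartAt (𝓡∂ 2) x₀).symm (extChartAt (𝓡∂ 2) x₀ p.1) = p.1 :=
    (extChartAt (𝓡∂ 2) x₀).left_inv hp
  rw [chartPt_eq h1, chartCo_eq p hp]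
  refine PartialEquiv.left_inv _ ?_
  rw [extChartAt_source, TangentBundle.mem_chart_source_iff]
  simpa using hp

lemma contMDiffOn_chartPt :
    ContMDiffOn 𝓘(ℝ, E2 × E2) (𝓡∂ 2).tangent ∞ (chartPt x₀) (chartDom x₀ ×ˢ univ) := by
  have h := contMDiffOn_extChartAt_symm (I := (𝓡∂ 2).tangent) (n := ∞) (⟨x₀, 0⟩ : TangentBundle (𝓡∂ 2) M)
  rw [extChartAt_tangent_target] at h
  exact h.congr fun s hs => chartPt_eq hs.1

lemma contMDiffOn_chartCo : ContMDiffOn (𝓡∂ 2).tangent 𝓘(ℝ, E2 × E2) ∞ (chartCo x₀)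
    (TotalSpace.proj ⁻¹' (extChartAt (𝓡∂ 2) x₀).source) := by
  have h := contMDiffOn_extChartAt (I := (𝓡∂ 2).tangent) (n := ∞) (x := (⟨x₀, 0⟩ : TangentBundle (𝓡∂ 2) M))
  refine (h.mono fun p hp => ?_).congr fun p hp => chartCo_eq p hp
  rw [TangentBundle.mem_chart_source_iff]
  simpa using hp

lemma uniqueDiffOn_chartDom : UniqueDiffOn ℝ (chartDom x₀) := uniqueDiffOn_extChartAt_target x₀

lemma isOpen_proj_source : IsOpen ((TotalSpace.proj : TangentBundle (𝓡∂ 2) M → M) ⁻¹'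
    (extChartAt (𝓡∂ 2) x₀).source) :=
  (isOpen_extChartAt_source x₀).preimage (FiberBundle.continuous_proj E2 (TangentSpace (𝓡∂ 2)))

lemma symmL_eq_zero_iff {x : M} (hx : x ∈ (triv x₀).baseSet) {v : E2} :
    (triv x₀).symmL ℝ x v = 0 ↔ v = 0 := by
  refine ⟨fun h => ?_, fun h => by rw [h, map_zero]⟩
  have := (triv x₀).continuousLinearMapAt_symmL (R := ℝ) hx v
  rw [h, map_zero] at this
  exact this.symm

lemma chartPt_ne_zero_iff {s : E2 × E2} (hs : s.1 ∈ chartDom x₀) : (chartPt x₀ s).2 ≠ 0 ↔ s.2 ≠ 0 :=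
  (symmL_eq_zero_iff (symm_mem_baseSet hs)).not

variable (x₀) in
/-- The domain of the local representation of functions on `SM × 𝔻`. -/
def repDom : Set ((E2 × E2) × ℂ) := (chartDom x₀ ×ˢ {0}ᶜ) ×ˢ Metric.closedBall (0 : ℂ) 1

lemma uniqueDiffOn_repDom : UniqueDiffOn ℝ (repDom x₀) :=
  (uniqueDiffOn_chartDom.prod isOpen_compl_singleton.uniqueDiffOn).prod
    (uniqueDiffOn_convex (convex_closedBall 0 1) (by
      rw [interior_closedBall _ one_ne_zero]; exact Metric.nonempty_ball.2 one_pos))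

variable [RiemannianBundle (fun x : M => TangentSpace (𝓡∂ 2) x)]

variable (x₀) in
/-- The local representation of a function on `SM × 𝔻`. -/
def rep (h : SM M × Disk → ℂ) (s : (E2 × E2) × ℂ) : ℂ := homExtD h (chartPt x₀ s.1, s.2)

lemma SmoothSMD.contDiffOn_rep {h : SM M × Disk → ℂ} (hh : SmoothSMD h) :
    ContDiffOn ℝ ∞ (rep x₀ h) (repDom x₀) := by
  have h1 : ContMDiffOn 𝓘(ℝ, (E2 × E2) × ℂ) ((𝓡∂ 2).tangent.prod 𝓘(ℝ, ℂ)) ∞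
      (fun s : (E2 × E2) × ℂ => (chartPt x₀ s.1, s.2)) (repDom x₀) :=
    ContMDiffOn.prodMk (contMDiffOn_chartPt.comp contDiff_fst.contMDiff.contMDiffOn
      fun s hs => ⟨hs.1.1, mem_univ _⟩) contDiff_snd.contMDiff.contMDiffOn
  exact (ContMDiffOn.comp hh h1 fun s hs => ⟨(chartPt_ne_zero_iff hs.1.1).2 hs.1.2, hs.2⟩).contDiffOn

/-- Smoothness need only be checked in the chart at each point. -/
lemma smoothSMD_of_contDiffWithinAt {h : SM M × Disk → ℂ}
    (hh : ∀ (x₀ : M) (v : E2), v ≠ 0 → ∀ w ∈ Metric.closedBall (0 : ℂ) 1,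
      ContDiffWithinAt ℝ ∞ (rep x₀ h) (repDom x₀) ((extChartAt (𝓡∂ 2) x₀ x₀, v), w)) : SmoothSMD h := by
  rintro ⟨p, w⟩ ⟨hp, hw⟩
  let U : Set (TangentBundle (𝓡∂ 2) M × ℂ) := (TotalSpace.proj ⁻¹' (extChartAt (𝓡∂ 2) p.1).source) ×ˢ univ
  let S : Set (TangentBundle (𝓡∂ 2) M × ℂ) := {p | p.2 ≠ 0} ×ˢ Metric.closedBall (0 : ℂ) 1
  have hU : U ∈ 𝓝 (p, w) := (isOpen_proj_source.prod isOpen_univ).mem_nhds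
    ⟨mem_extChartAt_source (I := 𝓡∂ 2) p.1, mem_univ _⟩
  have hUS : (p, w) ∈ U ∩ S := ⟨mem_of_mem_nhds hU, hp, hw⟩
  have hco : ∀ q ∈ U ∩ S, (chartCo p.1 q.1, q.2) ∈ repDom p.1 := fun q hq => by
    refine ⟨⟨(extChartAt (𝓡∂ 2) p.1).map_source hq.1.1, ?_⟩, hq.2.2⟩
    have h4 := (chartPt_ne_zero_iff (x₀ := p.1) (s := chartCo p.1 q.1)
      ((extChartAt (𝓡∂ 2) p.1).map_source hq.1.1)).1
    rw [chartPt_chartCo hq.1.1] at h4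
    exact h4 hq.2.1
  have h1 : ContMDiffOn ((𝓡∂ 2).tangent.prod 𝓘(ℝ, ℂ)) 𝓘(ℝ, (E2 × E2) × ℂ) ∞
      (fun q : TangentBundle (𝓡∂ 2) M × ℂ => (chartCo p.1 q.1, q.2)) U :=
    ContMDiffOn.prodMk_space (contMDiffOn_chartCo.comp contMDiff_fst.contMDiffOn fun q hq => hq.1)
      contMDiff_snd.contMDiffOn
  have h2 := (hh p.1 _ (hco _ hUS).1.2 w hw).contMDiffWithinAt.comp (p, w)
    ((h1 (p, w) hUS.1).mono (inter_subset_left : U ∩ S ⊆ U)) hco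
  have h3 := h2.congr (f₁ := homExtD h) (fun q hq => by
    simp only [Function.comp, rep]
    rw [chartPt_chartCo hq.1.1]) (by
    simp only [Function.comp, rep]
    rw [chartPt_chartCo hUS.1.1])
  rw [inter_comm] at h3
  exact h3.mono_of_mem_nhdsWithin
    (Filter.inter_mem self_mem_nhdsWithin (mem_nhdsWithin_of_mem_nhds hU))

/-- Functions on `SM` are treated as functions on `SM × 𝔻` independent of the disk variable, so that
one local theory serves both. -/
lemma smoothSM_iff {u : SM M → ℂ} : SmoothSM u ↔ SmoothSMD fun q => u q.1 := by
  constructor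
  · intro hu
    have h1 : ContMDiffOn ((𝓡∂ 2).tangent.prod 𝓘(ℝ, ℂ)) 𝓘(ℝ, ℂ) ∞
        (fun q : TangentBundle (𝓡∂ 2) M × ℂ => homExt u q.1)
        ({p | p.2 ≠ 0} ×ˢ Metric.closedBall (0 : ℂ) 1) :=
      ContMDiffOn.comp hu contMDiff_fst.contMDiffOn fun q hq => hq.1
    refine h1.congr fun q hq => ?_
    rw [homExtD_of_mem _ hq, homExt, dif_pos (show q.1.2 ≠ 0 from hq.1)]
  · intro hu
    exact hu.slice ⟨0, by simp⟩

end LocalCoordinates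

end Twistor

end

/-! ### The metric, normalisation and the right-angle rotation in a chart. -/

noncomputable section

namespace Twistor

open MeasureTheory Complex Set

section LocalMetric

variable {M : Type*} [TopologicalSpace M] [ChartedSpace (EuclideanHalfSpace 2) M]
  [IsManifold (𝓡∂ 2) ∞ M] [RiemannianBundle (fun x : M => TangentSpace (𝓡∂ 2) x)]
  {x₀ : M}

variable (x₀) in
/-- The linear isomorphism from coordinates to tangent vectors in the chart at `x₀`. -/
abbrev frameCLM (y : E2) : E2 →L[ℝ] TangentSpace (𝓡∂ 2) ((extChartAt (𝓡∂ 2) x₀).symm y) :=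
  (triv x₀).symmL ℝ ((extChartAt (𝓡∂ 2) x₀).symm y)

variable (x₀) in
/-- The metric in the chart at `x₀`. -/
def metricIn (y : E2) : E2 →L[ℝ] E2 →L[ℝ] ℝ :=
  (innerSL ℝ).bilinearComp (frameCLM x₀ y) (frameCLM x₀ y)

lemma metricIn_apply (y a b : E2) :
    metricIn x₀ y a b = inner ℝ (frameCLM x₀ y a) (frameCLM x₀ y b) := rfl

lemma metricIn_comm (y a b : E2) : metricIn x₀ y a b = metricIn x₀ y b a := by
  rw [metricIn_apply, metricIn_apply, real_inner_comm]

lemma metricIn_self (y a : E2) : metricIn x₀ y a a = ‖frameCLM x₀ y a‖ ^ 2 := by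
  rw [metricIn_apply, real_inner_self_eq_norm_sq]

lemma metricIn_self_pos {y : E2} (hy : y ∈ chartDom x₀) {a : E2} (ha : a ≠ 0) :
    0 < metricIn x₀ y a a := by
  rw [metricIn_self]
  have h : frameCLM x₀ y a ≠ 0 := (symmL_eq_zero_iff (symm_mem_baseSet hy)).not.2 ha
  positivity

lemma normalize_chartPt {s : E2 × E2} (hs : (chartPt x₀ s).2 ≠ 0) :
    (normalize (chartPt x₀ s) hs).1 = chartPt x₀ (s.1, (√(metricIn x₀ s.1 s.2 s.2))⁻¹ • s.2) := by
  rw [metricIn_self, Real.sqrt_sq (norm_nonneg _)]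
  simp only [normalize, chartPt, map_smul]
  rfl

variable [IsContMDiffRiemannianBundle (𝓡∂ 2) ∞ E2 (fun x : M => TangentSpace (𝓡∂ 2) x)]

lemma contDiffOn_metricIn : ContDiffOn ℝ ∞ (metricIn x₀) (chartDom x₀) := by
  refine contDiffOn_clm_apply.2 fun a => contDiffOn_clm_apply.2 fun b => ?_
  have h : ∀ c : E2, ContMDiffOn 𝓘(ℝ, E2) (𝓡∂ 2).tangent ∞ (fun y => chartPt x₀ (y, c)) (chartDom x₀) :=
    fun c => contMDiffOn_chartPt.comp (contDiff_id.prodMk contDiff_const).contMDiff.contMDiffOn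
      fun y hy => ⟨hy, mem_univ _⟩
  have h2 := ContMDiffOn.inner_bundle (IB := 𝓡∂ 2) (F := E2) (E := fun x : M => TangentSpace (𝓡∂ 2) x)
    (b := fun y => (extChartAt (𝓡∂ 2) x₀).symm y)
    (v := fun y => frameCLM x₀ y a) (w := fun y => frameCLM x₀ y b) (h a) (h b)
  exact h2.contDiffOn

lemma contDiffOn_metricIn_apply {S : Set (E2 × E2)} (hS : ∀ s ∈ S, s.1 ∈ chartDom x₀) {a b : E2 × E2 → E2}
    (ha : ContDiffOn ℝ ∞ a S) (hb : ContDiffOn ℝ ∞ b S) :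
    ContDiffOn ℝ ∞ (fun s => metricIn x₀ s.1 (a s) (b s)) S :=
  ((contDiffOn_metricIn.comp contDiff_fst.contDiffOn hS).clm_apply ha).clm_apply hb

variable (x₀) in
/-- Normalisation of a tangent vector, in coordinates. -/
def normCo (s : E2 × E2) : E2 × E2 := (s.1, (√(metricIn x₀ s.1 s.2 s.2))⁻¹ • s.2)

lemma contDiffOn_normCo : ContDiffOn ℝ ∞ (normCo x₀) (chartDom x₀ ×ˢ {0}ᶜ) := by
  have h1 : ContDiffOn ℝ ∞ (fun s : E2 × E2 => metricIn x₀ s.1 s.2 s.2) (chartDom x₀ ×ˢ {0}ᶜ) :=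
    contDiffOn_metricIn_apply (fun s hs => hs.1) contDiff_snd.contDiffOn contDiff_snd.contDiffOn
  refine contDiff_fst.contDiffOn.prodMk (ContDiffOn.smul (ContDiffOn.inv (h1.sqrt ?_) ?_) contDiff_snd.contDiffOn)
  · exact fun s hs => (metricIn_self_pos hs.1 hs.2).ne'
  · exact fun s hs => (Real.sqrt_pos.2 (metricIn_self_pos hs.1 hs.2)).ne'

lemma normCo_mem {s : E2 × E2} (hs : s ∈ chartDom x₀ ×ˢ {0}ᶜ) : normCo x₀ s ∈ chartDom x₀ ×ˢ {0}ᶜ :=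
  ⟨hs.1, smul_ne_zero (inv_ne_zero (Real.sqrt_pos.2 (metricIn_self_pos hs.1 hs.2)).ne') hs.2⟩

/-- A function on `SM × 𝔻` is smooth if it is locally given by smooth functions of the coordinates. -/
lemma smoothSMD_of_local {h : SM M × Disk → ℂ} (hh : ∀ x₀ : M, ∃ H : (E2 × E2) × ℂ → ℂ,
    (∀ v : E2, v ≠ 0 → ∀ w ∈ Metric.closedBall (0 : ℂ) 1,
      ContDiffWithinAt ℝ ∞ H (repDom x₀) ((extChartAt (𝓡∂ 2) x₀ x₀, v), w)) ∧
    ∀ q : SM M × Disk, q.1.1.1 ∈ (extChartAt (𝓡∂ 2) x₀).source →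
      h q = H (chartCo x₀ q.1.1, q.2.1)) : SmoothSMD h := by
  refine smoothSMD_of_contDiffWithinAt fun x₀ v hv w hw => ?_
  obtain ⟨H, hH, hq⟩ := hh x₀
  have h1 : ContDiffOn ℝ ∞ (fun s : (E2 × E2) × ℂ => (normCo x₀ s.1, s.2)) (repDom x₀) :=
    (contDiffOn_normCo.comp contDiff_fst.contDiffOn fun s hs => hs.1).prodMk contDiff_snd.contDiffOn
  have hmem : ((extChartAt (𝓡∂ 2) x₀ x₀, v), w) ∈ repDom x₀ := ⟨⟨mem_extChartAt_target x₀, hv⟩, hw⟩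
  -- The representation is constant along rays, so it is `H` precomposed with the normalisation in
  -- coordinates.
  have key : ∀ s ∈ repDom x₀, rep x₀ h s = H (normCo x₀ s.1, s.2) := fun s hs => by
    have hs' : (chartPt x₀ s.1).2 ≠ 0 := (chartPt_ne_zero_iff hs.1.1).2 hs.1.2
    rw [rep, homExtD_of_mem h (q := (chartPt x₀ s.1, s.2)) ⟨hs', hs.2⟩,
      hq _ ((extChartAt (𝓡∂ 2) x₀).map_target hs.1.1)]
    simp only
    rw [normalize_chartPt hs', ← normCo, chartCo_chartPt (normCo_mem hs.1).1]
  have h2 : ContDiffWithinAt ℝ ∞ H (repDom x₀) (normCo x₀ (extChartAt (𝓡∂ 2) x₀ x₀, v), w) :=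
    hH _ (normCo_mem (s := (extChartAt (𝓡∂ 2) x₀ x₀, v)) hmem.1).2 w hw
  have h3 := ContDiffWithinAt.comp ((extChartAt (𝓡∂ 2) x₀ x₀, v), w)
    (f := fun s : (E2 × E2) × ℂ => (normCo x₀ s.1, s.2)) (t := repDom x₀) h2 (h1 _ hmem)
    fun s hs => ⟨normCo_mem hs.1, hs.2⟩
  exact h3.congr key (key _ hmem)

lemma rep_chartCo (h : SM M × Disk → ℂ) (q : SM M × Disk) (hq : q.1.1.1 ∈ (extChartAt (𝓡∂ 2) x₀).source) :
    rep x₀ h (chartCo x₀ q.1.1, q.2.1) = h q := by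
  rw [rep]
  simp only
  rw [chartPt_chartCo hq, homExtD_of_mem h (q := (q.1.1, q.2.1)) ⟨SM.ne_zero q.1, q.2.2⟩]
  congr 2
  apply Subtype.ext
  have := q.1.2
  simp [normalize, this]

lemma chartCo_mem (p : SM M) (hp : p.1.1 ∈ (extChartAt (𝓡∂ 2) x₀).source) :
    chartCo x₀ p.1 ∈ chartDom x₀ ×ˢ {0}ᶜ := by
  refine ⟨(extChartAt (𝓡∂ 2) x₀).map_source hp, ?_⟩
  have h := (chartPt_ne_zero_iff (s := chartCo x₀ p.1) ((extChartAt (𝓡∂ 2) x₀).map_source hp)).1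
  rw [chartPt_chartCo hp] at h
  exact h (SM.ne_zero p)

end LocalMetric

section LocalRotation

variable {M : Type*} [TopologicalSpace M] [ChartedSpace (EuclideanHalfSpace 2) M]
  [IsManifold (𝓡∂ 2) ∞ M] [RiemannianBundle (fun x : M => TangentSpace (𝓡∂ 2) x)]
  (o : SurfaceOrientation M) {x₀ : M}

/-- It translates an orientation, given as a class of bases, into the sign of the area form. -/
lemma areaForm_pos_iff {V : Type*} [NormedAddCommGroup V] [InnerProductSpace ℝ V]
    [Fact (Module.finrank ℝ V = 2)] (o : Orientation ℝ V (Fin 2)) (b : Module.Basis (Fin 2) ℝ V) :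
    0 < o.areaForm (b 0) (b 1) ↔ b.orientation = o := by
  have h2 : Module.finrank ℝ V = 2 := Fact.out
  let c := o.finOrthonormalBasis two_pos h2
  have hc : c.toBasis.orientation = o := o.finOrthonormalBasis_orientation two_pos h2
  rw [o.areaForm_to_volumeForm, o.volumeForm_robust c hc, ← hc, eq_comm,
    Module.Basis.orientation_eq_iff_det_pos]
  have : ![b 0, b 1] = b := by ext i; fin_cases i <;> rfl
  rw [this]

/-- The rotation by a right angle, from two vectors and their inner products. -/
lemma areaForm_smul_rightAngleRotation {V : Type*} [NormedAddCommGroup V] [InnerProductSpace ℝ V]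
    [Fact (Module.finrank ℝ V = 2)] (o : Orientation ℝ V (Fin 2)) (a b c : V) :
    o.areaForm a b • o.rightAngleRotation c = inner ℝ a c • b - inner ℝ b c • a := by
  by_cases ha : a = 0
  · simp [ha]
  refine ext_inner_right ℝ fun d => ?_
  have ha' : ‖a‖ ^ 2 ≠ 0 := by positivity
  refine mul_left_cancel₀ ha' ?_
  rw [inner_sub_left, real_inner_smul_left, real_inner_smul_left, real_inner_smul_left,
    o.inner_rightAngleRotation_left]
  linear_combination (-o.areaForm a b) * o.inner_mul_areaForm_sub a c d +
    inner ℝ a c * o.inner_mul_inner_add_areaForm_mul_areaForm a b d -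
    inner ℝ a d * o.inner_mul_inner_add_areaForm_mul_areaForm a b c

variable (x₀) in
/-- The rotation by a right angle in the chart at `x₀`. -/
def rotIn (y : E2) : E2 →L[ℝ] E2 :=
  LinearMap.toContinuousLinearMap
    (((triv x₀).linearMapAt ℝ ((extChartAt (𝓡∂ 2) x₀).symm y)) ∘ₗ
      ((o.at' ((extChartAt (𝓡∂ 2) x₀).symm y)).rightAngleRotation.toLinearEquiv.toLinearMap) ∘ₗ
      ((triv x₀).symmₗ ℝ ((extChartAt (𝓡∂ 2) x₀).symm y)))

lemma frameCLM_rotIn {y : E2} (hy : y ∈ chartDom x₀) (v : E2) : frameCLM x₀ y (rotIn o x₀ y v) =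
    (o.at' ((extChartAt (𝓡∂ 2) x₀).symm y)).rightAngleRotation (frameCLM x₀ y v) :=
  (triv x₀).symmₗ_linearMapAt (symm_mem_baseSet hy) _

lemma frameCLM_injective {y : E2} (hy : y ∈ chartDom x₀) : Function.Injective (frameCLM x₀ y) :=
  (injective_iff_map_eq_zero _).2 fun _ h => (symmL_eq_zero_iff (symm_mem_baseSet hy)).1 h

lemma rotIn_rotIn {y : E2} (hy : y ∈ chartDom x₀) (v : E2) : rotIn o x₀ y (rotIn o x₀ y v) = -v := by
  apply frameCLM_injective hy
  rw [frameCLM_rotIn o hy, frameCLM_rotIn o hy, Orientation.rightAngleRotation_rightAngleRotation, map_neg]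

lemma metricIn_rotIn {y : E2} (hy : y ∈ chartDom x₀) (v w : E2) :
    metricIn x₀ y (rotIn o x₀ y v) (rotIn o x₀ y w) = metricIn x₀ y v w := by
  rw [metricIn_apply, frameCLM_rotIn o hy, frameCLM_rotIn o hy, Orientation.inner_comp_rightAngleRotation,
    metricIn_apply]

/-- The area form in the chart at `x₀` on the standard basis. -/
lemma exists_areaForm_eq (x₀ : M) : ∃ s : ℝ, s ^ 2 = 1 ∧ ∀ᶠ y in 𝓝[chartDom x₀] (extChartAt (𝓡∂ 2) x₀ x₀),
    (o.at' ((extChartAt (𝓡∂ 2) x₀).symm y)).areaForm (frameCLM x₀ y (EuclideanSpace.single 0 1))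
      (frameCLM x₀ y (EuclideanSpace.single 1 1)) =
    s * √(metricIn x₀ y (EuclideanSpace.single 0 1) (EuclideanSpace.single 0 1) *
      metricIn x₀ y (EuclideanSpace.single 1 1) (EuclideanSpace.single 1 1) -
      metricIn x₀ y (EuclideanSpace.single 0 1) (EuclideanSpace.single 1 1) ^ 2) := by
  obtain ⟨ξ, hξ⟩ := o.locallyConstant x₀
  let b : Module.Basis (Fin 2) ℝ E2 := (EuclideanSpace.basisFun (Fin 2) ℝ).toBasis
  have hb : ∀ i, b i = EuclideanSpace.single i 1 := fun i => by simp [b]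
  have hc : Filter.Tendsto (extChartAt (𝓡∂ 2) x₀).symm (𝓝[chartDom x₀] (extChartAt (𝓡∂ 2) x₀ x₀)) (𝓝 x₀) := by
    have h := (continuousOn_extChartAt_symm (I := 𝓡∂ 2) x₀ _ (mem_extChartAt_target x₀)).tendsto
    rwa [extChartAt_to_inv] at h
  classical
  -- By local constancy of the orientation, the comparison with the standard basis has the same
  -- outcome at all nearby points. This outcome is the sign of the area form, whose absolute value
  -- is the square root of the Gram determinant.
  refine ⟨if b.orientation = ξ then 1 else -1, by split_ifs <;> norm_num, ?_⟩
  filter_upwards [hc.eventually hξ, self_mem_nhdsWithin] with y ⟨hx, hy'⟩ hy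
  let e := (triv x₀).linearEquivAt ℝ _ hx
  let c : Module.Basis (Fin 2) ℝ (TangentSpace (𝓡∂ 2) ((extChartAt (𝓡∂ 2) x₀).symm y)) := b.map e.symm
  have hcb : ∀ i, c i = frameCLM x₀ y (EuclideanSpace.single i 1) := fun i => by
    simp only [c, Module.Basis.map_apply, hb]
    rw [LinearEquiv.symm_apply_eq]
    exact ((triv x₀).continuousLinearMapAt_symmL (R := ℝ) hx _).symm.trans
      (congrFun ((triv x₀).coe_linearMapAt_of_mem (R := ℝ) hx) _)
  have hsq := (o.at' ((extChartAt (𝓡∂ 2) x₀).symm y)).inner_sq_add_areaForm_sq (c 0) (c 1)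
  have hpos := areaForm_pos_iff (o.at' ((extChartAt (𝓡∂ 2) x₀).symm y)) c
  have hor : c.orientation = o.at' ((extChartAt (𝓡∂ 2) x₀).symm y) ↔ b.orientation = ξ := by
    rw [← hy', Module.Basis.orientation_map]
    constructor
    · intro h
      rw [← h, ← Orientation.map_symm, Equiv.apply_symm_apply]
    · intro h
      rw [h, ← Orientation.map_symm, Equiv.symm_apply_apply]
  rw [hor] at hpos
  rw [hcb, hcb] at hsq hpos
  rw [← metricIn_apply, ← metricIn_self, ← metricIn_self] at hsq
  rw [← eq_sub_iff_add_eq'] at hsq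
  rw [← hsq, Real.sqrt_sq_eq_abs]
  split_ifs with h
  · rw [one_mul, abs_of_pos (hpos.2 h)]
  · rw [abs_of_nonpos (not_lt.1 (hpos.not.2 h)), neg_mul_neg, one_mul]

variable [IsContMDiffRiemannianBundle (𝓡∂ 2) ∞ E2 (fun x : M => TangentSpace (𝓡∂ 2) x)]

/-- The rotation by a right angle is smooth. -/
lemma exists_contDiffOn_rotIn (x₀ : M) : ∃ V : Set E2, IsOpen V ∧ extChartAt (𝓡∂ 2) x₀ x₀ ∈ V ∧
    ContDiffOn ℝ ∞ (rotIn o x₀) (chartDom x₀ ∩ V) := by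
  obtain ⟨s, hs, h⟩ := exists_areaForm_eq o x₀
  obtain ⟨V, hV, hxV, hVs⟩ := mem_nhdsWithin.1 h
  refine ⟨V, hV, hxV, ?_⟩
  let b : Fin 2 → E2 := fun i => EuclideanSpace.single i 1
  let d : E2 → ℝ := fun y => metricIn x₀ y (b 0) (b 0) * metricIn x₀ y (b 1) (b 1) - metricIn x₀ y (b 0) (b 1) ^ 2
  have hm : ∀ v w : E2, ContDiffOn ℝ ∞ (fun y => metricIn x₀ y v w) (chartDom x₀ ∩ V) := fun v w =>
    ((contDiffOn_metricIn.clm_apply contDiffOn_const).clm_apply contDiffOn_const).mono inter_subset_left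
  have hb : ∀ y ∈ chartDom x₀, (o.at' ((extChartAt (𝓡∂ 2) x₀).symm y)).areaForm (frameCLM x₀ y (b 0))
      (frameCLM x₀ y (b 1)) ≠ 0 := by
    intro y hy h0
    have h1 := areaForm_smul_rightAngleRotation (o.at' ((extChartAt (𝓡∂ 2) x₀).symm y))
      (frameCLM x₀ y (b 0)) (frameCLM x₀ y (b 1)) (frameCLM x₀ y (b 0))
    rw [h0, zero_smul, ← map_smul, ← map_smul, ← map_sub, eq_comm, symmL_eq_zero_iff (symm_mem_baseSet hy),
      ← metricIn_apply, ← metricIn_apply] at h1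
    have h2 : metricIn x₀ y (b 0) (b 0) = 0 := by simpa [b] using congrArg (fun v : E2 => v 1) h1
    have h3 : b 0 ≠ 0 := fun h => by simpa [b] using congrArg (fun v : E2 => v 0) h
    exact (metricIn_self_pos hy h3).ne' h2
  have hd : ∀ y ∈ chartDom x₀ ∩ V, s * √(d y) ≠ 0 := fun y hy => by
    have h1 := hVs ⟨hy.2, hy.1⟩
    exact h1 ▸ hb y hy.1
  have hd' : ∀ y ∈ chartDom x₀ ∩ V, d y ≠ 0 := fun y hy h0 => by
    apply hd y hy
    rw [h0, Real.sqrt_zero, mul_zero]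
  refine contDiffOn_clm_apply.2 fun v => ?_
  -- The rotation is expressed by inner products with a basis, divided by the area form. The latter
  -- is the constant sign times a square root of a smooth positive function, so the formula is
  -- visibly smooth.
  have hform : ∀ y ∈ chartDom x₀ ∩ V, rotIn o x₀ y v =
      (s * √(d y))⁻¹ • (metricIn x₀ y (b 0) v • b 1 - metricIn x₀ y (b 1) v • b 0) := by
    intro y hy
    have h1 := areaForm_smul_rightAngleRotation (o.at' ((extChartAt (𝓡∂ 2) x₀).symm y))
      (frameCLM x₀ y (b 0)) (frameCLM x₀ y (b 1)) (frameCLM x₀ y v)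
    rw [← metricIn_apply, ← metricIn_apply, ← frameCLM_rotIn o hy.1,
      ← (frameCLM x₀ y).map_smul, ← (frameCLM x₀ y).map_smul, ← (frameCLM x₀ y).map_smul,
      ← (frameCLM x₀ y).map_sub] at h1
    rw [← frameCLM_injective hy.1 h1]
    have h2 : (o.at' ((extChartAt (𝓡∂ 2) x₀).symm y)).areaForm (frameCLM x₀ y (b 0))
      (frameCLM x₀ y (b 1)) = s * √(d y) := hVs ⟨hy.2, hy.1⟩
    rw [h2, inv_smul_smul₀ (hd y hy)]
  refine ContDiffOn.congr ?_ hform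
  have hsq : ContDiffOn ℝ ∞ (fun y => (s * √(d y))⁻¹) (chartDom x₀ ∩ V) :=
    (contDiffOn_const.mul ((((hm _ _).mul (hm _ _)).sub ((hm _ _).pow 2)).sqrt hd')).inv hd
  exact hsq.smul (((hm _ _).smul contDiffOn_const).sub ((hm _ _).smul contDiffOn_const))

end LocalRotation

end Twistor

end

/-! ### Vertical Fourier modes in charts, and smoothness of the mode series. -/

noncomputable section

namespace Twistor

open MeasureTheory Complex Set

section FourierSeries

variable {M : Type*} [TopologicalSpace M] [ChartedSpace (EuclideanHalfSpace 2) M]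
  [IsManifold (𝓡∂ 2) ∞ M] [RiemannianBundle (fun x : M => TangentSpace (𝓡∂ 2) x)]
  (o : SurfaceOrientation M) {x₀ : M}

/-- The rotation of tangent vectors by an angle. -/
def rotT (θ : Real.Angle) (p : TangentBundle (𝓡∂ 2) M) : TangentBundle (𝓡∂ 2) M :=
  ⟨p.1, (o.at' p.1).rotation θ p.2⟩

variable (x₀) in
/-- The rotation by an angle in the chart at `x₀`. -/
def rotCo (θ : Real.Angle) (s : E2 × E2) : E2 × E2 := (s.1, θ.cos • s.2 + θ.sin • rotIn o x₀ s.1 s.2)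

lemma chartPt_rotCo (θ : Real.Angle) {s : E2 × E2} (hs : s.1 ∈ chartDom x₀) :
    chartPt x₀ (rotCo o x₀ θ s) = rotT o θ (chartPt x₀ s) := by
  refine congrArg (TotalSpace.mk (E := fun x : M => TangentSpace (𝓡∂ 2) x) ((extChartAt (𝓡∂ 2) x₀).symm s.1))
    (?_ : frameCLM x₀ s.1 (θ.cos • s.2 + θ.sin • rotIn o x₀ s.1 s.2) =
      (o.at' ((extChartAt (𝓡∂ 2) x₀).symm s.1)).rotation θ (frameCLM x₀ s.1 s.2))
  rw [Orientation.rotation_apply, map_add, map_smul, map_smul, frameCLM_rotIn o hs]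

lemma chartCo_rot (θ : Real.Angle) (p : SM M) (hp : p.1.1 ∈ (extChartAt (𝓡∂ 2) x₀).source) :
    chartCo x₀ (rot o θ p).1 = rotCo o x₀ θ (chartCo x₀ p.1) := by
  have hs : (chartCo x₀ p.1).1 ∈ chartDom x₀ := (extChartAt (𝓡∂ 2) x₀).map_source hp
  have h1 : (rot o θ p).1 = rotT o θ (chartPt x₀ (chartCo x₀ p.1)) := by rw [chartPt_chartCo hp]; rfl
  rw [h1, ← chartPt_rotCo o θ hs, chartCo_chartPt (s := rotCo o x₀ θ (chartCo x₀ p.1)) hs]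

lemma rotCo_mem (θ : Real.Angle) {s : E2 × E2} (hs : s ∈ chartDom x₀ ×ˢ {0}ᶜ) :
    rotCo o x₀ θ s ∈ chartDom x₀ ×ˢ {0}ᶜ := by
  refine ⟨hs.1, ?_⟩
  have h := (chartPt_ne_zero_iff (s := rotCo o x₀ θ s) hs.1).1
  rw [chartPt_rotCo o θ hs.1] at h
  refine h fun h0 => (chartPt_ne_zero_iff hs.1).2 hs.2 ?_
  exact ((o.at' (chartPt x₀ s).1).rotation θ).map_eq_zero_iff.1 h0

/-- Compact convex neighbourhoods in the chart. -/
lemma exists_compact_convex_nhd (x₀ : M) {V : Set E2} (hV : IsOpen V) (hx : extChartAt (𝓡∂ 2) x₀ x₀ ∈ V)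
    {v : E2} (hv : v ≠ 0) : ∃ K : Set (E2 × E2), IsCompact K ∧ Convex ℝ K ∧ (interior K).Nonempty ∧
      K ⊆ (chartDom x₀ ∩ V) ×ˢ {0}ᶜ ∧ (extChartAt (𝓡∂ 2) x₀ x₀, v) ∈ K ∧
      K ∈ 𝓝[chartDom x₀ ×ˢ {0}ᶜ] (extChartAt (𝓡∂ 2) x₀ x₀, v) := by
  set y := extChartAt (𝓡∂ 2) x₀ x₀ with hy
  obtain ⟨W, hW, hyW, hWs⟩ := mem_nhdsWithin.1 (extChartAt_target_mem_nhdsWithin (I := 𝓡∂ 2) x₀)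
  have h1 : (W ∩ V) ×ˢ ({0}ᶜ : Set E2) ∈ 𝓝 (y, v) :=
    ((hW.inter hV).prod isOpen_compl_singleton).mem_nhds ⟨⟨hyW, hx⟩, hv⟩
  obtain ⟨r, hr, hrs⟩ := Metric.nhds_basis_closedBall.mem_iff.1 h1
  have hyR : y ∈ range (𝓡∂ 2) := extChartAt_target_subset_range x₀ (mem_extChartAt_target x₀)
  -- Intersecting with the range of the model keeps convexity at boundary points. The interior is
  -- nonempty because that range is contained in the closure of its interior.
  refine ⟨Metric.closedBall (y, v) r ∩ (range (𝓡∂ 2) ×ˢ univ), ?_, ?_, ?_, ?_, ?_, ?_⟩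
  · exact (isCompact_closedBall _ _).inter_right ((𝓡∂ 2).isClosed_range.prod isClosed_univ)
  · exact (convex_closedBall _ _).inter ((𝓡∂ 2).convex_range.prod convex_univ)
  · obtain ⟨z, hz, hzr⟩ := Metric.mem_closure_iff.1 ((𝓡∂ 2).range_subset_closure_interior hyR) r hr
    refine ⟨(z, v), mem_interior.2 ⟨Metric.ball (y, v) r ∩ (interior (range (𝓡∂ 2)) ×ˢ univ), ?_,
      Metric.isOpen_ball.inter (isOpen_interior.prod isOpen_univ), ?_, hz, mem_univ _⟩⟩
    · exact inter_subset_inter Metric.ball_subset_closedBall (prod_mono interior_subset le_rfl)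
    · rw [Metric.mem_ball, Prod.dist_eq, dist_self, max_lt_iff, dist_comm]
      exact ⟨hzr, hr⟩
  · rintro s ⟨hs, hsR⟩
    have := hrs hs
    exact ⟨⟨hWs ⟨this.1.1, hsR.1⟩, this.1.2⟩, this.2⟩
  · exact ⟨Metric.mem_closedBall_self hr.le, hyR, mem_univ _⟩
  · refine Filter.inter_mem (mem_nhdsWithin_of_mem_nhds (Metric.closedBall_mem_nhds _ hr)) ?_
    filter_upwards [self_mem_nhdsWithin] with s hs
    exact ⟨extChartAt_target_subset_range x₀ hs.1, mem_univ _⟩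

variable [IsContMDiffRiemannianBundle (𝓡∂ 2) ∞ E2 (fun x : M => TangentSpace (𝓡∂ 2) x)]

variable (x₀) in
/-- A function along the circle action, in the chart at `x₀`. -/
def orbitCo (u : SM M → ℂ) (p : (E2 × E2) × ℝ) : ℂ :=
  rep x₀ (fun q => u q.1) (rotCo o x₀ (p.2 : Real.Angle) p.1, 0)

lemma orbitCo_chartCo (u : SM M → ℂ) (p : SM M) (hp : p.1.1 ∈ (extChartAt (𝓡∂ 2) x₀).source) (t : ℝ) :
    orbitCo o x₀ u (chartCo x₀ p.1, t) = u (rot o (t : Real.Angle) p) := by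
  rw [orbitCo, ← chartCo_rot o _ p hp]
  exact rep_chartCo (fun q => u q.1) (rot o (t : Real.Angle) p, ⟨0, by simp⟩) hp

lemma contDiffOn_rotCo {V : Set E2} (hV : ContDiffOn ℝ ∞ (rotIn o x₀) (chartDom x₀ ∩ V)) :
    ContDiffOn ℝ ∞ (fun p : (E2 × E2) × ℝ => rotCo o x₀ (p.2 : Real.Angle) p.1)
      (((chartDom x₀ ∩ V) ×ˢ {0}ᶜ) ×ˢ univ) := by
  have h2 : ContDiff ℝ ∞ fun p : (E2 × E2) × ℝ => p.1.2 := by fun_prop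
  have h1 : ContDiffOn ℝ ∞ (fun p : (E2 × E2) × ℝ => rotIn o x₀ p.1.1 p.1.2)
      (((chartDom x₀ ∩ V) ×ˢ {0}ᶜ) ×ˢ univ) :=
    (hV.comp (by fun_prop : ContDiff ℝ ∞ fun p : (E2 × E2) × ℝ => p.1.1).contDiffOn
      fun p hp => hp.1.1).clm_apply h2.contDiffOn
  refine ContDiffOn.prodMk (by fun_prop) ?_
  simp only [Real.Angle.cos_coe, Real.Angle.sin_coe]
  have h3 : ContDiff ℝ ∞ fun p : (E2 × E2) × ℝ => Real.cos p.2 := by fun_prop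
  have h4 : ContDiff ℝ ∞ fun p : (E2 × E2) × ℝ => Real.sin p.2 := by fun_prop
  exact (h3.contDiffOn.smul h2.contDiffOn).add (h4.contDiffOn.smul h1)

lemma contDiffOn_orbitCo {u : SM M → ℂ} (hu : SmoothSM u) {V : Set E2}
    (hV : ContDiffOn ℝ ∞ (rotIn o x₀) (chartDom x₀ ∩ V)) :
    ContDiffOn ℝ ∞ (orbitCo o x₀ u) (((chartDom x₀ ∩ V) ×ˢ {0}ᶜ) ×ˢ univ) :=
  (smoothSM_iff.1 hu).contDiffOn_rep.comp ((contDiffOn_rotCo o hV).prodMk contDiffOn_const)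
    fun p hp => ⟨rotCo_mem o _ ⟨hp.1.1.1, hp.1.2⟩, by simp⟩

lemma fourierMode_eq (u : SM M → ℂ) (k : ℤ) (p : SM M) (hp : p.1.1 ∈ (extChartAt (𝓡∂ 2) x₀).source) :
    fourierMode o u k p = (1 / (2 * Real.pi) : ℂ) * fcoef (orbitCo o x₀ u) k (chartCo x₀ p.1) := by
  rw [fourierMode, fourierCoeff_eq_intervalIntegral _ _ 0, fcoef, zero_add]
  have h : ∀ t : ℝ, fourier (-k) (t : AddCircle (2 * Real.pi)) • u (rot o (t : Real.Angle) p) =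
      cexp (-(k * I) * t) • orbitCo o x₀ u (chartCo x₀ p.1, t) := fun t => by
    rw [orbitCo_chartCo o u p hp, fourier_coe_apply]
    congr 2
    have : (Real.pi : ℂ) ≠ 0 := by exact_mod_cast Real.pi_ne_zero
    push_cast
    field_simp
  have h' := intervalIntegral.integral_congr (μ := volume) (a := 0) (b := 2 * Real.pi) fun t _ => h t
  refine (congrArg ((1 / (2 * Real.pi) : ℝ) • ·) h').trans ?_
  simp only [Complex.real_smul]
  push_cast
  rfl

lemma periodicOver_orbitCo (u : SM M → ℂ) (K : Set (E2 × E2)) : PeriodicOver K (orbitCo o x₀ u) :=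
  fun s _ t => by simp [orbitCo]

/-- The holomorphic extension to the disk of the Fourier modes of index at least `c`. -/
def modeSeries (u : SM M → ℂ) (c : ℤ) (q : SM M × Disk) : ℂ :=
  ∑' m : ℕ, q.2.1 ^ m * fourierMode o u (m + c) q.1

/-- In the chart at the base point of `q` the modes are, up to a constant, Fourier coefficients of a
smooth periodic family over a compact convex set, where the quadratic decay applies. -/
lemma summable_modeSeries {u : SM M → ℂ} (hu : SmoothSM u) (c : ℤ) (q : SM M × Disk) :
    Summable fun m : ℕ => q.2.1 ^ m * fourierMode o u (m + c) q.1 := by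
  obtain ⟨V, hVo, hxV, hV⟩ := exists_contDiffOn_rotIn o q.1.1.1
  have hp := mem_extChartAt_source (I := 𝓡∂ 2) q.1.1.1
  obtain ⟨K, hK, hKc, hKi, hKs, hmem, -⟩ := exists_compact_convex_nhd q.1.1.1 hVo hxV (chartCo_mem q.1 hp).2
  have h := summable_fourierSeriesFrom hK (uniqueDiffOn_convex hKc hKi)
    ((contDiffOn_orbitCo o hu hV).mono (prod_mono hKs le_rfl)) (periodicOver_orbitCo o u K) c
    (p := (chartCo q.1.1.1 q.1.1, q.2.1)) ⟨hmem, q.2.2⟩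
  refine (h.mul_left (1 / (2 * Real.pi) : ℂ)).congr fun m => ?_
  rw [fourierMode_eq o u _ q.1 hp, smul_eq_mul]
  ring

lemma smoothSMD_modeSeries {u : SM M → ℂ} (hu : SmoothSM u) (c : ℤ) : SmoothSMD (modeSeries o u c) := by
  refine smoothSMD_of_local fun x₀ => ⟨fun s => (1 / (2 * Real.pi) : ℂ) *
    fourierSeriesFrom c (orbitCo o x₀ u) s, fun v hv w hw => ?_, fun q hq => ?_⟩
  · obtain ⟨V, hVo, hxV, hV⟩ := exists_contDiffOn_rotIn o x₀
    obtain ⟨K, hK, hKc, hKi, hKs, hmem, hnhd⟩ := exists_compact_convex_nhd x₀ hVo hxV hv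
    have h := contDiffOn_fourierSeriesFrom hK hKc hKi
      ((contDiffOn_orbitCo o hu hV).mono (prod_mono hKs le_rfl)) (periodicOver_orbitCo o u K) c
    refine (contDiffOn_const.mul h _ ⟨hmem, hw⟩).mono_of_mem_nhdsWithin ?_
    rw [repDom, nhdsWithin_prod_eq]
    exact Filter.prod_mem_prod hnhd self_mem_nhdsWithin
  · refine Eq.trans ?_ tsum_mul_left
    refine tsum_congr fun m => ?_
    rw [fourierMode_eq o u _ q.1 hq, smul_eq_mul]
    ring

end FourierSeries

end Twistor

end

/-! ### Christoffel symbols of a metric on a subset of a vector space. -/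

noncomputable section

namespace Twistor

attribute [-instance] instNormedAddCommGroupOfRiemannianBundleOfIsTopologicalAddGroupOfContinuousConstSMulReal
  instInnerProductSpaceReal

open MeasureTheory Complex Set

section Koszul

variable {E : Type} [NormedAddCommGroup E] [NormedSpace ℝ E] {R : Set E} {G : E → E →L[ℝ] E →L[ℝ] ℝ}

variable (R G) in
/-- The Christoffel symbols of the first kind of a metric. -/
def koszul (y v w : E) : E →L[ℝ] ℝ :=
  (2⁻¹ : ℝ) • (fderivWithin ℝ G R y v w + fderivWithin ℝ G R y w v -
    ((fderivWithin ℝ G R y).flip v).flip w)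

lemma koszul_apply (y v w e : E) : koszul R G y v w e =
    (fderivWithin ℝ G R y v w e + fderivWithin ℝ G R y w v e - fderivWithin ℝ G R y e v w) / 2 := by
  simp [koszul]; ring

lemma koszul_congr_set {S : Set E} {y : E} (h : S =ᶠ[𝓝 y] R) (v w : E) : koszul S G y v w = koszul R G y v w := by
  rw [koszul, koszul, fderivWithin_congr_set h]

variable (R G) in
/-- The Christoffel symbols of a metric. -/
def chr (y v w : E) : E := (G y).inverse (koszul R G y v w)

lemma chr_congr_set {S : Set E} {y : E} (h : S =ᶠ[𝓝 y] R) (v w : E) : chr S G y v w = chr R G y v w := by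
  rw [chr, chr, koszul_congr_set h]

lemma fderivWithin_metric_comm {y : E} (hR : UniqueDiffWithinAt ℝ R y) (hG : DifferentiableWithinAt ℝ G R y)
    (hs : ∀ y a b, G y a b = G y b a) (a b c : E) :
    fderivWithin ℝ G R y a b c = fderivWithin ℝ G R y a c b := by
  have h1 := (hG.hasFDerivWithinAt.clm_apply (hasFDerivWithinAt_const b y _)).clm_apply
    (hasFDerivWithinAt_const c y _)
  have h2 := (hG.hasFDerivWithinAt.clm_apply (hasFDerivWithinAt_const c y _)).clm_apply
    (hasFDerivWithinAt_const b y _)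
  have h3 : (fun y => G y b c) = fun y => G y c b := funext fun y => hs y b c
  rw [h3] at h1
  have h4 := congrArg (fun L : E →L[ℝ] ℝ => L a) (hR.eq h1 h2)
  simpa using h4

section

variable [FiniteDimensional ℝ E]

lemma isInvertible_of_pos {B : E →L[ℝ] E →L[ℝ] ℝ} (hB : ∀ a, a ≠ 0 → 0 < B a a) : B.IsInvertible := by
  have hinj : Function.Injective (B : E →ₗ[ℝ] E →L[ℝ] ℝ) := by
    refine (injective_iff_map_eq_zero _).2 fun a ha => ?_
    by_contra h0
    have h1 := hB a h0
    have h2 : B a = 0 := ha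
    rw [h2] at h1
    simp at h1
  have hdim : Module.finrank ℝ E = Module.finrank ℝ (E →L[ℝ] ℝ) := by
    rw [← (LinearMap.toContinuousLinearMap (𝕜 := ℝ) (E := E) (F' := ℝ)).finrank_eq]
    exact Subspace.dual_finrank_eq.symm
  refine ⟨(LinearMap.linearEquivOfInjective _ hinj hdim).toContinuousLinearEquiv, ?_⟩
  ext a b
  rfl

lemma metric_chr {y : E} (hG : ∀ a, a ≠ 0 → 0 < G y a a) (v w : E) : G y (chr R G y v w) = koszul R G y v w := by
  obtain ⟨e, he⟩ := isInvertible_of_pos hG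
  rw [chr, ← he, ContinuousLinearMap.inverse_equiv]
  exact e.apply_symm_apply _

lemma metric_left_cancel {B : E →L[ℝ] E →L[ℝ] ℝ} (hB : ∀ a, a ≠ 0 → 0 < B a a) {a b : E}
    (h : ∀ e, B a e = B b e) : a = b := by
  obtain ⟨e, he⟩ := isInvertible_of_pos hB
  rw [← he] at h
  exact e.injective (ContinuousLinearMap.ext h)

set_option maxSynthPendingDepth 3 in
lemma contDiffWithinAt_chr (hR : UniqueDiffOn ℝ R) (hG : ContDiffOn ℝ ∞ G R)
    (hpos : ∀ y ∈ R, ∀ a, a ≠ 0 → 0 < G y a a) {F : Type} [NormedAddCommGroup F] [NormedSpace ℝ F]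
    {S : Set F} {s₀ : F} {b v w : F → E} (hbS : ∀ s ∈ S, b s ∈ R) (hs₀ : s₀ ∈ S) (hb : ContDiffWithinAt ℝ ∞ b S s₀)
    (hv : ContDiffWithinAt ℝ ∞ v S s₀) (hw : ContDiffWithinAt ℝ ∞ w S s₀) :
    ContDiffWithinAt ℝ ∞ (fun s => chr R G (b s) (v s) (w s)) S s₀ := by
  have h1 : ContDiffWithinAt ℝ ∞ (fun s => G (b s)) S s₀ := (hG _ (hbS _ hs₀)).comp s₀ hb hbS
  have h2 : ContDiffWithinAt ℝ ∞ (fun s => fderivWithin ℝ G R (b s)) S s₀ :=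
    ((hG.fderivWithin hR (m := ∞) (by simp)) _ (hbS _ hs₀)).comp s₀ hb hbS
  have h3 := ((isInvertible_of_pos (hpos _ (hbS _ hs₀))).contDiffAt_map_inverse (n := ∞)).comp_contDiffWithinAt s₀ h1
  have hf : ∀ {H : Type} [NormedAddCommGroup H] [NormedSpace ℝ H] {A : F → E →L[ℝ] E →L[ℝ] H},
      ContDiffWithinAt ℝ ∞ A S s₀ → ContDiffWithinAt ℝ ∞ (fun s => (A s).flip) S s₀ := by
    intro H _ _ A hA
    let L : (E →L[ℝ] E →L[ℝ] H) →L[ℝ] (E →L[ℝ] E →L[ℝ] H) :=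
      (ContinuousLinearMap.flipₗᵢ ℝ E E H).toContinuousLinearEquiv
    exact L.contDiff.comp_contDiffWithinAt hA
  exact h3.clm_apply (ContDiffWithinAt.const_smul _ ((((h2.clm_apply hv).clm_apply hw).add
    ((h2.clm_apply hw).clm_apply hv)).sub ((hf ((hf h2).clm_apply hv)).clm_apply hw)))

end

variable {ψ : E → E} {G₀ : E → E →L[ℝ] E →L[ℝ] ℝ} {y : E}

set_option maxSynthPendingDepth 3 in
-- The relation between the metrics is differentiated. The second derivatives of the coordinate
-- change appear here and survive as the inhomogeneous term in the law for the Christoffel symbols.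
lemma fderivWithin_metric_transform (hR : UniqueDiffOn ℝ R) (hyR : y ∈ R)
    (hψ : ContDiffWithinAt ℝ ∞ ψ R y) (hmap : MapsTo ψ R R) (hG₀ : DifferentiableWithinAt ℝ G₀ R (ψ y))
    (hrel : ∀ᶠ z in 𝓝[R] y, ∀ a b, G z a b = G₀ (ψ z) (fderivWithin ℝ ψ R z a) (fderivWithin ℝ ψ R z b))
    (hG : DifferentiableWithinAt ℝ G R y) (c a b : E) :
    fderivWithin ℝ G R y c a b =
      fderivWithin ℝ G₀ R (ψ y) (fderivWithin ℝ ψ R y c) (fderivWithin ℝ ψ R y a) (fderivWithin ℝ ψ R y b) +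
      G₀ (ψ y) (fderivWithin ℝ (fderivWithin ℝ ψ R) R y c a) (fderivWithin ℝ ψ R y b) +
      G₀ (ψ y) (fderivWithin ℝ ψ R y a) (fderivWithin ℝ (fderivWithin ℝ ψ R) R y c b) := by
  have hψ1 := (hψ.differentiableWithinAt (by simp)).hasFDerivWithinAt
  have hψ2 := ((hψ.fderivWithin_right hR (m := ∞) (by simp) hyR).differentiableWithinAt (by simp)).hasFDerivWithinAt
  have h1 := (hG.hasFDerivWithinAt.clm_apply (hasFDerivWithinAt_const a y _)).clm_apply
    (hasFDerivWithinAt_const b y _)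
  have h0 := HasFDerivWithinAt.comp (g := G₀) (f := ψ) y hG₀.hasFDerivWithinAt hψ1 hmap
  have h2 := (h0.clm_apply
    (hψ2.clm_apply (hasFDerivWithinAt_const a y _))).clm_apply (hψ2.clm_apply (hasFDerivWithinAt_const b y _))
  have h3 := h2.congr_of_eventuallyEq (hrel.mono fun z hz => hz a b) (hrel.self_of_nhdsWithin hyR a b)
  have h4 := congrArg (fun L : E →L[ℝ] ℝ => L c) ((hR y hyR).eq h1 h3)
  simp at h4
  rw [h4]
  ring

/-- The transformation law of the Christoffel symbols. -/
lemma koszul_transform (hR : UniqueDiffOn ℝ R) (hyR : y ∈ R) (hcl : y ∈ closure (interior R))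
    (hψ : ContDiffWithinAt ℝ ∞ ψ R y) (hmap : MapsTo ψ R R) (hG₀ : DifferentiableWithinAt ℝ G₀ R (ψ y))
    (hrel : ∀ᶠ z in 𝓝[R] y, ∀ a b, G z a b = G₀ (ψ z) (fderivWithin ℝ ψ R z a) (fderivWithin ℝ ψ R z b))
    (hG : DifferentiableWithinAt ℝ G R y) (hs : ∀ a b, G₀ (ψ y) a b = G₀ (ψ y) b a) (v w e : E) :
    koszul R G y v w e =
      koszul R G₀ (ψ y) (fderivWithin ℝ ψ R y v) (fderivWithin ℝ ψ R y w) (fderivWithin ℝ ψ R y e) +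
      G₀ (ψ y) (fderivWithin ℝ (fderivWithin ℝ ψ R) R y w v) (fderivWithin ℝ ψ R y e) := by
  -- Symmetry of second derivatives holds also at boundary points, because they lie in the closure
  -- of the interior.
  have hsymm := hψ.isSymmSndFDerivWithinAt (by rw [minSmoothness_of_isRCLikeNormedField]; exact ENat.LEInfty.out) hR hcl hyR
  have T := fderivWithin_metric_transform hR hyR hψ hmap hG₀ hrel hG
  rw [koszul_apply, koszul_apply, T, T, T, hsymm v w, hsymm e w, hsymm e v]
  have c1 := hs (fderivWithin ℝ ψ R y w) (fderivWithin ℝ (fderivWithin ℝ ψ R) R y v e)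
  have c2 := hs (fderivWithin ℝ ψ R y v) (fderivWithin ℝ (fderivWithin ℝ ψ R) R y w e)
  linear_combination c1 / 2

end Koszul

end Twistor

end

/-! ### The horizontal derivative expressed in one fixed chart. -/

noncomputable section

namespace Twistor

open MeasureTheory Complex Set

section ChartDerivative

/-- The derivative of a function that factors through the preferred chart. -/
lemma mvfderiv_eq_of_eventuallyEq {E : Type*} [NormedAddCommGroup E] [NormedSpace ℝ E] {H : Type*}
    [TopologicalSpace H] {I : ModelWithCorners ℝ E H} {N : Type*} [TopologicalSpace N] [ChartedSpace H N]
    {F : Type*} [NormedAddCommGroup F] [NormedSpace ℝ F] {f : N → F} {x : N} {g : E → F} {g' : E →L[ℝ] F}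
    (hg : HasFDerivWithinAt g g' (range I) (extChartAt I x x))
    (hfg : ∀ᶠ z in 𝓝 x, f z = g (extChartAt I x z)) : mvfderiv I f x = g' := by
  have h1 : ContinuousAt f x := by
    have h2 : Filter.Tendsto (extChartAt I x) (𝓝 x) (𝓝[range I] (extChartAt I x x)) :=
      tendsto_nhdsWithin_iff.2 ⟨continuousAt_extChartAt x,
        Filter.Eventually.of_forall fun z => by simp⟩
    have h3 : Filter.Tendsto f (𝓝 x) (𝓝 (g (extChartAt I x x))) :=
      (hg.continuousWithinAt.tendsto.comp h2).congr' (hfg.mono fun z hz => hz.symm)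
    rw [← hfg.self_of_nhds] at h3
    exact h3
  have h4 : HasMFDerivAt I 𝓘(ℝ, F) f x g' := by
    refine ⟨h1, hg.congr_of_eventuallyEq ?_ ?_⟩
    · have h5 : Filter.Tendsto (extChartAt I x).symm (𝓝[range I] (extChartAt I x x)) (𝓝 x) := by
        have := (continuousAt_extChartAt_symm (I := I) x).tendsto
        rw [extChartAt_to_inv] at this
        exact this.mono_left nhdsWithin_le_nhds
      filter_upwards [h5.eventually hfg, extChartAt_target_mem_nhdsWithin (I := I) x] with y hy hy'
      simp only [writtenInExtChartAt, extChartAt_model_space_eq_id, Function.comp, PartialEquiv.refl_coe, id]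
      rw [hy, (extChartAt I x).right_inv hy']
    · simp only [writtenInExtChartAt, extChartAt_model_space_eq_id, Function.comp, PartialEquiv.refl_coe, id]
      rw [extChartAt_to_inv, hfg.self_of_nhds]
  rw [mvfderiv, h4.mfderiv]
  rfl

end ChartDerivative

section ChristoffelSymbols

variable {M : Type*} [TopologicalSpace M] [ChartedSpace (EuclideanHalfSpace 2) M]
  [IsManifold (𝓡∂ 2) ∞ M]

lemma symmL_eq_tangentCoordChange {x₀ z : M} (hz : z ∈ (extChartAt (𝓡∂ 2) x₀).source) (a : E2) :
    ((triv x₀).symmL ℝ z a : E2) = tangentCoordChange (𝓡∂ 2) x₀ z z a := by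
  have hz' : z ∈ (chartAt (EuclideanHalfSpace 2) x₀).source := by simpa using hz
  rw [TangentBundle.symmL_trivializationAt_eq_core hz']
  rfl

lemma symmL_self (x : M) (a : E2) : ((triv x).symmL ℝ x a : E2) = a :=
  (symmL_eq_tangentCoordChange (mem_extChartAt_source x) a).trans
    (tangentCoordChange_self (I := 𝓡∂ 2) (E := E2) (v := a) (mem_extChartAt_source x))

lemma triv_self (x : M) (a : E2) : (triv x (⟨x, a⟩ : TangentBundle (𝓡∂ 2) M)).2 = a :=
  tangentCoordChange_self (I := 𝓡∂ 2) (E := E2) (v := a) (mem_extChartAt_source x)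

lemma range_tangent : range (𝓡∂ 2).tangent = range (𝓡∂ 2) ×ˢ (univ : Set E2) := by
  rw [ModelWithCorners.tangent, modelWithCorners_prod_coe, range_prodMap]
  simp

lemma extChartAt_tangent_eventuallyEq (p : TangentBundle (𝓡∂ 2) M) :
    ∀ᶠ q in 𝓝 p, extChartAt (𝓡∂ 2).tangent p q = chartCo p.1 q := by
  filter_upwards [isOpen_proj_source.mem_nhds (mem_extChartAt_source (I := 𝓡∂ 2) p.1)] with q hq
  rw [chartCo_eq q hq]
  erw [FiberBundle.extChartAt]

variable [RiemannianBundle (fun x : M => TangentSpace (𝓡∂ 2) x)] {x₀ x : M}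

lemma metricIn_extChartAt {z : M} (hz : z ∈ (extChartAt (𝓡∂ 2) x₀).source) (a b : E2) :
    metricIn x₀ (extChartAt (𝓡∂ 2) x₀ z) a b =
      inner ℝ ((triv x₀).symmL ℝ z a) ((triv x₀).symmL ℝ z b) := by
  have h : ∀ z', z' = z → inner ℝ ((triv x₀).symmL ℝ z' a) ((triv x₀).symmL ℝ z' b) =
      inner ℝ ((triv x₀).symmL ℝ z a) ((triv x₀).symmL ℝ z b) := by rintro _ rfl; rfl
  exact h _ ((extChartAt (𝓡∂ 2) x₀).left_inv hz)

lemma metricIn_self_chart (x : M) (a b : E2) :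
    metricIn x (extChartAt (𝓡∂ 2) x x) a b = inner ℝ (E := TangentSpace (𝓡∂ 2) x) a b := by
  rw [metricIn_extChartAt (mem_extChartAt_source x)]
  exact congrArg₂ (inner ℝ (E := TangentSpace (𝓡∂ 2) x)) (symmL_self x a) (symmL_self x b)

lemma metricIn_change {z : M} (hz : z ∈ (extChartAt (𝓡∂ 2) x).source)
    (hz₀ : z ∈ (extChartAt (𝓡∂ 2) x₀).source) (a b : E2) :
    metricIn x (extChartAt (𝓡∂ 2) x z) a b = metricIn x₀ (extChartAt (𝓡∂ 2) x₀ z)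
      (tangentCoordChange (𝓡∂ 2) x x₀ z a) (tangentCoordChange (𝓡∂ 2) x x₀ z b) := by
  have h : ∀ a, (triv x).symmL ℝ z a = (triv x₀).symmL ℝ z (tangentCoordChange (𝓡∂ 2) x x₀ z a) := fun a => by
    refine (symmL_eq_tangentCoordChange hz a).trans (Eq.trans ?_ (symmL_eq_tangentCoordChange hz₀ _).symm)
    exact (tangentCoordChange_comp ⟨⟨hz, hz₀⟩, mem_extChartAt_source z⟩).symm
  rw [metricIn_extChartAt hz, metricIn_extChartAt hz₀, h, h]

variable [IsContMDiffRiemannianBundle (𝓡∂ 2) ∞ E2 (fun x : M => TangentSpace (𝓡∂ 2) x)]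

lemma differentiableWithinAt_metricIn {y : E2} (hy : y ∈ chartDom x₀) :
    DifferentiableWithinAt ℝ (metricIn x₀) (range (𝓡∂ 2)) y :=
  (differentiableWithinAt_congr_set (extChartAt_target_eventuallyEq_of_mem hy)).1
    ((contDiffOn_metricIn.differentiableOn (by simp)) y hy)

lemma hasFDerivWithinAt_metricIn_apply {y : E2} (hy : y ∈ chartDom x₀) (b c : E2) :
    HasFDerivWithinAt (fun y => metricIn x₀ y b c)
      (((fderivWithin ℝ (metricIn x₀) (range (𝓡∂ 2)) y).flip b).flip c) (range (𝓡∂ 2)) y :=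
  (((differentiableWithinAt_metricIn hy).hasFDerivWithinAt.clm_apply
    (hasFDerivWithinAt_const b _ _)).clm_apply (hasFDerivWithinAt_const c _ _)).congr_fderiv (by
      ext a; simp)

lemma extend_eq_symmL {z : M} (hz : z ∈ (extChartAt (𝓡∂ 2) x).source) (b : TangentSpace (𝓡∂ 2) x) :
    FiberBundle.extend E2 b z = (triv x).symmL ℝ z b :=
  Eq.trans (congrArg ((triv x).symm z) (triv_self x b))
    (Trivialization.symmL_apply (triv x) (R := ℝ) (mem_baseSet_of_mem hz) (b : E2)).symm

lemma metricDeriv_eq (x : M) (a b c : TangentSpace (𝓡∂ 2) x) : metricDeriv x a b c =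
    fderivWithin ℝ (metricIn x) (range (𝓡∂ 2)) (extChartAt (𝓡∂ 2) x x) a b c := by
  have h2 := mvfderiv_eq_of_eventuallyEq (I := 𝓡∂ 2) (x := x)
    (f := fun y : M => inner ℝ (FiberBundle.extend E2 b y) (FiberBundle.extend E2 c y))
    (hasFDerivWithinAt_metricIn_apply (mem_extChartAt_target (I := 𝓡∂ 2) x) b c) ?_
  · exact congrArg (fun L : E2 →L[ℝ] ℝ => L a) h2
  · filter_upwards [(isOpen_extChartAt_source (I := 𝓡∂ 2) x).mem_nhds (mem_extChartAt_source x)] with z hz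
    exact (congrArg₂ (inner ℝ) (extend_eq_symmL hz b) (extend_eq_symmL hz c)).trans (metricIn_extChartAt hz b c).symm

lemma inner_sum_smul_basis {V : Type*} [NormedAddCommGroup V] [InnerProductSpace ℝ V] {ι : Type*} [Fintype ι]
    (b : OrthonormalBasis ι ℝ V) (k : V →ₗ[ℝ] ℝ) (e : V) : inner ℝ (∑ i, k (b i) • b i) e = k e := by
  conv_rhs => rw [← b.sum_repr' e]
  rw [sum_inner, map_sum]
  exact Finset.sum_congr rfl fun i _ => by rw [real_inner_smul_left, map_smul, smul_eq_mul, mul_comm]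

/-- The defining property of the Christoffel symbols. -/
lemma metricIn_christoffel (x : M) (v w e : TangentSpace (𝓡∂ 2) x) :
    metricIn x (extChartAt (𝓡∂ 2) x x) (christoffel x v w) e =
      koszul (range (𝓡∂ 2)) (metricIn x) (extChartAt (𝓡∂ 2) x x) v w e := by
  let b := stdOrthonormalBasis ℝ (TangentSpace (𝓡∂ 2) x)
  let k : TangentSpace (𝓡∂ 2) x →ₗ[ℝ] ℝ :=
    (koszul (range (𝓡∂ 2)) (metricIn x) (extChartAt (𝓡∂ 2) x x) v w : E2 →ₗ[ℝ] ℝ)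
  have h0 : christoffel x v w = ∑ i, k (b i) • b i := by
    refine Finset.sum_congr rfl fun i _ => congrArg (· • b i) ?_
    rw [metricDeriv_eq, metricDeriv_eq, metricDeriv_eq]
    exact (koszul_apply (R := range (𝓡∂ 2)) (G := metricIn x) (y := extChartAt (𝓡∂ 2) x x) v w (b i)).symm
  refine (metricIn_self_chart x _ e).trans ?_
  rw [h0]
  exact inner_sum_smul_basis b k e

lemma extChartAt_mem_range (z : M) : extChartAt (𝓡∂ 2) x₀ z ∈ range (𝓡∂ 2) := by simp

variable (x₀) in
/-- The coordinates of the horizontal lift of `w` at `p`. -/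
def horLift (p : TangentBundle (𝓡∂ 2) M) (w : E2) : E2 × E2 :=
  (w, -chr (range (𝓡∂ 2)) (metricIn x₀) (chartCo x₀ p).1 (chartCo x₀ p).2 w)

/-- The transformation law of the Christoffel symbols. -/
lemma tangentCoordChange_christoffel (hx : x ∈ (extChartAt (𝓡∂ 2) x₀).source) (v w : TangentSpace (𝓡∂ 2) x) :
    tangentCoordChange (𝓡∂ 2) x x₀ x (christoffel x v w) =
      chr (range (𝓡∂ 2)) (metricIn x₀) (extChartAt (𝓡∂ 2) x₀ x) (tangentCoordChange (𝓡∂ 2) x x₀ x v)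
        (tangentCoordChange (𝓡∂ 2) x x₀ x w) +
      fderivWithin ℝ (fderivWithin ℝ (extChartAt (𝓡∂ 2) x₀ ∘ (extChartAt (𝓡∂ 2) x).symm) (range (𝓡∂ 2)))
        (range (𝓡∂ 2)) (extChartAt (𝓡∂ 2) x x) w v := by
  have hxx := mem_extChartAt_source (I := 𝓡∂ 2) x
  have hty := mem_extChartAt_target (I := 𝓡∂ 2) x
  set ψ := extChartAt (𝓡∂ 2) x₀ ∘ (extChartAt (𝓡∂ 2) x).symm with hψ
  set y := extChartAt (𝓡∂ 2) x x with hy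
  have hψy : ψ y = extChartAt (𝓡∂ 2) x₀ x := by rw [hψ, hy, Function.comp_apply, extChartAt_to_inv]
  have hT : fderivWithin ℝ ψ (range (𝓡∂ 2)) y = tangentCoordChange (𝓡∂ 2) x x₀ x := rfl
  have hpos : ∀ a, a ≠ 0 → 0 < metricIn x₀ (extChartAt (𝓡∂ 2) x₀ x) a a := fun a ha =>
    metricIn_self_pos ((extChartAt (𝓡∂ 2) x₀).map_source hx) ha
  have hψs : ContDiffWithinAt ℝ ∞ ψ (range (𝓡∂ 2)) y := by
    refine contDiffWithinAt_ext_coord_change x₀ x ?_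
    rw [PartialEquiv.trans_source'', PartialEquiv.symm_symm, PartialEquiv.symm_target]
    exact mem_image_of_mem _ ⟨hxx, hx⟩
  have hrel : ∀ᶠ z in 𝓝[range (𝓡∂ 2)] y, ∀ a b, metricIn x z a b =
      metricIn x₀ (ψ z) (fderivWithin ℝ ψ (range (𝓡∂ 2)) z a) (fderivWithin ℝ ψ (range (𝓡∂ 2)) z b) := by
    have h1 : ∀ᶠ z in 𝓝[range (𝓡∂ 2)] y, (extChartAt (𝓡∂ 2) x).symm z ∈ (extChartAt (𝓡∂ 2) x₀).source := by
      have h2 := (continuousAt_extChartAt_symm (I := 𝓡∂ 2) x).eventually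
        ((isOpen_extChartAt_source (I := 𝓡∂ 2) x₀).mem_nhds (by rwa [extChartAt_to_inv]))
      exact h2.filter_mono nhdsWithin_le_nhds
    filter_upwards [h1, extChartAt_target_mem_nhdsWithin (I := 𝓡∂ 2) x] with z hz hz' a b
    have h3 := metricIn_change (x := x) (x₀ := x₀) ((extChartAt (𝓡∂ 2) x).map_target hz') hz a b
    rw [(extChartAt (𝓡∂ 2) x).right_inv hz', tangentCoordChange_def, (extChartAt (𝓡∂ 2) x).right_inv hz'] at h3
    exact h3
  have hG₀ : DifferentiableWithinAt ℝ (metricIn x₀) (range (𝓡∂ 2)) (ψ y) := by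
    rw [hψy]; exact differentiableWithinAt_metricIn ((extChartAt (𝓡∂ 2) x₀).map_source hx)
  -- Both sides are compared through the metric of the chart at `x₀`. Every test vector is the image
  -- of one in the chart at `x`, since the coordinate change is invertible.
  refine metric_left_cancel hpos fun e => ?_
  obtain ⟨e, rfl⟩ : ∃ e', tangentCoordChange (𝓡∂ 2) x x₀ x e' = e :=
    ⟨tangentCoordChange (𝓡∂ 2) x₀ x x e, by
      rw [tangentCoordChange_comp ⟨⟨hx, hxx⟩, hx⟩, tangentCoordChange_self hx]⟩
  have hK := koszul_transform (𝓡∂ 2).uniqueDiffOn (extChartAt_mem_range x)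
    ((𝓡∂ 2).range_subset_closure_interior (extChartAt_mem_range x)) hψs
    (fun z _ => extChartAt_mem_range _) hG₀ hrel (differentiableWithinAt_metricIn hty)
    (fun a b => metricIn_comm _ a b) v w e
  refine (metricIn_change hxx hx (christoffel x v w) e).symm.trans ?_
  rw [map_add, add_apply, metric_chr hpos]
  refine (metricIn_christoffel x v w e).trans (hK.trans ?_)
  rw [hψy, hT]

/-- The horizontal derivative in the chart at `x₀`. -/
lemma horDeriv_eq {u : SM M → ℂ} {p : SM M} (hp : p.1.1 ∈ (extChartAt (𝓡∂ 2) x₀).source) {u' : E2 × E2 →L[ℝ] ℂ}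
    (hu : HasFDerivWithinAt (fun s => homExt u (chartPt x₀ s)) u' (range (𝓡∂ 2) ×ˢ univ) (chartCo x₀ p.1))
    (w : TangentSpace (𝓡∂ 2) p.1.1) :
    horDeriv u p w = u' (horLift x₀ p.1 (tangentCoordChange (𝓡∂ 2) p.1.1 x₀ p.1.1 w)) := by
  let x : M := p.1.1
  let v : TangentSpace (𝓡∂ 2) x := p.1.2
  have hxx := mem_extChartAt_source (I := 𝓡∂ 2) x
  set ψ := extChartAt (𝓡∂ 2) x₀ ∘ (extChartAt (𝓡∂ 2) x).symm with hψ
  -- This is the coordinate change on the tangent bundle from the chart at the base point, where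
  -- `horDeriv` is defined, to the fixed chart at `x₀`.
  let θ : E2 × E2 → E2 × E2 := fun s => (ψ s.1, fderivWithin ℝ ψ (range (𝓡∂ 2)) s.1 s.2)
  have hψs : ContDiffWithinAt ℝ ∞ ψ (range (𝓡∂ 2)) (extChartAt (𝓡∂ 2) x x) := by
    refine contDiffWithinAt_ext_coord_change x₀ x ?_
    rw [PartialEquiv.trans_source'', PartialEquiv.symm_symm, PartialEquiv.symm_target]
    exact mem_image_of_mem _ ⟨hxx, hp⟩
  have hψ2 : DifferentiableWithinAt ℝ (fderivWithin ℝ ψ (range (𝓡∂ 2))) (range (𝓡∂ 2)) (extChartAt (𝓡∂ 2) x x) :=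
    (hψs.fderivWithin_right (m := ∞) (𝓡∂ 2).uniqueDiffOn (by simp) (extChartAt_mem_range x)).differentiableWithinAt
      (by simp)
  have hθco : ∀ q : TangentBundle (𝓡∂ 2) M, q.1 ∈ (extChartAt (𝓡∂ 2) x).source →
      q.1 ∈ (extChartAt (𝓡∂ 2) x₀).source → θ (chartCo x q) = chartCo x₀ q := by
    intro q hq hq₀
    have h1 : ψ (chartCo x q).1 = extChartAt (𝓡∂ 2) x₀ q.1 :=
      congrArg (extChartAt (𝓡∂ 2) x₀) ((extChartAt (𝓡∂ 2) x).left_inv hq)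
    have h2 : (θ (chartCo x q)).2 =
        tangentCoordChange (𝓡∂ 2) x x₀ q.1 (tangentCoordChange (𝓡∂ 2) q.1 x q.1 q.2) := rfl
    have h3 := tangentCoordChange_comp (I := 𝓡∂ 2) (E := E2) (v := q.2)
      (show q.1 ∈ (extChartAt (𝓡∂ 2) q.1).source ∩ (extChartAt (𝓡∂ 2) x).source ∩ (extChartAt (𝓡∂ 2) x₀).source from
        ⟨⟨mem_extChartAt_source q.1, hq⟩, hq₀⟩)
    exact Prod.ext h1 (h2.trans h3)
  have hco : (chartCo x p.1).2 = v := triv_self x v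
  have hfst : HasFDerivWithinAt (Prod.fst : E2 × E2 → E2) (ContinuousLinearMap.fst ℝ E2 E2)
    (range (𝓡∂ 2) ×ˢ univ) (chartCo x p.1) := hasFDerivWithinAt_fst
  have hsnd : HasFDerivWithinAt (Prod.snd : E2 × E2 → E2) (ContinuousLinearMap.snd ℝ E2 E2)
    (range (𝓡∂ 2) ×ˢ univ) (chartCo x p.1) := hasFDerivWithinAt_snd
  have hmaps : MapsTo (Prod.fst : E2 × E2 → E2) (range (𝓡∂ 2) ×ˢ univ) (range (𝓡∂ 2)) := fun s hs => hs.1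
  have hθ := (HasFDerivWithinAt.comp (chartCo x p.1) (hψs.differentiableWithinAt (by simp)).hasFDerivWithinAt
    hfst hmaps).prodMk ((HasFDerivWithinAt.comp (chartCo x p.1) hψ2.hasFDerivWithinAt hfst hmaps).clm_apply hsnd)
  rw [← hθco p.1 hxx hp] at hu
  have hg := HasFDerivWithinAt.comp (f := θ) (chartCo x p.1) hu hθ fun s hs => ⟨extChartAt_mem_range _, mem_univ _⟩
  have hev : ∀ᶠ q in 𝓝 p.1, homExt u q =
      ((fun s => homExt u (chartPt x₀ s)) ∘ θ) (extChartAt (𝓡∂ 2).tangent p.1 q) := by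
    filter_upwards [extChartAt_tangent_eventuallyEq p.1, isOpen_proj_source.mem_nhds hxx,
      isOpen_proj_source.mem_nhds hp] with q h1 h2 h3
    rw [h1, Function.comp_apply, hθco q h2 h3, chartPt_chartCo h3]
  have hpp := (extChartAt_tangent_eventuallyEq p.1).self_of_nhds
  rw [← range_tangent, ← hpp] at hg
  have key := mvfderiv_eq_of_eventuallyEq hg hev
  refine (congrArg (fun L : E2 × E2 →L[ℝ] ℂ => L (w, -christoffel x v w)) key).trans
    (congrArg u' (Prod.ext rfl ?_))
  -- The derivative of `θ` contributes a second derivative of `ψ`, which cancels the inhomogeneous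
  -- term in the transformation law.
  have hc := tangentCoordChange_christoffel hp v w
  have h1 : tangentCoordChange (𝓡∂ 2) x x₀ x (-christoffel x v w) =
      -tangentCoordChange (𝓡∂ 2) x x₀ x (christoffel x v w) := map_neg _ _
  refine Eq.trans (congrArg₂ (· + ·) h1 (congrArg (fderivWithin ℝ (fderivWithin ℝ ψ (range (𝓡∂ 2)))
        (range (𝓡∂ 2)) (extChartAt (𝓡∂ 2) x x) w) hco)) ?_
  rw [hc]
  have h2 : ∀ c d : E2, -(c + d) + d = -c := fun c d => by abel
  exact h2 _ _

end ChristoffelSymbols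

end Twistor

end

/-! ### The right-angle rotation is parallel. -/

noncomputable section

namespace Twistor

attribute [-instance] instNormedAddCommGroupOfRiemannianBundleOfIsTopologicalAddGroupOfContinuousConstSMulReal
  instInnerProductSpaceReal

open MeasureTheory Complex Set

section ParallelRotation

variable {E : Type} [NormedAddCommGroup E] [NormedSpace ℝ E] [FiniteDimensional ℝ E] {R : Set E}
  {G : E → E →L[ℝ] E →L[ℝ] ℝ} {J : E → E →L[ℝ] E} {y : E}

/-- The metric is parallel. -/
lemma koszul_add_koszul (hR : UniqueDiffWithinAt ℝ R y) (hG : DifferentiableWithinAt ℝ G R y)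
    (hs : ∀ y a b, G y a b = G y b a) (a b w : E) :
    koszul R G y a w b + koszul R G y b w a = fderivWithin ℝ G R y w a b := by
  rw [koszul_apply, koszul_apply, fderivWithin_metric_comm hR hG hs a w b, fderivWithin_metric_comm hR hG hs b w a,
    fderivWithin_metric_comm hR hG hs w b a]
  ring

lemma chr_add_left (hpos : ∀ a, a ≠ 0 → 0 < G y a a) (a b w : E) :
    chr R G y (a + b) w = chr R G y a w + chr R G y b w := by
  refine metric_left_cancel hpos fun e => ?_
  rw [map_add, add_apply, metric_chr hpos, metric_chr hpos, metric_chr hpos]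
  simp only [koszul_apply, map_add, add_apply]
  ring

lemma chr_smul_left (hpos : ∀ a, a ≠ 0 → 0 < G y a a) (c : ℝ) (a w : E) :
    chr R G y (c • a) w = c • chr R G y a w := by
  refine metric_left_cancel hpos fun e => ?_
  rw [map_smul, smul_apply, metric_chr hpos, metric_chr hpos]
  simp only [koszul_apply, map_smul, smul_apply, smul_eq_mul]
  ring

lemma chr_add_right (hpos : ∀ a, a ≠ 0 → 0 < G y a a) (v a b : E) :
    chr R G y v (a + b) = chr R G y v a + chr R G y v b := by
  refine metric_left_cancel hpos fun e => ?_
  rw [map_add, add_apply, metric_chr hpos, metric_chr hpos, metric_chr hpos]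
  simp only [koszul_apply, map_add, add_apply]
  ring

lemma chr_smul_right (hpos : ∀ a, a ≠ 0 → 0 < G y a a) (v : E) (c : ℝ) (a : E) :
    chr R G y v (c • a) = c • chr R G y v a := by
  refine metric_left_cancel hpos fun e => ?_
  rw [map_smul, smul_apply, metric_chr hpos, metric_chr hpos]
  simp only [koszul_apply, map_smul, smul_apply, smul_eq_mul]
  ring

/-- In dimension two a nonzero vector and its image under `J y` form a basis. -/
lemma eq_zero_of_orthogonal_rot (hdim : Module.finrank ℝ E = 2) (hpos : ∀ a, a ≠ 0 → 0 < G y a a)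
    (hJJ : ∀ a, J y (J y a) = -a) {a c : E} (ha : a ≠ 0) (h1 : G y c a = 0) (h2 : G y c (J y a) = 0) : c = 0 := by
  have hli : LinearIndependent ℝ ![a, J y a] := by
    rw [LinearIndependent.pair_iff]
    intro s t hst
    have h3 : J y (s • a + t • J y a) = 0 := by rw [hst, map_zero]
    rw [map_add, map_smul, map_smul, hJJ] at h3
    have h4 : (s ^ 2 + t ^ 2) • a = 0 := by
      have : (s ^ 2 + t ^ 2) • a = s • (s • a + t • J y a) - t • (s • J y a + t • -a) := by module
      rw [this, hst, h3]; simp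
    have h5 := (smul_eq_zero.1 h4).resolve_right ha
    constructor <;> nlinarith [sq_nonneg s, sq_nonneg t]
  have hspan := hli.span_eq_top_of_card_eq_finrank (by simp [hdim])
  by_contra hc
  have hker : Submodule.span ℝ (range ![a, J y a]) ≤ LinearMap.ker (G y c : E →ₗ[ℝ] ℝ) := by
    rw [Submodule.span_le]
    rintro _ ⟨i, rfl⟩
    fin_cases i
    · exact h1
    · exact h2
  rw [hspan] at hker
  have h6 : G y c c = 0 := hker (Submodule.mem_top (x := c))
  exact (hpos c hc).ne' h6

/-- A complex structure compatible with the metric of a surface is parallel. -/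
lemma fderivWithin_rot_apply (hdim : Module.finrank ℝ E = 2) (hR : UniqueDiffWithinAt ℝ R y) (hyR : y ∈ R)
    (hG : DifferentiableWithinAt ℝ G R y) (hs : ∀ y a b, G y a b = G y b a)
    (hpos : ∀ a, a ≠ 0 → 0 < G y a a) (hJ : DifferentiableWithinAt ℝ J R y)
    (hJJ : ∀ᶠ z in 𝓝[R] y, ∀ a, J z (J z a) = -a)
    (hGJ : ∀ᶠ z in 𝓝[R] y, ∀ a b, G z (J z a) (J z b) = G z a b) (v w : E) :
    fderivWithin ℝ J R y w v = J y (chr R G y v w) - chr R G y (J y v) w := by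
  let Γ : E → E := fun a => chr R G y a w
  -- `A` is the covariant derivative of `J` in the direction `w`; the claim is that it vanishes at
  -- `v`.
  let A : E → E := fun a => fderivWithin ℝ J R y w a + Γ (J y a) - J y (Γ a)
  have hJJy := hJJ.self_of_nhdsWithin hyR
  have hGJy := hGJ.self_of_nhdsWithin hyR
  have hΓ : ∀ a b, G y (Γ a) b + G y (Γ b) a = fderivWithin ℝ G R y w a b := fun a b => by
    rw [metric_chr hpos, metric_chr hpos, koszul_add_koszul hR hG hs]
  have hJ' : ∀ a, HasFDerivWithinAt (fun z => J z a) ((fderivWithin ℝ J R y).flip a) R y := fun a =>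
    (hJ.hasFDerivWithinAt.clm_apply (hasFDerivWithinAt_const a y _)).congr_fderiv (by ext; simp)
  have hdJJ : ∀ a, fderivWithin ℝ J R y w (J y a) + J y (fderivWithin ℝ J R y w a) = 0 := fun a => by
    have h1 := hJ.hasFDerivWithinAt.clm_apply (hJ' a)
    have h2 : HasFDerivWithinAt (fun z => J z (J z a)) (0 : E →L[ℝ] E) R y :=
      (hasFDerivWithinAt_const (-a) y R).congr_of_eventuallyEq (hJJ.mono fun z hz => hz a) (hJJy a)
    have h3 := congrArg (fun L : E →L[ℝ] E => L w) (hR.eq h1 h2)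
    simp only [add_apply, ContinuousLinearMap.comp_apply, ContinuousLinearMap.flip_apply, zero_apply] at h3
    rw [← h3, add_comm]
  have hdGJ : ∀ a b, fderivWithin ℝ G R y w (J y a) (J y b) + G y (fderivWithin ℝ J R y w a) (J y b) +
      G y (J y a) (fderivWithin ℝ J R y w b) = fderivWithin ℝ G R y w a b := fun a b => by
    have h1 := (hG.hasFDerivWithinAt.clm_apply (hJ' a)).clm_apply (hJ' b)
    have h2 : HasFDerivWithinAt (fun z => G z (J z a) (J z b)) (((fderivWithin ℝ G R y).flip a).flip b) R y :=
      (((hG.hasFDerivWithinAt.clm_apply (hasFDerivWithinAt_const a y _)).clm_apply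
        (hasFDerivWithinAt_const b y _)).congr_fderiv (by ext; simp)).congr_of_eventuallyEq
        (hGJ.mono fun z hz => hz a b) (hGJy a b)
    have h3 := congrArg (fun L : E →L[ℝ] ℝ => L w) (hR.eq h1 h2)
    simp only [add_apply, ContinuousLinearMap.comp_apply, ContinuousLinearMap.flip_apply] at h3
    rw [← h3]; ring
  have hA1 : ∀ a b, G y (A a) (J y b) + G y (J y a) (A b) = 0 := fun a b => by
    have h1 := hdGJ a b
    rw [← hΓ, ← hΓ] at h1
    simp only [A, map_add, map_sub, add_apply, sub_apply, hGJy]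
    rw [hs y (J y a) (Γ (J y b)), hs y a (Γ b)]
    linarith
  have hA2 : ∀ a, A (J y a) = -J y (A a) := fun a => by
    have h1 := eq_neg_of_add_eq_zero_left (hdJJ a)
    have h2 : Γ (-a) = -Γ a := by
      have := chr_smul_left (R := R) hpos (-1) a w
      simpa using this
    simp only [A, map_add, map_sub, hJJy, h1, h2]
    abel
  -- Differentiating `J² = -1` and the isometry property gives `A J = -J A` and `G(A a, J b) + G(J
  -- a, A b) = 0`. Taking `a = v` with `b = J v` and then `b = v` shows that `A v` is orthogonal to
  -- `v` and to `J v`.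
  have hA : A v = 0 := by
    by_cases hv : v = 0
    · have h2 : Γ 0 = 0 := by simpa using chr_smul_left (R := R) hpos 0 0 w
      simp only [A, hv, map_zero, h2]; simp
    · refine eq_zero_of_orthogonal_rot hdim hpos hJJy hv ?_ ?_
      · have h1 := hA1 v (J y v)
        rw [hA2, hJJy, map_neg, map_neg, hGJy, hs y v] at h1
        linarith
      · have h1 := hA1 v v
        rw [hs y (J y v)] at h1
        linarith
  have h3 : fderivWithin ℝ J R y w v = A v + (J y (Γ v) - Γ (J y v)) := by simp only [A]; abel
  rw [h3, hA, zero_add]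

end ParallelRotation

end Twistor

end

/-! ### Horizontal and disk derivatives in charts: smoothness and commutation. -/

noncomputable section

namespace Twistor

open MeasureTheory Complex Set

section DerivativesInCharts

variable {M : Type*} [TopologicalSpace M] [ChartedSpace (EuclideanHalfSpace 2) M]
  [IsManifold (𝓡∂ 2) ∞ M] [RiemannianBundle (fun x : M => TangentSpace (𝓡∂ 2) x)]
  [IsContMDiffRiemannianBundle (𝓡∂ 2) ∞ E2 (fun x : M => TangentSpace (𝓡∂ 2) x)] {x₀ : M}
  {h : SM M × Disk → ℂ}

lemma homExt_slice (h : SM M × Disk → ℂ) (z : Disk) (P : TangentBundle (𝓡∂ 2) M) :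
    homExt (fun p => h (p, z)) P = homExtD h (P, z.1) := by
  by_cases hP : P.2 ≠ 0
  · rw [homExt, dif_pos hP, homExtD_of_mem h (q := (P, z.1)) ⟨hP, z.2⟩]
  · rw [homExt, dif_neg hP, homExtD, dif_neg fun h => hP h.1]

lemma diskExt_normalize (h : SM M × Disk → ℂ) (P : TangentBundle (𝓡∂ 2) M) (hP : P.2 ≠ 0) (z : ℂ) :
    diskExt h (normalize P hP) z = homExtD h (P, z) := by
  by_cases hz : z ∈ Metric.closedBall (0 : ℂ) 1
  · rw [diskExt, dif_pos hz, homExtD_of_mem h (q := (P, z)) ⟨hP, hz⟩]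
  · rw [diskExt, dif_neg hz, homExtD, dif_neg fun h => hz h.2]

lemma mem_repDom (q : SM M × Disk) (hq : q.1.1.1 ∈ (extChartAt (𝓡∂ 2) x₀).source) :
    (chartCo x₀ q.1.1, q.2.1) ∈ repDom x₀ := ⟨chartCo_mem q.1 hq, q.2.2⟩

lemma SmoothSMD.hasFDerivWithinAt_rep (hh : SmoothSMD h) {s : (E2 × E2) × ℂ} (hs : s ∈ repDom x₀) :
    HasFDerivWithinAt (rep x₀ h) (fderivWithin ℝ (rep x₀ h) (repDom x₀) s) (repDom x₀) s :=
  (hh.contDiffOn_rep.differentiableOn (by simp) s hs).hasFDerivWithinAt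

lemma chartDom_prod_eventuallyEq {s : E2 × E2} (hs : s ∈ chartDom x₀ ×ˢ {0}ᶜ) :
    (chartDom x₀ ×ˢ {0}ᶜ : Set (E2 × E2)) =ᶠ[𝓝 s] range (𝓡∂ 2) ×ˢ univ := by
  have h1 := extChartAt_target_eventuallyEq_of_mem (I := 𝓡∂ 2) hs.1
  have h2 : ∀ᶠ v in 𝓝 s.2, v ∈ ({0}ᶜ : Set E2) := isOpen_compl_singleton.mem_nhds hs.2
  filter_upwards [continuous_fst.continuousAt.eventually h1, continuous_snd.continuousAt.eventually h2] with t ht ht'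
  exact propext ⟨fun hh => ⟨ht.mp hh.1, mem_univ _⟩, fun hh => ⟨ht.mpr hh.1, ht'⟩⟩

/-- The horizontal derivative of a slice in the chart at `x₀`. -/
lemma SmoothSMD.horDeriv_slice (hh : SmoothSMD h) (q : SM M × Disk)
    (hq : q.1.1.1 ∈ (extChartAt (𝓡∂ 2) x₀).source) (w : TangentSpace (𝓡∂ 2) q.1.1.1) :
    horDeriv (fun p => h (p, q.2)) q.1 w = fderivWithin ℝ (rep x₀ h) (repDom x₀) (chartCo x₀ q.1.1, q.2.1)
      (horLift x₀ q.1.1 (tangentCoordChange (𝓡∂ 2) q.1.1.1 x₀ q.1.1.1 w), 0) := by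
  have hsl : HasFDerivWithinAt (fun s : E2 × E2 => (s, q.2.1)) (ContinuousLinearMap.inl ℝ (E2 × E2) ℂ)
    (chartDom x₀ ×ˢ {0}ᶜ) (chartCo x₀ q.1.1) := (hasFDerivAt_prodMk_left _ _).hasFDerivWithinAt
  have h1 := HasFDerivWithinAt.comp (f := fun s : E2 × E2 => (s, q.2.1)) (chartCo x₀ q.1.1)
    (hh.hasFDerivWithinAt_rep (mem_repDom q hq)) hsl fun s hs => ⟨hs, q.2.2⟩
  have h2 : rep x₀ h ∘ (fun s : E2 × E2 => (s, q.2.1)) = fun s => homExt (fun p => h (p, q.2)) (chartPt x₀ s) :=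
    funext fun s => (homExt_slice h q.2 _).symm
  rw [h2, hasFDerivWithinAt_congr_set (chartDom_prod_eventuallyEq (chartCo_mem q.1 hq))] at h1
  rw [horDeriv_eq hq h1]
  rfl

/-- The derivative in direction `c` along the disk. -/
def diskDeriv (c : ℂ) (h : SM M × Disk → ℂ) (q : SM M × Disk) : ℂ :=
  fderivWithin ℝ (diskExt h q.1) (Metric.closedBall 0 1) q.2.1 c

lemma dbar₂_eq (h : SM M × Disk → ℂ) (q : SM M × Disk) :
    dbar₂ h q = (diskDeriv 1 h q + Complex.I * diskDeriv Complex.I h q) / 2 := rfl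

/-- The fibre derivative of a function given near a fibre by a function of the coordinates. -/
lemma diskDeriv_eq_of_local {k : SM M × Disk → ℂ} {H : (E2 × E2) × ℂ → ℂ} (q : SM M × Disk)
    (hq : q.1.1.1 ∈ (extChartAt (𝓡∂ 2) x₀).source)
    (hH : DifferentiableWithinAt ℝ H (repDom x₀) (chartCo x₀ q.1.1, q.2.1))
    (hkH : ∀ z : Disk, k (q.1, z) = H (chartCo x₀ q.1.1, z.1)) (c : ℂ) :
    diskDeriv c k q = fderivWithin ℝ H (repDom x₀) (chartCo x₀ q.1.1, q.2.1) (0, c) := by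
  have hsl : HasFDerivWithinAt (fun z : ℂ => (chartCo x₀ q.1.1, z)) (ContinuousLinearMap.inr ℝ (E2 × E2) ℂ)
    (Metric.closedBall 0 1) q.2.1 := (hasFDerivAt_prodMk_right _ _).hasFDerivWithinAt
  have h1 := HasFDerivWithinAt.comp (f := fun z : ℂ => (chartCo x₀ q.1.1, z)) q.2.1
    hH.hasFDerivWithinAt hsl fun z hz => ⟨chartCo_mem q.1 hq, hz⟩
  have h2 : ∀ z ∈ Metric.closedBall (0 : ℂ) 1, diskExt k q.1 z = (H ∘ fun z : ℂ => (chartCo x₀ q.1.1, z)) z :=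
    fun z hz => (dif_pos hz).trans (hkH ⟨z, hz⟩)
  rw [diskDeriv, (h1.congr h2 (h2 _ q.2.2)).fderivWithin (uniqueDiffDisk q.2)]
  rfl

lemma rep_diskDeriv (hh : SmoothSMD h) (c : ℂ) {s : (E2 × E2) × ℂ} (hs : s ∈ repDom x₀) :
    rep x₀ (diskDeriv c h) s = fderivWithin ℝ (rep x₀ h) (repDom x₀) s (0, c) := by
  have hP : (chartPt x₀ s.1).2 ≠ 0 := (chartPt_ne_zero_iff hs.1.1).2 hs.1.2
  have hsl : HasFDerivWithinAt (fun z : ℂ => (s.1, z)) (ContinuousLinearMap.inr ℝ (E2 × E2) ℂ)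
    (Metric.closedBall 0 1) s.2 := (hasFDerivAt_prodMk_right _ _).hasFDerivWithinAt
  have h1 := HasFDerivWithinAt.comp (f := fun z : ℂ => (s.1, z)) s.2
    (hh.hasFDerivWithinAt_rep hs) hsl fun z hz => ⟨hs.1, hz⟩
  have h2 : rep x₀ h ∘ (fun z : ℂ => (s.1, z)) = diskExt h (normalize (chartPt x₀ s.1) hP) :=
    funext fun z => (diskExt_normalize h _ hP z).symm
  rw [h2] at h1
  rw [rep, homExtD_of_mem _ (q := (chartPt x₀ s.1, s.2)) ⟨hP, hs.2⟩, diskDeriv,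
    h1.fderivWithin (uniqueDiffDisk ⟨s.2, hs.2⟩)]
  rfl

lemma contDiffOn_fderivWithin_rep (hh : SmoothSMD h) :
    ContDiffOn ℝ ∞ (fderivWithin ℝ (rep x₀ h) (repDom x₀)) (repDom x₀) :=
  hh.contDiffOn_rep.fderivWithin uniqueDiffOn_repDom (by simp)

lemma repDom_center_mem {v : E2} (hv : v ≠ 0) {z : ℂ} (hz : z ∈ Metric.closedBall (0 : ℂ) 1) :
    ((extChartAt (𝓡∂ 2) x₀ x₀, v), z) ∈ repDom x₀ := ⟨⟨mem_extChartAt_target x₀, hv⟩, hz⟩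

lemma SmoothSMD.apply_diskDeriv (hh : SmoothSMD h) (c : ℂ) : SmoothSMD (diskDeriv c h) :=
  smoothSMD_of_contDiffWithinAt fun _ _ hv _ hw =>
    (((contDiffOn_fderivWithin_rep hh).clm_apply contDiffOn_const).congr fun _ hs => rep_diskDeriv hh c hs) _
      (repDom_center_mem hv hw)

lemma SmoothSMD.apply_dbar₂ (hh : SmoothSMD h) : SmoothSMD (dbar₂ h) := by
  have h1 := functionClassSMD.mul (functionClassSMD.add (hh.apply_diskDeriv 1)
    (functionClassSMD.mul (functionClassSMD.const Complex.I) (hh.apply_diskDeriv Complex.I))) (functionClassSMD.const 2⁻¹)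
  exact h1

variable (o : SurfaceOrientation M)

/-- The derivative along the horizontal lift of the rotated vector. -/
def horDir (θ : Real.Angle) (u : SM M → ℂ) (p : SM M) : ℂ := horDeriv u p ((o.at' p.1.1).rotation θ p.1.2)

lemma X_eq_horDir (u : SM M → ℂ) (p : SM M) : X u p = horDir o 0 u p := by
  rw [horDir, Orientation.rotation_zero]; rfl

lemma Xperp_eq_horDir (u : SM M → ℂ) (p : SM M) : Xperp o u p = horDir o (-(Real.pi / 2 : ℝ) : Real.Angle) u p := by
  rw [horDir, ← Orientation.rotation_symm, Orientation.rotation_pi_div_two, Orientation.rightAngleRotation_symm]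
  rfl

variable (x₀) in
/-- The horizontal vector field of `horDir` in the chart at `x₀`. -/
def horFld (θ : Real.Angle) (s : E2 × E2) : E2 × E2 :=
  ((rotCo o x₀ θ s).2, -chr (range (𝓡∂ 2)) (metricIn x₀) s.1 s.2 (rotCo o x₀ θ s).2)

lemma SmoothSMD.horDir_slice (hh : SmoothSMD h) (θ : Real.Angle) (q : SM M × Disk)
    (hq : q.1.1.1 ∈ (extChartAt (𝓡∂ 2) x₀).source) :
    horDir o θ (fun p => h (p, q.2)) q.1 = fderivWithin ℝ (rep x₀ h) (repDom x₀) (chartCo x₀ q.1.1, q.2.1)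
      (horFld x₀ o θ (chartCo x₀ q.1.1), 0) := by
  have h1 := congrArg Prod.snd (chartCo_rot o θ q.1 hq)
  have h2 : tangentCoordChange (𝓡∂ 2) q.1.1.1 x₀ q.1.1.1 ((o.at' q.1.1.1).rotation θ q.1.1.2) =
    (rotCo o x₀ θ (chartCo x₀ q.1.1)).2 := h1
  rw [horDir, hh.horDeriv_slice q hq, h2]
  rfl

/-- Smoothness is claimed only over the centre of the chart, near which the rotation is known to be
smooth; `smoothSMD_of_local` asks for no more. -/
lemma contDiffWithinAt_horFld (θ : Real.Angle) {v : E2} (hv : v ≠ 0) :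
    ContDiffWithinAt ℝ ∞ (horFld x₀ o θ) (chartDom x₀ ×ˢ {0}ᶜ) (extChartAt (𝓡∂ 2) x₀ x₀, v) := by
  obtain ⟨V, hVo, hxV, hV⟩ := exists_contDiffOn_rotIn o x₀
  have hmem : (extChartAt (𝓡∂ 2) x₀ x₀, v) ∈ chartDom x₀ ×ˢ ({0}ᶜ : Set E2) := ⟨mem_extChartAt_target x₀, hv⟩
  induction θ using Real.Angle.induction_on with | _ t
  have h1 : ContDiffWithinAt ℝ ∞ (fun s => (rotCo o x₀ (t : Real.Angle) s).2) (chartDom x₀ ×ˢ {0}ᶜ)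
      (extChartAt (𝓡∂ 2) x₀ x₀, v) := by
    have h2 := contDiff_snd.comp_contDiffOn ((contDiffOn_rotCo o hV).comp
      (contDiff_id.prodMk contDiff_const : ContDiff ℝ ∞ fun s : E2 × E2 => (s, t)).contDiffOn
      (s := (chartDom x₀ ∩ V) ×ˢ {0}ᶜ) fun s hs => ⟨hs, mem_univ _⟩)
    refine (h2 _ ⟨⟨hmem.1, hxV⟩, hv⟩).mono_of_mem_nhdsWithin ?_
    have h3 : V ×ˢ univ ∈ 𝓝 (extChartAt (𝓡∂ 2) x₀ x₀, v) := (hVo.prod isOpen_univ).mem_nhds ⟨hxV, mem_univ _⟩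
    filter_upwards [self_mem_nhdsWithin, mem_nhdsWithin_of_mem_nhds h3] with s hs hs'
    exact ⟨⟨hs.1, hs'.1⟩, hs.2⟩
  refine h1.prodMk (ContDiffWithinAt.neg ?_)
  have h4 := contDiffWithinAt_chr uniqueDiffOn_chartDom contDiffOn_metricIn
    (fun y hy a ha => metricIn_self_pos hy ha) (fun s hs => hs.1) hmem contDiff_fst.contDiffWithinAt
    contDiff_snd.contDiffWithinAt h1
  refine h4.congr (fun s hs => ?_) ?_
  · exact (chr_congr_set (extChartAt_target_eventuallyEq_of_mem hs.1) _ _).symm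
  · exact (chr_congr_set (extChartAt_target_eventuallyEq_of_mem hmem.1) _ _).symm

lemma contDiffWithinAt_horDir (hh : SmoothSMD h) (θ : Real.Angle) {v : E2} (hv : v ≠ 0) {z : ℂ}
    (hz : z ∈ Metric.closedBall (0 : ℂ) 1) :
    ContDiffWithinAt ℝ ∞ (fun s => fderivWithin ℝ (rep x₀ h) (repDom x₀) s (horFld x₀ o θ s.1, 0)) (repDom x₀)
      ((extChartAt (𝓡∂ 2) x₀ x₀, v), z) := by
  have h1 : ContDiffWithinAt ℝ ∞ (fun s : (E2 × E2) × ℂ => horFld x₀ o θ s.1) (repDom x₀)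
      ((extChartAt (𝓡∂ 2) x₀ x₀, v), z) :=
    (contDiffWithinAt_horFld o θ hv).comp ((extChartAt (𝓡∂ 2) x₀ x₀, v), z) contDiff_fst.contDiffWithinAt
      fun s hs => hs.1
  exact (contDiffOn_fderivWithin_rep hh _ (repDom_center_mem hv hz)).clm_apply
    (h1.prodMk contDiffWithinAt_const)

lemma SmoothSMD.apply_horDir (hh : SmoothSMD h) (θ : Real.Angle) :
    SmoothSMD fun q => horDir o θ (fun p => h (p, q.2)) q.1 :=
  smoothSMD_of_local fun _ => ⟨_, fun _ hv _ hw => contDiffWithinAt_horDir o hh θ hv hw,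
    fun q hq => hh.horDir_slice o θ q hq⟩

/-- Horizontal derivatives commute with derivatives along the disk. -/
lemma diskDeriv_horDir (hh : SmoothSMD h) (θ : Real.Angle) (c : ℂ) (q : SM M × Disk) :
    diskDeriv c (fun q => horDir o θ (fun p => h (p, q.2)) q.1) q =
      horDir o θ (fun p => diskDeriv c h (p, q.2)) q.1 := by
  let x₀ := q.1.1.1
  have hq : q.1.1.1 ∈ (extChartAt (𝓡∂ 2) x₀).source := mem_extChartAt_source _
  have hs := mem_repDom q hq
  set s₀ : (E2 × E2) × ℂ := (chartCo x₀ q.1.1, q.2.1) with hs₀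
  have hcl : s₀ ∈ closure (interior (repDom x₀)) := by
    rw [repDom, interior_prod_eq, interior_prod_eq, closure_prod_eq, closure_prod_eq,
      isOpen_compl_singleton.interior_eq, interior_closedBall _ one_ne_zero, closure_ball _ one_ne_zero]
    exact ⟨⟨extChartAt_target_subset_closure_interior hs.1.1, subset_closure hs.1.2⟩, hs.2⟩
  -- The commutation rests on symmetry of the second derivative of the local representation, valid
  -- at boundary and corner points too.
  have hsymm := (hh.contDiffOn_rep s₀ hs).isSymmSndFDerivWithinAt
    (by rw [minSmoothness_of_isRCLikeNormedField]; exact ENat.LEInfty.out) uniqueDiffOn_repDom hcl hs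
  have hd := ((contDiffOn_fderivWithin_rep hh).differentiableOn (by simp) s₀ hs).hasFDerivWithinAt
  have hsm := contDiffWithinAt_horDir (x₀ := x₀) o hh θ hs.1.2 q.2.2
  rw [diskDeriv_eq_of_local q hq (hsm.differentiableWithinAt (by simp))
    (fun z => hh.horDir_slice o θ (q.1, z) hq), (hh.apply_diskDeriv c).horDir_slice o θ q hq]
  have hR : fderivWithin ℝ (rep x₀ (diskDeriv c h)) (repDom x₀) s₀ =
      (fderivWithin ℝ (fderivWithin ℝ (rep x₀ h) (repDom x₀)) (repDom x₀) s₀).flip (0, c) := by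
    rw [fderivWithin_congr (fun s hs => rep_diskDeriv hh c hs) (rep_diskDeriv hh c hs)]
    refine HasFDerivWithinAt.fderivWithin ?_ (uniqueDiffOn_repDom _ hs)
    exact (hd.clm_apply (hasFDerivWithinAt_const _ _ _)).congr_fderiv (by ext <;> simp)
  -- The horizontal field does not depend on the disk variable, so its derivative contributes
  -- nothing in the direction `(0, c)`.
  have hX : HasFDerivWithinAt (horFld x₀ o θ) (fderivWithin ℝ (horFld x₀ o θ) (chartDom x₀ ×ˢ {0}ᶜ) s₀.1)
      (chartDom x₀ ×ˢ {0}ᶜ) s₀.1 :=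
    ((contDiffWithinAt_horFld o θ hs.1.2).differentiableWithinAt (by simp)).hasFDerivWithinAt
  have hfst : HasFDerivWithinAt Prod.fst (ContinuousLinearMap.fst ℝ (E2 × E2) ℂ) (repDom x₀) s₀ :=
    hasFDerivWithinAt_fst
  have hF := (HasFDerivWithinAt.comp s₀ hX hfst fun s hs => hs.1).prodMk
    (hasFDerivWithinAt_const (0 : ℂ) s₀ (repDom x₀))
  have hL := (hd.clm_apply hF).fderivWithin (uniqueDiffOn_repDom _ hs)
  refine (congrArg (fun L : (E2 × E2) × ℂ →L[ℝ] ℂ => L (0, c)) hL).trans ?_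
  rw [← hs₀, hR]
  simp only [add_apply, ContinuousLinearMap.comp_apply, ContinuousLinearMap.flip_apply,
    ContinuousLinearMap.prod_apply, ContinuousLinearMap.coe_fst', map_zero, zero_apply]
  rw [hsymm]
  exact (congrArg₂ (· + ·) (map_zero (fderivWithin ℝ (rep x₀ h) (repDom x₀) s₀)) rfl).trans (zero_add _)

end DerivativesInCharts

end Twistor

end

/-! ### Horizontal derivatives under the circle action. -/

noncomputable section

namespace Twistor

open MeasureTheory Complex Set

section Equivariance

variable {M : Type*} [TopologicalSpace M] [ChartedSpace (EuclideanHalfSpace 2) M]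
  [IsManifold (𝓡∂ 2) ∞ M] [RiemannianBundle (fun x : M => TangentSpace (𝓡∂ 2) x)]
  [IsContMDiffRiemannianBundle (𝓡∂ 2) ∞ E2 (fun x : M => TangentSpace (𝓡∂ 2) x)] {x₀ : M}
  {u : SM M → ℂ}

lemma SmoothSM.differentiableWithinAt_chart (hu : SmoothSM u) (p : SM M)
    (hp : p.1.1 ∈ (extChartAt (𝓡∂ 2) x₀).source) :
    DifferentiableWithinAt ℝ (fun s => homExt u (chartPt x₀ s)) (range (𝓡∂ 2) ×ˢ univ) (chartCo x₀ p.1) := by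
  have hh := smoothSM_iff.1 hu
  let q : SM M × Disk := (p, ⟨0, by simp⟩)
  have hsl : HasFDerivWithinAt (fun s : E2 × E2 => (s, q.2.1)) (ContinuousLinearMap.inl ℝ (E2 × E2) ℂ)
    (chartDom x₀ ×ˢ {0}ᶜ) (chartCo x₀ q.1.1) := (hasFDerivAt_prodMk_left _ _).hasFDerivWithinAt
  have h1 := HasFDerivWithinAt.comp (f := fun s : E2 × E2 => (s, q.2.1)) (chartCo x₀ q.1.1)
    (hh.hasFDerivWithinAt_rep (mem_repDom q hp)) hsl fun s hs => ⟨hs, q.2.2⟩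
  have h2 : rep x₀ (fun q => u q.1) ∘ (fun s : E2 × E2 => (s, q.2.1)) = fun s => homExt u (chartPt x₀ s) :=
    funext fun s => (homExt_slice (fun q => u q.1) q.2 _).symm
  rw [h2, hasFDerivWithinAt_congr_set (chartDom_prod_eventuallyEq (chartCo_mem q.1 hp))] at h1
  exact h1.differentiableWithinAt

/-- Horizontal derivatives are linear in the direction. -/
lemma SmoothSM.horDeriv_combination (hu : SmoothSM u) (p : SM M) (a b : ℝ) (w w' : TangentSpace (𝓡∂ 2) p.1.1) :
    horDeriv u p (a • w + b • w') = a * horDeriv u p w + b * horDeriv u p w' := by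
  have hp := mem_extChartAt_source (I := 𝓡∂ 2) p.1.1
  have hy := (chartCo_mem p hp).1
  have hd := (hu.differentiableWithinAt_chart p hp).hasFDerivWithinAt
  rw [horDeriv_eq hp hd, horDeriv_eq hp hd, horDeriv_eq hp hd]
  set L := fderivWithin ℝ (fun s => homExt u (chartPt p.1.1 s)) (range (𝓡∂ 2) ×ˢ univ) (chartCo p.1.1 p.1)
  let T : E2 →L[ℝ] E2 := tangentCoordChange (𝓡∂ 2) p.1.1 p.1.1 p.1.1
  have h1 : T (a • w + b • w') = a • T w + b • T w' := by
    refine (map_add T _ _).trans ?_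
    exact congrArg₂ (· + ·) (map_smul T a w) (map_smul T b w')
  have h2 : horLift p.1.1 p.1 (a • T w + b • T w') = a • horLift p.1.1 p.1 (T w) + b • horLift p.1.1 p.1 (T w') := by
    refine Prod.ext rfl ?_
    change -chr _ _ _ _ _ = a • -chr _ _ _ _ _ + b • -chr _ _ _ _ _
    have hpos : ∀ a, a ≠ 0 → 0 < metricIn p.1.1 (chartCo p.1.1 p.1).1 a a := fun a ha => metricIn_self_pos hy ha
    rw [chr_add_right hpos, chr_smul_right hpos, chr_smul_right hpos]
    module
  have h3 : L (horLift p.1.1 p.1 (T (a • w + b • w'))) =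
      a * L (horLift p.1.1 p.1 (T w)) + b * L (horLift p.1.1 p.1 (T w')) := by
    rw [h1, h2, map_add, map_smul, map_smul, Complex.real_smul, Complex.real_smul]
  exact h3

variable (o : SurfaceOrientation M)

lemma rotT_ne_zero_iff (θ : Real.Angle) (P : TangentBundle (𝓡∂ 2) M) : (rotT o θ P).2 ≠ 0 ↔ P.2 ≠ 0 :=
  (((o.at' P.1).rotation θ).toLinearEquiv.map_ne_zero_iff)

lemma homExt_rot (θ : Real.Angle) (u : SM M → ℂ) (P : TangentBundle (𝓡∂ 2) M) :
    homExt (fun p => u (rot o θ p)) P = homExt u (rotT o θ P) := by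
  by_cases hP : P.2 ≠ 0
  · have hP' := (rotT_ne_zero_iff o θ P).2 hP
    rw [homExt, dif_pos hP, homExt, dif_pos hP']
    congr 1
    apply Subtype.ext
    refine congrArg (TotalSpace.mk (E := fun x : M => TangentSpace (𝓡∂ 2) x) P.1) ?_
    change (o.at' P.1).rotation θ (‖P.2‖⁻¹ • P.2) = ‖(o.at' P.1).rotation θ P.2‖⁻¹ • (o.at' P.1).rotation θ P.2
    rw [map_smul, LinearIsometryEquiv.norm_map]
  · rw [homExt, dif_neg hP, homExt, dif_neg fun h => hP ((rotT_ne_zero_iff o θ P).1 h)]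

/-- Horizontal lifts are invariant under the circle action. -/
lemma SmoothSM.horDeriv_rot (hu : SmoothSM u) (θ : Real.Angle) (p : SM M) (w : TangentSpace (𝓡∂ 2) p.1.1) :
    horDeriv (fun p => u (rot o θ p)) p w = horDeriv u (rot o θ p) w := by
  obtain ⟨V, hVo, hxV, hV⟩ := exists_contDiffOn_rotIn o p.1.1
  have hp := mem_extChartAt_source (I := 𝓡∂ 2) p.1.1
  have hs := chartCo_mem p hp
  have hy := hs.1
  have hR : range (𝓡∂ 2) ∈ 𝓝[range (𝓡∂ 2)] (extChartAt (𝓡∂ 2) p.1.1 p.1.1) := self_mem_nhdsWithin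
  have hD := extChartAt_target_mem_nhdsWithin (I := 𝓡∂ 2) p.1.1
  have hJ : DifferentiableWithinAt ℝ (rotIn o p.1.1) (range (𝓡∂ 2)) (extChartAt (𝓡∂ 2) p.1.1 p.1.1) :=
    (hV.differentiableOn (by simp) _ ⟨hy, hxV⟩).mono_of_mem_nhdsWithin
      (Filter.inter_mem hD (mem_nhdsWithin_of_mem_nhds (hVo.mem_nhds hxV)))
  set s₀ := chartCo p.1.1 p.1 with hs₀
  have hJs : HasFDerivWithinAt (rotIn o p.1.1) (fderivWithin ℝ (rotIn o p.1.1) (range (𝓡∂ 2)) s₀.1)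
    (range (𝓡∂ 2)) s₀.1 := hJ.hasFDerivWithinAt
  have hfst : HasFDerivWithinAt (Prod.fst : E2 × E2 → E2) (ContinuousLinearMap.fst ℝ E2 E2)
    (range (𝓡∂ 2) ×ˢ univ) s₀ := hasFDerivWithinAt_fst
  have hsnd : HasFDerivWithinAt (Prod.snd : E2 × E2 → E2) (ContinuousLinearMap.snd ℝ E2 E2)
    (range (𝓡∂ 2) ×ˢ univ) s₀ := hasFDerivWithinAt_snd
  have hrot := hfst.prodMk ((hsnd.const_smul θ.cos).add
    (((HasFDerivWithinAt.comp s₀ hJs hfst fun s hs => hs.1).clm_apply hsnd).const_smul θ.sin))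
  have hco : chartCo p.1.1 (rot o θ p).1 = rotCo o p.1.1 θ s₀ := chartCo_rot o θ p hp
  have hd : HasFDerivWithinAt (fun s => homExt u (chartPt p.1.1 s)) _ (range (𝓡∂ 2) ×ˢ univ)
    (chartCo p.1.1 (rot o θ p).1) := (hu.differentiableWithinAt_chart (rot o θ p) hp).hasFDerivWithinAt
  set L := fderivWithin ℝ (fun s => homExt u (chartPt p.1.1 s)) (range (𝓡∂ 2) ×ˢ univ)
    (chartCo p.1.1 (rot o θ p).1) with hL
  have hd' := hd
  rw [hco] at hd'
  have hcomp := HasFDerivWithinAt.comp (f := rotCo o p.1.1 θ) s₀ hd' hrot fun s hs => ⟨hs.1, mem_univ _⟩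
  have hnear : (chartDom p.1.1 ×ˢ {0}ᶜ : Set (E2 × E2)) ∈ 𝓝[range (𝓡∂ 2) ×ˢ univ] s₀ := by
    have := (chartDom_prod_eventuallyEq hs).mem_iff
    filter_upwards [mem_nhdsWithin_of_mem_nhds this, self_mem_nhdsWithin] with t ht ht'
    exact ht.2 ht'
  have hcomp' := hcomp.congr_of_eventuallyEq (f₁ := fun s => homExt (fun p => u (rot o θ p)) (chartPt p.1.1 s))
    (Filter.mem_of_superset hnear fun s hs => by
      change homExt (fun p => u (rot o θ p)) (chartPt p.1.1 s) = homExt u (chartPt p.1.1 (rotCo o p.1.1 θ s))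
      rw [homExt_rot, chartPt_rotCo o θ hs.1])
    (by
      change homExt (fun p => u (rot o θ p)) (chartPt p.1.1 s₀) = homExt u (chartPt p.1.1 (rotCo o p.1.1 θ s₀))
      rw [homExt_rot, chartPt_rotCo o θ hy])
  refine (horDeriv_eq hp hcomp' w).trans (Eq.trans ?_ (horDeriv_eq (p := rot o θ p) hp hd w).symm)
  refine congrArg L (Prod.ext rfl ?_)
  let w' : E2 := tangentCoordChange (𝓡∂ 2) p.1.1 p.1.1 p.1.1 w
  have hpos : ∀ a, a ≠ 0 → 0 < metricIn p.1.1 s₀.1 a a := fun a ha => metricIn_self_pos hy ha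
  -- Rotating a vector by `θ` is `cos θ + sin θ J`. Since `J` is parallel, the differential of the
  -- rotation maps horizontal lifts to horizontal lifts of the same base vector.
  have key := fderivWithin_rot_apply (R := range (𝓡∂ 2)) (G := metricIn p.1.1) (J := rotIn o p.1.1) (y := s₀.1)
    (finrank_euclideanSpace_fin) ((𝓡∂ 2).uniqueDiffOn _ (extChartAt_mem_range _)) (extChartAt_mem_range _)
    (differentiableWithinAt_metricIn hy) metricIn_comm hpos hJ
    (Filter.mem_of_superset hD fun z hz => rotIn_rotIn o hz)
    (Filter.mem_of_superset hD fun z hz => metricIn_rotIn o hz) s₀.2 w'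
  change θ.cos • -chr (range (𝓡∂ 2)) (metricIn p.1.1) s₀.1 s₀.2 w' +
      θ.sin • (rotIn o p.1.1 s₀.1 (-chr (range (𝓡∂ 2)) (metricIn p.1.1) s₀.1 s₀.2 w') +
        fderivWithin ℝ (rotIn o p.1.1) (range (𝓡∂ 2)) s₀.1 w' s₀.2) =
    -chr (range (𝓡∂ 2)) (metricIn p.1.1) (chartCo p.1.1 (rot o θ p).1).1 (chartCo p.1.1 (rot o θ p).1).2 w'
  rw [key, hco]
  change _ = -chr (range (𝓡∂ 2)) (metricIn p.1.1) s₀.1 (θ.cos • s₀.2 + θ.sin • rotIn o p.1.1 s₀.1 s₀.2) w'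
  rw [chr_add_left hpos, chr_smul_left hpos, chr_smul_left hpos, map_neg]
  module

lemma SmoothSM.comp_rot (hu : SmoothSM u) (θ : Real.Angle) : SmoothSM fun p => u (rot o θ p) := by
  induction θ using Real.Angle.induction_on with | _ t
  rw [smoothSM_iff]
  refine smoothSMD_of_local fun x₀ => ⟨fun s => orbitCo o x₀ u (s.1, t), fun v hv z hz => ?_, fun q hq =>
    (orbitCo_chartCo o u q.1 hq t).symm⟩
  obtain ⟨V, hVo, hxV, hV⟩ := exists_contDiffOn_rotIn o x₀
  have h1 := (contDiffOn_orbitCo o hu hV).comp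
    (contDiff_fst.prodMk contDiff_const : ContDiff ℝ ∞ fun s : (E2 × E2) × ℂ => (s.1, t)).contDiffOn
    (s := ((chartDom x₀ ∩ V) ×ˢ {0}ᶜ) ×ˢ univ) fun s hs => ⟨hs.1, mem_univ _⟩
  have hm : ((extChartAt (𝓡∂ 2) x₀ x₀, v), z) ∈ ((chartDom x₀ ∩ V) ×ˢ ({0}ᶜ : Set E2)) ×ˢ (univ : Set ℂ) :=
    ⟨⟨⟨mem_extChartAt_target x₀, hxV⟩, hv⟩, mem_univ _⟩
  refine (h1 _ hm).mono_of_mem_nhdsWithin ?_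
  have h3 : (V ×ˢ univ) ×ˢ univ ∈ 𝓝 ((extChartAt (𝓡∂ 2) x₀ x₀, v), z) :=
    ((hVo.prod isOpen_univ).prod isOpen_univ).mem_nhds ⟨⟨hxV, mem_univ _⟩, mem_univ _⟩
  filter_upwards [self_mem_nhdsWithin, mem_nhdsWithin_of_mem_nhds h3] with s hs hs'
  exact ⟨⟨⟨hs.1.1, hs'.1.1⟩, hs.1.2⟩, mem_univ _⟩

lemma SmoothSM.horDir_eq (hu : SmoothSM u) (θ : Real.Angle) (p : SM M) :
    horDir o θ u p = θ.cos * X u p - θ.sin * Xperp o u p := by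
  have h1 : (o.at' p.1.1).rotation θ p.1.2 = θ.cos • p.1.2 + (-θ.sin) • (-(o.at' p.1.1).rightAngleRotation p.1.2) := by
    rw [Orientation.rotation_apply]; module
  rw [horDir, h1, hu.horDeriv_combination, X, Xperp]
  push_cast
  ring

lemma SmoothSM.horDir_rot (hu : SmoothSM u) (θ φ : Real.Angle) (p : SM M) :
    horDir o φ u (rot o θ p) = horDir o (φ + θ) (fun p => u (rot o θ p)) p := by
  rw [horDir, horDir, hu.horDeriv_rot o]
  exact congrArg (horDeriv u (rot o θ p)) ((o.at' p.1.1).rotation_rotation φ θ p.1.2)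

/-- Multiplied by `e^{it}`, the right-hand side is `ω² η₊ + η₋` at `ω = e^{it}`, applied to the
rotated function. This identity links the geodesic field to the first component of `∂̄`. -/
lemma SmoothSM.X_rot (hu : SmoothSM u) (t : ℝ) (p : SM M) : X u (rot o (t : Real.Angle) p) =
    cexp (t * I) * etaPlus o (fun p => u (rot o (t : Real.Angle) p)) p +
      cexp (-(t * I)) * etaMinus o (fun p => u (rot o (t : Real.Angle) p)) p := by
  rw [X_eq_horDir o, hu.horDir_rot, (hu.comp_rot o _).horDir_eq, etaPlus, etaMinus, zero_add,
    Real.Angle.cos_coe, Real.Angle.sin_coe, Complex.exp_mul_I, show -(t * I : ℂ) = (-t) * I by ring, Complex.exp_mul_I,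
    Complex.cos_neg, Complex.sin_neg, Complex.ofReal_cos, Complex.ofReal_sin]
  ring_nf
  rw [I_sq]
  ring

lemma SmoothSM.Xperp_rot (hu : SmoothSM u) (t : ℝ) (p : SM M) : Xperp o u (rot o (t : Real.Angle) p) =
    Real.sin t * X (fun p => u (rot o (t : Real.Angle) p)) p +
      Real.cos t * Xperp o (fun p => u (rot o (t : Real.Angle) p)) p := by
  rw [Xperp_eq_horDir, hu.horDir_rot, (hu.comp_rot o _).horDir_eq]
  rw [add_comm, ← Real.Angle.coe_neg, ← Real.Angle.coe_add, Real.Angle.cos_coe, Real.Angle.sin_coe,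
    ← sub_eq_add_neg, Real.cos_sub_pi_div_two, Real.sin_sub_pi_div_two]
  push_cast
  ring

lemma SmoothSM.X_rot' (hu : SmoothSM u) (t : ℝ) (p : SM M) : X u (rot o (t : Real.Angle) p) =
    Real.cos t * X (fun p => u (rot o (t : Real.Angle) p)) p -
      Real.sin t * Xperp o (fun p => u (rot o (t : Real.Angle) p)) p := by
  rw [X_eq_horDir o, hu.horDir_rot, (hu.comp_rot o _).horDir_eq, zero_add, Real.Angle.cos_coe, Real.Angle.sin_coe]

/-- The operators `η₊` and `η₋` shift the weight under the circle action by `+1` and `-1`, which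
fixes the behaviour of `ω² η₊ + η₋` under rotation. -/
lemma SmoothSM.etaPlus_rot (hu : SmoothSM u) (t : ℝ) (p : SM M) : etaPlus o u (rot o (t : Real.Angle) p) =
    cexp (t * I) * etaPlus o (fun p => u (rot o (t : Real.Angle) p)) p := by
  rw [etaPlus, etaPlus, hu.Xperp_rot, hu.X_rot' o, Complex.exp_mul_I, ← Complex.ofReal_cos, ← Complex.ofReal_sin]
  linear_combination (-(Real.sin t : ℂ) * Xperp o (fun p => u (rot o (t : Real.Angle) p)) p / 2) * I_sq

lemma SmoothSM.etaMinus_rot (hu : SmoothSM u) (t : ℝ) (p : SM M) : etaMinus o u (rot o (t : Real.Angle) p) =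
    cexp (-(t * I)) * etaMinus o (fun p => u (rot o (t : Real.Angle) p)) p := by
  rw [etaMinus, etaMinus, hu.Xperp_rot, hu.X_rot' o, show -(t * I : ℂ) = (-t) * I by ring, Complex.exp_mul_I,
    Complex.cos_neg, Complex.sin_neg, ← Complex.ofReal_cos, ← Complex.ofReal_sin]
  linear_combination (-(Real.sin t : ℂ) * Xperp o (fun p => u (rot o (t : Real.Angle) p)) p / 2) * I_sq

end Equivariance

end Twistor

end

/-! ### The two components of `∂̄`, and holomorphic extension along the disks. -/

noncomputable section

namespace Twistor

open MeasureTheory Complex Set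

section Operators

variable {M : Type*} [TopologicalSpace M] [ChartedSpace (EuclideanHalfSpace 2) M]
  [IsManifold (𝓡∂ 2) ∞ M] [RiemannianBundle (fun x : M => TangentSpace (𝓡∂ 2) x)]
  [IsContMDiffRiemannianBundle (𝓡∂ 2) ∞ E2 (fun x : M => TangentSpace (𝓡∂ 2) x)] {x₀ : M}
  {h k : SM M × Disk → ℂ} {u : SM M → ℂ} (o : SurfaceOrientation M)

lemma smoothSMD_coord : SmoothSMD fun q : SM M × Disk => q.2.1 :=
  smoothSMD_of_local fun _ => ⟨fun s => s.2, fun _ _ _ _ => contDiff_snd.contDiffWithinAt, fun _ _ => rfl⟩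

/-- The operator `h ↦ X_θ h` on functions on `SM × 𝔻`. -/
def fldD (θ : Real.Angle) (h : SM M × Disk → ℂ) (q : SM M × Disk) : ℂ := horDir o θ (fun p => h (p, q.2)) q.1

lemma derivationFldD (θ : Real.Angle) : DerivationOn (SmoothSMD (M := M)) (fldD o θ) where
  const c q := horDeriv_const c q.1 _
  add hu hw q := horDeriv_add (hu.slice q.2) (hw.slice q.2) q.1 _
  mul hu hw q := horDeriv_mul (hu.slice q.2) (hw.slice q.2) q.1 _

lemma SmoothSMD.apply_fldD (hh : SmoothSMD h) (θ : Real.Angle) : SmoothSMD (fldD o θ h) := hh.apply_horDir o θ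

lemma DerivationOn.const_mul {Y : Type*} {S : (Y → ℂ) → Prop} {D : (Y → ℂ) → Y → ℂ} (hS : FunctionClass S)
    (hD : DerivationOn S D) (c : ℂ) {u : Y → ℂ} (hu : S u) (y : Y) : D (fun z => c * u z) y = c * D u y := by
  rw [hD.mul (hS.const c) hu, hD.const, zero_mul, zero_add]

lemma dbar₂_fldD (hh : SmoothSMD h) (θ : Real.Angle) (q : SM M × Disk) :
    dbar₂ (fldD o θ h) q = fldD o θ (dbar₂ h) q := by
  have h1 : dbar₂ h = fun q => 2⁻¹ * (diskDeriv 1 h q + Complex.I * diskDeriv Complex.I h q) := by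
    funext q; rw [dbar₂_eq]; ring
  have hD := derivationFldD o θ
  rw [h1, hD.const_mul functionClassSMD _ (functionClassSMD.add (hh.apply_diskDeriv 1)
    (functionClassSMD.mul (functionClassSMD.const _) (hh.apply_diskDeriv I))), hD.add (hh.apply_diskDeriv 1)
    (functionClassSMD.mul (functionClassSMD.const _) (hh.apply_diskDeriv I)),
    hD.const_mul functionClassSMD _ (hh.apply_diskDeriv I), dbar₂_eq, fldD, fldD, ← diskDeriv_horDir o hh,
    ← diskDeriv_horDir o hh]
  change (diskDeriv 1 (fldD o θ h) q + I * diskDeriv I (fldD o θ h) q) / 2 = 2⁻¹ * (diskDeriv 1 (fldD o θ h) q + I * diskDeriv I (fldD o θ h) q)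
  ring

/-- Written with the fields `fldD` and the coordinate `ω`, the operator is accessible to the
algebraic closure rules for smooth functions and derivations. -/
lemma dbar₁_eq (h : SM M × Disk → ℂ) : dbar₁ o h = fun q =>
    q.2.1 * q.2.1 * (2⁻¹ * (fldD o 0 h q + I * fldD o (-(Real.pi / 2 : ℝ) : Real.Angle) h q)) +
      2⁻¹ * (fldD o 0 h q + (-I) * fldD o (-(Real.pi / 2 : ℝ) : Real.Angle) h q) := by
  funext q
  simp only [dbar₁, etaPlus, etaMinus, X_eq_horDir o, Xperp_eq_horDir, fldD]
  ring

lemma SmoothSMD.apply_dbar₁ (hh : SmoothSMD h) : SmoothSMD (dbar₁ o h) := by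
  rw [dbar₁_eq]
  have hS := functionClassSMD (M := M)
  exact hS.add (hS.mul (hS.mul smoothSMD_coord smoothSMD_coord) (hS.mul (hS.const _)
    (hS.add (hh.apply_fldD o 0) (hS.mul (hS.const I) (hh.apply_fldD o _))))) (hS.mul (hS.const _)
      (hS.add (hh.apply_fldD o 0) (hS.mul (hS.const (-I)) (hh.apply_fldD o _))))

lemma dbar₂_coord (q : SM M × Disk) : dbar₂ (fun q : SM M × Disk => q.2.1) q = 0 := by
  have h1 : ∀ z ∈ Metric.closedBall (0 : ℂ) 1, diskExt (fun q : SM M × Disk => q.2.1) q.1 z = z :=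
    fun z hz => dif_pos hz
  rw [dbar₂, fderivWithin_congr h1 (h1 _ q.2.2), fderivWithin_fun_id (uniqueDiffDisk q.2)]
  simp

/-- The factor `ω²` is holomorphic, and horizontal fields commute with `∂_{ω̄}`. -/
lemma dbar₂_dbar₁ (hh : SmoothSMD h) (q : SM M × Disk) : dbar₂ (dbar₁ o h) q = dbar₁ o (dbar₂ h) q := by
  have hS := functionClassSMD (M := M)
  have hD := derivationDbar₂ (M := M)
  have h0 := hh.apply_fldD o 0
  have h1 := hh.apply_fldD o (-(Real.pi / 2 : ℝ) : Real.Angle)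
  have hp := hS.add h0 (hS.mul (hS.const I) h1)
  have hm := hS.add h0 (hS.mul (hS.const (-I)) h1)
  have hz := hS.mul (smoothSMD_coord (M := M)) (smoothSMD_coord (M := M))
  rw [dbar₁_eq, dbar₁_eq, hD.add (hS.mul hz (hS.mul (hS.const _) hp)) (hS.mul (hS.const _) hm),
    hD.mul hz (hS.mul (hS.const _) hp), hD.mul smoothSMD_coord smoothSMD_coord, dbar₂_coord,
    hD.const_mul hS _ hp, hD.const_mul hS _ hm, hD.add h0 (hS.mul (hS.const I) h1),
    hD.add h0 (hS.mul (hS.const (-I)) h1), hD.const_mul hS _ h1, hD.const_mul hS _ h1, dbar₂_fldD o hh, dbar₂_fldD o hh]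
  ring

end Operators

section FibreAnalysis

variable {M : Type*} [TopologicalSpace M] [ChartedSpace (EuclideanHalfSpace 2) M]
  [IsManifold (𝓡∂ 2) ∞ M] [RiemannianBundle (fun x : M => TangentSpace (𝓡∂ 2) x)]
  [IsContMDiffRiemannianBundle (𝓡∂ 2) ∞ E2 (fun x : M => TangentSpace (𝓡∂ 2) x)]
  {h k : SM M × Disk → ℂ} {u v : SM M → ℂ} (o : SurfaceOrientation M)

lemma SmoothSMD.continuousOn_diskExt (hh : SmoothSMD h) (p : SM M) :
    ContinuousOn (diskExt h p) (Metric.closedBall 0 1) := fun z hz =>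
  (hh.differentiableWithinAt (p, ⟨z, hz⟩)).continuousWithinAt

lemma SmoothSMD.differentiableAt_diskExt (hh : SmoothSMD h) (hd : ∀ q, dbar₂ h q = 0) (p : SM M) {z : ℂ}
    (hz : z ∈ Metric.ball (0 : ℂ) 1) : DifferentiableAt ℂ (diskExt h p) z := by
  have hzc := Metric.ball_subset_closedBall hz
  have hnhds : Metric.closedBall (0 : ℂ) 1 ∈ 𝓝 z := Filter.mem_of_superset (Metric.isOpen_ball.mem_nhds hz)
    Metric.ball_subset_closedBall
  have h1 := (hh.differentiableWithinAt (p, ⟨z, hzc⟩)).differentiableAt hnhds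
  refine differentiableAt_complex_iff_differentiableAt_real.2 ⟨h1, ?_⟩
  have h2 := hd (p, ⟨z, hzc⟩)
  rw [dbar₂, fderivWithin_of_mem_nhds hnhds] at h2
  change fderiv ℝ (diskExt h p) z I = I • fderiv ℝ (diskExt h p) z 1
  rw [smul_eq_mul]
  have h3 : fderiv ℝ (diskExt h p) z 1 + I * fderiv ℝ (diskExt h p) z I = 0 := by
    have := congrArg (· * 2) h2
    simpa using this
  linear_combination (-I) * h3 + fderiv ℝ (diskExt h p) z I * I_sq

lemma SmoothSMD.diffContOnCl_diskExt (hh : SmoothSMD h) (hd : ∀ q, dbar₂ h q = 0) (p : SM M) :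
    DiffContOnCl ℂ (diskExt h p) (Metric.ball 0 1) := by
  refine ⟨fun z hz => (hh.differentiableAt_diskExt hd p hz).differentiableWithinAt, ?_⟩
  rw [closure_ball _ one_ne_zero]
  exact hh.continuousOn_diskExt p

/-- A point of the boundary circle. -/
def circ (t : ℝ) : Disk := ⟨cexp (t * I), by simp [Complex.norm_exp_ofReal_mul_I]⟩

/-- A function holomorphic along the disks is determined by its boundary values. -/
lemma SmoothSMD.ext_of_circ (hh : SmoothSMD h) (hd : ∀ q, dbar₂ h q = 0) (hk : SmoothSMD k)
    (hd' : ∀ q, dbar₂ k q = 0) (heq : ∀ p t, h (p, circ t) = k (p, circ t)) : h = k := by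
  funext q
  have h1 := Complex.eqOn_closure_of_eqOn_frontier (Metric.isBounded_ball (x := (0 : ℂ)) (r := 1))
    (hh.diffContOnCl_diskExt hd q.1) (hk.diffContOnCl_diskExt hd' q.1) (fun z hz => by
      rw [frontier_ball _ one_ne_zero, mem_sphere_zero_iff_norm] at hz
      have h2 : circ z.arg = ⟨z, by simp [hz]⟩ := by
        apply Subtype.ext
        have := Complex.norm_mul_exp_arg_mul_I z
        rwa [hz, Complex.ofReal_one, one_mul] at this
      have h3 := heq q.1 z.arg
      rw [h2] at h3
      rw [diskExt, diskExt, dif_pos (by simp [hz]), dif_pos (by simp [hz])]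
      exact h3)
  rw [closure_ball _ one_ne_zero] at h1
  have h4 := h1 q.2.2
  rwa [diskExt_eq, diskExt_eq] at h4

/-- `h` is holomorphic along the disks, with boundary values `e^{-ict} u(φ_t p)`. -/
structure IsDiskExtension (c : ℤ) (u : SM M → ℂ) (h : SM M × Disk → ℂ) : Prop where
  smooth : SmoothSMD h
  holomorphic : ∀ q, dbar₂ h q = 0
  boundary : ∀ p t, h (p, circ t) = cexp (-(c * t * I)) * u (rot o (t : Real.Angle) p)

namespace IsDiskExtension

variable {o} {c d : ℤ}

lemma unique (hh : IsDiskExtension o c u h) (hk : IsDiskExtension o c u k) : h = k :=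
  hh.smooth.ext_of_circ hh.holomorphic hk.smooth hk.holomorphic fun p t => by rw [hh.boundary, hk.boundary]

lemma const (b : ℂ) : IsDiskExtension o 0 (fun _ => b) fun _ => b where
  smooth := functionClassSMD.const b
  holomorphic q := derivationDbar₂.const b q
  boundary p t := by simp

lemma add (hh : IsDiskExtension o c u h) (hk : IsDiskExtension o c v k) :
    IsDiskExtension o c (fun p => u p + v p) fun q => h q + k q where
  smooth := functionClassSMD.add hh.smooth hk.smooth
  holomorphic q := by rw [derivationDbar₂.add hh.smooth hk.smooth, hh.holomorphic, hk.holomorphic, add_zero]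
  boundary p t := by rw [hh.boundary, hk.boundary, mul_add]

lemma mul (hh : IsDiskExtension o c u h) (hk : IsDiskExtension o d v k) :
    IsDiskExtension o (c + d) (fun p => u p * v p) fun q => h q * k q where
  smooth := functionClassSMD.mul hh.smooth hk.smooth
  holomorphic q := by rw [derivationDbar₂.mul hh.smooth hk.smooth, hh.holomorphic, hk.holomorphic]; simp
  boundary p t := by
    rw [hh.boundary, hk.boundary, Int.cast_add, add_mul, add_mul, neg_add, Complex.exp_add]; ring

lemma sum {ι : Type*} (s : Finset ι) {u : ι → SM M → ℂ} {h : ι → SM M × Disk → ℂ}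
    (hh : ∀ i, IsDiskExtension o c (u i) (h i)) :
    IsDiskExtension o c (fun p => ∑ i ∈ s, u i p) fun q => ∑ i ∈ s, h i q := by
  classical
  induction s using Finset.induction_on with
  | empty =>
    simp only [Finset.sum_empty]
    exact ⟨functionClassSMD.const 0, fun q => derivationDbar₂.const 0 q, fun p t => by simp⟩
  | insert a s ha ih => simp only [Finset.sum_insert ha]; exact (hh a).add ih

/-- The geodesic vector field corresponds to the first component of the `∂̄` operator. -/
lemma apply_dbar₁ (hu : SmoothSM u) (hh : IsDiskExtension o 0 u h) : IsDiskExtension o (-1) (X u) (dbar₁ o h) where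
  smooth := hh.smooth.apply_dbar₁ o
  holomorphic q := by
    rw [dbar₂_dbar₁ o hh.smooth, show dbar₂ h = fun _ => 0 from funext hh.holomorphic, (derivationDbar₁ o).const]
  boundary p t := by
    have h1 : (fun p => h (p, circ t)) = fun p => u (rot o (t : Real.Angle) p) := by
      funext p; rw [hh.boundary]; simp
    rw [dbar₁, h1, hu.X_rot o]
    have h2 : cexp (-(((-1 : ℤ) : ℂ) * t * I)) = cexp (t * I) := by congr 1; push_cast; ring
    have h3 : cexp (t * I) * cexp (-(t * I)) = 1 := by rw [← Complex.exp_add]; simp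
    rw [h2]
    simp only [circ]
    linear_combination (-etaMinus o (fun p => u (rot o (t : Real.Angle) p)) p) * h3

end IsDiskExtension

end FibreAnalysis

end Twistor

end

/-! ### Disk extensions and Fourier modes determine each other. -/

noncomputable section

namespace Twistor

open MeasureTheory Complex Set

section DiskExtensions

variable {M : Type*} [TopologicalSpace M] [ChartedSpace (EuclideanHalfSpace 2) M]
  [IsManifold (𝓡∂ 2) ∞ M] [RiemannianBundle (fun x : M => TangentSpace (𝓡∂ 2) x)]
  [IsContMDiffRiemannianBundle (𝓡∂ 2) ∞ E2 (fun x : M => TangentSpace (𝓡∂ 2) x)]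
  {h k : SM M × Disk → ℂ} {u v : SM M → ℂ} (o : SurfaceOrientation M)

lemma fourierMode_eq_integral (u : SM M → ℂ) (k : ℤ) (p : SM M) : fourierMode o u k p =
    (1 / (2 * Real.pi) : ℂ) * ∫ t in (0 : ℝ)..2 * Real.pi, cexp (-(k * I) * t) * u (rot o (t : Real.Angle) p) := by
  rw [fourierMode_eq o u k p (mem_extChartAt_source _), fcoef]
  simp only [orbitCo_chartCo o u p (mem_extChartAt_source _), smul_eq_mul]

/-- The mode of index `k` has weight `k` under the circle action, by translating the periodic
integral. -/
lemma fourierMode_rot (u : SM M → ℂ) (k : ℤ) (s : ℝ) (p : SM M) :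
    fourierMode o u k (rot o (s : Real.Angle) p) = cexp (k * s * I) * fourierMode o u k p := by
  rw [fourierMode_eq_integral, fourierMode_eq_integral]
  have h1 : ∀ t : ℝ, cexp (-(k * I) * t) * u (rot o (t : Real.Angle) (rot o (s : Real.Angle) p)) =
      cexp (k * s * I) * (cexp (-(k * I) * (t + s : ℝ)) * u (rot o ((t + s : ℝ) : Real.Angle) p)) := fun t => by
    rw [rot_add, ← mul_assoc, ← Complex.exp_add]
    congr 2
    push_cast; ring
  simp only [h1]
  rw [intervalIntegral.integral_const_mul, intervalIntegral.integral_comp_add_right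
    (fun t : ℝ => cexp (-(k * I) * t) * u (rot o (t : Real.Angle) p))]
  have hper : Function.Periodic (fun t : ℝ => cexp (-(k * I) * t) * u (rot o (t : Real.Angle) p)) (2 * Real.pi) := by
    intro t
    have h2 : cexp (-(k * I) * (t + 2 * Real.pi : ℝ)) = cexp (-(k * I) * t) := by
      rw [show -(k * I) * (t + 2 * Real.pi : ℝ) = -(k * I) * t + (-k : ℤ) * (2 * Real.pi * I) by push_cast; ring,
        Complex.exp_add, Complex.exp_int_mul_two_pi_mul_I, mul_one]
    simp only [h2, Real.Angle.coe_add, Real.Angle.coe_two_pi, add_zero]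
  have h3 := hper.intervalIntegral_add_eq s 0
  rw [zero_add] at h3
  rw [zero_add, add_comm (2 * Real.pi) s, h3]
  ring

lemma modeSeries_rotD (u : SM M → ℂ) (c : ℤ) (t : ℝ) (q : SM M × Disk) :
    modeSeries o u c (rotD o (t : Real.Angle) q) = cexp (c * t * I) * modeSeries o u c q := by
  rw [modeSeries, modeSeries, ← tsum_mul_left]
  refine tsum_congr fun m => ?_
  have h1 : ((-(t : Real.Angle)).toCircle : ℂ) = cexp (-t * I) := by
    rw [← Real.Angle.coe_neg, Real.Angle.toCircle_coe, Circle.coe_exp]; push_cast; rfl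
  simp only [rotD, fourierMode_rot, h1, mul_pow, ← Complex.exp_nat_mul]
  rw [show cexp (c * t * I) = cexp (m * (-t * I)) * cexp (((m + c : ℤ) : ℂ) * t * I) by
    rw [← Complex.exp_add]; congr 1; push_cast; ring]
  ring

/-- The sum of a function over the integers from `c` on. -/
lemma hasSum_nat_add_iff {f : ℤ → ℂ} {c : ℤ} (hf : ∀ k < c, f k = 0) {a : ℂ} :
    HasSum (fun m : ℕ => f (m + c)) a ↔ HasSum f a := by
  have hi : Function.Injective fun m : ℕ => (m + c : ℤ) := fun a b hab => by simpa using hab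
  refine hi.hasSum_iff (f := f) fun k hk => hf k ?_
  by_contra hkc
  exact hk ⟨(k - c).toNat, by have := Int.toNat_of_nonneg (sub_nonneg.2 (not_lt.1 hkc)); simp only [this]; ring⟩

lemma dbar₂_eq_zero_of_differentiableAt (p : SM M) {z : ℂ} (hz : z ∈ Metric.ball (0 : ℂ) 1)
    (hd : DifferentiableAt ℂ (diskExt h p) z) : dbar₂ h (p, ⟨z, Metric.ball_subset_closedBall hz⟩) = 0 := by
  have hnhds : Metric.closedBall (0 : ℂ) 1 ∈ 𝓝 z := Filter.mem_of_superset (Metric.isOpen_ball.mem_nhds hz)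
    Metric.ball_subset_closedBall
  obtain ⟨-, h2⟩ := differentiableAt_complex_iff_differentiableAt_real.1 hd
  rw [dbar₂, fderivWithin_of_mem_nhds hnhds]
  have h3 : fderiv ℝ (diskExt h p) z I = I • fderiv ℝ (diskExt h p) z 1 := h2
  rw [smul_eq_mul] at h3
  simp only [h3]
  linear_combination (fderiv ℝ (diskExt h p) z 1 / 2) * I_sq

/-- On the open disk these are the Cauchy–Riemann equations. The derivative taken within the closed
disk is continuous up to the circle, so it vanishes there as well. -/
lemma SmoothSMD.dbar₂_eq_zero (hh : SmoothSMD h)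
    (hd : ∀ p, DifferentiableOn ℂ (diskExt h p) (Metric.ball 0 1)) (q : SM M × Disk) : dbar₂ h q = 0 := by
  have h1 : EqOn (diskExt (dbar₂ h) q.1) (fun _ => 0) (closure (Metric.ball 0 1)) := by
    refine EqOn.of_subset_closure (s := Metric.ball (0 : ℂ) 1) (fun z hz => ?_) ?_ continuousOn_const subset_closure le_rfl
    · exact (dif_pos (Metric.ball_subset_closedBall hz)).trans
        (dbar₂_eq_zero_of_differentiableAt q.1 hz ((hd q.1).differentiableAt (Metric.isOpen_ball.mem_nhds hz)))
    · rw [closure_ball _ one_ne_zero]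
      exact hh.apply_dbar₂.continuousOn_diskExt q.1
  rw [closure_ball _ one_ne_zero] at h1
  have h2 := h1 q.2.2
  rwa [diskExt_eq] at h2

lemma differentiableOn_diskExt_modeSeries (hu : SmoothSM u) (c : ℤ) (p : SM M) :
    DifferentiableOn ℂ (diskExt (modeSeries o u c) p) (Metric.ball 0 1) := by
  have hs := (summable_modeSeries o hu c (p, ⟨1, by simp⟩)).norm
  simp only [one_pow, one_mul] at hs
  have h1 := Complex.differentiableOn_tsum_of_summable_norm (U := Metric.ball (0 : ℂ) 1)
    (F := fun (m : ℕ) z => z ^ m * fourierMode o u (m + c) p) hs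
    (fun m => (differentiableOn_id.pow m).mul_const _) Metric.isOpen_ball fun m z hz => by
      rw [norm_mul, norm_pow]
      exact mul_le_of_le_one_left (norm_nonneg _) (pow_le_one₀ (norm_nonneg _) (mem_ball_zero_iff.1 hz).le)
  exact h1.congr fun z hz => dif_pos (Metric.ball_subset_closedBall hz)

/-- On the boundary circle the series is the Fourier series of `u` along the orbit, which converges
absolutely; the missing modes below `c` are zero by hypothesis. -/
lemma isDiskExtension_modeSeries (hu : SmoothSM u) (c : ℤ) (hc : ∀ k < c, ∀ p, fourierMode o u k p = 0) :
    IsDiskExtension o c u (modeSeries o u c) where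
  smooth := smoothSMD_modeSeries o hu c
  holomorphic := (smoothSMD_modeSeries o hu c).dbar₂_eq_zero (differentiableOn_diskExt_modeSeries o hu c)
  boundary p t := by
    let f : C(AddCircle (2 * Real.pi), ℂ) := ⟨_, hu.continuous_fibre o p⟩
    have hf : ∀ k, fourierCoeff f k = fourierMode o u k p := fun k => rfl
    have hi : Function.Injective fun m : ℕ => (m + c : ℤ) := fun a b hab => by simpa using hab
    have hs : Summable (fourierCoeff f) := by
      have h1 := summable_modeSeries o hu c (p, ⟨1, by simp⟩)
      simp only [one_pow, one_mul] at h1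
      exact ((hasSum_nat_add_iff (f := fourierCoeff f) fun k hk => hc k hk p).1 h1.hasSum).summable
    have h2 := has_pointwise_sum_fourier_series_of_summable hs (t : AddCircle (2 * Real.pi))
    have h3 := (hasSum_nat_add_iff (c := c) fun k hk => by rw [hf, hc k hk p, zero_smul]).2 h2
    have h4 := h3.mul_left (cexp (-(c * t * I)))
    refine Eq.trans ?_ h4.tsum_eq
    refine tsum_congr fun m => ?_
    rw [fourier_coe_apply, hf, smul_eq_mul]
    have h5 : 2 * (Real.pi : ℂ) * I * ((m + c : ℤ) : ℂ) * t / (2 * Real.pi : ℝ) = (m + c : ℤ) * t * I := by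
      have : (Real.pi : ℂ) ≠ 0 := by exact_mod_cast Real.pi_ne_zero
      push_cast
      field_simp
    rw [h5]
    simp only [circ, ← Complex.exp_nat_mul]
    rw [show cexp (m * (t * I)) = cexp (-(c * t * I)) * cexp ((m + c : ℤ) * t * I) by
      rw [← Complex.exp_add]; congr 1; push_cast; ring]
    ring

namespace IsDiskExtension

variable {o} {c : ℤ}

/-- Cauchy's theorem applied to `ω^n h` with `n = c - k - 1`. On the unit circle `ω^n h dω` is `i`
times the integrand of the mode of index `k`, and `k < c` makes `n` nonnegative. -/
lemma fourierMode_eq_zero (hh : IsDiskExtension o c u h) (k : ℤ) (hk : k < c) (p : SM M) :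
    fourierMode o u k p = 0 := by
  obtain ⟨n, hn⟩ : ∃ n : ℕ, (n : ℤ) = c - k - 1 := ⟨(c - k - 1).toNat, Int.toNat_of_nonneg (by omega)⟩
  have h1 : DiffContOnCl ℂ (fun z => z ^ n * diskExt h p z) (Metric.ball 0 1) :=
    ((differentiable_pow n).diffContOnCl).smul (hh.smooth.diffContOnCl_diskExt hh.holomorphic p)
  have h2 := h1.circleIntegral_eq_zero zero_le_one
  rw [circleIntegral] at h2
  have h3 : ∀ t : ℝ, deriv (circleMap 0 1) t • (circleMap 0 1 t ^ n * diskExt h p (circleMap 0 1 t)) =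
      I * (cexp (-(k * I) * t) * u (rot o (t : Real.Angle) p)) := fun t => by
    have h4 : circleMap 0 1 t = (circ t).1 := by simp [circleMap, circ]
    rw [deriv_circleMap, h4, smul_eq_mul, diskExt_eq h (p, circ t), hh.boundary]
    simp only [circ, ← Complex.exp_nat_mul]
    rw [show cexp (-(k * I) * t) = cexp (t * I) * cexp (n * (t * I)) * cexp (-(c * t * I)) by
      rw [← Complex.exp_add, ← Complex.exp_add]
      congr 1
      have : (n : ℂ) = c - k - 1 := by exact_mod_cast hn
      rw [this]; ring]
    ring
  simp only [h3] at h2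
  rw [intervalIntegral.integral_const_mul] at h2
  rw [fourierMode_eq_integral, (mul_eq_zero.1 h2).resolve_left I_ne_zero, mul_zero]

lemma eq_boundary (hh : IsDiskExtension o c u h) : u = fun p => h (p, circ 0) := by
  funext p
  rw [hh.boundary]
  simp [rot_zero]

lemma smoothSM (hh : IsDiskExtension o c u h) : SmoothSM u := by
  rw [hh.eq_boundary]
  exact hh.smooth.slice _

/-- By uniqueness every disk extension is the explicit series, so its equivariance may be read off
the series. -/
lemma eq_modeSeries (hh : IsDiskExtension o c u h) : h = modeSeries o u c :=
  hh.unique (isDiskExtension_modeSeries o hh.smoothSM c fun k hk p => hh.fourierMode_eq_zero k hk p)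

lemma rotD (hh : IsDiskExtension o c u h) (t : ℝ) (q : SM M × Disk) :
    h (rotD o (t : Real.Angle) q) = cexp (c * t * I) * h q := by
  rw [hh.eq_modeSeries, modeSeries_rotD]

lemma VV_eq (hh : IsDiskExtension o c u h) (q : SM M × Disk) : VV o h q = c * I * h q := by
  have h1 : (fun t : ℝ => h (Twistor.rotD o (t : Real.Angle) q)) = fun t : ℝ => cexp (c * t * I) * h q :=
    funext fun t => hh.rotD t q
  have h2 : HasDerivAt (fun t : ℝ => cexp (c * t * I) * h q) (cexp (c * (0 : ℝ) * I) * (c * 1 * I) * h q) 0 :=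
    ((((Complex.ofRealCLM.hasDerivAt (x := (0 : ℝ))).const_mul (c : ℂ)).mul_const I).cexp).mul_const _
  rw [VV, h1, h2.deriv]
  simp

end IsDiskExtension

/-- Every boundary point `(p, e^{it})` is rotated to the slice `ω = 1`, so weight and holomorphy
already determine the boundary behaviour. -/
lemma isDiskExtension_of_rotD {c : ℤ} (hh : SmoothSMD h) (hd : ∀ q, dbar₂ h q = 0)
    (hrot : ∀ (t : ℝ) q, h (rotD o (t : Real.Angle) q) = cexp (c * t * I) * h q) :
    IsDiskExtension o c (fun p => h (p, circ 0)) h where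
  smooth := hh
  holomorphic := hd
  boundary p t := by
    have h1 : rotD o (t : Real.Angle) (p, circ t) = (rot o (t : Real.Angle) p, circ 0) := by
      refine Prod.ext rfl (Subtype.ext ?_)
      have h1 : ((-(t : Real.Angle)).toCircle : ℂ) = cexp (-t * I) := by
        rw [← Real.Angle.coe_neg, Real.Angle.toCircle_coe, Circle.coe_exp]; push_cast; rfl
      simp only [rotD, h1, circ, ← Complex.exp_add]
      congr 1
      simp
    rw [← h1, hrot, ← mul_assoc, ← Complex.exp_add]
    simp

end DiskExtensions

/-! ### From the infinitesimal to the integrated weight condition. -/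

section Weights

variable {M : Type*} [TopologicalSpace M] [ChartedSpace (EuclideanHalfSpace 2) M]
  [IsManifold (𝓡∂ 2) ∞ M] [RiemannianBundle (fun x : M => TangentSpace (𝓡∂ 2) x)]
  [IsContMDiffRiemannianBundle (𝓡∂ 2) ∞ E2 (fun x : M => TangentSpace (𝓡∂ 2) x)]
  {h : SM M × Disk → ℂ} (o : SurfaceOrientation M)

lemma coe_rotD_snd (t : ℝ) (q : SM M × Disk) : (rotD o (t : Real.Angle) q).2.1 = cexp (-t * I) * q.2.1 := by
  have h1 : ((-(t : Real.Angle)).toCircle : ℂ) = cexp (-t * I) := by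
    rw [← Real.Angle.coe_neg, Real.Angle.toCircle_coe, Circle.coe_exp]; push_cast; rfl
  rw [← h1]; rfl

/-- The base point is constant along an orbit, so the whole orbit lies in one chart domain and is an
explicit trigonometric curve there. -/
lemma SmoothSMD.differentiable_rotD (hh : SmoothSMD h) (q : SM M × Disk) :
    Differentiable ℝ fun t : ℝ => h (rotD o (t : Real.Angle) q) := by
  have hq := mem_extChartAt_source (I := 𝓡∂ 2) q.1.1.1
  let γ : ℝ → (E2 × E2) × ℂ := fun t =>
    (rotCo o q.1.1.1 (t : Real.Angle) (chartCo q.1.1.1 q.1.1), cexp (-t * I) * q.2.1)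
  have h1 : ∀ t : ℝ, h (rotD o (t : Real.Angle) q) = rep q.1.1.1 h (γ t) := fun t => by
    rw [← rep_chartCo (x₀ := q.1.1.1) h (rotD o (t : Real.Angle) q) hq, coe_rotD_snd]
    congr 2
    exact chartCo_rot o _ q.1 hq
  have h2 : ∀ t, γ t ∈ repDom q.1.1.1 := fun t => by
    refine ⟨rotCo_mem o _ (chartCo_mem q.1 hq), ?_⟩
    change cexp (-t * I) * q.2.1 ∈ _
    rw [← coe_rotD_snd o]
    exact (rotD o (t : Real.Angle) q).2.2
  have h3 : Differentiable ℝ γ := by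
    have h4 : Differentiable ℝ fun t : ℝ => cexp (-t * I) * q.2.1 := by
      have h5 : Differentiable ℝ fun t : ℝ => (t : ℂ) := Complex.ofRealCLM.differentiable
      fun_prop
    refine Differentiable.prodMk (Differentiable.prodMk (differentiable_const _) ?_) h4
    simp only [Real.Angle.cos_coe, Real.Angle.sin_coe]
    fun_prop
  intro t
  rw [show (fun t : ℝ => h (rotD o (t : Real.Angle) q)) = rep q.1.1.1 h ∘ γ from funext h1]
  have h5 := (hh.hasFDerivWithinAt_rep (h2 t)).differentiableWithinAt.comp t
    (h3 t).differentiableWithinAt (s := univ) fun s _ => h2 s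
  rwa [differentiableWithinAt_univ] at h5

/-- Functions on `SM × 𝔻` satisfying `𝕍 h + i h = 0` have weight `-1` under the circle action. -/
lemma SmoothSMD.rotD_of_VV (hh : SmoothSMD h) (hV : ∀ q, VV o h q + I * h q = 0) (t : ℝ) (q : SM M × Disk) :
    h (rotD o (t : Real.Angle) q) = cexp (-t * I) * h q := by
  have hf : ∀ t : ℝ, HasDerivAt (fun t : ℝ => h (rotD o (t : Real.Angle) q)) (-I * h (rotD o (t : Real.Angle) q)) t := by
    intro t
    have h1 := (hh.differentiable_rotD o q t).hasDerivAt
    have h2 : deriv (fun t : ℝ => h (rotD o (t : Real.Angle) q)) t = VV o h (rotD o (t : Real.Angle) q) := by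
      have h3 : ∀ s : ℝ, h (rotD o (s : Real.Angle) (rotD o (t : Real.Angle) q)) =
          (fun t : ℝ => h (rotD o (t : Real.Angle) q)) (s + t) := fun s => by simp only [rotD_add, Real.Angle.coe_add]
      rw [VV]
      simp only [h3]
      rw [deriv_comp_add_const (f := fun t : ℝ => h (rotD o (t : Real.Angle) q)), zero_add]
    rw [h2, eq_neg_of_add_eq_zero_left (hV _)] at h1
    rwa [neg_mul]
  have he : ∀ t : ℝ, HasDerivAt (fun t : ℝ => cexp (t * I)) (cexp (t * I) * (1 * I)) t := fun t =>
    ((Complex.ofRealCLM.hasDerivAt (x := t)).mul_const I).cexp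
  have hg : ∀ t : ℝ, HasDerivAt (fun t : ℝ => cexp (t * I) * h (rotD o (t : Real.Angle) q)) 0 t := fun t => by
    refine ((he t).mul (hf t)).congr_deriv ?_
    ring
  have hc := is_const_of_deriv_eq_zero (fun t => (hg t).differentiableAt) (fun t => (hg t).deriv) t 0
  simp only [Complex.ofReal_zero, zero_mul, Complex.exp_zero, one_mul, Real.Angle.coe_zero, rotD_zero] at hc
  rw [← hc, ← mul_assoc, ← Complex.exp_add]
  simp

end Weights

end Twistor

end

/-! ### Matrix-valued extensions, flatness, invariance and injectivity. -/

noncomputable section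

namespace Twistor

open MeasureTheory Complex Set

section MatrixExtensions

variable {M : Type*} [TopologicalSpace M] [ChartedSpace (EuclideanHalfSpace 2) M]
  [IsManifold (𝓡∂ 2) ∞ M] [RiemannianBundle (fun x : M => TangentSpace (𝓡∂ 2) x)]
  [IsContMDiffRiemannianBundle (𝓡∂ 2) ∞ E2 (fun x : M => TangentSpace (𝓡∂ 2) x)]
  (o : SurfaceOrientation M) {n : ℕ}

/-- The entries of `a` extend those of `A` holomorphically along the disks. -/
def IsMatExtension (c : ℤ) (A : SM M → Mat n) (a : SM M × Disk → Mat n) : Prop :=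
  ∀ i j, IsDiskExtension o c (fun p => A p i j) fun q => a q i j

namespace IsMatExtension

variable {o} {c d : ℤ} {A B : SM M → Mat n} {a b : SM M × Disk → Mat n}

lemma unique (ha : IsMatExtension o c A a) (hb : IsMatExtension o c A b) : a = b := by
  funext q
  ext i j
  exact congrFun ((ha i j).unique (hb i j)) q

lemma unique_boundary (ha : IsMatExtension o c A a) (hb : IsMatExtension o c B a) : A = B := by
  funext p
  ext i j
  exact congrFun ((ha i j).eq_boundary.trans (hb i j).eq_boundary.symm) p

lemma one : IsMatExtension o 0 (fun _ => (1 : Mat n)) fun _ => 1 := fun _ _ => IsDiskExtension.const _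

lemma add (ha : IsMatExtension o c A a) (hb : IsMatExtension o c B b) :
    IsMatExtension o c (fun p => A p + B p) fun q => a q + b q := fun i j => (ha i j).add (hb i j)

lemma mul (ha : IsMatExtension o c A a) (hb : IsMatExtension o d B b) :
    IsMatExtension o (c + d) (fun p => A p * B p) fun q => a q * b q := fun i j => by
  simp only [Matrix.mul_apply]
  exact IsDiskExtension.sum _ fun k => (ha i k).mul (hb k j)

lemma congr (ha : IsMatExtension o c A a) (h : c = d) : IsMatExtension o d A a := h ▸ ha

lemma apply_dbar₁ (ha : IsMatExtension o 0 A a) :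
    IsMatExtension o (-1) (entrywise X A) (entrywise (dbar₁ o) a) := by
  intro i j
  have h1 := IsDiskExtension.apply_dbar₁ (ha i j).smoothSM (ha i j)
  simp only [entrywise, Matrix.of_apply]
  exact h1

lemma smoothMat (ha : IsMatExtension o c A a) : SmoothMat A := fun i j => (ha i j).smoothSM

lemma dbar₂_eq_zero (ha : IsMatExtension o c A a) (q : SM M × Disk) : entrywise dbar₂ a q = 0 := by
  ext i j
  exact (ha i j).holomorphic q

/-- The geodesic gauge action corresponds to the first component of the gauge action. -/
lemma gaugeAct {F : SM M → GL (Fin n) ℂ} {φ : SM M × Disk → GL (Fin n) ℂ} (ha : IsMatExtension o (-1) A a)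
    (hF : IsMatExtension o 0 (fun p => (F p).1) fun q => (φ q).1)
    (hF' : IsMatExtension o 0 (fun p => ((F p)⁻¹ : GL (Fin n) ℂ).1) fun q => ((φ q)⁻¹ : GL (Fin n) ℂ).1) :
    IsMatExtension o (-1) (gaugeAct X A F) (gaugeAct (dbar₁ o) a φ) :=
  ((hF'.mul hF.apply_dbar₁).congr (by norm_num)).add (((hF'.mul ha).mul hF).congr (by norm_num))

end IsMatExtension

lemma isMatExtension_twistorForm {c : ℤ} (A : SM M → Mat n) (hA : SmoothMat A)
    (hc : ∀ k < c, ∀ p i j, fourierMode o (fun q => A q i j) k p = 0) :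
    IsMatExtension o c A fun q => Matrix.of fun i j => modeSeries o (fun p => A p i j) c q :=
  fun i j => isDiskExtension_modeSeries o (hA i j) c fun k hk p => hc k hk p i j

lemma Mho.isMatExtension (A : Mho o n) : IsMatExtension o (-1) A.1 (twistorForm o A.1).1 :=
  isMatExtension_twistorForm o A.1 A.2.1 A.2.2

lemma isMatExtension_mho {A : SM M → Mat n} {a : SM M × Disk → Mat n} (ha : IsMatExtension o (-1) A a) :
    SmoothMat A ∧ ∀ k < -1, ∀ p i j, fourierMode o (fun q => A q i j) k p = 0 :=
  ⟨ha.smoothMat, fun k hk p i j => (ha i j).fourierMode_eq_zero k hk p⟩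

lemma dbar₁_zero (q : SM M × Disk) : dbar₁ o (fun _ => 0) q = 0 := (derivationDbar₁ o).const 0 q

lemma isForm01_zero : IsForm01 o (0 : SM M × Disk → Mat n) := fun i j =>
  ⟨functionClassSMD.const 0, fun q => by
    change VV o (fun _ => 0) q + I * 0 = 0
    simp [VV]⟩

lemma IsMatExtension.isForm01 {A : SM M → Mat n} {a : SM M × Disk → Mat n} (ha : IsMatExtension o (-1) A a) :
    IsForm01 o a := fun i j => ⟨(ha i j).smooth, fun q => by rw [(ha i j).VV_eq]; push_cast; ring⟩

lemma isFlat_twistorForm (A : Mho o n) : IsFlat o (twistorForm o A.1) := by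
  refine ⟨(A.isMatExtension o).isForm01, isForm01_zero o, fun q => ?_⟩
  have h1 : entrywise (dbar₁ o) (twistorForm o A.1).2 q = 0 := by
    ext i j
    exact dbar₁_zero o q
  rw [h1, (A.isMatExtension o).dbar₂_eq_zero]
  simp [twistorForm]

lemma toZ_rotD (θ : Real.Angle) (q : SM M × Disk) : toZ o (rotD o θ q) = toZ o q :=
  (Quotient.sound (s := circleSetoid o) ⟨θ, rfl⟩ : toZ o q = toZ o (rotD o θ q)).symm

/-- Both `F` and `F⁻¹` extend along the disks. The products of the two extensions extend the
identity, hence equal it by uniqueness, so the extension is invertible. Weight zero means invariance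
under rotation, so it descends to `Z`. -/
lemma exists_gauge (F : SM M → GL (Fin n) ℂ) (hF : F ∈ GG o n) : ∃ φ ∈ Gauge o n,
    IsMatExtension o 0 (fun p => (F p).1) (fun q => (φ (toZ o q)).1) ∧
    IsMatExtension o 0 (fun p => ((F p)⁻¹ : GL (Fin n) ℂ).1) (fun q => ((φ (toZ o q))⁻¹ : GL (Fin n) ℂ).1) := by
  have h1 := isMatExtension_twistorForm o (c := 0) (fun p => (F p).1) hF.1 fun k hk p i j => hF.2.1 i j k hk p
  have h2 := isMatExtension_twistorForm o (c := 0) (fun p => ((F p)⁻¹ : GL (Fin n) ℂ).1)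
    (functionClassSM.matInv hF.1) fun k hk p i j => hF.2.2 i j k hk p
  set Φ : SM M × Disk → Mat n := fun q => Matrix.of fun i j => modeSeries o (fun p => (F p).1 i j) 0 q with hΦ
  set Ψ : SM M × Disk → Mat n := fun q => Matrix.of fun i j =>
    modeSeries o (fun p => ((F p)⁻¹ : GL (Fin n) ℂ).1 i j) 0 q with hΨ
  have h3 : (fun q => Φ q * Ψ q) = fun _ => 1 := by
    refine IsMatExtension.unique (h1.mul h2) ?_
    simp only [Units.mul_inv]
    exact IsMatExtension.one
  have h4 : (fun q => Ψ q * Φ q) = fun _ => 1 := by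
    refine IsMatExtension.unique (h2.mul h1) ?_
    simp only [Units.inv_mul]
    exact IsMatExtension.one
  let φ' : SM M × Disk → GL (Fin n) ℂ := fun q => ⟨Φ q, Ψ q, congrFun h3 q, congrFun h4 q⟩
  have h5 : ∀ (θ : Real.Angle) q, φ' (rotD o θ q) = φ' q := fun θ q => by
    induction θ using Real.Angle.induction_on with | _ t
    apply Units.ext
    ext i j
    have := (h1 i j).rotD t q
    simpa using this
  let φ : Z o → GL (Fin n) ℂ := Quotient.lift (s := circleSetoid o) φ' (by
    rintro q _ ⟨θ, rfl⟩
    exact (h5 θ q).symm)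
  exact ⟨φ, fun i j => (h1 i j).smooth, h1, h2⟩

/-- Differentiate `φ φ⁻¹ = 1`. -/
lemma entrywise_dbar₂_inv {φ : SM M × Disk → GL (Fin n) ℂ} (hφ : ∀ i j, SmoothSMD fun q => (φ q).1 i j)
    (h : ∀ q, entrywise dbar₂ (fun q => (φ q).1) q = 0) (q : SM M × Disk) :
    entrywise dbar₂ (fun q => ((φ q)⁻¹ : GL (Fin n) ℂ).1) q = 0 := by
  have h1 := entrywise_mul functionClassSMD derivationDbar₂ hφ (functionClassSMD.matInv hφ) q
  have h2 : entrywise dbar₂ (fun q : SM M × Disk => (φ q).1 * ((φ q)⁻¹ : GL (Fin n) ℂ).1) q = 0 := by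
    simp only [Units.mul_inv]
    ext i j
    exact derivationDbar₂.const _ q
  rw [h2, h, zero_mul, zero_add] at h1
  have h3 := congrArg (((φ q)⁻¹ : GL (Fin n) ℂ).1 * ·) h1
  simp only [mul_zero, ← mul_assoc, Units.inv_mul, one_mul] at h3
  exact h3.symm

/-- Gauges that are holomorphic along the disks extend elements of `𝔾`. -/
lemma gauge_boundary {φ : Z o → GL (Fin n) ℂ} (hφ : φ ∈ Gauge o n)
    (h : ∀ q, entrywise dbar₂ (fun q => (φ (toZ o q)).1) q = 0) :
    IsMatExtension o 0 (fun p => (φ (toZ o (p, circ 0))).1) (fun q => (φ (toZ o q)).1) ∧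
    IsMatExtension o 0 (fun p => ((φ (toZ o (p, circ 0)))⁻¹ : GL (Fin n) ℂ).1)
      (fun q => ((φ (toZ o q))⁻¹ : GL (Fin n) ℂ).1) := by
  constructor
  · refine fun i j => isDiskExtension_of_rotD o (hφ i j) (fun q => congrFun (congrFun (h q) i) j) fun t q => ?_
    rw [toZ_rotD]; simp
  · refine fun i j => isDiskExtension_of_rotD o (functionClassSMD.matInv (F := fun q => φ (toZ o q)) hφ i j)
      (fun q => congrFun (congrFun (entrywise_dbar₂_inv hφ h q) i) j) fun t q => ?_
    rw [toZ_rotD]; simp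

lemma gaugeAct_dbar₂_zero {φ : SM M × Disk → GL (Fin n) ℂ} (h : ∀ q, entrywise dbar₂ (fun q => (φ q).1) q = 0) :
    gaugeAct dbar₂ 0 φ = 0 := by
  funext q
  rw [gaugeAct, h]
  simp

/-- The group `𝔾` acts on the attenuations. -/
lemma exists_mho_gaugeAct (A : Mho o n) (F : SM M → GL (Fin n) ℂ) (hF : F ∈ GG o n) :
    ∃ B : Mho o n, B.1 = gaugeAct X A.1 F := by
  obtain ⟨φ, -, h1, h2⟩ := exists_gauge o F hF
  exact ⟨⟨_, isMatExtension_mho o ((A.isMatExtension o).gaugeAct h1 h2)⟩, rfl⟩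

/-- The gauge extending `F` transforms `A^{0,1}` into an extension of `A ◁ F`, which is `B^{0,1}` by
uniqueness; holomorphy along the disks keeps the second component zero. -/
lemma gaugeSetoid_of_orbitSetoid {A B : Mho o n} (h : (orbitSetoid o n).r A B) :
    (gaugeSetoid o n).r ⟨twistorForm o A.1, isFlat_twistorForm o A⟩ ⟨twistorForm o B.1, isFlat_twistorForm o B⟩ := by
  obtain ⟨F, hF, hB⟩ := h
  obtain ⟨φ, hφ, h1, h2⟩ := exists_gauge o F hF
  refine ⟨φ, hφ, ?_, ?_⟩
  · have h3 := (A.isMatExtension o).gaugeAct h1 h2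
    rw [← hB] at h3
    exact (B.isMatExtension o).unique h3
  · exact (gaugeAct_dbar₂_zero fun q => h1.dbar₂_eq_zero q).symm

/-- The element of `𝔾` is the restriction of the gauge to `ω = 1`. -/
lemma orbitSetoid_of_gaugeSetoid {A B : Mho o n} (h : (gaugeSetoid o n).r ⟨twistorForm o A.1, isFlat_twistorForm o A⟩
    ⟨twistorForm o B.1, isFlat_twistorForm o B⟩) : (orbitSetoid o n).r A B := by
  obtain ⟨φ, hφ, h1, h2⟩ := h
  -- Both second components vanish, so the second gauge equation reduces to `φ⁻¹ ∂_{ω̄} φ = 0`.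
  have h3 : ∀ q, entrywise dbar₂ (fun q => (φ (toZ o q)).1) q = 0 := fun q => by
    have h4 : (0 : Mat n) = gaugeAct dbar₂ 0 (fun q => φ (toZ o q)) q := congrFun h2 q
    rw [gaugeAct, Pi.zero_apply, mul_zero, zero_mul, add_zero] at h4
    have h5 := congrArg ((φ (toZ o q)).1 * ·) h4
    simp only [mul_zero, ← mul_assoc, Units.mul_inv, one_mul] at h5
    exact h5.symm
  obtain ⟨h4, h5⟩ := gauge_boundary o hφ h3
  refine ⟨fun p => φ (toZ o (p, circ 0)), ⟨h4.smoothMat, fun i j k hk p => (h4 i j).fourierMode_eq_zero k hk p,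
    fun i j k hk p => (h5 i j).fourierMode_eq_zero k hk p⟩, ?_⟩
  have h6 := (A.isMatExtension o).gaugeAct h4 h5
  have h7 : (twistorForm o B.1).1 = gaugeAct (dbar₁ o) (twistorForm o A.1).1 fun q => φ (toZ o q) := h1
  rw [← h7] at h6
  exact (B.isMatExtension o).unique_boundary h6

end MatrixExtensions

end Twistor

end

/-! ### Gauge fixing: eliminating the second component. -/

noncomputable section

namespace Twistor

open MeasureTheory Complex Set

section GaugeFixing

variable {M : Type*} [TopologicalSpace M] [ChartedSpace (EuclideanHalfSpace 2) M]
  [IsManifold (𝓡∂ 2) ∞ M] [RiemannianBundle (fun x : M => TangentSpace (𝓡∂ 2) x)]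
  [IsContMDiffRiemannianBundle (𝓡∂ 2) ∞ E2 (fun x : M => TangentSpace (𝓡∂ 2) x)]
  (o : SurfaceOrientation M) {n : ℕ}

lemma entrywise_add {Y : Type*} {S : (Y → ℂ) → Prop} {D : (Y → ℂ) → Y → ℂ} (hD : DerivationOn S D) {A B : Y → Mat n}
    (hA : ∀ i j, S fun y => A y i j) (hB : ∀ i j, S fun y => B y i j) (y : Y) :
    entrywise D (fun z => A z + B z) y = entrywise D A y + entrywise D B y := by
  ext i j
  exact hD.add (hA i j) (hB i j) y

/-- A gauge in which the second component vanishes turns the first one into a fibrewise holomorphic one. -/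
lemma dbar₂_gaugeAct {a₁ a₂ : SM M × Disk → Mat n} {φ : SM M × Disk → GL (Fin n) ℂ}
    (h₁ : ∀ i j, SmoothSMD fun q => a₁ q i j) (h₂ : ∀ i j, SmoothSMD fun q => a₂ q i j)
    (hφ : ∀ i j, SmoothSMD fun q => (φ q).1 i j)
    (hflat : ∀ q, entrywise (dbar₁ o) a₂ q - entrywise dbar₂ a₁ q + (a₁ q * a₂ q - a₂ q * a₁ q) = 0)
    (heq : ∀ q, entrywise dbar₂ (fun q => (φ q).1) q + a₂ q * (φ q).1 = 0) :
    (∀ i j, SmoothSMD fun q => gaugeAct (dbar₁ o) a₁ φ q i j) ∧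
      ∀ q, entrywise dbar₂ (gaugeAct (dbar₁ o) a₁ φ) q = 0 := by
  have hS := functionClassSMD (M := M)
  have hD₁ := derivationDbar₁ o
  have hD₂ := derivationDbar₂ (M := M)
  set P : SM M × Disk → Mat n := fun q => (φ q).1 with hP
  set b := gaugeAct (dbar₁ o) a₁ φ with hb
  have hP₁ : ∀ i j, SmoothSMD fun q => entrywise (dbar₁ o) P q i j := fun i j => (hφ i j).apply_dbar₁ o
  have hP₂ : ∀ i j, SmoothSMD fun q => entrywise dbar₂ P q i j := fun i j => (hφ i j).apply_dbar₂
  have hinv := hS.matInv hφ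
  have hbs : ∀ i j, SmoothSMD fun q => b q i j := fun i j =>
    hS.add (hS.matMul hinv hP₁ i j) (hS.matMul (hS.matMul hinv h₁) hφ i j)
  refine ⟨hbs, fun q => ?_⟩
  -- Clearing the inverse gives `P b = D₁ P + a₁ P`, with `D₁` the first component of `∂̄`; applying
  -- `∂_{ω̄}` to this identity isolates `P ∂_{ω̄} b`.
  have h3 : (fun q => P q * b q) = fun q => entrywise (dbar₁ o) P q + a₁ q * P q := by
    funext q
    have hPi : P q * ((φ q)⁻¹ : GL (Fin n) ℂ).1 = 1 := (φ q).mul_inv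
    change P q * (((φ q)⁻¹ : GL (Fin n) ℂ).1 * entrywise (dbar₁ o) P q +
      ((φ q)⁻¹ : GL (Fin n) ℂ).1 * a₁ q * P q) = entrywise (dbar₁ o) P q + a₁ q * P q
    rw [mul_add, ← mul_assoc, mul_assoc _ (a₁ q), ← mul_assoc (P q), hPi, one_mul, one_mul]
  have h4 := entrywise_mul hS hD₂ hφ hbs q
  rw [h3, entrywise_add hD₂ hP₁ (hS.matMul h₁ hφ), entrywise_mul hS hD₂ h₁ hφ] at h4
  have h5 : entrywise dbar₂ (entrywise (dbar₁ o) P) q = entrywise (dbar₁ o) (entrywise dbar₂ P) q := by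
    ext i j
    exact dbar₂_dbar₁ o (hφ i j) q
  -- Applying the first operator to `∂_{ω̄} P + a₂ P = 0` expresses the mixed derivative of `P`.
  -- Together with commutation and flatness everything except `P ∂_{ω̄} b` cancels.
  have h6 : entrywise (dbar₁ o) (fun q => entrywise dbar₂ P q + a₂ q * P q) q = 0 := by
    rw [show (fun q => entrywise dbar₂ P q + a₂ q * P q) = fun _ => 0 from funext heq]
    ext i j
    exact hD₁.const 0 q
  rw [entrywise_add hD₁ hP₂ (hS.matMul h₂ hφ), entrywise_mul hS hD₁ h₂ hφ] at h6
  have h7 := hflat q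
  have h8 : entrywise dbar₂ P q = -(a₂ q * P q) := eq_neg_of_add_eq_zero_left (heq q)
  have h9 := congrFun h3 q
  have h10 : entrywise (dbar₁ o) P q = P q * b q - a₁ q * P q := by rw [show P q * b q = _ from h9]; abel
  rw [h5, eq_neg_of_add_eq_zero_left h6, h8, h10] at h4
  have h11 : entrywise dbar₂ a₁ q = entrywise (dbar₁ o) a₂ q + (a₁ q * a₂ q - a₂ q * a₁ q) := by
    rw [← sub_eq_zero, ← neg_eq_zero, ← h7]; abel
  rw [h11] at h4
  have h12 : P q * entrywise dbar₂ b q = 0 := by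
    have h13 : P q * entrywise dbar₂ b q = (-(a₂ q * P q) * b q + P q * entrywise dbar₂ b q) + a₂ q * P q * b q := by
      noncomm_ring
    rw [h13]
    change _ = -(a₂ q * P q) * b q + P q * entrywise dbar₂ b q at h4
    rw [← h4]
    noncomm_ring
  have h14 := congrArg (((φ q)⁻¹ : GL (Fin n) ℂ).1 * ·) h12
  simp only [mul_zero, ← mul_assoc, hP, Units.inv_mul, one_mul] at h14
  exact h14

/-- The factors `e^{-2it}` from `ω²` and `e^{it}` from `η₊` combine to `e^{-it}`, the factor already
produced by `η₋`. -/
lemma dbar₁_rotD {h : SM M × Disk → ℂ} (hh : SmoothSMD h) (hinv : ∀ (t : ℝ) q, h (rotD o (t : Real.Angle) q) = h q)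
    (t : ℝ) (q : SM M × Disk) : dbar₁ o h (rotD o (t : Real.Angle) q) = cexp (-t * I) * dbar₁ o h q := by
  have hu := hh.slice (rotD o (t : Real.Angle) q).2
  have h1 : (fun p => h (rot o (t : Real.Angle) p, (rotD o (t : Real.Angle) q).2)) = fun p => h (p, q.2) :=
    funext fun p => hinv t (p, q.2)
  rw [dbar₁, dbar₁]
  have h2 := hu.etaPlus_rot o t q.1
  have h3 := hu.etaMinus_rot o t q.1
  rw [h1] at h2 h3
  rw [show (rotD o (t : Real.Angle) q).1 = rot o (t : Real.Angle) q.1 from rfl, h2, h3, coe_rotD_snd,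
    show cexp (-(t * I)) = cexp (-t * I) by rw [neg_mul]]
  have h4 : cexp (-t * I) * cexp (t * I) = 1 := by rw [← Complex.exp_add]; simp
  linear_combination (cexp (-t * I) * q.2.1 ^ 2 * etaPlus o (fun p => h (p, q.2)) q.1) * h4

/-- A flat partial connection with a solution of `∂̄_ω φ + a₂ φ = 0` is gauge equivalent to `A^{0,1}` for some `A`. -/
lemma exists_mho_of_gauge (a : FlatPartialConnection o n) {φ : Z o → GL (Fin n) ℂ} (hφ : φ ∈ Gauge o n)
    (heq : ∀ q, entrywise dbar₂ (fun q => (φ (toZ o q)).1) q + a.1.2 q * (φ (toZ o q)).1 = 0) :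
    ∃ A : Mho o n, (gaugeSetoid o n).r a ⟨twistorForm o A.1, isFlat_twistorForm o A⟩ := by
  obtain ⟨h₁, h₂, hflat⟩ := a.2
  set ψ : SM M × Disk → GL (Fin n) ℂ := fun q => φ (toZ o q) with hψ
  have hψs : ∀ i j, SmoothSMD fun q => (ψ q).1 i j := hφ
  obtain ⟨hbs, hb₂⟩ := dbar₂_gaugeAct o (fun i j => (h₁ i j).1) (fun i j => (h₂ i j).1) hψs hflat heq
  set b := gaugeAct (dbar₁ o) a.1.1 ψ with hb
  have hψr : ∀ (t : ℝ) q, ψ (rotD o (t : Real.Angle) q) = ψ q := fun t q => congrArg φ (toZ_rotD o _ q)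
  -- The gauged component has weight `-1`, since `a₁` and the first derivative of an invariant
  -- function both have it. With holomorphy along the disks this makes it the extension of an
  -- element of `℧`.
  have hbr : ∀ (t : ℝ) q, b (rotD o (t : Real.Angle) q) = cexp (-t * I) • b q := fun t q => by
    have h3 : entrywise (dbar₁ o) (fun q => (ψ q).1) (rotD o (t : Real.Angle) q) =
        cexp (-t * I) • entrywise (dbar₁ o) (fun q => (ψ q).1) q := by
      ext i j
      exact dbar₁_rotD o (hψs i j) (fun t q => by rw [hψr]) t q
    have h4 : a.1.1 (rotD o (t : Real.Angle) q) = cexp (-t * I) • a.1.1 q := by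
      ext i j
      exact (h₁ i j).1.rotD_of_VV o (h₁ i j).2 t q
    simp only [hb, gaugeAct, h3, h4, hψr, Matrix.mul_smul, Matrix.smul_mul, smul_add]
  have hext : IsMatExtension o (-1) (fun p => b (p, circ 0)) b := fun i j =>
    isDiskExtension_of_rotD o (hbs i j) (fun q => congrFun (congrFun (hb₂ q) i) j) fun t q => by
      have h3 := congrFun (congrFun (hbr t q) i) j
      have h4 : ((-1 : ℤ) : ℂ) * t * I = -t * I := by push_cast; ring
      rw [h4]
      exact h3
  let A : Mho o n := ⟨_, isMatExtension_mho o hext⟩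
  refine ⟨A, φ, hφ, (A.isMatExtension o).unique hext, ?_⟩
  funext q
  change (0 : Mat n) = ((ψ q)⁻¹ : GL (Fin n) ℂ).1 * entrywise dbar₂ (fun q => (ψ q).1) q +
    ((ψ q)⁻¹ : GL (Fin n) ℂ).1 * a.1.2 q * (ψ q).1
  rw [mul_assoc, ← mul_add, heq, mul_zero]

end GaugeFixing

end Twistor

end

/-! ### A nonvanishing vector field on a disk, and the angle it defines. -/

noncomputable section

namespace Twistor

open MeasureTheory Complex Set

section DiskField

variable {M : Type*} [TopologicalSpace M] [ChartedSpace (EuclideanHalfSpace 2) M]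
  [IsManifold (𝓡∂ 2) ∞ M]

/-- A surface diffeomorphic to the disk carries a smooth nonvanishing vector field. -/
lemma exists_field {f : M → ℂ} {f' : ℂ → M} (hf : ContMDiff (𝓡∂ 2) 𝓘(ℝ, ℂ) ∞ f)
    (hf' : ContMDiffOn 𝓘(ℝ, ℂ) (𝓡∂ 2) ∞ f' (Metric.closedBall 0 1))
    (hmem : ∀ x, f x ∈ Metric.closedBall (0 : ℂ) 1) (hl : ∀ x, f' (f x) = x)
    (hr : ∀ z ∈ Metric.closedBall (0 : ℂ) 1, f (f' z) = z) :
    ∃ V : ∀ x : M, TangentSpace (𝓡∂ 2) x, (∀ x, V x ≠ 0) ∧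
      ContMDiff (𝓡∂ 2) (𝓡∂ 2).tangent ∞ fun x => (⟨x, V x⟩ : TangentBundle (𝓡∂ 2) M) := by
  set D := Metric.closedBall (0 : ℂ) 1 with hD
  have hu : UniqueDiffOn ℝ D := uniqueDiffOn_convex (convex_closedBall 0 1) (by
    rw [interior_closedBall _ one_ne_zero]; exact Metric.nonempty_ball.2 one_pos)
  have hum : UniqueMDiffOn 𝓘(ℝ, ℂ) D := hu.uniqueMDiffOn
  -- The constant field `1` on the closed disk is pushed forward by the inverse diffeomorphism.
  let e : ℂ → TangentBundle 𝓘(ℝ, ℂ) ℂ := fun z => ⟨z, (1 : ℂ)⟩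
  have he : ContMDiff 𝓘(ℝ, ℂ) 𝓘(ℝ, ℂ).tangent ∞ e := by
    have := contMDiff_vectorSpace_iff_contDiff (𝕜 := ℝ) (E := ℂ) (n := ∞) (V := fun _ => (1 : ℂ))
    exact this.2 contDiff_const
  have hσ := (hf'.contMDiffOn_tangentMapWithin (m := ∞) (by simp) hum).comp he.contMDiffOn (s := D) fun z hz => hz
  set σ : ℂ → TangentBundle (𝓡∂ 2) M := tangentMapWithin 𝓘(ℝ, ℂ) (𝓡∂ 2) f' D ∘ e with hσd
  have hσf : ContMDiff (𝓡∂ 2) (𝓡∂ 2).tangent ∞ fun x => σ (f x) := hσ.comp_contMDiff hf hmem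
  have hproj : ∀ x, ∃ v : TangentSpace (𝓡∂ 2) x, (⟨x, v⟩ : TangentBundle (𝓡∂ 2) M) = σ (f x) := fun x => by
    have key : ∀ P : TangentBundle (𝓡∂ 2) M, P.1 = x → ∃ v : TangentSpace (𝓡∂ 2) x,
        (⟨x, v⟩ : TangentBundle (𝓡∂ 2) M) = P := by rintro P rfl; exact ⟨P.2, rfl⟩
    exact key _ (hl x)
  choose V hV using hproj
  refine ⟨V, fun x hx => ?_, by simp only [hV]; exact hσf⟩
  have h1 : mfderivWithin 𝓘(ℝ, ℂ) (𝓡∂ 2) f' D (f x) (1 : ℂ) = (0 : E2) := by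
    have key : ∀ P : TangentBundle (𝓡∂ 2) M, (⟨x, 0⟩ : TangentBundle (𝓡∂ 2) M) = P → P.2 = (0 : E2) := by
      rintro P rfl; rfl
    exact key (σ (f x)) (by rw [← hV x, hx])
  have h2 := mfderiv_comp_mfderivWithin (f x) (hf.mdifferentiableAt (by simp))
    (hf'.mdifferentiableOn (by simp) _ (hmem x)) (hum _ (hmem x))
  -- A zero of the pushed-forward field would contradict the chain rule for `f ∘ f'`, which is the
  -- identity on the closed disk.
  have h3 : mfderivWithin 𝓘(ℝ, ℂ) 𝓘(ℝ, ℂ) (f ∘ f') D (f x) = ContinuousLinearMap.id ℝ ℂ := by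
    have h7 : fderivWithin ℝ (f ∘ f') D (f x) = fderivWithin ℝ (fun z => z) D (f x) :=
      fderivWithin_congr (fun z hz => hr z hz) (hr _ (hmem x))
    exact mfderivWithin_eq_fderivWithin.trans (h7.trans (fderivWithin_fun_id (hu _ (hmem x))))
  have h4 := congrArg (fun L : ℂ →L[ℝ] ℂ => L 1) (h3.symm.trans h2)
  have h5 : (1 : ℂ) = mfderiv (𝓡∂ 2) 𝓘(ℝ, ℂ) f (f' (f x)) (mfderivWithin 𝓘(ℝ, ℂ) (𝓡∂ 2) f' D (f x) (1 : ℂ)) := h4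
  have h6 : (1 : ℂ) = 0 := h5.trans ((congrArg (mfderiv (𝓡∂ 2) 𝓘(ℝ, ℂ) f (f' (f x))) h1).trans (map_zero _))
  exact one_ne_zero h6

end DiskField

section AngleFunction

variable {M : Type*} [TopologicalSpace M] [ChartedSpace (EuclideanHalfSpace 2) M]
  [IsManifold (𝓡∂ 2) ∞ M] [RiemannianBundle (fun x : M => TangentSpace (𝓡∂ 2) x)]
  [IsContMDiffRiemannianBundle (𝓡∂ 2) ∞ E2 (fun x : M => TangentSpace (𝓡∂ 2) x)]
  (o : SurfaceOrientation M) (V : ∀ x : M, TangentSpace (𝓡∂ 2) x)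

/-- The angle from `V` to a unit vector. -/
def angleFrom (p : SM M) : Real.Angle := (o.at' p.1.1).oangle (V p.1.1) p.1.2

variable {V}

lemma angleFrom_rot (hV : ∀ x, V x ≠ 0) (θ : Real.Angle) (p : SM M) :
    angleFrom o V (rot o θ p) = angleFrom o V p + θ :=
  (o.at' p.1.1).oangle_rotation_right (hV _) (SM.ne_zero p) θ

lemma rot_angleFrom (hV : ∀ x, V x ≠ 0) (p : SM M) :
    rot o (angleFrom o V p) (normalize ⟨p.1.1, V p.1.1⟩ (hV _)) = p := by
  refine Subtype.ext (congrArg (TotalSpace.mk (E := fun x : M => TangentSpace (𝓡∂ 2) x) p.1.1)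
    (?_ : (o.at' p.1.1).rotation ((o.at' p.1.1).oangle (V p.1.1) p.1.2) (‖V p.1.1‖⁻¹ • V p.1.1) = p.1.2))
  have hpos : 0 < ‖V p.1.1‖⁻¹ := inv_pos.2 (norm_pos_iff.2 (hV _))
  rw [← Orientation.oangle_smul_left_of_pos _ _ _ hpos, Orientation.rotation_oangle_eq_iff_norm_eq, p.2]
  exact norm_smul_inv_norm (𝕜 := ℝ) (hV _)

/-- For a unit vector the complex-valued Kähler form `⟨V, v⟩ + i ⟨J V, v⟩` has modulus `‖V‖` and
argument the angle. Unlike the angle, this expression is manifestly smooth. -/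
lemma coe_toCircle_angleFrom (hV : ∀ x, V x ≠ 0) (p : SM M) : ((angleFrom o V p).toCircle : ℂ) =
    ((inner ℝ (V p.1.1) p.1.2 : ℝ) + (inner ℝ ((o.at' p.1.1).rightAngleRotation (V p.1.1)) p.1.2 : ℝ) * I) *
      ((√(inner ℝ (V p.1.1) (V p.1.1)))⁻¹ : ℝ) := by
  have h1 := Complex.norm_mul_exp_arg_mul_I ((o.at' p.1.1).kahler (V p.1.1) p.1.2)
  rw [Orientation.norm_kahler, p.2, mul_one] at h1
  have h2 : ((angleFrom o V p).toCircle : ℂ) = cexp (((o.at' p.1.1).kahler (V p.1.1) p.1.2).arg * I) := by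
    rw [angleFrom, Orientation.oangle, Real.Angle.toCircle_coe, Circle.coe_exp]
  have h3 : (‖V p.1.1‖ : ℂ) ≠ 0 := by exact_mod_cast (norm_pos_iff.2 (hV _)).ne'
  rw [h2, real_inner_self_eq_norm_sq, Real.sqrt_sq (norm_nonneg _), Orientation.inner_rightAngleRotation_left,
    Complex.ofReal_inv, eq_mul_inv_iff_mul_eq₀ h3, mul_comm, h1, Orientation.kahler_apply_apply, Complex.real_smul]

lemma smoothSM_angleFrom (hV : ∀ x, V x ≠ 0)
    (hVs : ContMDiff (𝓡∂ 2) (𝓡∂ 2).tangent ∞ fun x => (⟨x, V x⟩ : TangentBundle (𝓡∂ 2) M)) :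
    SmoothSM fun p => ((angleFrom o V p).toCircle : ℂ) := by
  rw [smoothSM_iff]
  refine smoothSMD_of_local fun x₀ => ?_
  let Vc : E2 → E2 := fun y => (chartCo x₀ ⟨(extChartAt (𝓡∂ 2) x₀).symm y, V _⟩).2
  have hVc : ContDiffOn ℝ ∞ Vc (chartDom x₀) := by
    have h1 : ContMDiffOn 𝓘(ℝ, E2) 𝓘(ℝ, E2 × E2) ∞
        (fun y => chartCo x₀ ⟨(extChartAt (𝓡∂ 2) x₀).symm y, V _⟩) (chartDom x₀) :=
      contMDiffOn_chartCo.comp (hVs.comp_contMDiffOn (contMDiffOn_extChartAt_symm x₀))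
        fun y hy => (extChartAt (𝓡∂ 2) x₀).map_target hy
    exact contDiff_snd.comp_contDiffOn h1.contDiffOn
  have hfr : ∀ y ∈ chartDom x₀, frameCLM x₀ y (Vc y) = V ((extChartAt (𝓡∂ 2) x₀).symm y) := fun y hy => by
    have h1 : Vc y = (triv x₀).linearMapAt ℝ ((extChartAt (𝓡∂ 2) x₀).symm y) (V _) := by
      rw [Trivialization.coe_linearMapAt_of_mem _ (symm_mem_baseSet hy)]
      rfl
    rw [h1]
    exact (triv x₀).symmₗ_linearMapAt (R := ℝ) (symm_mem_baseSet hy) _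
  refine ⟨fun s => ((metricIn x₀ s.1.1 (Vc s.1.1) s.1.2 : ℝ) +
    (metricIn x₀ s.1.1 (rotIn o x₀ s.1.1 (Vc s.1.1)) s.1.2 : ℝ) * I) *
      ((√(metricIn x₀ s.1.1 (Vc s.1.1) (Vc s.1.1)))⁻¹ : ℝ), fun v hv z hz => ?_, ?_⟩
  · obtain ⟨W, hWo, hxW, hW⟩ := exists_contDiffOn_rotIn o x₀
    let S : Set ((E2 × E2) × ℂ) := ((chartDom x₀ ∩ W) ×ˢ {0}ᶜ) ×ˢ Metric.closedBall (0 : ℂ) 1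
    have hπ : ContDiffOn ℝ ∞ (fun s : (E2 × E2) × ℂ => s.1.1) S :=
      (contDiff_fst.fst).contDiffOn
    have hv2 : ContDiffOn ℝ ∞ (fun s : (E2 × E2) × ℂ => s.1.2) S := (contDiff_fst.snd).contDiffOn
    have hG : ContDiffOn ℝ ∞ (fun s : (E2 × E2) × ℂ => metricIn x₀ s.1.1) S :=
      contDiffOn_metricIn.comp hπ fun s hs => hs.1.1.1
    have hVS : ContDiffOn ℝ ∞ (fun s : (E2 × E2) × ℂ => Vc s.1.1) S := hVc.comp hπ fun s hs => hs.1.1.1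
    have hJS : ContDiffOn ℝ ∞ (fun s : (E2 × E2) × ℂ => rotIn o x₀ s.1.1) S := hW.comp hπ fun s hs => hs.1.1
    have h1 := (hG.clm_apply hVS).clm_apply hv2
    have h2 := (hG.clm_apply (hJS.clm_apply hVS)).clm_apply hv2
    have h3 := (hG.clm_apply hVS).clm_apply hVS
    have hpos : ∀ s ∈ S, 0 < metricIn x₀ s.1.1 (Vc s.1.1) (Vc s.1.1) := fun s hs => by
      rw [metricIn_self, hfr _ hs.1.1.1]
      exact pow_pos (norm_pos_iff.2 (hV _)) 2
    have h4 := (h3.sqrt fun s hs => (hpos s hs).ne').inv fun s hs => (Real.sqrt_pos.2 (hpos s hs)).ne'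
    have hof : ContDiff ℝ ∞ fun r : ℝ => (r : ℂ) := Complex.ofRealCLM.contDiff
    have h5 := ((hof.comp_contDiffOn h1).add ((hof.comp_contDiffOn h2).mul (contDiffOn_const (c := I)))).mul
      (hof.comp_contDiffOn h4)
    have hm : ((extChartAt (𝓡∂ 2) x₀ x₀, v), z) ∈ S := ⟨⟨⟨mem_extChartAt_target x₀, hxW⟩, hv⟩, hz⟩
    refine (h5 _ hm).mono_of_mem_nhdsWithin ?_
    have h6 : (W ×ˢ univ) ×ˢ univ ∈ 𝓝 ((extChartAt (𝓡∂ 2) x₀ x₀, v), z) :=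
      ((hWo.prod isOpen_univ).prod isOpen_univ).mem_nhds ⟨⟨hxW, mem_univ _⟩, mem_univ _⟩
    filter_upwards [self_mem_nhdsWithin, mem_nhdsWithin_of_mem_nhds h6] with s hs hs'
    exact ⟨⟨⟨hs.1.1, hs'.1.1⟩, hs.1.2⟩, hs.2⟩
  · rintro ⟨⟨P, hP⟩, z⟩ hq
    have hq' : P.1 ∈ (extChartAt (𝓡∂ 2) x₀).source := hq
    obtain ⟨s, hs, rfl⟩ : ∃ s : E2 × E2, s.1 ∈ chartDom x₀ ∧ chartPt x₀ s = P :=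
      ⟨chartCo x₀ P, (extChartAt (𝓡∂ 2) x₀).map_source hq', chartPt_chartCo hq'⟩
    rw [coe_toCircle_angleFrom o hV]
    simp only [chartCo_chartPt hs, metricIn_apply, frameCLM_rotIn o hs, hfr _ hs]
    rfl

end AngleFunction

end Twistor

end

/-! ### Surjectivity over a disk. -/

noncomputable section

namespace Twistor

open MeasureTheory Complex Set

/-- The chain rule for `∂̄` under multiplication by `c` produces the conjugate of `c`, which is
`c⁻¹` on the unit circle. -/
lemma dbar_comp_circle {Ψ : ℂ → ℂ} {c : Circle} {z : ℂ} (hz : z ∈ Metric.closedBall (0 : ℂ) 1)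
    (hΨ : DifferentiableWithinAt ℝ Ψ (Metric.closedBall 0 1) (c * z)) :
    fderivWithin ℝ (fun w => Ψ (c * w)) (Metric.closedBall 0 1) z 1 +
        I * fderivWithin ℝ (fun w => Ψ (c * w)) (Metric.closedBall 0 1) z I =
      ((c⁻¹ : Circle) : ℂ) * (fderivWithin ℝ Ψ (Metric.closedBall 0 1) (c * z) 1 +
        I * fderivWithin ℝ Ψ (Metric.closedBall 0 1) (c * z) I) := by
  let m : ℂ →L[ℝ] ℂ := ContinuousLinearMap.mul ℝ ℂ c
  have hmaps : MapsTo m (Metric.closedBall (0 : ℂ) 1) (Metric.closedBall 0 1) := fun w hw => by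
    rw [mem_closedBall_zero_iff] at hw ⊢
    change ‖(c : ℂ) * w‖ ≤ 1
    rwa [norm_mul, Circle.norm_coe, one_mul]
  have h1 : HasFDerivWithinAt Ψ (fderivWithin ℝ Ψ (Metric.closedBall 0 1) (c * z))
    (Metric.closedBall 0 1) (m z) := hΨ.hasFDerivWithinAt
  have h2 := (h1.comp z m.hasFDerivWithinAt hmaps).fderivWithin (uniqueDiffDisk ⟨z, hz⟩)
  have h3 : fderivWithin ℝ (fun w => Ψ (c * w)) (Metric.closedBall 0 1) z = _ := h2
  rw [h3]
  set L := fderivWithin ℝ Ψ (Metric.closedBall 0 1) (c * z)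
  have hL : ∀ w : ℂ, L w = w.re * L 1 + w.im * L I := fun w => by
    have h4 : w = w.re • (1 : ℂ) + w.im • I := by
      simp only [Complex.real_smul, mul_one, Complex.re_add_im]
    conv_lhs => rw [h4]
    rw [map_add, map_smul, map_smul, Complex.real_smul, Complex.real_smul]
  have hm : ∀ w, m w = c * w := fun w => rfl
  simp only [ContinuousLinearMap.comp_apply, hm]
  rw [hL (c * 1), hL (c * I), Circle.coe_inv_eq_conj]
  have hc : (starRingEnd ℂ) (c : ℂ) = (c : ℂ).re - (c : ℂ).im * I := by
    apply Complex.ext <;> simp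
  rw [hc]
  simp only [mul_one, Complex.mul_re, Complex.mul_im, I_re, I_im, mul_zero, zero_sub, add_zero]
  push_cast
  linear_combination (c : ℂ).im * L I * Complex.I_sq

section Surjective

variable {M : Type*} [TopologicalSpace M] [ChartedSpace (EuclideanHalfSpace 2) M]
  [IsManifold (𝓡∂ 2) ∞ M] [RiemannianBundle (fun x : M => TangentSpace (𝓡∂ 2) x)]
  [IsContMDiffRiemannianBundle (𝓡∂ 2) ∞ E2 (fun x : M => TangentSpace (𝓡∂ 2) x)]
  (o : SurfaceOrientation M) {V : ∀ x : M, TangentSpace (𝓡∂ 2) x} {n : ℕ}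

/-- Every orbit of the circle action meets the slice over the normalised field, and `e^{iα} ω` is
the disk coordinate there. This trivialises `Z` as `M × 𝔻`. -/
lemma rotD_angleFrom (hV : ∀ x, V x ≠ 0) (q : SM M × Disk) (z : Disk)
    (hz : z.1 = (angleFrom o V q.1).toCircle * q.2.1) :
    rotD o (angleFrom o V q.1) (normalize ⟨q.1.1.1, V q.1.1.1⟩ (hV _), z) = q := by
  refine Prod.ext (rot_angleFrom o hV q.1) (Subtype.ext ?_)
  simp only [rotD, hz, Real.Angle.toCircle_neg, ← mul_assoc, ← Circle.coe_mul, inv_mul_cancel, Circle.coe_one, one_mul]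

lemma SmoothSMD.rotD_of_VV_angle {h : SM M × Disk → ℂ} (hh : SmoothSMD h)
    (hV : ∀ q, VV o h q + I * h q = 0) (θ : Real.Angle) (q : SM M × Disk) :
    h (rotD o θ q) = (θ.toCircle⁻¹ : Circle) * h q := by
  induction θ using Real.Angle.induction_on with | _ t =>
  rw [hh.rotD_of_VV o hV t q, Real.Angle.toCircle_coe, ← Circle.exp_neg, Circle.coe_exp]
  push_cast; rfl

lemma circle_mul_mem (c : Circle) {z : ℂ} (hz : z ∈ Metric.closedBall (0 : ℂ) 1) :
    (c : ℂ) * z ∈ Metric.closedBall (0 : ℂ) 1 := by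
  rw [mem_closedBall_zero_iff] at hz ⊢
  rwa [norm_mul, Circle.norm_coe, one_mul]

/-- Over a disk every flat partial connection is gauge equivalent to some `A^{0,1}`. -/
lemma exists_mho_of_disk (hM : DiffeomorphicToDisk M) (a : FlatPartialConnection o n) :
    ∃ A : Mho o n, (gaugeSetoid o n).r a ⟨twistorForm o A.1, isFlat_twistorForm o A⟩ := by
  obtain ⟨f, f', hf, hf', hmem, hl, hr⟩ := hM
  obtain ⟨V, hV, hVs⟩ := exists_field hf hf' hmem hl hr
  obtain ⟨h₁, h₂, hflat⟩ := a.2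
  set D := Metric.closedBall (0 : ℂ) 1 with hD
  -- The coefficient is `a₂` on the slice given by the vector field, with `M` parametrised by the
  -- closed disk. The field need not be normalised, because `homExtD` is constant along rays.
  obtain ⟨Φ, hΦ, hu, hd⟩ := exists_frame_bidisc (n := n)
    (a := fun s => Matrix.of fun i j => homExtD (fun q => a.1.2 q i j) (⟨f' s.1, V (f' s.1)⟩, s.2)) (fun i j => by
      have h1 : ContMDiffOn 𝓘(ℝ, ℂ × ℂ) 𝓘(ℝ, ℂ) ∞ (fun s : ℂ × ℂ => s.1) (D ×ˢ D) :=
        contDiff_fst.contMDiff.contMDiffOn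
      have h2 : ContMDiffOn 𝓘(ℝ, ℂ × ℂ) 𝓘(ℝ, ℂ) ∞ (fun s : ℂ × ℂ => s.2) (D ×ˢ D) :=
        contDiff_snd.contMDiff.contMDiffOn
      have h3 := hVs.comp_contMDiffOn (hf'.comp h1 fun s hs => hs.1)
      have h4 := ContMDiffOn.comp (h₂ i j).1 (h3.prodMk h2) fun s hs => ⟨hV _, hs.2⟩
      exact h4.contDiffOn)
  set c : SM M → Circle := fun p => (angleFrom o V p).toCircle with hc
  have hcs : SmoothSM fun p => (c p : ℂ) := smoothSM_angleFrom o hV hVs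
  have hunit : ∀ q : SM M × Disk, IsUnit (Φ (f q.1.1.1, c q.1 * q.2.1)) := fun q =>
    hu _ (hmem _) _ (circle_mul_mem _ q.2.2)
  -- Moving along an orbit by `θ` multiplies `c` by `e^{iθ}` and `ω` by `e^{-iθ}`, so the product
  -- entering `Φ` is well defined on `Z`.
  let φ : Z o → GL (Fin n) ℂ := Quotient.lift (fun q => (hunit q).unit) (by
    rintro q _ ⟨θ, rfl⟩
    refine Units.ext ?_
    change Φ (f q.1.1.1, c q.1 * q.2.1) = Φ (f q.1.1.1, c (rot o θ q.1) * (((-θ).toCircle : ℂ) * q.2.1))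
    have h1 : c (rot o θ q.1) * (-θ).toCircle = c q.1 := by
      simp only [hc, angleFrom_rot o hV, Real.Angle.toCircle_add, Real.Angle.toCircle_neg, mul_inv_cancel_right]
    rw [← mul_assoc, ← Circle.coe_mul, h1])
  have hφ : ∀ q, (φ (toZ o q)).1 = Φ (f q.1.1.1, c q.1 * q.2.1) := fun q => rfl
  refine exists_mho_of_gauge o a (φ := φ) (fun i j => ?_) fun q => ?_
  · have h1 : ContMDiffOn ((𝓡∂ 2).tangent.prod 𝓘(ℝ, ℂ)) 𝓘(ℝ, ℂ) ∞
        (fun s : TangentBundle (𝓡∂ 2) M × ℂ => homExt (fun p => (c p : ℂ)) s.1) ({p | p.2 ≠ 0} ×ˢ D) :=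
      ContMDiffOn.comp hcs contMDiff_fst.contMDiffOn fun s hs => hs.1
    have h2 := contMDiffOn_mul h1 (contMDiff_snd (I := (𝓡∂ 2).tangent) (J := 𝓘(ℝ, ℂ))).contMDiffOn
    have h3 : ContMDiff ((𝓡∂ 2).tangent.prod 𝓘(ℝ, ℂ)) 𝓘(ℝ, ℂ) ∞
        (fun s : TangentBundle (𝓡∂ 2) M × ℂ => f s.1.1) :=
      hf.comp ((contMDiff_proj (IB := 𝓡∂ 2) (n := ∞) (TangentSpace (𝓡∂ 2) : M → Type _)).comp contMDiff_fst)
    have h4 := (hΦ i j).contMDiffOn.comp (h3.contMDiffOn.prodMk_space h2) fun s hs => ⟨hmem _, by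
      change homExt (fun p => (c p : ℂ)) s.1 * s.2 ∈ D
      rw [homExt, dif_pos (show s.1.2 ≠ 0 from hs.1)]
      exact circle_mul_mem _ hs.2⟩
    refine h4.congr fun s hs => ?_
    rw [homExtD_of_mem _ hs, hφ]
    change _ = Φ (f s.1.1, homExt (fun p => (c p : ℂ)) s.1 * s.2) i j
    rw [homExt, dif_pos (show s.1.2 ≠ 0 from hs.1)]
    rfl
  · obtain ⟨x, hx⟩ : ∃ x, x = q.1.1.1 := ⟨_, rfl⟩
    have hz := circle_mul_mem (c q.1) q.2.2
    -- The weight `-1` of `a₂` relates its value at `q` to the slice through the factor `c⁻¹`. The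
    -- same factor appears in `∂_{ω̄}` of the gauge, so the equation on the slice gives the equation
    -- everywhere.
    have ha : ∀ i j, a.1.2 q i j = ((c q.1)⁻¹ : Circle) *
        homExtD (fun q => a.1.2 q i j) (⟨f' (f x), V (f' (f x))⟩, c q.1 * q.2.1) := fun i j => by
      have h1 := (h₂ i j).1.rotD_of_VV_angle o (h₂ i j).2 (angleFrom o V q.1)
        (normalize ⟨q.1.1.1, V q.1.1.1⟩ (hV _), ⟨_, hz⟩)
      rw [rotD_angleFrom o hV q _ rfl] at h1
      have h2 : homExtD (fun q => a.1.2 q i j) (⟨f' (f x), V (f' (f x))⟩, c q.1 * q.2.1) =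
          homExtD (fun q => a.1.2 q i j) (⟨x, V x⟩, c q.1 * q.2.1) :=
        congrArg (fun y => homExtD (fun q => a.1.2 q i j) (⟨y, V y⟩, c q.1 * q.2.1)) (hl x)
      rw [h2, hx, homExtD_of_mem _ (q := (⟨q.1.1.1, V q.1.1.1⟩, c q.1 * q.2.1)) ⟨hV _, hz⟩]
      exact h1
    ext i j
    have h3 := hd (f x) (hmem x) _ hz i j
    have hdiff : DifferentiableWithinAt ℝ (fun z => Φ (f x, z) i j) D (c q.1 * q.2.1) := by
      refine (((hΦ i j).comp (contDiff_const.prodMk contDiff_id).contDiffOn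
        fun z hz => ⟨hmem x, hz⟩).differentiableOn (by simp)) _ hz
    have h4 : ∀ z ∈ D, diskExt (fun q => (φ (toZ o q)).1 i j) q.1 z = Φ (f x, c q.1 * z) i j := fun z hz => by
      rw [diskExt, dif_pos hz, hφ, hx]
    have h5 : dbar₂ (fun q => (φ (toZ o q)).1 i j) q = ((c q.1)⁻¹ : Circle) *
        ((fderivWithin ℝ (fun z => Φ (f x, z) i j) D (c q.1 * q.2.1) 1 +
          I * fderivWithin ℝ (fun z => Φ (f x, z) i j) D (c q.1 * q.2.1) I) / 2) := by
      rw [dbar₂, fderivWithin_congr h4 (h4 _ q.2.2), dbar_comp_circle q.2.2 hdiff, mul_div_assoc]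
    have h6 : (a.1.2 q * (φ (toZ o q)).1) i j = ((c q.1)⁻¹ : Circle) * ((Matrix.of fun i j =>
        homExtD (fun q => a.1.2 q i j) (⟨f' (f x), V (f' (f x))⟩, c q.1 * q.2.1) : Mat n) *
          Φ (f x, c q.1 * q.2.1)) i j := by
      rw [Matrix.mul_apply, Matrix.mul_apply, Finset.mul_sum]
      refine Finset.sum_congr rfl fun k _ => ?_
      rw [ha, hφ, hx, Matrix.of_apply, mul_assoc]
    change dbar₂ (fun q => (φ (toZ o q)).1 i j) q + (a.1.2 q * (φ (toZ o q)).1) i j = 0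
    rw [h5, h6, ← mul_add]
    exact (congrArg _ h3).trans (mul_zero _)

end Surjective

end Twistor

end

noncomputable section
namespace Twistor
variable {M : Type*} [TopologicalSpace M] [ChartedSpace (EuclideanHalfSpace 2) M]
  [IsManifold (𝓡∂ 2) ∞ M] [RiemannianBundle (fun x : M => TangentSpace (𝓡∂ 2) x)]
  [IsContMDiffRiemannianBundle (𝓡∂ 2) ∞ E2 (fun x : M => TangentSpace (𝓡∂ 2) x)]
  (o : SurfaceOrientation M) {n : ℕ}

lemma toModuli_eq_iff {A B : Mho o n} :
    toModuli o n (isFlat_twistorForm o) A = toModuli o n (isFlat_twistorForm o) B ↔ (orbitSetoid o n).r A B :=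
  ⟨fun h => orbitSetoid_of_gaugeSetoid o (@Quotient.exact _ (gaugeSetoid o n) _ _ h),
    fun h => @Quotient.sound _ (gaugeSetoid o n) _ _ (gaugeSetoid_of_orbitSetoid o h)⟩

lemma injective_lift_toModuli (hinv : ∀ A B : Mho o n, (orbitSetoid o n).r A B →
      toModuli o n (isFlat_twistorForm o) A = toModuli o n (isFlat_twistorForm o) B) :
    Function.Injective (Quotient.lift (s := orbitSetoid o n) (toModuli o n (isFlat_twistorForm o)) hinv) := by
  rintro ⟨A⟩ ⟨B⟩ h
  exact @Quotient.sound _ (orbitSetoid o n) _ _ ((toModuli_eq_iff o).1 h)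

lemma toModuli_surjective (hM : DiffeomorphicToDisk M) :
    Function.Surjective (toModuli o n (isFlat_twistorForm o)) := by
  rintro ⟨a⟩
  obtain ⟨A, hA⟩ := exists_mho_of_disk o hM a
  exact ⟨A, (@Quotient.sound _ (gaugeSetoid o n) _ _ hA).symm⟩

end Twistor
end

theorem mainTheorem6 {M : Type*} [TopologicalSpace M] [ChartedSpace (EuclideanHalfSpace 2) M]
    [IsManifold (𝓡∂ 2) ∞ M] [RiemannianBundle (fun x : M => TangentSpace (𝓡∂ 2) x)]
    [IsContMDiffRiemannianBundle (𝓡∂ 2) ∞ Twistor.E2 (fun x : M => TangentSpace (𝓡∂ 2) x)]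
    (o : Twistor.SurfaceOrientation M) (n : ℕ) :
    -- the series defining `A^{0,1}` converges
    (∀ (A : Twistor.Mho o n) (q : Twistor.SM M × Twistor.Disk) (i j : Fin n),
      Summable fun m : ℕ =>
        q.2.1 ^ m * Twistor.fourierMode o (fun p => A.1 p i j) ((m : ℤ) - 1) q.1) ∧
    -- the group acts on the attenuations
    (∀ (A : Twistor.Mho o n), ∀ F ∈ Twistor.GG o n,
      ∃ B : Twistor.Mho o n, B.1 = Twistor.gaugeAct Twistor.X A.1 F) ∧
    -- `A^{0,1}` is a partial connection with vanishing curvature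
    ∃ hflat : ∀ A : Twistor.Mho o n, Twistor.IsFlat o (Twistor.twistorForm o A.1),
      -- the map into the moduli space is constant on orbits
      ∃ hinv : ∀ A B : Twistor.Mho o n, (Twistor.orbitSetoid o n).r A B →
          Twistor.toModuli o n hflat A = Twistor.toModuli o n hflat B,
        -- injectivity and, over a disk, bijectivity of the induced map on the set of orbits
        Function.Injective
          (Quotient.lift (s := Twistor.orbitSetoid o n) (Twistor.toModuli o n hflat) hinv) ∧
        (Twistor.DiffeomorphicToDisk M → Function.Bijective
          (Quotient.lift (s := Twistor.orbitSetoid o n) (Twistor.toModuli o n hflat) hinv)) := by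
  refine ⟨fun A q i j => ?_, Twistor.exists_mho_gaugeAct o, Twistor.isFlat_twistorForm o,
    fun A B h => (Twistor.toModuli_eq_iff o).2 h, Twistor.injective_lift_toModuli o _,
    fun hM => ⟨Twistor.injective_lift_toModuli o _, Quotient.lift_surjective _ _ (Twistor.toModuli_surjective o hM)⟩⟩
  simpa only [sub_eq_add_neg] using Twistor.summable_modeSeries o (A.2.1 i j) (-1) q
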